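/- Let $G=(V,E)$ be a finite undirected connected chordal graph (UCCG). Write $\Pi(G)$ for the set of maximal cliques and $\Delta(G)$ for the set of minimal separators of $G$ (the sets that are minimal $a$-$b$-separators for some nonadjacent $a,b$). For $S\in\Delta(G)$, an $S$-flower is a maximal set $F\subseteq\{K\in\Pi(G): S\subseteq K\}$ such that $\bigl(\bigcup_{K\in F}K\bigr)\setminus S$ induces a connected subgraph of $G[V\setminus S]$; $F\setminus S$ denotes the subgraph of $G$ induced by $\bigl(\bigcup_{K\in F}K\bigr)\setminus S$. An AMO of $G$ is an orientation of all edges of $G$ without directed cycles and without induced subgraphs $a\to c\leftarrow b$. For a clique $K$, $G^K$ is the union of all AMOs of $G$ that have a topological ordering beginning with some permutation of $K$, and $\mathcal C_G(K)$ is the set of undirected connected components of $G^K[V\setminus K]$. A rooted clique tree $\mathcal T=(T,r,\iota)$ of $G$ is a rooted tree $(T,r)$ with a bijection $\iota:V_T\to\Pi(G)$ such that $\{x:v\in\iota(x)\}$ is connected in $T$ for every $v\in V$; $\mathrm{FP}(v,\mathcal T)$ is the set of all $\iota(x)\cap\iota(y)\subseteq\iota(v)$ with $xy$ an edge of the path from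 $r$ to $v$; and $\phi(A,R)$ is the number of permutations of the set $A$ that have no set in $R$ as a prefix. Clique-Picking on input $G$ is the call $\mathrm{count}(G)$ with an empty memo table, where $\mathrm{count}(H)$ returns the memoized value if $H$ is in the memo table; otherwise it takes a rooted clique tree $\mathcal T$ of $H$, computes, traversing $\mathcal T$ from the root by breadth-first search, $$\sum_{v\in V_T}\phi\bigl(\iota(v),\mathrm{FP}(v,\mathcal T)\bigr)\prod_{H'\in\mathcal C_H(\iota(v))}\mathrm{count}(H'),$$ stores this value for $H$ in the memo table and returns it. 1. In every execution of Clique-Picking on $G$ (whatever clique trees and processing orders are chosen), the set of distinct graphs for which $\mathrm{count}$ is called has at most $2|\Pi(G)|-1$ elements; each of them is a UCCG, and each of them other than $G$ is of the form $F\setminus S$ for some $S\in\Delta(G)$ and some $S$-flower $F$. 2. Clique-Picking runs in time $O\bigl(|\Pi(G)|^2\cdot(|V|+|E|)\bigr)$: there are a program for a random access machine (natural numbers as cell contents; unit-cost addition, truncated subtraction, multiplication, comparison, indirect memory access, jump and procedure call) and a constant $C$ such that, for every UCCG $G$ on the vertex set $\{0,\dots,n-1\}$ given by adjacency lists, the program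 carries out an execution of Clique-Picking on $G$ and halts after at most $C\cdot|\Pi(G)|^2\cdot(|V|+|E|)$ steps. Here "carries out an execution" means that its output is the log of such an execution: in order, the graph of each call of $\mathrm{count}$, each maximal clique $\iota(v)$ visited, each factor $\phi$ used, and each value returned. -/

import Mathlib

/-! ## Chordal graphs, maximal cliques, minimal separators, flowers -/

namespace CliquePicking

/-- Every cycle of length at least four has a chord: an edge between two of its vertices that is
not an edge of the cycle. -/
def IsChordal {V : Type*} (G : SimpleGraph V) : Prop :=
  ∀ (v : V) (c : G.Walk v v), c.IsCycle → 4 ≤ c.length →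
    ∃ x ∈ c.support, ∃ y ∈ c.support, G.Adj x y ∧ s(x, y) ∉ c.edges

/-- An undirected connected chordal graph. -/
def IsUCCG {V : Type*} (G : SimpleGraph V) : Prop :=
  G.Connected ∧ IsChordal G

/-- The maximal cliques `Π(H)`. The graphs met by the algorithm on input `G` all have their
vertices and edges in `G`; they are represented as subgraphs of `G`, and `G` itself as `⊤`. -/
def maxCliques {V : Type*} {G : SimpleGraph V} (H : G.Subgraph) : Set (Set V) :=
  {K | Maximal (fun K : Set V => K ⊆ H.verts ∧ K.Pairwise H.Adj) K}

/-- `S` is an `a`-`b`-separator: `a` and `b` are nonadjacent, and they lie in different connected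
components of `G[V \ S]`. -/
def Separates {V : Type*} (G : SimpleGraph V) (S : Set V) (a b : V) : Prop :=
  a ≠ b ∧ ¬ G.Adj a b ∧
    ∃ (ha : a ∈ Sᶜ) (hb : b ∈ Sᶜ), ¬ (G.induce Sᶜ).Reachable ⟨a, ha⟩ ⟨b, hb⟩

/-- The minimal separators `Δ(G)`: the minimal `a`-`b`-separators, over all pairs `a`, `b`. -/
def minSeparators {V : Type*} (G : SimpleGraph V) : Set (Set V) :=
  {S | ∃ a b : V, Minimal (fun S : Set V => Separates G S a b) S}

/-- The bouquet `B(S)`, i.e. the set of `S`-flowers: the maximal sets `F` of maximal cliques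
containing `S` such that the union of `F`, without `S`, is connected in `G[V \ S]`. -/
def bouquet {V : Type*} (G : SimpleGraph V) (S : Set V) : Set (Set (Set V)) :=
  {F | Maximal (fun F : Set (Set V) =>
      F ⊆ {K | K ∈ maxCliques (⊤ : G.Subgraph) ∧ S ⊆ K} ∧ (G.induce (⋃₀ F \ S)).Connected) F}

/-- The graph `F \ S`: the subgraph of `G` induced by the vertices of the flower `F` outside `S`. -/
def flowerMinus {V : Type*} (G : SimpleGraph V) (F : Set (Set V)) (S : Set V) : G.Subgraph :=
  (⊤ : G.Subgraph).induce (⋃₀ F \ S)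

/-! ## Acyclic moral orientations and the subproblems `C_H(K)` -/

/-- `α` is an acyclic moral orientation (AMO) of `H`: every edge gets exactly one direction, there
is no directed cycle, and no induced `a → c ← b`. -/
def IsAMO {V : Type*} {G : SimpleGraph V} (H : G.Subgraph) (α : V → V → Prop) : Prop :=
  (∀ u v, H.Adj u v ↔ α u v ∨ α v u) ∧ (∀ u v, α u v → ¬ α v u) ∧
    (∀ v, ¬ Relation.TransGen α v v) ∧
    (∀ a b c, α a c → α b c → a ≠ b → H.Adj a b)

/-- The linear ordering `τ` of the vertices of `H` is a topological ordering of `α`. -/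
def IsTopologicalOrdering {V : Type*} {G : SimpleGraph V} (H : G.Subgraph) (α : V → V → Prop)
    (τ : List V) : Prop :=
  τ.Nodup ∧ (∀ v, v ∈ τ ↔ v ∈ H.verts) ∧ ∀ u v, α u v → List.Sublist [u, v] τ

/-- `π` is a permutation of the set `K`. -/
def IsPermOf {V : Type*} (π : List V) (K : Set V) : Prop :=
  π.Nodup ∧ ∀ v, v ∈ π ↔ v ∈ K

/-- The `π(K)`-orientation `H^{π(K)}`: the union of all AMOs of `H` that have a topological
ordering beginning with `π`. -/
def permOrientation {V : Type*} {G : SimpleGraph V} (H : G.Subgraph) (π : List V) (u v : V) :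
    Prop :=
  ∃ α τ, IsAMO H α ∧ IsTopologicalOrdering H α τ ∧ π <+: τ ∧ α u v

/-- `H^K`, the union of the `π(K)`-orientations over all permutations `π` of `K`. -/
def cliqueOrientation {V : Type*} {G : SimpleGraph V} (H : G.Subgraph) (K : Set V) (u v : V) :
    Prop :=
  ∃ π : List V, IsPermOf π K ∧ permOrientation H π u v

theorem cliqueOrientation_adj {V : Type*} {G : SimpleGraph V} {H : G.Subgraph} {K : Set V}
    {u v : V} (h : cliqueOrientation H K u v) : H.Adj u v := by
  obtain ⟨π, _, α, τ, hα, _, _, huv⟩ := h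
  exact (hα.1 u v).2 (Or.inl huv)

/-- The vertices of `H^K[V_H \ K]` with its undirected edges. -/
def undirectedPart {V : Type*} {G : SimpleGraph V} (H : G.Subgraph) (K : Set V) : G.Subgraph where
  verts := H.verts \ K
  Adj u v := u ∉ K ∧ v ∉ K ∧ cliqueOrientation H K u v ∧ cliqueOrientation H K v u
  adj_sub h := H.adj_sub (cliqueOrientation_adj h.2.2.1)
  edge_vert h := ⟨H.edge_vert (cliqueOrientation_adj h.2.2.1), h.1⟩
  symm := ⟨fun _ _ h => ⟨h.2.1, h.1, h.2.2.2, h.2.2.1⟩⟩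

/-- `C_H(K)`: the undirected connected components of `H^K[V_H \ K]`. -/
def subproblems {V : Type*} {G : SimpleGraph V} (H : G.Subgraph) (K : Set V) : Set G.Subgraph :=
  {C | Maximal (fun C : G.Subgraph => C ≤ undirectedPart H K ∧ C.Connected) C}

/-! ## Clique trees, forbidden prefixes, the function `φ` -/

/-- A rooted clique tree `(T, r, ι)` of `H`. -/
structure RootedCliqueTree {V : Type*} {G : SimpleGraph V} (H : G.Subgraph) where
  size : ℕ
  tree : SimpleGraph (Fin size)
  root : Fin size
  bag : Fin size → Set V
  isTree : tree.IsTree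
  bijOn : Set.BijOn bag Set.univ (maxCliques H)
  connected : ∀ v ∈ H.verts, (tree.induce {x | v ∈ bag x}).Connected

/-- The set `FP(v, 𝒯)` of forbidden prefixes: the sets `ι(x) ∩ ι(y) ⊆ ι(v)` for the edges
`x - y` on the path from the root to `v`. -/
def forbiddenPrefixes {V : Type*} {G : SimpleGraph V} {H : G.Subgraph} (𝒯 : RootedCliqueTree H)
    (v : Fin 𝒯.size) : Set (Set V) :=
  {X | ∃ p : 𝒯.tree.Walk 𝒯.root v, p.IsPath ∧
    ∃ d ∈ p.darts, X = 𝒯.bag d.fst ∩ 𝒯.bag d.snd ∧ X ⊆ 𝒯.bag v}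

/-- `w` is a child of `v`. -/
def IsChild {V : Type*} {G : SimpleGraph V} {H : G.Subgraph} (𝒯 : RootedCliqueTree H)
    (v w : Fin 𝒯.size) : Prop :=
  𝒯.tree.Adj v w ∧ 𝒯.tree.dist 𝒯.root w = 𝒯.tree.dist 𝒯.root v + 1

/-- `φ(S, R)`: the number of permutations of `S` that do not have a set of `R` as prefix. -/
noncomputable def phi {V : Type*} (S : Set V) (R : Set (Set V)) : ℕ :=
  {π : List V | IsPermOf π S ∧ ∀ X ∈ R, ∀ ρ : List V, ρ <+: π → ¬ IsPermOf ρ X}.ncard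

/-! ## The Clique-Picking algorithm

The pseudocode is nondeterministic (choice of the clique tree, order in which children and
subproblems are processed), so its executions are described by a relation, which also records a
log of the execution. -/

/-- Log entries: a call `count(H, memo)`, the clique `ι(v)` of a node `v` popped from the queue,
the factor `φ(ι(v), FP(v, 𝒯))` used when the sum is updated, and the value returned by a call. -/
inductive Event {V : Type*} (G : SimpleGraph V) where
  | call (H : G.Subgraph)
  | pop (K : Set V)
  | factor (w : ℕ)
  | ret (a : ℕ)

/-- What remains to be executed: a call of `count`, the while loop for a given clique tree, queue
and value of `sum`, or the inner loop over the given graphs with a given value of `prod`. -/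
inductive Task {V : Type*} (G : SimpleGraph V) where
  | count (H : G.Subgraph)
  | loop (H : G.Subgraph) (𝒯 : RootedCliqueTree H) (queue : List (Fin 𝒯.size)) (sum : ℕ)
  | prod (Hs : List G.Subgraph) (prod : ℕ)

/-- `Run task memo log memo' a`: the task can be executed starting with the memo table `memo`,
producing `log`, the memo table `memo'` and the value `a` (the returned value of `count`, the
final value of `sum`, or the final value of `prod`). A memo table is a list of pairs
(graph, value). -/
inductive Run {V : Type*} {G : SimpleGraph V} :
    Task G → List (G.Subgraph × ℕ) → List (Event G) → List (G.Subgraph × ℕ) → ℕ → Prop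
  | count_memo {H : G.Subgraph} {memo : List (G.Subgraph × ℕ)} {a : ℕ} (h : (H, a) ∈ memo) :
      Run (.count H) memo [.call H, .ret a] memo a
  | count_new {H : G.Subgraph} {memo memo' : List (G.Subgraph × ℕ)} {log : List (Event G)} {a : ℕ}
      (h : ∀ b, (H, b) ∉ memo) (𝒯 : RootedCliqueTree H)
      (run : Run (.loop H 𝒯 [𝒯.root] 0) memo log memo' a) :
      Run (.count H) memo (.call H :: log ++ [.ret a]) ((H, a) :: memo') a
  | loop_done {H : G.Subgraph} {𝒯 : RootedCliqueTree H} {memo : List (G.Subgraph × ℕ)} {sum : ℕ} :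
      Run (.loop H 𝒯 [] sum) memo [] memo sum
  | loop_step {H : G.Subgraph} {𝒯 : RootedCliqueTree H} {v : Fin 𝒯.size}
      {queue children : List (Fin 𝒯.size)} {sum prod a : ℕ} {Hs : List G.Subgraph}
      {memo memo' memo'' : List (G.Subgraph × ℕ)} {log log' : List (Event G)}
      (children_nodup : children.Nodup) (mem_children : ∀ w, w ∈ children ↔ IsChild 𝒯 v w)
      (Hs_nodup : Hs.Nodup) (mem_Hs : ∀ H', H' ∈ Hs ↔ H' ∈ subproblems H (𝒯.bag v))
      (inner : Run (.prod Hs 1) memo log memo' prod)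
      (rest : Run (.loop H 𝒯 (queue ++ children)
        (sum + phi (𝒯.bag v) (forbiddenPrefixes 𝒯 v) * prod)) memo' log' memo'' a) :
      Run (.loop H 𝒯 (v :: queue) sum) memo
        (.pop (𝒯.bag v) :: log ++
          .factor (phi (𝒯.bag v) (forbiddenPrefixes 𝒯 v)) :: log') memo'' a
  | prod_done {memo : List (G.Subgraph × ℕ)} {prod : ℕ} : Run (.prod [] prod) memo [] memo prod
  | prod_step {H : G.Subgraph} {Hs : List G.Subgraph} {prod a b : ℕ}
      {memo memo' memo'' : List (G.Subgraph × ℕ)} {log log' : List (Event G)}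
      (call : Run (.count H) memo log memo' b)
      (rest : Run (.prod Hs (prod * b)) memo' log' memo'' a) :
      Run (.prod (H :: Hs) prod) memo (log ++ log') memo'' a

/-- `log` is the log of an execution of Clique-Picking on input `G`, i.e. of `count(G, ∅)`. -/
def IsCliquePickingLog {V : Type*} (G : SimpleGraph V) (log : List (Event G)) : Prop :=
  ∃ memo a, Run (.count (⊤ : G.Subgraph)) [] log memo a

/-- The graphs explored in an execution: those for which `count` is called. -/
def explored {V : Type*} {G : SimpleGraph V} (log : List (Event G)) : Set G.Subgraph :=
  {H | Event.call H ∈ log}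

/-! ## The machine model: a random access machine

Programs of a small structured language over natural numbers. The memory consists of arrays
(array `a` has cells `0, 1, 2, …`; a program uses finitely many arrays, a scalar variable is a
cell of an array), arithmetic operations, comparisons, memory accesses, jumps and calls have unit
cost, and there is a write-only output tape. -/

inductive Expr where
  | const (c : ℕ)
  | get (array : ℕ) (index : Expr)
  | add (e f : Expr)
  | sub (e f : Expr)
  | mul (e f : Expr)
  | lt (e f : Expr)
  | eq (e f : Expr)

/-- The value of an expression; subtraction is truncated, truth values are `1` and `0`. -/
def Expr.eval (mem : ℕ → ℕ → ℕ) : Expr → ℕ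
  | .const c => c
  | .get array index => mem array (index.eval mem)
  | .add e f => e.eval mem + f.eval mem
  | .sub e f => e.eval mem - f.eval mem
  | .mul e f => e.eval mem * f.eval mem
  | .lt e f => if e.eval mem < f.eval mem then 1 else 0
  | .eq e f => if e.eval mem = f.eval mem then 1 else 0

/-- The number of elementary steps needed to evaluate an expression. -/
def Expr.cost : Expr → ℕ
  | .const _ => 1
  | .get _ index => index.cost + 1
  | .add e f => e.cost + f.cost + 1
  | .sub e f => e.cost + f.cost + 1
  | .mul e f => e.cost + f.cost + 1
  | .lt e f => e.cost + f.cost + 1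
  | .eq e f => e.cost + f.cost + 1

inductive Cmd where
  | skip
  | assign (array : ℕ) (index value : Expr)
  | emit (value : Expr)
  | seq (c d : Cmd)
  | ite (cond : Expr) (c d : Cmd)
  | while (cond : Expr) (body : Cmd)
  | call (procedure : ℕ)

/-- A program: a main command and the bodies of finitely many parameterless, possibly recursive
procedures (all data live in the memory). -/
structure Program where
  main : Cmd
  procedures : List Cmd

structure MachineState where
  mem : ℕ → ℕ → ℕ
  out : List ℕ

/-- `Exec procs c s t s'`: the command `c` started in state `s` halts after `t` steps in
state `s'`. -/
inductive Exec (procs : List Cmd) : Cmd → MachineState → ℕ → MachineState → Prop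
  | skip (s : MachineState) : Exec procs .skip s 1 s
  | assign (array : ℕ) (index value : Expr) (s : MachineState) :
      Exec procs (.assign array index value) s (index.cost + value.cost + 1)
        { s with
          mem := Function.update s.mem array
            (Function.update (s.mem array) (index.eval s.mem) (value.eval s.mem)) }
  | emit (value : Expr) (s : MachineState) :
      Exec procs (.emit value) s (value.cost + 1) { s with out := s.out ++ [value.eval s.mem] }
  | seq {c d : Cmd} {s s' s'' : MachineState} {t t' : ℕ}
      (hc : Exec procs c s t s') (hd : Exec procs d s' t' s'') :
      Exec procs (.seq c d) s (t + t') s''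
  | ite_true {cond : Expr} {c d : Cmd} {s s' : MachineState} {t : ℕ}
      (h : cond.eval s.mem ≠ 0) (hc : Exec procs c s t s') :
      Exec procs (.ite cond c d) s (cond.cost + 1 + t) s'
  | ite_false {cond : Expr} {c d : Cmd} {s s' : MachineState} {t : ℕ}
      (h : cond.eval s.mem = 0) (hd : Exec procs d s t s') :
      Exec procs (.ite cond c d) s (cond.cost + 1 + t) s'
  | while_true {cond : Expr} {body : Cmd} {s s' s'' : MachineState} {t t' : ℕ}
      (h : cond.eval s.mem ≠ 0) (hbody : Exec procs body s t s')
      (hrest : Exec procs (.while cond body) s' t' s'') :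
      Exec procs (.while cond body) s (cond.cost + 1 + t + t') s''
  | while_false {cond : Expr} {body : Cmd} {s : MachineState} (h : cond.eval s.mem = 0) :
      Exec procs (.while cond body) s (cond.cost + 1) s
  | call {p : ℕ} {body : Cmd} {s s' : MachineState} {t : ℕ}
      (hp : procs[p]? = some body) (hbody : Exec procs body s t s') :
      Exec procs (.call p) s (t + 1) s'

/-- The start state: the input is in the cells of array `0`, everything else is zero. -/
def initialState (input : List ℕ) : MachineState where
  mem := fun array i => if array = 0 then input.getD i 0 else 0
  out := []

/-- The program, started on `input`, halts after `t` steps with output `out`. -/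
def Program.HaltsWith (P : Program) (input : List ℕ) (t : ℕ) (out : List ℕ) : Prop :=
  ∃ s, Exec P.procedures P.main (initialState input) t s ∧ s.out = out

/-! ## Input and output of the machine -/

/-- `adj` is an adjacency list representation of `G` (the lists may be in any order). -/
def IsAdjacencyLists {n : ℕ} (G : SimpleGraph (Fin n)) (adj : Fin n → List (Fin n)) : Prop :=
  ∀ v, (adj v).Nodup ∧ ∀ w, w ∈ adj v ↔ G.Adj v w

/-- The input word: the number of vertices, then for each vertex its degree and its neighbors. -/
def encodeInput {n : ℕ} (adj : Fin n → List (Fin n)) : List ℕ :=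
  n :: (List.finRange n).flatMap fun v => (adj v).length :: (adj v).map Fin.val

/-- `code` describes the log entry. Graphs and cliques are given by a list of their vertices, in
any order, preceded by its length. -/
inductive EncodesEvent {n : ℕ} {G : SimpleGraph (Fin n)} : Event G → List ℕ → Prop
  | call (H : G.Subgraph) (l : List (Fin n)) (h : IsPermOf l H.verts) :
      EncodesEvent (.call H) (0 :: l.length :: l.map Fin.val)
  | pop (K : Set (Fin n)) (l : List (Fin n)) (h : IsPermOf l K) :
      EncodesEvent (.pop K) (1 :: l.length :: l.map Fin.val)
  | factor (w : ℕ) : EncodesEvent (.factor w) [2, w]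
  | ret (a : ℕ) : EncodesEvent (.ret a) [3, a]

/-- The output word `out` describes the log. -/
def EncodesLog {n : ℕ} {G : SimpleGraph (Fin n)} (log : List (Event G)) (out : List ℕ) : Prop :=
  ∃ codes : List (List ℕ), List.Forall₂ EncodesEvent log codes ∧ out = codes.flatten

/-- The program implements Clique-Picking: on every UCCG it halts and its output is the complete
log of an execution of Clique-Picking (the last entry is the returned value); and it does so within
`bound G` steps. -/
def ImplementsCliquePickingWithin (P : Program)
    (bound : ∀ n : ℕ, SimpleGraph (Fin n) → ℕ) : Prop :=
  ∀ (n : ℕ) (G : SimpleGraph (Fin n)), IsUCCG G → ∀ adj, IsAdjacencyLists G adj →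
    ∃ t out log, P.HaltsWith (encodeInput adj) t out ∧ IsCliquePickingLog G log ∧
      EncodesLog log out ∧ t ≤ bound n G

end CliquePicking

/-!
**Subproblems are flowers.** Let `K` be a maximal clique of a chordal graph `H`. For a vertex `x`
outside of `K`, let `nearSep` be the minimal separator between `K` and `x` that is closest to `x`.
An edge outside of `K` is undirected in the union `G^K` if and only if its ends have the same
`nearSep`. If these differ, one end lies in `nearSep` of the other, and the edge always points to
the latter (`orient_of_mem_nearSep`); if they agree, a suitable perfect ordering puts either end
first (`exists_orientation`). So the subproblems of `K` are components of sets of common neighbors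
of a separator (`subproblems_eq`).

In a clique tree, these components are read off the edges: the bags that can be reached from an end
of the edge `j` along labels strictly larger than the label of `j` are the cliques of a flower for
this label, and `flowerTree` turns them into a clique tree of the flower. The subproblems of a
clique of a flower are again such flowers (`subproblems_flower`), so all graphs explored by
Clique-Picking belong to one of the `2 k` pairs of one of the `k` tree nodes `j` and an end of the
edge from `j` to its parent. The root has no parent, and its two pairs both stand for the whole
graph. This gives the bound `2 k - 1`.

**The program.** Maximum cardinality search visits the vertices in a perfect ordering and computes a
clique tree with root `0`, one bag being enlarged (`IsCliqueTree.enlarge`) or added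
(`IsCliqueTree.grow`) per vertex. This takes time `O(k n²)`, and `n² = O(k (n + m))` since the
vertices can be partitioned into `k` cliques (`IsCliqueTree.sq_card_le`). From then on the program
works with numbers of flowers instead of graphs. In time `O(k² n)` it fills tables that describe the
flowers: their nodes and vertices, the numbers of edges with a given property on tree paths, and a
representative `rep d` of all numbers with the same graph as `d`, under which the memo table is
accessed. Numbers with the property `Canon` enumerate the subproblems of a clique without
repetition.

The forbidden prefixes for `φ` form a chain of labels (`phi_flower`). Hence `φ` satisfies a
recursion over the shortest forbidden prefix (`ncard_prefixFreePerms`), which is evaluated in time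
quadratic in the number of vertices of the clique; this is `O(n + m)` (`ncard_sq_le_of_pairwise`).
For all `2 k` flowers and all bags, this takes time `O(k² (n + m))`.

In the recursion, the vertex lists that are output for the subproblems of one clique have total
length at most `n`, as these subproblems are disjoint (`sum_card_le`). The computation for a graph
outside of the memo table costs `O(k (n + k))`, besides the nested calls of `count`. It ends with a
new entry of the memo table, and the potential `memoPotential` charges the costs to the entry; there
are at most `2 k` entries. Since `k ≤ n`, the total is `O(k² n)`.
-/

namespace CliquePicking

variable {V : Type*} {G : SimpleGraph V}

/-! ### Connected sets of vertices in chordal graphs -/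

/-- There is a walk from `a` to `b` all of whose edges lie inside `Z`. (If `a = b`, no condition on
membership in `Z` is implied.) -/
def Joined (G : SimpleGraph V) (Z : Set V) : V → V → Prop :=
  Relation.ReflTransGen fun x y => G.Adj x y ∧ x ∈ Z ∧ y ∈ Z

/-- Any two vertices of `D` are joined inside `D`. The empty set is allowed. -/
def ConnSet (G : SimpleGraph V) (D : Set V) : Prop :=
  ∀ a ∈ D, ∀ b ∈ D, Joined G D a b

theorem Joined.mono {Z Z' : Set V} (h : Z ⊆ Z') {a b : V} (hab : Joined G Z a b) :
    Joined G Z' a b :=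
  Relation.ReflTransGen.mono (fun _ _ hxy => ⟨hxy.1, h hxy.2.1, h hxy.2.2⟩) _ _ hab

theorem Joined.symm {Z : Set V} {a b : V} (hab : Joined G Z a b) : Joined G Z b a := by
  induction hab with
  | refl => exact Relation.ReflTransGen.refl
  | tail _ h ih => exact Relation.ReflTransGen.head ⟨h.1.symm, h.2.2, h.2.1⟩ ih

theorem Joined.trans {Z : Set V} {a b c : V} (hab : Joined G Z a b) (hbc : Joined G Z b c) :
    Joined G Z a c :=
  Relation.ReflTransGen.trans hab hbc

theorem Joined.refl {Z : Set V} {a : V} : Joined G Z a a := Relation.ReflTransGen.refl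

theorem Joined.tail {Z : Set V} {a b c : V} (hab : Joined G Z a b) (h : G.Adj b c) (hb : b ∈ Z)
    (hc : c ∈ Z) : Joined G Z a c :=
  Relation.ReflTransGen.tail hab ⟨h, hb, hc⟩

theorem Joined.single {Z : Set V} {a b : V} (h : G.Adj a b) (ha : a ∈ Z) (hb : b ∈ Z) :
    Joined G Z a b :=
  Relation.ReflTransGen.single ⟨h, ha, hb⟩

theorem Joined.mem {Z : Set V} {a b : V} (hab : Joined G Z a b) (ha : a ∈ Z) : b ∈ Z := by
  induction hab with
  | refl => exact ha
  | tail _ h _ => exact h.2.2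

/-- The connected component of `a` in `G[Z]`, for `a ∈ Z`. -/
def comp (G : SimpleGraph V) (Z : Set V) (a : V) : Set V := {b | Joined G Z a b}

theorem joined_comp {Z : Set V} {a b : V} (hab : Joined G Z a b) : Joined G (comp G Z a) a b := by
  induction hab with
  | refl => exact Joined.refl
  | tail h1 h2 ih =>
    exact ih.tail h2.1 h1 (Relation.ReflTransGen.tail h1 h2)

theorem connSet_comp {Z : Set V} {a : V} : ConnSet G (comp G Z a) := fun _ hx _ hy =>
  (joined_comp hx).symm.trans (joined_comp hy)

theorem comp_subset {Z : Set V} {a : V} (ha : a ∈ Z) : comp G Z a ⊆ Z := fun _ h => Joined.mem h ha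

theorem comp_adj {Z : Set V} {a b c : V} (ha : a ∈ Z) (hb : b ∈ comp G Z a) (hbc : G.Adj b c)
    (hc : c ∈ Z) : c ∈ comp G Z a :=
  Joined.tail hb hbc (comp_subset ha hb) hc

theorem Joined.exists_walk {Z : Set V} {a b : V} (hab : Joined G Z a b) (ha : a ∈ Z) :
    ∃ p : G.Walk a b, ∀ x ∈ p.support, x ∈ Z := by
  induction hab with
  | refl => exact ⟨.nil, by simpa using ha⟩
  | tail h1 h2 ih =>
    obtain ⟨p, hp⟩ := ih
    refine ⟨p.concat h2.1, fun x hx => ?_⟩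
    rw [SimpleGraph.Walk.support_concat] at hx
    simp only [List.mem_append, List.mem_singleton] at hx
    rcases hx with hx | rfl
    · exact hp x hx
    · exact h2.2.2

theorem joined_of_walk {Z : Set V} {a b : V} (p : G.Walk a b) (hp : ∀ x ∈ p.support, x ∈ Z) :
    Joined G Z a b := by
  induction p with
  | nil => exact Joined.refl
  | cons h p ih =>
    simp only [SimpleGraph.Walk.support_cons, List.mem_cons, forall_eq_or_imp] at hp
    exact (Joined.single h hp.1 (hp.2 _ p.start_mem_support)).trans (ih hp.2)

theorem reachable_induce_iff {Z : Set V} {a b : V} (ha : a ∈ Z) (hb : b ∈ Z) :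
    (G.induce Z).Reachable ⟨a, ha⟩ ⟨b, hb⟩ ↔ Joined G Z a b := by
  constructor
  · rintro ⟨p⟩
    refine joined_of_walk (p.map (SimpleGraph.Embedding.induce Z).toHom) fun x hx => ?_
    erw [SimpleGraph.Walk.support_map, List.mem_map] at hx
    obtain ⟨y, _, rfl⟩ := hx
    exact y.2
  · intro h
    obtain ⟨p, hp⟩ := h.exists_walk ha
    exact ⟨p.induce Z hp⟩

theorem connected_induce_iff {Z : Set V} :
    (G.induce Z).Connected ↔ Z.Nonempty ∧ ConnSet G Z := by
  rw [SimpleGraph.connected_iff]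
  constructor
  · rintro ⟨h1, ⟨x, hx⟩⟩
    exact ⟨⟨x, hx⟩, fun a ha b hb => (reachable_induce_iff ha hb).1 (h1 _ _)⟩
  · rintro ⟨⟨x, hx⟩, h⟩
    exact ⟨fun a b => (reachable_induce_iff a.2 b.2).2 (h _ a.2 _ b.2), ⟨x, hx⟩⟩

/-- A shortest walk inside `Z` is an induced path. -/
theorem exists_induced_path {Z : Set V} {s t : V} (h : ∃ p : G.Walk s t, ∀ x ∈ p.support, x ∈ Z) :
    ∃ p : G.Walk s t, p.IsPath ∧ (∀ x ∈ p.support, x ∈ Z) ∧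
      ∀ x ∈ p.support, ∀ y ∈ p.support, G.Adj x y → s(x, y) ∈ p.edges := by
  classical
  have hex : ∃ n, ∃ p : G.Walk s t, (∀ x ∈ p.support, x ∈ Z) ∧ p.length = n := by
    obtain ⟨p, hp⟩ := h
    exact ⟨_, p, hp, rfl⟩
  obtain ⟨p0, hp0, hlen0⟩ := Nat.find_spec hex
  have hmin : ∀ q : G.Walk s t, (∀ x ∈ q.support, x ∈ Z) → Nat.find hex ≤ q.length :=
    fun q hq => Nat.find_min' hex ⟨q, hq, rfl⟩
  obtain ⟨p, hpath, hpZ, hlen⟩ : ∃ p : G.Walk s t, p.IsPath ∧ (∀ x ∈ p.support, x ∈ Z) ∧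
      p.length = Nat.find hex := by
    refine ⟨p0.bypass, p0.bypass_isPath, fun x hx => hp0 x (p0.support_bypass_subset_support hx),
      ?_⟩
    exact le_antisymm (hlen0 ▸ p0.length_bypass_le_length)
      (hmin _ fun x hx => hp0 x (p0.support_bypass_subset_support hx))
  have key : ∀ x (hx : x ∈ p.support) y (hy : y ∈ p.support), G.Adj x y →
      (p.takeUntil y hy).length ≤ (p.takeUntil x hx).length + 1 := by
    intro x hx y hy hxy
    have h1 := hmin ((p.takeUntil x hx).append (.cons hxy (p.dropUntil y hy))) (by
      intro z hz
      rw [SimpleGraph.Walk.mem_support_append_iff, SimpleGraph.Walk.support_cons,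
        List.mem_cons] at hz
      rcases hz with hz | rfl | hz
      · exact hpZ z (p.support_takeUntil_subset_support hx hz)
      · exact hpZ z hx
      · exact hpZ z (p.support_dropUntil_subset_support hy hz))
    have h2 := congrArg SimpleGraph.Walk.length (p.take_spec hy)
    simp only [SimpleGraph.Walk.length_append, SimpleGraph.Walk.length_cons] at h1 h2
    omega
  have edge : ∀ x (hx : x ∈ p.support) y (hy : y ∈ p.support), x ≠ y →
      (p.takeUntil y hy).length = (p.takeUntil x hx).length + 1 → s(x, y) ∈ p.edges := by
    intro x hx y hy hxy he
    rw [SimpleGraph.Walk.mk_mem_edges_iff_exists]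
    have h3 := p.length_takeUntil_le_length hy
    refine ⟨(p.takeUntil x hx).length, by omega, ?_⟩
    rw [← he, SimpleGraph.Walk.getVert_length_takeUntil, SimpleGraph.Walk.getVert_length_takeUntil]
  refine ⟨p, hpath, hpZ, fun x hx y hy hxy => ?_⟩
  have h1 := key x hx y hy hxy
  have h2 := key y hy x hx hxy.symm
  have h3 : (p.takeUntil y hy).length ≠ (p.takeUntil x hx).length := by
    intro he
    apply hxy.ne
    rw [← SimpleGraph.Walk.getVert_length_takeUntil hx, ← he,
      SimpleGraph.Walk.getVert_length_takeUntil hy]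
  rcases Nat.lt_or_gt_of_ne h3 with h | h
  · rw [Sym2.eq_swap]
    exact edge y hy x hx hxy.ne' (by omega)
  · exact edge x hx y hy hxy.ne (by omega)

/-- Two vertices that are both attached to each of two separated connected sets of a chordal graph
are adjacent: otherwise induced paths through the two sets would close to a chordless cycle. -/
theorem adj_of_two_sides (hG : IsChordal G) {D E : Set V} (hD : ConnSet G D) (hE : ConnSet G E)
    (hdis : ∀ x ∈ D, x ∉ E) (hno : ∀ d ∈ D, ∀ e ∈ E, ¬ G.Adj d e) {s t : V} (hst : s ≠ t)
    (hsD : s ∉ D) (htD : t ∉ D) (hsE : s ∉ E) (htE : t ∉ E)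
    (h1 : ∃ d ∈ D, G.Adj s d) (h2 : ∃ d ∈ D, G.Adj t d) (h3 : ∃ e ∈ E, G.Adj s e)
    (h4 : ∃ e ∈ E, G.Adj t e) : G.Adj s t := by
  by_contra hadj
  have walk : ∀ D : Set V, ConnSet G D → (∃ d ∈ D, G.Adj s d) → (∃ d ∈ D, G.Adj t d) →
      ∃ p : G.Walk s t, ∀ x ∈ p.support, x ∈ insert s (insert t D) := by
    rintro D hD ⟨d, hd, hsd⟩ ⟨d', hd', htd'⟩
    obtain ⟨p, hp⟩ := (hD d hd d' hd').exists_walk hd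
    refine ⟨.cons hsd (p.concat htd'.symm), fun x hx => ?_⟩
    rw [SimpleGraph.Walk.support_cons, SimpleGraph.Walk.support_concat] at hx
    simp only [List.mem_cons, List.mem_append, List.not_mem_nil,
      or_false] at hx
    rcases hx with rfl | hx | rfl
    · simp
    · simp [hp x hx]
    · simp
  obtain ⟨p, hp, hpZ, hpc⟩ := exists_induced_path (walk D hD h1 h2)
  obtain ⟨q, hq, hqZ, hqc⟩ := exists_induced_path (walk E hE h3 h4)
  have len : ∀ p : G.Walk s t, 2 ≤ p.length := by
    intro p
    rcases p with _ | ⟨h, _ | ⟨h', p⟩⟩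
    · exact absurd rfl hst
    · exact absurd h hadj
    · simp only [SimpleGraph.Walk.length_cons]; omega
  have common : ∀ x, x ∈ p.support → x ∈ q.support → x = s ∨ x = t := by
    intro x hx hx'
    have a := hpZ x hx
    have b := hqZ x hx'
    simp only [Set.mem_insert_iff] at a b
    rcases a with a | a | a
    · exact .inl a
    · exact .inr a
    · rcases b with b | b | b
      · exact .inl b
      · exact .inr b
      · exact absurd b (hdis x a)
  have hcyc : (p.append q.reverse).IsCycle := by
    rw [SimpleGraph.Walk.isCycle_def]
    have nodup : (p.append q.reverse).support.tail.Nodup := by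
      rw [SimpleGraph.Walk.support_append, List.tail_append_of_ne_nil (by simp),
        List.nodup_append]
      refine ⟨?_, ?_, ?_⟩
      · exact hp.support_nodup.tail
      · exact hq.reverse.support_nodup.tail
      · rintro x hx y hy rfl
        have hxp := List.mem_of_mem_tail hx
        have hxq := List.mem_of_mem_tail hy
        rw [SimpleGraph.Walk.support_reverse, List.mem_reverse] at hxq
        rcases common x hxp hxq with rfl | rfl
        · have := hp.support_nodup
          rw [← SimpleGraph.Walk.cons_tail_support] at this
          exact (List.nodup_cons.1 this).1 hx
        · have := hq.reverse.support_nodup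
          rw [← SimpleGraph.Walk.cons_tail_support] at this
          exact (List.nodup_cons.1 this).1 hy
    refine ⟨?_, ?_, nodup⟩
    · -- a common edge of the two paths would join `s` and `t`
      rw [SimpleGraph.Walk.isTrail_def, SimpleGraph.Walk.edges_append, List.nodup_append]
      refine ⟨hp.isTrail.edges_nodup, hq.reverse.isTrail.edges_nodup, ?_⟩
      rintro e he f hf rfl
      rw [SimpleGraph.Walk.edges_reverse, List.mem_reverse] at hf
      induction e with | _ x y =>
      have hxy := p.adj_of_mem_edges he
      have a := common x (p.fst_mem_support_of_mem_edges he) (q.fst_mem_support_of_mem_edges hf)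
      have b := common y (p.snd_mem_support_of_mem_edges he) (q.snd_mem_support_of_mem_edges hf)
      rcases a with rfl | rfl <;> rcases b with rfl | rfl
      · exact hxy.ne rfl
      · exact hadj hxy
      · exact hadj hxy.symm
      · exact hxy.ne rfl
    · intro h
      have := congrArg SimpleGraph.Walk.length h
      simp only [SimpleGraph.Walk.length_append, SimpleGraph.Walk.length_nil] at this
      have := len p
      omega
  obtain ⟨x, hx, y, hy, hxy, hne⟩ := hG s _ hcyc (by
    have := len p
    have := len q
    simp only [SimpleGraph.Walk.length_append, SimpleGraph.Walk.length_reverse]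
    omega)
  simp only [SimpleGraph.Walk.mem_support_append_iff, SimpleGraph.Walk.support_reverse,
    List.mem_reverse] at hx hy
  simp only [SimpleGraph.Walk.edges_append, SimpleGraph.Walk.edges_reverse, List.mem_append,
    List.mem_reverse, not_or] at hne
  have cross : ∀ x y, x ∈ p.support → y ∈ q.support → G.Adj x y →
      (x ∈ q.support ∨ y ∈ p.support) := by
    intro x y hx hy hxy
    have a := hpZ x hx
    have b := hqZ y hy
    simp only [Set.mem_insert_iff] at a b
    rcases a with rfl | rfl | a
    · exact .inl q.start_mem_support
    · exact .inl q.end_mem_support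
    rcases b with rfl | rfl | b
    · exact .inr p.start_mem_support
    · exact .inr p.end_mem_support
    exact absurd hxy (hno x a y b)
  rcases hx with hx | hx <;> rcases hy with hy | hy
  · exact hne.1 (hpc x hx y hy hxy)
  · rcases cross x y hx hy hxy with h | h
    · exact hne.2 (hqc x h y hy hxy)
    · exact hne.1 (hpc x hx y h hxy)
  · rcases cross y x hy hx hxy.symm with h | h
    · exact hne.2 (hqc x hx y h hxy)
    · exact hne.1 (hpc x h y hy hxy)
  · exact hne.2 (hqc x hx y hy hxy)

/-- A finite clique `S` each of whose vertices has a neighbor in the nonempty connected set `B` has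
a common neighbor in `B`. -/
theorem exists_complete_vertex (hG : IsChordal G) {B S : Set V} (hB : ConnSet G B)
    (hne : B.Nonempty) (hS : S.Pairwise G.Adj) (hfin : S.Finite) (hdis : ∀ s ∈ S, s ∉ B)
    (hnb : ∀ s ∈ S, ∃ b ∈ B, G.Adj s b) : ∃ b ∈ B, ∀ s ∈ S, G.Adj s b := by
  -- a vertex of `B` with as many neighbors in `S` as possible
  have hex : ∃ b ∈ B, ∀ b' ∈ B, {s ∈ S | G.Adj s b'}.ncard ≤ {s ∈ S | G.Adj s b}.ncard := by
    have hbd : ∀ b ∈ B, {s ∈ S | G.Adj s b}.ncard ≤ S.ncard :=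
      fun b _ => Set.ncard_le_ncard (Set.sep_subset _ _) hfin
    obtain ⟨b0, hb0⟩ := hne
    by_contra hcon
    push Not at hcon
    have : ∀ n : ℕ, ∃ b ∈ B, n ≤ {s ∈ S | G.Adj s b}.ncard := by
      intro n
      induction n with
      | zero => exact ⟨b0, hb0, Nat.zero_le _⟩
      | succ n ih =>
        obtain ⟨b, hb, h⟩ := ih
        obtain ⟨b', hb', h'⟩ := hcon b hb
        exact ⟨b', hb', by omega⟩
    obtain ⟨b, hb, h⟩ := this (S.ncard + 1)
    have := hbd b hb
    omega
  obtain ⟨b, hb, hmax⟩ := hex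
  refine ⟨b, hb, fun s hs => ?_⟩
  by_contra hsb
  -- the part of `B` around `b` that avoids the neighbors of `s`
  set E := comp G {x ∈ B | ¬ G.Adj s x} b with hEdef
  have hbZ : b ∈ {x ∈ B | ¬ G.Adj s x} := ⟨hb, hsb⟩
  have hEB : E ⊆ {x ∈ B | ¬ G.Adj s x} := comp_subset hbZ
  obtain ⟨b1, hb1, hsb1⟩ := hnb s hs
  have hex : ∃ b' ∈ B, G.Adj s b' ∧ ∃ e ∈ E, G.Adj b' e := by
    have hj := hB b hb b1 hb1
    by_contra hcon
    push Not at hcon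
    have : ∀ y, Joined G B b y → y ∈ E := by
      intro y hy
      induction hy with
      | refl => exact Joined.refl
      | tail h1 h2 ih =>
        refine comp_adj hbZ ih h2.1 ⟨h2.2.2, fun hadj => ?_⟩
        exact hcon _ h2.2.2 hadj _ ih h2.1.symm
    exact (hEB (this b1 hj)).2 hsb1
  obtain ⟨b', hb', hsb', e, he, hbe⟩ := hex
  have hle := hmax b' hb'
  have hlt : {s ∈ S | G.Adj s b}.ncard < {s ∈ S | G.Adj s b'}.ncard := by
    refine Set.ncard_lt_ncard ⟨?_, fun hsub => hsb (hsub ⟨hs, hsb'⟩).2⟩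
      (hfin.subset (Set.sep_subset _ _))
    rintro t ⟨ht, htb⟩
    refine ⟨ht, ?_⟩
    have hts : t ≠ s := by rintro rfl; exact hsb htb
    refine adj_of_two_sides (D := {s}) (E := E) hG ?_ connSet_comp ?_ ?_ ?_ ?_ ?_ ?_ ?_ ?_ ?_ ?_ ?_
    · rintro x rfl y rfl; exact Joined.refl
    · rintro x rfl hx; exact hdis x hs (hEB hx).1
    · rintro x rfl y hy; exact (hEB hy).2
    · rintro rfl; exact hdis t ht hb'
    · exact hts
    · rintro rfl; exact hdis b' hs hb'
    · exact fun h => hdis t ht (hEB h).1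
    · exact fun h => (hEB h).2 hsb'
    · exact ⟨s, rfl, hS ht hs hts⟩
    · exact ⟨s, rfl, hsb'.symm⟩
    · exact ⟨b, Joined.refl, htb⟩
    · exact ⟨e, he, hbe⟩
  omega

/-! ### Perfect orderings -/

/-- `W ⊆ U` is such that the vertices of `W` attached to one component of `G[U \ W]` always form a
clique. These are the vertex sets from which a perfect ordering of `G[U]` can be continued. -/
def Good (G : SimpleGraph V) (U W : Set V) : Prop :=
  W ⊆ U ∧ ∀ z ∈ U \ W, ∀ s ∈ W, ∀ t ∈ W, s ≠ t →
    (∃ d, Joined G (U \ W) z d ∧ G.Adj s d) → (∃ d, Joined G (U \ W) z d ∧ G.Adj t d) → G.Adj s t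

/-- In a list ordered like this, the earlier neighbors of each vertex form a clique. -/
def PerfectList (G : SimpleGraph V) (l : List V) : Prop :=
  l.Nodup ∧ ∀ l₁ z l₂, l = l₁ ++ z :: l₂ → {u | u ∈ l₁ ∧ G.Adj u z}.Pairwise G.Adj

/-- `z` is adjacent to all vertices of `W` that are attached to the component of `z` in
`G[U \ W]`. -/
def Saturated (G : SimpleGraph V) (U W : Set V) (z : V) : Prop :=
  ∀ s ∈ W, (∃ d, Joined G (U \ W) z d ∧ G.Adj s d) → G.Adj s z

theorem Good.pairwise_of_mem {U W : Set V} (h : Good G U W) {z : V} (hz : z ∈ U \ W) :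
    {s ∈ W | G.Adj s z}.Pairwise G.Adj := fun s hs t ht hst =>
  h.2 z hz s hs.1 t ht.1 hst ⟨z, Joined.refl, hs.2⟩ ⟨z, Joined.refl, ht.2⟩

theorem Good.insert_saturated {U W : Set V} (h : Good G U W) {z : V} (hz : z ∈ U \ W)
    (hs : Saturated G U W z) : Good G U (insert z W) := by
  have hsub : U \ insert z W ⊆ U \ W := fun x hx => ⟨hx.1, fun h => hx.2 (.inr h)⟩
  refine ⟨Set.insert_subset hz.1 h.1, ?_⟩
  have main : ∀ y ∈ U \ insert z W, ∀ d, Joined G (U \ insert z W) y d → G.Adj z d → ∀ t ∈ W,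
      (∃ d, Joined G (U \ insert z W) y d ∧ G.Adj t d) → G.Adj t z := by
    rintro y hy d hyd hzd t ht ⟨d', hyd', htd'⟩
    refine hs t ht ⟨d', ?_, htd'⟩
    have hd := hyd.mem hy
    exact (Joined.single hzd hz (hsub hd)).trans ((hyd.symm.trans hyd').mono hsub)
  rintro y hy s hsW t htW hst ⟨d, hyd, hsd⟩ ⟨d', hyd', htd'⟩
  rcases hsW with rfl | hsW <;> rcases htW with rfl | htW
  · exact absurd rfl hst
  · exact (main y hy d hyd hsd t htW ⟨d', hyd', htd'⟩).symm
  · exact main y hy d' hyd' htd' s hsW ⟨d, hyd, hsd⟩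
  · exact h.2 y (hsub hy) s hsW t htW hst ⟨d, hyd.mono hsub, hsd⟩ ⟨d', hyd'.mono hsub, htd'⟩

theorem Good.exists_saturated [Finite V] (hG : IsChordal G) {U W : Set V} (h : Good G U W) {y : V}
    (hy : y ∈ U \ W) : ∃ z ∈ comp G (U \ W) y, Saturated G U W z := by
  obtain ⟨z, hz, hzS⟩ := exists_complete_vertex hG (B := comp G (U \ W) y)
    (S := {s ∈ W | ∃ d, Joined G (U \ W) y d ∧ G.Adj s d}) connSet_comp ⟨y, Joined.refl⟩
    (fun s hs t ht hst => h.2 y hy s hs.1 t ht.1 hst hs.2 ht.2) (Set.toFinite _)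
    (fun s hs hsB => (comp_subset hy hsB).2 hs.1) (fun s hs => hs.2)
  refine ⟨z, hz, fun s hs hd => hzS s ⟨hs, ?_⟩⟩
  obtain ⟨d, hd, hsd⟩ := hd
  exact ⟨d, hz.trans hd, hsd⟩

/-- A vertex with the maximal number of neighbors in `W` is saturated, since its component contains
a saturated vertex. -/
theorem Good.saturated_of_max [Finite V] (hG : IsChordal G) {U W : Set V} (h : Good G U W) {z : V}
    (hz : z ∈ U \ W)
    (hmax : ∀ y ∈ U \ W, {s ∈ W | G.Adj s y}.ncard ≤ {s ∈ W | G.Adj s z}.ncard) :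
    Saturated G U W z := by
  obtain ⟨y, hy, hyS⟩ := h.exists_saturated hG hz
  have hsub : {s ∈ W | G.Adj s z} ⊆ {s ∈ W | G.Adj s y} :=
    fun s hs => ⟨hs.1, hyS s hs.1 ⟨z, hy.symm, hs.2⟩⟩
  have heq := Set.eq_of_subset_of_ncard_le hsub (hmax y (comp_subset hz hy)) (Set.toFinite _)
  rintro s hs ⟨d, hd, hsd⟩
  have : s ∈ {s ∈ W | G.Adj s y} := ⟨hs, hyS s hs ⟨d, hy.symm.trans hd, hsd⟩⟩
  rw [← heq] at this
  exact this.2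

theorem PerfectList.concat {l : List V} (h : PerfectList G l) {z : V} (hz : z ∉ l)
    (hc : {u | u ∈ l ∧ G.Adj u z}.Pairwise G.Adj) : PerfectList G (l ++ [z]) := by
  refine ⟨?_, fun l₁ y l₂ he => ?_⟩
  · rw [List.nodup_append]
    exact ⟨h.1, by simp, by rintro a ha b hb rfl; simp at hb; exact hz (hb ▸ ha)⟩
  · rcases List.eq_nil_or_concat l₂ with rfl | ⟨l₂, w, rfl⟩
    · have := List.append_inj' he rfl
      obtain ⟨rfl, h2⟩ := this
      simp at h2
      subst h2
      exact hc
    · rw [List.concat_eq_append, ← List.cons_append, ← List.append_assoc] at he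
      exact h.2 l₁ y l₂ (List.append_inj' he rfl).1

theorem PerfectList.extend [Finite V] (hG : IsChordal G) {U : Set V} {l : List V}
    (h : PerfectList G l) (hgood : Good G U {v | v ∈ l}) :
    ∃ l', PerfectList G (l ++ l') ∧ ∀ v, v ∈ l ++ l' ↔ v ∈ U := by
  induction hn : (U \ {v | v ∈ l}).ncard using Nat.strong_induction_on generalizing l with
  | _ n ih =>
  by_cases hne : (U \ {v | v ∈ l}).Nonempty
  · obtain ⟨y, hy⟩ := hne
    obtain ⟨z, hz, hsat⟩ := hgood.exists_saturated hG hy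
    have hz' := comp_subset hy hz
    have hset : {v | v ∈ l ++ [z]} = insert z {v | v ∈ l} := by
      ext v; simp [or_comm]
    obtain ⟨l', h1, h2⟩ := ih (U \ {v | v ∈ l ++ [z]}).ncard (by
      rw [← hn, hset]
      refine Set.ncard_lt_ncard ⟨fun x hx => ⟨hx.1, fun h => hx.2 (.inr h)⟩, fun hsub => ?_⟩
        (Set.toFinite _)
      exact (hsub hz').2 (.inl rfl)) (h.concat hz'.2 (hgood.pairwise_of_mem hz'))
      (by rw [hset]; exact hgood.insert_saturated hz' hsat) rfl
    exact ⟨z :: l', by simpa using h1, by simpa using h2⟩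
  · rw [Set.not_nonempty_iff_eq_empty, Set.sdiff_eq_empty] at hne
    exact ⟨[], by simpa using h, fun v => by
      rw [List.append_nil]; exact ⟨fun hv => hgood.1 hv, fun hv => hne hv⟩⟩

/-! ### Induced subgraphs and perfect orderings as orientations -/

/-- The induced subgraph `G[U]` as a subgraph of `G`. -/
abbrev sub (G : SimpleGraph V) (U : Set V) : G.Subgraph := (⊤ : G.Subgraph).induce U

theorem sub_adj {U : Set V} {u v : V} : (sub G U).Adj u v ↔ u ∈ U ∧ v ∈ U ∧ G.Adj u v := by
  simp [SimpleGraph.Subgraph.induce]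

theorem sub_univ : sub G Set.univ = ⊤ := by
  rw [← SimpleGraph.Subgraph.induce_self_verts (G' := (⊤ : G.Subgraph))]; rfl

theorem sub_connected {U : Set V} : (sub G U).Connected ↔ U.Nonempty ∧ ConnSet G U := by
  rw [← connected_induce_iff, SimpleGraph.induce_eq_coe_induce_top]
  exact ⟨fun h => h.1, fun h => ⟨h⟩⟩

theorem sublist_pair_iff [DecidableEq V] {l : List V} (hl : l.Nodup) {u v : V} :
    [u, v].Sublist l ↔ u ∈ l ∧ v ∈ l ∧ l.idxOf u < l.idxOf v := by
  induction l with
  | nil => simp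
  | cons a l ih =>
    rw [List.nodup_cons] at hl
    rw [List.sublist_cons_iff, ih hl.2]
    constructor
    · rintro (⟨h1, h2, h3⟩ | ⟨r, hr, h⟩)
      · have hu : a ≠ u := by rintro rfl; exact hl.1 h1
        have hv : a ≠ v := by rintro rfl; exact hl.1 h2
        refine ⟨.tail _ h1, .tail _ h2, ?_⟩
        rw [List.idxOf_cons_ne _ hu, List.idxOf_cons_ne _ hv]
        omega
      · simp only [List.cons.injEq] at hr
        obtain ⟨rfl, rfl⟩ := hr
        rw [List.singleton_sublist] at h
        have hv : u ≠ v := by rintro rfl; exact hl.1 h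
        refine ⟨.head _, .tail _ h, ?_⟩
        rw [List.idxOf_cons_self, List.idxOf_cons_ne _ hv]
        omega
    · rintro ⟨h1, h2, h3⟩
      by_cases hu : a = u
      · subst hu
        right
        refine ⟨[v], rfl, ?_⟩
        rw [List.singleton_sublist]
        rcases List.mem_cons.1 h2 with rfl | h2
        · simp at h3
        · exact h2
      · left
        have hv : a ≠ v := by
          rintro rfl
          rw [List.idxOf_cons_self] at h3
          omega
        rw [List.idxOf_cons_ne _ hu, List.idxOf_cons_ne _ hv] at h3
        refine ⟨(List.mem_cons.1 h1).resolve_left (Ne.symm hu),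
          (List.mem_cons.1 h2).resolve_left (Ne.symm hv), by omega⟩

/-- Orienting all edges along a perfect ordering gives an acyclic moral orientation. -/
theorem PerfectList.isAMO {U : Set V} {l : List V} (hl : PerfectList G l)
    (hU : ∀ v, v ∈ l ↔ v ∈ U) :
    IsAMO (sub G U) (fun u v => G.Adj u v ∧ [u, v].Sublist l) ∧
      IsTopologicalOrdering (sub G U) (fun u v => G.Adj u v ∧ [u, v].Sublist l) l := by
  classical
  have hs : ∀ u v, [u, v].Sublist l ↔ u ∈ l ∧ v ∈ l ∧ l.idxOf u < l.idxOf v :=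
    fun u v => sublist_pair_iff hl.1
  refine ⟨⟨?_, ?_, ?_, ?_⟩, hl.1, hU, fun u v h => h.2⟩
  · intro u v
    beta_reduce
    rw [sub_adj, hs, hs, ← hU, ← hU]
    constructor
    · rintro ⟨hu, hv, h⟩
      rcases Nat.lt_trichotomy (l.idxOf u) (l.idxOf v) with hlt | heq | hlt
      · exact .inl ⟨h, hu, hv, hlt⟩
      · exact absurd ((List.idxOf_inj hu).1 heq) h.ne
      · exact .inr ⟨h.symm, hv, hu, hlt⟩
    · rintro (⟨h, hu, hv, _⟩ | ⟨h, hv, hu, _⟩)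
      · exact ⟨hu, hv, h⟩
      · exact ⟨hu, hv, h.symm⟩
  · rintro u v ⟨_, h1⟩ ⟨_, h2⟩
    rw [hs] at h1 h2
    omega
  · intro v hv
    have : ∀ u, Relation.TransGen (fun u v => G.Adj u v ∧ [u, v].Sublist l) v u →
        l.idxOf v < l.idxOf u := by
      intro u hu
      induction hu with
      | single h => exact ((hs _ _).1 h.2).2.2
      | tail _ h ih => exact ih.trans ((hs _ _).1 h.2).2.2
    exact lt_irrefl _ (this v hv)
  · rintro a b c ⟨hac, h1⟩ ⟨hbc, h2⟩ hab
    have h1' := (hs _ _).1 h1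
    have h2' := (hs _ _).1 h2
    obtain ⟨l₁, l₂, rfl⟩ := List.append_of_mem h1'.2.1
    have hc : c ∉ l₁ := fun h => by
      have := hl.1
      rw [List.nodup_append] at this
      exact this.2.2 c h c (by simp) rfl
    have mem : ∀ x, [x, c].Sublist (l₁ ++ c :: l₂) → x ∈ l₁ := by
      intro x hx
      rw [hs] at hx
      by_contra hxl
      have h3 := hx.2.2
      rw [List.idxOf_append_of_notMem hc, List.idxOf_append_of_notMem hxl,
        List.idxOf_cons_self] at h3
      omega
    exact sub_adj.2 ⟨(hU a).1 h1'.1, (hU b).1 h2'.1,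
      hl.2 l₁ c l₂ rfl ⟨mem a h1, hac⟩ ⟨mem b h2, hbc⟩ hab⟩

/-! ### The subproblems of a maximal clique -/

/-- The vertices of `U` with an edge to all of `S`. -/
def commonNbrs (G : SimpleGraph V) (U S : Set V) : Set V := {y | y ∈ U ∧ ∀ s ∈ S, G.Adj s y}

/-- For a maximal clique `K` of `G[U]` and a vertex `x` outside, the component of `G[U \ N[x]]` that
contains the vertices of `K` not adjacent to `x`. -/
def farSide (G : SimpleGraph V) (U K : Set V) (x : V) : Set V :=
  {d | ∃ k ∈ K, ¬ G.Adj x k ∧ Joined G (U \ {y | y = x ∨ G.Adj x y}) k d}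

/-- The minimal separator between `K` and `x` that is closest to `x`: the neighborhood of
`farSide G U K x`. -/
def nearSep (G : SimpleGraph V) (U K : Set V) (x : V) : Set V :=
  {s | s ∈ U ∧ G.Adj x s ∧ ∃ d ∈ farSide G U K x, G.Adj s d}

/-- The common neighbors of `nearSep G U K x`, restricted to the component of `x`. -/
def bubble (G : SimpleGraph V) (U K : Set V) (x : V) : Set V :=
  comp G (commonNbrs G U (nearSep G U K x)) x

theorem maxCliques_sub {U K : Set V} : K ∈ maxCliques (sub G U) ↔
    K ⊆ U ∧ K.Pairwise G.Adj ∧ ∀ x ∈ U, (∀ k ∈ K, k ≠ x → G.Adj k x) → x ∈ K := by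
  constructor
  · intro h
    refine ⟨h.1.1, fun a ha b hb hab => (sub_adj.1 (h.1.2 ha hb hab)).2.2, fun x hx hK => ?_⟩
    refine h.2 (y := insert x K) ⟨Set.insert_subset hx h.1.1, ?_⟩ (Set.subset_insert _ _)
      (Set.mem_insert _ _)
    rintro a (rfl | ha) b (rfl | hb) hab
    · exact absurd rfl hab
    · exact sub_adj.2 ⟨hx, h.1.1 hb, (hK b hb hab.symm).symm⟩
    · exact sub_adj.2 ⟨h.1.1 ha, hx, hK a ha hab⟩
    · exact h.1.2 ha hb hab
  · rintro ⟨h1, h2, h3⟩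
    refine ⟨⟨h1, fun a ha b hb hab => sub_adj.2 ⟨h1 ha, h1 hb, h2 ha hb hab⟩⟩, ?_⟩
    intro K' hK' hle x hx
    exact h3 x (hK'.1 hx) fun k hk hkx => (sub_adj.1 (hK'.2 (hle hk) hx hkx)).2.2

section

variable {U K : Set V}

theorem exists_not_adj (hK : K ∈ maxCliques (sub G U)) {x : V} (hx : x ∈ U \ K) :
    ∃ k ∈ K, ¬ G.Adj x k := by
  by_contra h
  push Not at h
  exact hx.2 ((maxCliques_sub.1 hK).2.2 x hx.1 fun k hk _ => (h k hk).symm)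

theorem farSide_subset (hKU : K ⊆ U) {x : V} (hx : x ∉ K) :
    farSide G U K x ⊆ U \ {y | y = x ∨ G.Adj x y} := by
  rintro d ⟨k, hk, hkx, hj⟩
  refine hj.mem ⟨hKU hk, ?_⟩
  rintro (rfl | h)
  · exact hx hk
  · exact hkx h

theorem farSide_adj (hKU : K ⊆ U) {x d e : V} (hx : x ∉ K) (hd : d ∈ farSide G U K x)
    (hde : G.Adj d e) (he : e ∈ U) (hex : e ≠ x) (hxe : ¬ G.Adj x e) : e ∈ farSide G U K x := by
  have hd' := farSide_subset hKU hx hd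
  obtain ⟨k, hk, hkx, hj⟩ := hd
  exact ⟨k, hk, hkx, hj.tail hde hd' ⟨he, fun h => h.elim hex hxe⟩⟩

theorem farSide_connSet (hK : K ∈ maxCliques (sub G U)) {x : V} :
    ConnSet G (farSide G U K x) := by
  have hK' := maxCliques_sub.1 hK
  have main : ∀ k ∈ K, ¬ G.Adj x k → ∀ d,
      Joined G (U \ {y | y = x ∨ G.Adj x y}) k d → Joined G (farSide G U K x) k d := by
    intro k hk hkx d hj
    induction hj with
    | refl => exact Joined.refl
    | tail h1 h2 ih =>
      exact ih.tail h2.1 ⟨k, hk, hkx, h1⟩ ⟨k, hk, hkx, Relation.ReflTransGen.tail h1 h2⟩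
  rintro a ⟨k, hk, hkx, hj⟩ b ⟨k', hk', hkx', hj'⟩
  have hkk : Joined G (farSide G U K x) k k' := by
    by_cases h : k = k'
    · subst h; exact Joined.refl
    · exact Joined.single (hK'.2.1 hk hk' h) ⟨k, hk, hkx, Joined.refl⟩ ⟨k', hk', hkx', Joined.refl⟩
  exact ((main k hk hkx a hj).symm.trans hkk).trans (main k' hk' hkx' b hj')

theorem nearSep_pairwise (hG : IsChordal G) (hK : K ∈ maxCliques (sub G U)) {x : V} (hx : x ∉ K) :
    (nearSep G U K x).Pairwise G.Adj := by
  have hsub := farSide_subset (G := G) hK.1.1 hx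
  rintro s ⟨_, hxs, d, hd, hsd⟩ t ⟨_, hxt, d', hd', htd⟩ hst
  refine adj_of_two_sides (E := {x}) hG (farSide_connSet hK) ?_ ?_ ?_ hst ?_ ?_ ?_ ?_
    ⟨d, hd, hsd⟩ ⟨d', hd', htd⟩ ⟨x, rfl, hxs.symm⟩ ⟨x, rfl, hxt.symm⟩
  · rintro a rfl b rfl; exact Joined.refl
  · rintro a ha rfl; exact (hsub ha).2 (.inl rfl)
  · rintro a ha b rfl h; exact (hsub ha).2 (.inr h.symm)
  · exact fun h => (hsub h).2 (.inr hxs)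
  · exact fun h => (hsub h).2 (.inr hxt)
  · rintro rfl; exact hxs.ne rfl
  · rintro rfl; exact hxt.ne rfl

theorem mem_nearSep_of_mem_clique (hK : K ∈ maxCliques (sub G U)) {x k : V} (hx : x ∈ U \ K)
    (hk : k ∈ K) (h : G.Adj x k) : k ∈ nearSep G U K x := by
  have hK' := maxCliques_sub.1 hK
  obtain ⟨k', hk', hxk'⟩ := exists_not_adj hK hx
  exact ⟨hK'.1 hk, h, k', ⟨k', hk', hxk', Joined.refl⟩,
    hK'.2.1 hk hk' (by rintro rfl; exact hxk' h)⟩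

/-- In an acyclic moral orientation, a vertex without parents in a connected set is an ancestor of
all its vertices. -/
theorem IsAMO.ancestor_of_source {α : V → V → Prop} (hα : IsAMO (sub G U) α) {X : Set V}
    (hXU : X ⊆ U) {f : V} (hsrc : ∀ z ∈ X, ¬ α z f) {z : V} (hz : Joined G X f z) :
    Relation.ReflTransGen α f z := by
  -- the predecessors in `X` of a descendant of `f` are descendants of `f`
  have up : ∀ w, Relation.ReflTransGen (fun a b => α a b ∧ a ∈ X) f w → ∀ y ∈ X, α y w →
      Relation.ReflTransGen (fun a b => α a b ∧ a ∈ X) f y := by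
    intro w hw
    induction hw with
    | refl => exact fun y hy h => absurd h (hsrc y hy)
    | tail h1 h2 ih =>
      rename_i b c
      intro y hy hyc
      by_cases hby : b = y
      · exact hby ▸ h1
      · rcases (hα.1 b y).1 (hα.2.2.2 b y _ h2.1 hyc hby) with h | h
        · exact h1.tail ⟨h, h2.2⟩
        · exact ih y hy h
  have : Relation.ReflTransGen (fun a b => α a b ∧ a ∈ X) f z := by
    induction hz with
    | refl => exact Relation.ReflTransGen.refl
    | tail h1 h2 ih =>
      rcases (hα.1 _ _).1 (sub_adj.2 ⟨hXU h2.2.1, hXU h2.2.2, h2.1⟩) with h | h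
      · exact ih.tail ⟨h, h2.2.1⟩
      · exact up _ ih _ h2.2.2 h
  exact Relation.ReflTransGen.mono (fun _ _ h => h.1) _ _ this

theorem mem_clique_of_ancestor {α : V → V → Prop} {π τ : List V}
    (hτ : IsTopologicalOrdering (sub G U) α τ) (hπ : IsPermOf π K) (hpre : π <+: τ) {y k : V}
    (hk : k ∈ K) (h : Relation.ReflTransGen α y k) : y ∈ K := by
  classical
  have step : ∀ y k, k ∈ K → α y k → y ∈ K := by
    intro y k hk hyk
    have := hτ.2.2 y k hyk
    rw [sublist_pair_iff hτ.1] at this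
    obtain ⟨ρ, rfl⟩ := hpre
    by_contra hy
    rw [List.idxOf_append_of_mem ((hπ.2 k).2 hk),
      List.idxOf_append_of_notMem fun h => hy ((hπ.2 y).1 h)] at this
    have := List.idxOf_lt_length_of_mem ((hπ.2 k).2 hk)
    omega
  induction h using Relation.ReflTransGen.head_induction_on with
  | refl => exact hk
  | head h1 _ ih => exact step _ _ ih h1

/-- All orientations that start with `K` direct the edges from `nearSep G U K y` towards `y`:
otherwise `y` would be an ancestor of a vertex of `K`. -/
theorem orient_of_mem_nearSep (hK : K ∈ maxCliques (sub G U)) {α : V → V → Prop} {π τ : List V}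
    (hα : IsAMO (sub G U) α) (hτ : IsTopologicalOrdering (sub G U) α τ) (hπ : IsPermOf π K)
    (hpre : π <+: τ) {x y : V} (hy : y ∈ U \ K) (hx : x ∈ nearSep G U K y) : ¬ α y x := by
  intro hyx
  have hsub := farSide_subset (G := G) hK.1.1 hy.2
  obtain ⟨hxU, hxy, d, hd, hxd⟩ := hx
  obtain ⟨k, hk, hky⟩ := exists_not_adj hK hy
  have hkD : k ∈ farSide G U K y := ⟨k, hk, hky, Joined.refl⟩
  refine hy.2 (mem_clique_of_ancestor hτ hπ hpre hk
    (hα.ancestor_of_source (X := insert y (insert x (farSide G U K y))) ?_ ?_ ?_))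
  · exact Set.insert_subset hy.1 (Set.insert_subset hxU fun z hz => (hsub hz).1)
  · rintro z (rfl | rfl | hz) hzy
    · exact hα.2.1 _ _ hzy hzy
    · exact hα.2.1 _ _ hzy hyx
    · exact (hsub hz).2 (.inr (sub_adj.1 ((hα.1 _ _).2 (.inl hzy))).2.2.symm)
  · refine (Joined.single hxy (by simp) (by simp)).trans ?_
    refine (Joined.single hxd (by simp) (by simp [hd])).trans ?_
    exact (farSide_connSet hK d hd k hkD).mono fun z hz => by simp [hz]

/-- Adjacent vertices outside `K` with different separators are in each other's separator, one way
or the other. -/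
theorem farSide_eq_of_not_mem (hK : K ∈ maxCliques (sub G U)) {x y : V} (hx : x ∈ U \ K)
    (hy : y ∈ U \ K) (hxy : G.Adj x y) (h1 : x ∉ nearSep G U K y) (h2 : y ∉ nearSep G U K x) :
    farSide G U K x = farSide G U K y := by
  have main : ∀ x y : V, x ∈ U \ K → y ∈ U \ K → G.Adj x y → x ∉ nearSep G U K y →
      y ∉ nearSep G U K x → farSide G U K x ⊆ farSide G U K y := by
    rintro x y hx hy hxy h1 h2 d ⟨k, hk, hkx, hj⟩
    have hno : ∀ d ∈ farSide G U K x, ¬ G.Adj y d := fun d hd h => h2 ⟨hy.1, hxy, d, hd, h⟩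
    have hky := hno k ⟨k, hk, hkx, Joined.refl⟩
    induction hj with
    | refl => exact ⟨k, hk, hky, Joined.refl⟩
    | tail ha hb ih =>
      rename_i a b
      have hb' : b ∈ farSide G U K x := ⟨k, hk, hkx, Relation.ReflTransGen.tail ha hb⟩
      refine farSide_adj hK.1.1 hy.2 ih hb.1 hb.2.2.1 ?_ (hno b hb')
      rintro rfl
      exact hb.2.2.2 (.inr hxy)
  exact Set.Subset.antisymm (main x y hx hy hxy h1 h2) (main y x hy hx hxy.symm h2 h1)

theorem nearSep_eq_of_not_mem (hK : K ∈ maxCliques (sub G U)) {x y : V} (hx : x ∈ U \ K)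
    (hy : y ∈ U \ K) (hxy : G.Adj x y) (h1 : x ∉ nearSep G U K y) (h2 : y ∉ nearSep G U K x) :
    nearSep G U K x = nearSep G U K y := by
  have hD := farSide_eq_of_not_mem hK hx hy hxy h1 h2
  have main : ∀ x y : V, x ∈ U \ K → y ∈ U \ K → G.Adj x y → x ∉ nearSep G U K y →
      farSide G U K x = farSide G U K y → nearSep G U K x ⊆ nearSep G U K y := by
    rintro x y hx hy hxy h1 hD s ⟨hs, hxs, d, hd, hsd⟩
    refine ⟨hs, ?_, d, hD ▸ hd, hsd⟩
    by_contra hys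
    have hsy : s ≠ y := by
      rintro rfl
      exact (farSide_subset (G := G) hK.1.1 hy.2 (hD ▸ hd)).2 (.inr hsd)
    have := farSide_adj hK.1.1 hy.2 (hD ▸ hd) hsd.symm hs hsy hys
    exact h1 ⟨hx.1, hxy.symm, s, this, hxs⟩
  exact Set.Subset.antisymm (main x y hx hy hxy h1 hD) (main y x hy hx hxy.symm h2 hD.symm)

/-- Along the edges inside the common neighborhood of the separator of `z`, the separator does not
change. -/
theorem nearSep_eq_of_commonNbr (hK : K ∈ maxCliques (sub G U)) {z y : V} (hz : z ∈ U \ K)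
    (hzy : G.Adj z y) (hy : y ∈ commonNbrs G U (nearSep G U K z)) :
    y ∉ K ∧ nearSep G U K y = nearSep G U K z := by
  have hyS : y ∉ nearSep G U K z := fun h => (hy.2 y h).ne rfl
  have hyK : y ∉ K := fun h => hyS (mem_nearSep_of_mem_clique hK hz h hzy)
  refine ⟨hyK, (nearSep_eq_of_not_mem hK hz ⟨hy.1, hyK⟩ hzy ?_ hyS).symm⟩
  -- the far side of `y` is contained in that of `z`
  have hsub : farSide G U K y ⊆ farSide G U K z := by
    rintro d ⟨k, hk, hky, hj⟩
    have hkz : ¬ G.Adj z k := fun h => hky (hy.2 k (mem_nearSep_of_mem_clique hK hz hk h)).symm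
    induction hj with
    | refl => exact ⟨k, hk, hkz, Joined.refl⟩
    | tail ha hb ih =>
      rename_i a b
      refine farSide_adj hK.1.1 hz.2 ih hb.1 hb.2.2.1 ?_ ?_
      · rintro rfl; exact hb.2.2.2 (.inr hzy.symm)
      · intro hzb
        exact hb.2.2.2 (.inr (hy.2 b ⟨hb.2.2.1, hzb, a, ih, hb.1.symm⟩).symm)
  rintro ⟨_, _, d, hd, hzd⟩
  exact (farSide_subset (G := G) hK.1.1 hz.2 (hsub hd)).2 (.inr hzd)

theorem mem_bubble {x y : V} (hK : K ∈ maxCliques (sub G U)) (hx : x ∈ U \ K)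
    (hy : y ∈ bubble G U K x) :
    y ∈ U \ K ∧ nearSep G U K y = nearSep G U K x := by
  induction hy with
  | refl => exact ⟨hx, rfl⟩
  | tail h1 h2 ih =>
    have := nearSep_eq_of_commonNbr hK ih.1 h2.1 (by rw [ih.2]; exact h2.2.2)
    exact ⟨⟨h2.2.2.1, this.1⟩, this.2.trans ih.2⟩

theorem self_mem_commonNbrs {x : V} (hx : x ∈ U) : x ∈ commonNbrs G U (nearSep G U K x) :=
  ⟨hx, fun _ hs => hs.2.1.symm⟩

/-- Adjacent vertices with the same separator can be oriented either way: order first all vertices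
beyond that separator, then `x`, then `y`, then the rest. -/
theorem exists_orientation [Finite V] (hG : IsChordal G) (hK : K ∈ maxCliques (sub G U)) {x y : V}
    (hx : x ∈ U \ K) (hy : y ∈ U \ K) (hxy : G.Adj x y)
    (hS : nearSep G U K x = nearSep G U K y) : cliqueOrientation (sub G U) K x y := by
  classical
  have hK' := maxCliques_sub.1 hK
  set S := nearSep G U K x with hSdef
  have hSclique : S.Pairwise G.Adj := nearSep_pairwise hG hK hx.2
  have hSU : S ⊆ U := fun s hs => hs.1
  have hxZ : x ∈ U \ S := ⟨hx.1, fun h => h.2.1.ne rfl⟩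
  have hyS : y ∉ S := by rw [hS]; exact fun h => h.2.1.ne rfl
  have hxS : ∀ s ∈ S, G.Adj s x := fun s hs => hs.2.1.symm
  have hyS' : ∀ s ∈ S, G.Adj s y := by
    intro s hs
    rw [hS] at hs
    exact hs.2.1.symm
  set B := comp G (U \ S) x with hB
  have hBsub : B ⊆ U \ S := comp_subset hxZ
  have hyB : y ∈ B := comp_adj hxZ Joined.refl hxy ⟨hy.1, hyS⟩
  -- the component of `x` avoids the far side
  have hBD : ∀ d ∈ farSide G U K x, d ∉ B := by
    have : ∀ b, b ∈ B → b ∉ farSide G U K x := by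
      intro b hb
      induction hb with
      | refl => exact fun h => (farSide_subset (G := G) hK'.1 hx.2 h).2 (.inl rfl)
      | tail h1 h2 ih =>
        rename_i b c
        intro hc
        by_cases hbx : b = x
        · subst hbx
          exact (farSide_subset (G := G) hK'.1 hx.2 hc).2 (.inr h2.1)
        · by_cases hxb : G.Adj x b
          · exact h2.2.1.2 ⟨h2.2.1.1, hxb, c, hc, h2.1⟩
          · exact ih (farSide_adj hK'.1 hx.2 hc h2.1.symm h2.2.1.1 hbx hxb)
    exact fun d hd hb => this d hb hd
  have hKB : K ⊆ U \ B := by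
    intro k hk
    refine ⟨hK'.1 hk, fun hkB => ?_⟩
    by_cases h : G.Adj x k
    · exact (hBsub hkB).2 (mem_nearSep_of_mem_clique hK hx hk h)
    · exact hBD k ⟨k, hk, h, Joined.refl⟩ hkB
  obtain ⟨π, hπ⟩ : ∃ π : List V, IsPermOf π K :=
    ⟨(Set.toFinite K).toFinset.toList, Finset.nodup_toList _, by simp⟩
  have hπset : {v | v ∈ π} = K := Set.ext hπ.2
  have hperf : PerfectList G π := ⟨hπ.1, by
    rintro l₁ z l₂ rfl u hu v hv huv
    exact hK'.2.1 ((hπ.2 u).1 (by simp [hu.1])) ((hπ.2 v).1 (by simp [hv.1])) huv⟩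
  obtain ⟨l₁, hl₁, hmem₁⟩ := hperf.extend hG (U := U \ B) ⟨by rw [hπset]; exact hKB, by
    rintro z _ s hs t ht hst _ _
    rw [hπset] at hs ht
    exact hK'.2.1 hs ht hst⟩
  have hset₁ : {v | v ∈ π ++ l₁} = U \ B := Set.ext hmem₁
  have hUB : U \ (U \ B) = B := by
    ext v
    have : v ∈ B → v ∈ U := fun h => (hBsub h).1
    simp only [Set.mem_sdiff]
    tauto
  have attach : ∀ s ∈ U \ B, ∀ d ∈ B, G.Adj s d → s ∈ S := by
    intro s hs d hd hsd
    by_contra hsS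
    exact hs.2 (comp_adj hxZ hd hsd.symm ⟨hs.1, hsS⟩)
  have joinedB : ∀ z ∈ B, ∀ d, Joined G B z d → d ∈ B := fun z hz d hd => hd.mem hz
  have good₁ : Good G U (U \ B) := by
    refine ⟨Set.sdiff_subset, ?_⟩
    rw [hUB]
    rintro z hz s hs t ht hst ⟨d, hd, hsd⟩ ⟨d', hd', htd⟩
    exact hSclique (attach s hs d (joinedB z hz d hd) hsd)
      (attach t ht d' (joinedB z hz d' hd') htd) hst
  have sat₁ : Saturated G U (U \ B) x := by
    rintro s hs ⟨d, hd, hsd⟩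
    rw [hUB] at hd
    exact hxS s (attach s hs d (joinedB x Joined.refl d hd) hsd)
  have hxin : x ∈ U \ (U \ B) := by rw [hUB]; exact Joined.refl
  have good₂ := good₁.insert_saturated hxin sat₁
  have hxl : x ∉ π ++ l₁ := fun h => ((hmem₁ x).1 h).2 Joined.refl
  have hset₂ : {v | v ∈ π ++ l₁ ++ [x]} = insert x (U \ B) := by
    rw [← hset₁]; ext v; simp [or_comm, or_left_comm]
  have perf₂ := hl₁.concat hxl (by
    have := good₁.pairwise_of_mem hxin
    rwa [← hset₁] at this)
  have hyin : y ∈ U \ insert x (U \ B) :=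
    ⟨hy.1, by rintro (h | h); exacts [hxy.ne h.symm, h.2 hyB]⟩
  have sat₂ : Saturated G U (insert x (U \ B)) y := by
    have hsub : U \ insert x (U \ B) ⊆ B := by
      intro v hv
      by_contra h
      exact hv.2 (.inr ⟨hv.1, h⟩)
    rintro s (rfl | hs) ⟨d, hd, hsd⟩
    · exact hxy
    · exact hyS' s (attach s hs d (hsub (hd.mem hyin)) hsd)
  have good₃ := good₂.insert_saturated hyin sat₂
  have perf₃ := perf₂.concat (z := y) (fun h => hyin.2 (hset₂ ▸ h)) (by
    have := good₂.pairwise_of_mem hyin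
    rwa [← hset₂] at this)
  have hset₃ : {v | v ∈ π ++ l₁ ++ [x] ++ [y]} = insert y (insert x (U \ B)) := by
    rw [← hset₂]; ext v; simp [or_comm, or_assoc, or_left_comm]
  obtain ⟨l₂, hl₂, hmem₂⟩ := perf₃.extend hG (hset₃ ▸ good₃)
  obtain ⟨hamo, htop⟩ := hl₂.isAMO hmem₂
  refine ⟨π, hπ, _, _, hamo, htop, ⟨l₁ ++ [x] ++ [y] ++ l₂, by simp⟩, hxy, ?_⟩
  simp

theorem undirectedPart_adj [Finite V] (hG : IsChordal G) (hK : K ∈ maxCliques (sub G U)) {x y : V} :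
    (undirectedPart (sub G U) K).Adj x y ↔
      x ∈ U \ K ∧ y ∈ U \ K ∧ G.Adj x y ∧ nearSep G U K x = nearSep G U K y := by
  constructor
  · rintro ⟨hx, hy, h1, h2⟩
    have hadj := sub_adj.1 (cliqueOrientation_adj h1)
    refine ⟨⟨hadj.1, hx⟩, ⟨hadj.2.1, hy⟩, hadj.2.2, ?_⟩
    refine nearSep_eq_of_not_mem hK ⟨hadj.1, hx⟩ ⟨hadj.2.1, hy⟩ hadj.2.2 ?_ ?_
    · intro h
      obtain ⟨π, hπ, α, τ, hα, hτ, hpre, huv⟩ := h2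
      exact orient_of_mem_nearSep hK hα hτ hπ hpre ⟨hadj.2.1, hy⟩ h huv
    · intro h
      obtain ⟨π, hπ, α, τ, hα, hτ, hpre, huv⟩ := h1
      exact orient_of_mem_nearSep hK hα hτ hπ hpre ⟨hadj.1, hx⟩ h huv
  · rintro ⟨hx, hy, hxy, hS⟩
    exact ⟨hx.2, hy.2, exists_orientation hG hK hx hy hxy hS,
      exists_orientation hG hK hy hx hxy.symm hS.symm⟩

/-- The subproblems `C_H(K)` of an induced subgraph `H = G[U]` are the graphs induced by the
bubbles. -/
theorem subproblems_eq [Finite V] (hG : IsChordal G) (hK : K ∈ maxCliques (sub G U)) :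
    subproblems (sub G U) K = {C | ∃ x ∈ U \ K, C = sub G (bubble G U K x)} := by
  have hbub : ∀ x ∈ U \ K, sub G (bubble G U K x) ≤ undirectedPart (sub G U) K ∧
      (sub G (bubble G U K x)).Connected := by
    refine fun x hx => ⟨⟨fun y hy => (mem_bubble hK hx hy).1, fun u v huv => ?_⟩,
      sub_connected.2 ⟨⟨x, Joined.refl⟩, connSet_comp⟩⟩
    rw [sub_adj] at huv
    have hu := mem_bubble hK hx huv.1
    have hv := mem_bubble hK hx huv.2.1
    exact (undirectedPart_adj hG hK).2 ⟨hu.1, hv.1, huv.2.2, hu.2.trans hv.2.symm⟩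
  have hle : ∀ C : G.Subgraph, C ≤ undirectedPart (sub G U) K → C.Connected → ∀ x ∈ C.verts,
      C ≤ sub G (bubble G U K x) := by
    intro C hC hconn x hx
    have hxU : x ∈ U \ K := hC.1 hx
    have hverts : C.verts ⊆ bubble G U K x := by
      intro y hy
      obtain ⟨p⟩ := hconn.coe.preconnected ⟨x, hx⟩ ⟨y, hy⟩
      have : ∀ (a b : C.verts) (p : C.coe.Walk a b), a.1 ∈ bubble G U K x →
          b.1 ∈ bubble G U K x := by
        intro a b p
        induction p with
        | nil => exact id
        | cons h p ih =>
          intro ha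
          apply ih
          have h1 := (undirectedPart_adj hG hK).1 (hC.2 h)
          have h2 := (mem_bubble hK hxU ha).2
          refine comp_adj (self_mem_commonNbrs hxU.1) ha h1.2.2.1 ?_
          rw [← h2, h1.2.2.2]
          exact self_mem_commonNbrs h1.2.1.1
      exact this _ _ p Joined.refl
    exact ⟨hverts, fun u v huv =>
      sub_adj.2 ⟨hverts (C.edge_vert huv), hverts (C.edge_vert huv.symm), huv.adj_sub⟩⟩
  ext C
  constructor
  · intro h
    obtain ⟨⟨x, hx⟩⟩ := h.1.2.coe.nonempty
    exact ⟨x, h.1.1.1 hx, le_antisymm (hle C h.1.1 h.1.2 x hx)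
      (h.2 (hbub x (h.1.1.1 hx)) (hle C h.1.1 h.1.2 x hx))⟩
  · rintro ⟨x, hx, rfl⟩
    exact ⟨hbub x hx, fun C hC hxC => hle C hC.1 hC.2 x (hxC.1 Joined.refl)⟩

end

/-! ### Trees given by parent functions -/

/-- The edges of the path between the nodes `x` and `y` of the tree on `ℕ` in which the parent of
`j > 0` is `par j < j`. The edge between `j` and `par j` is denoted by `j`. The larger of two
different nodes is never an ancestor of the other, so the path leads through its parent. -/
def pathEdges (par : ℕ → ℕ) (x y : ℕ) : Finset ℕ :=
  if x = y then ∅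
  else if y < x then
    if par x < x then insert x (pathEdges par (par x) y) else ∅
  else
    if par y < y then insert y (pathEdges par x (par y)) else ∅
termination_by x + y

section

variable {par : ℕ → ℕ}

@[simp] theorem pathEdges_self (x : ℕ) : pathEdges par x x = ∅ := by
  rw [pathEdges]; simp

theorem pathEdges_gt (hpar : ∀ j, 0 < j → par j < j) {x y : ℕ} (h : y < x) :
    pathEdges par x y = insert x (pathEdges par (par x) y) := by
  rw [pathEdges, if_neg h.ne', if_pos h, if_pos (hpar x (by omega))]

theorem pathEdges_lt (hpar : ∀ j, 0 < j → par j < j) {x y : ℕ} (h : x < y) :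
    pathEdges par x y = insert y (pathEdges par x (par y)) := by
  rw [pathEdges, if_neg h.ne, if_neg (by omega), if_pos (hpar y (by omega))]

/-- Induction along the path between two nodes. -/
theorem pathEdges_induction (hpar : ∀ j, 0 < j → par j < j) {P : ℕ → ℕ → Prop}
    (self : ∀ x, P x x) (gt : ∀ x y, y < x → P (par x) y → P x y)
    (lt : ∀ x y, x < y → P x (par y) → P x y) (x y : ℕ) : P x y := by
  induction h : x + y using Nat.strong_induction_on generalizing x y with
  | _ n ih =>
  rcases Nat.lt_trichotomy x y with hxy | rfl | hxy
  · have := hpar y (by omega)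
    exact lt x y hxy (ih _ (by omega) _ _ rfl)
  · exact self x
  · have := hpar x (by omega)
    exact gt x y hxy (ih _ (by omega) _ _ rfl)

theorem pathEdges_comm (hpar : ∀ j, 0 < j → par j < j) (x y : ℕ) :
    pathEdges par x y = pathEdges par y x := by
  induction x, y using pathEdges_induction hpar with
  | self x => rfl
  | gt x y h ih => rw [pathEdges_gt hpar h, pathEdges_lt hpar h, ih]
  | lt x y h ih => rw [pathEdges_lt hpar h, pathEdges_gt hpar h, ih]

theorem pathEdges_triangle (hpar : ∀ j, 0 < j → par j < j) (x y z : ℕ) :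
    pathEdges par x z ⊆ pathEdges par x y ∪ pathEdges par y z := by
  induction h : x + y + z using Nat.strong_induction_on generalizing x y z with
  | _ n ih =>
  by_cases hxz : x = z
  · subst hxz; simp
  by_cases hxy : x = y
  · subst hxy; simp
  by_cases hyz : y = z
  · subst hyz; simp
  rcases lt_or_ge x y with h1 | h1
  · rcases lt_or_ge z y with h2 | h2
    · have := hpar y (by omega)
      have := ih _ (by omega) x (par y) z rfl
      rw [pathEdges_lt hpar h1, pathEdges_gt hpar h2]
      intro e he
      have := this he
      simp only [Finset.mem_union, Finset.mem_insert] at this ⊢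
      tauto
    · have h2 : y < z := by omega
      have := hpar z (by omega)
      have := ih _ (by omega) x y (par z) rfl
      rw [pathEdges_lt hpar h2, pathEdges_lt hpar (h1.trans h2)]
      intro e he
      simp only [Finset.mem_union, Finset.mem_insert] at he ⊢
      rcases he with he | he
      · tauto
      · have := this he
        simp only [Finset.mem_union] at this
        tauto
  · have h1 : y < x := by omega
    rcases lt_or_ge z x with h2 | h2
    · have := hpar x (by omega)
      have := ih _ (by omega) (par x) y z rfl
      rw [pathEdges_gt hpar h1, pathEdges_gt hpar h2]
      intro e he
      simp only [Finset.mem_union, Finset.mem_insert] at he ⊢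
      rcases he with he | he
      · tauto
      · have := this he
        simp only [Finset.mem_union] at this
        tauto
    · have h2 : x < z := by omega
      have := hpar z (by omega)
      have := ih _ (by omega) x y (par z) rfl
      rw [pathEdges_lt hpar h2, pathEdges_lt hpar (h1.trans h2)]
      intro e he
      simp only [Finset.mem_union, Finset.mem_insert] at he ⊢
      rcases he with he | he
      · tauto
      · have := this he
        simp only [Finset.mem_union] at this
        tauto

theorem mem_pathEdges_trans (hpar : ∀ j, 0 < j → par j < j) {x z e : ℕ} (y : ℕ)
    (h : e ∈ pathEdges par x z) : e ∈ pathEdges par x y ∨ e ∈ pathEdges par y z :=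
  Finset.mem_union.1 (pathEdges_triangle hpar x y z h)

theorem mem_pathEdges_pos (hpar : ∀ j, 0 < j → par j < j) {x y e : ℕ}
    (h : e ∈ pathEdges par x y) : 0 < e ∧ (e ≤ x ∨ e ≤ y) := by
  induction x, y using pathEdges_induction hpar with
  | self x => simp at h
  | gt x y hlt ih =>
    have := hpar x (by omega)
    rw [pathEdges_gt hpar hlt, Finset.mem_insert] at h
    rcases h with rfl | h
    · omega
    · have := ih h; omega
  | lt x y hlt ih =>
    have := hpar y (by omega)
    rw [pathEdges_lt hpar hlt, Finset.mem_insert] at h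
    rcases h with rfl | h
    · omega
    · have := ih h; omega

/-- If some edge of the path from `x` to `y` has the property `P`, then there is a first one, with
near end `q`. -/
theorem exists_first_edge (hpar : ∀ j, 0 < j → par j < j) (P : ℕ → Prop) {x y : ℕ}
    (h : ∃ e ∈ pathEdges par x y, P e) :
    ∃ e ∈ pathEdges par x y, ∃ q, (q = e ∨ q = par e) ∧ P e ∧
      ∀ e' ∈ pathEdges par x q, ¬ P e' := by
  induction x, y using pathEdges_induction hpar with
  | self x => simp at h
  | gt x y hlt ih =>
    rw [pathEdges_gt hpar hlt] at h ⊢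
    by_cases hx : P x
    · exact ⟨x, Finset.mem_insert_self _ _, x, .inl rfl, hx, by simp⟩
    · obtain ⟨e, he, hPe⟩ := h
      have hne : e ≠ x := by rintro rfl; exact hx hPe
      obtain ⟨e', he', q, hq, hP, hno⟩ := ih ⟨e, (Finset.mem_insert.1 he).resolve_left hne, hPe⟩
      refine ⟨e', Finset.mem_insert_of_mem he', q, hq, hP, fun f hf => ?_⟩
      rcases mem_pathEdges_trans hpar (par x) hf with hf | hf
      · rw [pathEdges_gt hpar (hpar x (by omega))] at hf
        simp only [pathEdges_self, Finset.mem_insert, Finset.notMem_empty, or_false] at hf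
        exact hf ▸ hx
      · exact hno f hf
  | lt x y hlt ih =>
    rw [pathEdges_lt hpar hlt] at h ⊢
    by_cases hex : ∃ e ∈ pathEdges par x (par y), P e
    · obtain ⟨e, he, hq⟩ := ih hex
      exact ⟨e, Finset.mem_insert_of_mem he, hq⟩
    · obtain ⟨e, he, hPe⟩ := h
      rcases Finset.mem_insert.1 he with rfl | he
      · exact ⟨e, he, par e, .inr rfl, hPe, fun f hf hPf => hex ⟨f, hf, hPf⟩⟩
      · exact absurd ⟨e, he, hPe⟩ hex

/-- On the path from a node with the property `P` to one without, there is an edge with exactly one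
end with this property. -/
theorem exists_flip_edge (hpar : ∀ j, 0 < j → par j < j) (P : ℕ → Prop) {x y : ℕ}
    (h : ¬ (P x ↔ P y)) : ∃ e ∈ pathEdges par x y, ¬ (P e ↔ P (par e)) := by
  induction x, y using pathEdges_induction hpar with
  | self x => exact absurd Iff.rfl h
  | gt x y hlt ih =>
    rw [pathEdges_gt hpar hlt]
    by_cases hx : P x ↔ P (par x)
    · obtain ⟨e, he, h'⟩ := ih (by rwa [← hx])
      exact ⟨e, Finset.mem_insert_of_mem he, h'⟩
    · exact ⟨x, Finset.mem_insert_self _ _, hx⟩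
  | lt x y hlt ih =>
    rw [pathEdges_lt hpar hlt]
    by_cases hy : P y ↔ P (par y)
    · obtain ⟨e, he, h'⟩ := ih (by rwa [← hy])
      exact ⟨e, Finset.mem_insert_of_mem he, h'⟩
    · exact ⟨y, Finset.mem_insert_self _ _, hy⟩

end

/-! ### Clique trees -/

/-- `bag` and `par` give a clique tree of `G[U]` with node set `F` and root `r`; the connectivity
of the sets of nodes whose bags contain a given vertex is expressed by the running intersection
property `rip`. -/
structure IsCliqueTree (G : SimpleGraph V) (U : Set V) (F : Finset ℕ) (r : ℕ) (par : ℕ → ℕ)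
    (bag : ℕ → Set V) : Prop where
  par_lt : ∀ j, 0 < j → par j < j
  root_mem : r ∈ F
  root_le : ∀ w ∈ F, r ≤ w
  par_mem : ∀ w ∈ F, w ≠ r → par w ∈ F
  bag_mem : ∀ w ∈ F, bag w ∈ maxCliques (sub G U)
  surj : ∀ K ∈ maxCliques (sub G U), ∃ w ∈ F, bag w = K
  inj : ∀ w ∈ F, ∀ w' ∈ F, bag w = bag w' → w = w'
  rip : ∀ i ∈ F, ∀ j ∈ F, i < j → ∀ u ∈ bag i, u ∈ bag j → u ∈ bag (par j)

/-- The intersection of the bags at the ends of the edge `e`. There is no edge `0`; the empty set is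
its label by convention. -/
def label (par : ℕ → ℕ) (bag : ℕ → Set V) (e : ℕ) : Set V :=
  {u | 0 < e ∧ u ∈ bag e ∧ u ∈ bag (par e)}

theorem exists_maxClique_superset [Finite V] {U C : Set V} (hC : C ⊆ U) (h : C.Pairwise G.Adj) :
    ∃ K ∈ maxCliques (sub G U), C ⊆ K := by
  obtain ⟨K, hK, hmax⟩ := (Set.toFinite {K : Set V | K ⊆ (sub G U).verts ∧
    K.Pairwise (sub G U).Adj}).exists_le_maximal (a := C)
    ⟨hC, fun a ha b hb hab => sub_adj.2 ⟨hC ha, hC hb, h ha hb hab⟩⟩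
  exact ⟨K, hmax, hK⟩

namespace IsCliqueTree

variable {U : Set V} {F : Finset ℕ} {r : ℕ} {par : ℕ → ℕ} {bag : ℕ → Set V}

theorem bag_pairwise (T : IsCliqueTree G U F r par bag) {w : ℕ} (hw : w ∈ F) :
    (bag w).Pairwise G.Adj := (maxCliques_sub.1 (T.bag_mem w hw)).2.1

theorem bag_subset (T : IsCliqueTree G U F r par bag) {w : ℕ} (hw : w ∈ F) : bag w ⊆ U :=
  (T.bag_mem w hw).1.1

theorem eq_of_subset (T : IsCliqueTree G U F r par bag) {w w' : ℕ} (hw : w ∈ F) (hw' : w' ∈ F)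
    (h : bag w ⊆ bag w') : w = w' := by
  refine T.inj w hw w' hw' (Set.Subset.antisymm h ?_)
  exact (T.bag_mem w hw).2 (T.bag_mem w' hw').1 h

theorem exists_bag [Finite V] (T : IsCliqueTree G U F r par bag) {C : Set V} (hC : C ⊆ U)
    (h : C.Pairwise G.Adj) : ∃ w ∈ F, C ⊆ bag w := by
  obtain ⟨K, hK, hCK⟩ := exists_maxClique_superset hC h
  obtain ⟨w, hw, rfl⟩ := T.surj K hK
  exact ⟨w, hw, hCK⟩

theorem exists_bag_pair [Finite V] (T : IsCliqueTree G U F r par bag) {u v : V} (hu : u ∈ U)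
    (hv : v ∈ U) (h : G.Adj u v) : ∃ w ∈ F, u ∈ bag w ∧ v ∈ bag w := by
  obtain ⟨w, hw, hsub⟩ := T.exists_bag (C := {u, v}) (by
    rintro x (rfl | rfl); exacts [hu, hv]) (by
    rintro x (rfl | rfl) y (rfl | rfl) hxy
    exacts [absurd rfl hxy, h, h.symm, absurd rfl hxy])
  exact ⟨w, hw, hsub (by simp), hsub (by simp)⟩

/-- The path between two nodes of the tree stays in the tree, and its bags contain the intersection
of the bags at its ends. -/
theorem path_mem (T : IsCliqueTree G U F r par bag) {x y : ℕ} (hx : x ∈ F) (hy : y ∈ F) {e : ℕ}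
    (he : e ∈ pathEdges par x y) :
    e ∈ F ∧ par e ∈ F ∧ e ≠ r ∧ ∀ u ∈ bag x, u ∈ bag y → u ∈ label par bag e := by
  induction x, y using pathEdges_induction T.par_lt with
  | self x => simp at he
  | gt x y hlt ih =>
    have hne : x ≠ r := by have := T.root_le y hy; omega
    have hpx := T.par_mem x hx hne
    rw [pathEdges_gt T.par_lt hlt, Finset.mem_insert] at he
    rcases he with rfl | he
    · exact ⟨hx, hpx, hne, fun u hu hu' => ⟨by omega, hu, T.rip y hy e hx hlt u hu' hu⟩⟩
    · obtain ⟨h1, h2, h3, h4⟩ := ih hpx hy he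
      exact ⟨h1, h2, h3, fun u hu hu' => h4 u (T.rip y hy x hx hlt u hu' hu) hu'⟩
  | lt x y hlt ih =>
    have hne : y ≠ r := by have := T.root_le x hx; omega
    have hpy := T.par_mem y hy hne
    rw [pathEdges_lt T.par_lt hlt, Finset.mem_insert] at he
    rcases he with rfl | he
    · exact ⟨hy, hpy, hne, fun u hu hu' => ⟨by omega, hu', T.rip x hx e hy hlt u hu hu'⟩⟩
    · obtain ⟨h1, h2, h3, h4⟩ := ih hx hpy he
      exact ⟨h1, h2, h3, fun u hu hu' => h4 u hu (T.rip x hx y hy hlt u hu hu')⟩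

/-- If all labels on a path meet `Z`, then the parts of the bags in `Z` are joined inside `Z`. -/
theorem joined_of_path (T : IsCliqueTree G U F r par bag) {Z : Set V} {x y : ℕ} (hx : x ∈ F)
    (hy : y ∈ F) (h : ∀ e ∈ pathEdges par x y, ∃ u ∈ label par bag e, u ∈ Z) {a b : V}
    (ha : a ∈ bag x) (haZ : a ∈ Z) (hb : b ∈ bag y) (hbZ : b ∈ Z) : Joined G Z a b := by
  have clique : ∀ w ∈ F, ∀ a ∈ bag w, a ∈ Z → ∀ b ∈ bag w, b ∈ Z → Joined G Z a b := by
    intro w hw a ha haZ b hb hbZ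
    by_cases hab : a = b
    · subst hab; exact Joined.refl
    · exact Joined.single (T.bag_pairwise hw ha hb hab) haZ hbZ
  induction x, y using pathEdges_induction T.par_lt generalizing a b with
  | self x => exact clique x hx a ha haZ b hb hbZ
  | gt x y hlt ih =>
    have hne : x ≠ r := by have := T.root_le y hy; omega
    rw [pathEdges_gt T.par_lt hlt] at h
    obtain ⟨u, hu, huZ⟩ := h x (Finset.mem_insert_self _ _)
    exact (clique x hx a ha haZ u hu.2.1 huZ).trans (ih (T.par_mem x hx hne) hy
      (fun e he => h e (Finset.mem_insert_of_mem he)) hu.2.2 huZ hb hbZ)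
  | lt x y hlt ih =>
    have hne : y ≠ r := by have := T.root_le x hx; omega
    rw [pathEdges_lt T.par_lt hlt] at h
    obtain ⟨u, hu, huZ⟩ := h y (Finset.mem_insert_self _ _)
    exact (ih hx (T.par_mem y hy hne) (fun e he => h e (Finset.mem_insert_of_mem he)) ha haZ
      hu.2.2 huZ).trans (clique y hy u hu.2.1 huZ b hb hbZ)

/-- The label of an edge separates the two sides of the tree. -/
theorem not_mem_path_of_joined [Finite V] (T : IsCliqueTree G U F r par bag) {Z : Set V}
    (hZ : Z ⊆ U) {e : ℕ} (he : ∀ u ∈ label par bag e, u ∉ Z) {x y : ℕ} (hx : x ∈ F) (hy : y ∈ F)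
    {a b : V} (ha : a ∈ bag x) (haZ : a ∈ Z) (hb : b ∈ bag y) (h : Joined G Z a b) :
    e ∉ pathEdges par x y := by
  induction h generalizing y with
  | refl => exact fun hmem => he a ((T.path_mem hx hy hmem).2.2.2 a ha hb) haZ
  | @tail b c _ h2 ih =>
    obtain ⟨z, hz, hbz, hcz⟩ := T.exists_bag_pair (hZ h2.2.1) (hZ h2.2.2) h2.1
    intro hmem
    rcases mem_pathEdges_trans T.par_lt z hmem with hmem | hmem
    · exact ih hz hbz hmem
    · exact he c ((T.path_mem hz hy hmem).2.2.2 c hcz hb) h2.2.2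

theorem nearSep_subset_label [Finite V] (T : IsCliqueTree G U F r par bag) {v t : ℕ} (hv : v ∈ F)
    (ht : t ∈ F) {x : V} (hxt : x ∈ bag t) {e : ℕ} (he : e ∈ pathEdges par v t)
    (hadj : ∀ u ∈ label par bag e, G.Adj x u) : nearSep G U (bag v) x ⊆ label par bag e := by
  rintro s ⟨hsU, hxs, d, ⟨k, hk, hkx, hj⟩, hsd⟩
  have hxU := T.bag_subset ht hxt
  have hxe : x ∉ label par bag e := fun h => (hadj x h).ne rfl
  have hkU : k ∈ U \ {y | y = x ∨ G.Adj x y} := by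
    refine ⟨T.bag_subset hv hk, ?_⟩
    rintro (rfl | h)
    · exact hxe ((T.path_mem hv ht he).2.2.2 _ hk hxt)
    · exact hkx h
  obtain ⟨z, hz, hdz, hsz⟩ := T.exists_bag_pair (hj.mem hkU).1 hsU hsd.symm
  obtain ⟨z', hz', hxz', hsz'⟩ := T.exists_bag_pair hxU hsU hxs
  have h1 : e ∉ pathEdges par v z := T.not_mem_path_of_joined Set.sdiff_subset
    (fun u hu h => h.2 (.inr (hadj u hu))) hv hz hk hkU hdz hj
  have h2 : e ∉ pathEdges par z' t := fun h => hxe ((T.path_mem hz' ht h).2.2.2 x hxz' hxt)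
  have h3 : e ∈ pathEdges par z z' := by
    rcases mem_pathEdges_trans T.par_lt z he with h | h
    · exact absurd h h1
    · rcases mem_pathEdges_trans T.par_lt z' h with h | h
      · exact h
      · exact absurd h h2
  exact (T.path_mem hz hz' h3).2.2.2 s hsz hsz'

/-- The separator between a bag and a vertex that is closest to the vertex is the label of an edge
on the way. -/
theorem exists_nearSep_eq_label [Finite V] (T : IsCliqueTree G U F r par bag) {v t : ℕ} (hv : v ∈ F)
    (ht : t ∈ F) {x : V} (hxv : x ∉ bag v) (hxt : x ∈ bag t) :
    ∃ e ∈ pathEdges par v t, nearSep G U (bag v) x = label par bag e := by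
  have hxU := T.bag_subset ht hxt
  have flip : ∀ y ∈ F, x ∈ bag y → ∃ e ∈ pathEdges par v y,
      ∀ u ∈ label par bag e, u ≠ x → G.Adj x u := by
    intro y hy hxy
    obtain ⟨e, he, hflip⟩ := exists_flip_edge T.par_lt (fun w => x ∈ bag w) (x := v) (y := y)
      (by simp [hxv, hxy])
    obtain ⟨h1, h2, -⟩ := T.path_mem hv hy he
    refine ⟨e, he, fun u hu hux => ?_⟩
    by_cases hxe : x ∈ bag e
    · exact T.bag_pairwise h1 hxe hu.2.1 hux.symm
    · have hxp : x ∈ bag (par e) := by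
        by_contra h
        exact hflip (by simp [hxe, h])
      exact T.bag_pairwise h2 hxp hu.2.2 hux.symm
  obtain ⟨e, he, q, hq, hP, hno⟩ := exists_first_edge T.par_lt _ (flip t ht hxt)
  obtain ⟨h1, h2, -⟩ := T.path_mem hv ht he
  have hqF : q ∈ F := by rcases hq with rfl | rfl <;> assumption
  have hlq : label par bag e ⊆ bag q := by
    rcases hq with rfl | rfl
    · exact fun u hu => hu.2.1
    · exact fun u hu => hu.2.2
  have hxq : x ∉ bag q := by
    intro hxq
    obtain ⟨e', he', hP'⟩ := flip q hqF hxq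
    exact hno e' he' hP'
  have hadj : ∀ u ∈ label par bag e, G.Adj x u := fun u hu =>
    hP u hu (by rintro rfl; exact hxq (hlq hu))
  refine ⟨e, he, Set.Subset.antisymm (T.nearSep_subset_label hv ht hxt he hadj) ?_⟩
  obtain ⟨u₀, hu₀, hxu₀⟩ := exists_not_adj (T.bag_mem q hqF) ⟨hxU, hxq⟩
  obtain ⟨k₀, hk₀, hxk₀⟩ := exists_not_adj (T.bag_mem v hv) ⟨hxU, hxv⟩
  intro s hs
  refine ⟨T.bag_subset hqF (hlq hs), hadj s hs, u₀, ⟨k₀, hk₀, hxk₀, ?_⟩, ?_⟩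
  · refine T.joined_of_path hv hqF (fun e' he' => ?_) hk₀ ⟨T.bag_subset hv hk₀, ?_⟩ hu₀
      ⟨T.bag_subset hqF hu₀, ?_⟩
    · have := hno e' he'
      push Not at this
      obtain ⟨u, hu, hux, hxu⟩ := this
      obtain ⟨h3, -⟩ := T.path_mem hv hqF he'
      exact ⟨u, hu, T.bag_subset h3 hu.2.1, fun h => h.elim hux hxu⟩
    · rintro (rfl | h)
      · exact hxv hk₀
      · exact hxk₀ h
    · rintro (rfl | h)
      · exact hxq hu₀
      · exact hxu₀ h
  · exact T.bag_pairwise hqF (hlq hs) hu₀ (by rintro rfl; exact hxu₀ (hadj _ hs))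

/-! ### Construction of clique trees -/

theorem empty (G : SimpleGraph V) {par : ℕ → ℕ} {bag : ℕ → Set V}
    (hpar : ∀ j, 0 < j → par j < j) (hbag : bag 0 = ∅) :
    IsCliqueTree G ∅ (Finset.range 1) 0 par bag where
  par_lt := hpar
  root_mem := by simp
  root_le := by simp
  par_mem := by simp
  bag_mem := by
    intro w hw
    have : w = 0 := by simpa using hw
    rw [this, hbag, maxCliques_sub]
    simp
  surj := by
    intro K hK
    exact ⟨0, by simp, by rw [hbag]; exact (Set.subset_empty_iff.1 hK.1.1).symm⟩
  inj := by simp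
  rip := by
    intro i hi j hj hij
    simp at hi hj
    omega

/-- The maximal cliques after adding a vertex `z` whose neighborhood in `W` is the clique `S`. -/
theorem maxCliques_insert {W K : Set V} {z : V} (hz : z ∉ W)
    (hS : {s ∈ W | G.Adj s z}.Pairwise G.Adj) :
    K ∈ maxCliques (sub G (insert z W)) ↔ K = insert z {s ∈ W | G.Adj s z} ∨
      (K ∈ maxCliques (sub G W) ∧ ¬ K ⊆ {s ∈ W | G.Adj s z}) := by
  rw [maxCliques_sub, maxCliques_sub]
  constructor
  · rintro ⟨h1, h2, h3⟩
    by_cases hzK : z ∈ K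
    · left
      have hsub : K ⊆ insert z {s ∈ W | G.Adj s z} := by
        intro k hk
        by_cases hkz : k = z
        · exact .inl hkz
        · exact .inr ⟨(h1 hk).resolve_left hkz, h2 hk hzK hkz⟩
      refine Set.Subset.antisymm hsub ?_
      rintro s (rfl | hs)
      · exact hzK
      · refine h3 s (.inr hs.1) fun k hk hks => ?_
        rcases hsub hk with rfl | hk'
        · exact hs.2.symm
        · exact hS hk' hs hks
    · right
      have hKW : K ⊆ W := fun k hk =>
        (h1 hk).resolve_left (by rintro rfl; exact hzK hk)
      refine ⟨⟨hKW, h2, fun x hx => h3 x (.inr hx)⟩, fun hsub => hzK ?_⟩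
      exact h3 z (.inl rfl) fun k hk _ => (hsub hk).2
  · rintro (rfl | ⟨⟨h1, h2, h3⟩, h4⟩)
    · refine ⟨?_, ?_, ?_⟩
      · rintro s (rfl | hs)
        · exact .inl rfl
        · exact .inr hs.1
      · rintro s (rfl | hs) t (rfl | ht) hst
        · exact absurd rfl hst
        · exact ht.2.symm
        · exact hs.2
        · exact hS hs ht hst
      · rintro x (rfl | hx) h
        · exact .inl rfl
        · exact .inr ⟨hx, (h z (.inl rfl) (by rintro rfl; exact hz hx)).symm⟩
    · refine ⟨fun k hk => .inr (h1 hk), h2, ?_⟩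
      rintro x (rfl | hx) h
      · exact absurd (fun k hk => ⟨h1 hk, h k hk (by rintro rfl; exact hz (h1 hk))⟩) h4
      · exact h3 x hx h

/-- Adding a vertex whose earlier neighborhood is a whole bag enlarges this bag. -/
theorem enlarge {W : Set V} {k : ℕ}
    (T : IsCliqueTree G W (Finset.range k) 0 par bag) {z : V} (hz : z ∉ W) {p : ℕ} (hp : p < k)
    (hS : {s ∈ W | G.Adj s z} = bag p) {bag' : ℕ → Set V} (hbag : bag' p = insert z (bag p))
    (hbag' : ∀ j, j < k → j ≠ p → bag' j = bag j) :
    IsCliqueTree G (insert z W) (Finset.range k) 0 par bag' := by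
  have hpF : p ∈ Finset.range k := by simpa using hp
  have hclique : {s ∈ W | G.Adj s z}.Pairwise G.Adj := by rw [hS]; exact T.bag_pairwise hpF
  have hzb : ∀ w < k, z ∉ bag w := fun w hw h => hz (T.bag_subset (by simpa using hw) h)
  have hle : ∀ w < k, ∀ u, u ∈ bag' w ↔ u ∈ bag w ∨ (u = z ∧ w = p) := by
    intro w hw u
    by_cases hwp : w = p
    · subst hwp; rw [hbag]; simp [or_comm]
    · rw [hbag' w hw hwp]; simp [hwp]
  refine ⟨T.par_lt, T.root_mem, T.root_le, T.par_mem, ?_, ?_, ?_, ?_⟩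
  · intro w hw
    rw [maxCliques_insert hz hclique, hS]
    by_cases hwp : w = p
    · subst hwp; exact .inl hbag
    · rw [hbag' w (by simpa using hw) hwp]
      exact .inr ⟨T.bag_mem w hw, fun h => hwp (T.eq_of_subset hw hpF h)⟩
  · intro K hK
    rw [maxCliques_insert hz hclique, hS] at hK
    rcases hK with rfl | ⟨hK, hsub⟩
    · exact ⟨p, hpF, hbag⟩
    · obtain ⟨w, hw, rfl⟩ := T.surj K hK
      refine ⟨w, hw, hbag' w (by simpa using hw) ?_⟩
      rintro rfl
      exact hsub subset_rfl
  · intro w hw w' hw' h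
    rw [Finset.mem_range] at hw hw'
    have hsub : ∀ w < k, ∀ w' < k, bag' w = bag' w' → bag w ⊆ bag w' := by
      intro w hw w' hw' h u hu
      have := (hle w' hw' u).1 (h ▸ (hle w hw u).2 (.inl hu))
      rcases this with h | ⟨rfl, _⟩
      · exact h
      · exact absurd hu (hzb w hw)
    exact T.eq_of_subset (by simpa using hw) (by simpa using hw') (hsub w hw w' hw' h)
  · intro i hi j hj hij u hu hu'
    have hi' := Finset.mem_range.1 hi
    have hj' := Finset.mem_range.1 hj
    rw [hle i hi'] at hu
    rw [hle j hj'] at hu'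
    rw [hle _ (lt_trans (T.par_lt j (by omega)) hj')]
    rcases hu with hu | ⟨rfl, rfl⟩
    · rcases hu' with hu' | ⟨rfl, rfl⟩
      · exact .inl (T.rip i hi j hj hij u hu hu')
      · exact absurd hu (hzb i hi')
    · rcases hu' with hu' | ⟨_, rfl⟩
      · exact absurd hu' (hzb j hj')
      · omega

/-- Adding a vertex whose earlier neighborhood is a proper part of the bag of `p` creates a new
node below `p`. -/
theorem grow {W : Set V} {k : ℕ}
    (T : IsCliqueTree G W (Finset.range k) 0 par bag) {z : V} (hz : z ∉ W) {p : ℕ} (hp : p < k)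
    (hS : {s ∈ W | G.Adj s z} ⊆ bag p) (hne : {s ∈ W | G.Adj s z} ≠ bag p) {bag' : ℕ → Set V}
    {par' : ℕ → ℕ} (hbag : bag' k = insert z {s ∈ W | G.Adj s z})
    (hbag' : ∀ j < k, bag' j = bag j) (hpar : par' k = p) (hpar' : ∀ j, j ≠ k → par' j = par j) :
    IsCliqueTree G (insert z W) (Finset.range (k + 1)) 0 par' bag' := by
  have hpF : p ∈ Finset.range k := by simpa using hp
  have hclique : {s ∈ W | G.Adj s z}.Pairwise G.Adj := (T.bag_pairwise hpF).mono hS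
  have hzb : ∀ w < k, z ∉ bag w := fun w hw h => hz (T.bag_subset (by simpa using hw) h)
  have hnot : ∀ w < k, ¬ bag w ⊆ {s ∈ W | G.Adj s z} := by
    intro w hw h
    have := T.eq_of_subset (by simpa using hw) hpF (h.trans hS)
    subst this
    exact hne (Set.Subset.antisymm hS h)
  refine ⟨?_, by simp, by simp, ?_, ?_, ?_, ?_, ?_⟩
  · intro j hj
    by_cases h : j = k
    · subst h; omega
    · rw [hpar' j h]; exact T.par_lt j hj
  · intro w hw hw0
    rw [Finset.mem_range] at *
    by_cases h : w = k
    · subst h; omega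
    · rw [hpar' w h]; have := T.par_lt w (by omega); omega
  · intro w hw
    rw [maxCliques_insert hz hclique]
    by_cases hwk : w = k
    · subst hwk; exact .inl hbag
    · have hw : w < k := by rw [Finset.mem_range] at hw; omega
      rw [hbag' w hw]
      exact .inr ⟨T.bag_mem w (by simpa using hw), hnot w hw⟩
  · intro K hK
    rw [maxCliques_insert hz hclique] at hK
    rcases hK with rfl | ⟨hK, -⟩
    · exact ⟨k, by simp, hbag⟩
    · obtain ⟨w, hw, rfl⟩ := T.surj K hK
      rw [Finset.mem_range] at hw
      exact ⟨w, by rw [Finset.mem_range]; omega, hbag' w hw⟩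
  · intro w hw w' hw' h
    rw [Finset.mem_range] at hw hw'
    have key : ∀ w < k, bag' w ≠ bag' k := by
      intro w hw h
      rw [hbag, hbag' w hw] at h
      exact hzb w hw (h ▸ Set.mem_insert _ _)
    by_cases h1 : w = k <;> by_cases h2 : w' = k
    · omega
    · subst h1; exact absurd h.symm (key w' (by omega))
    · subst h2; exact absurd h (key w (by omega))
    · rw [hbag' w (by omega), hbag' w' (by omega)] at h
      exact T.inj w (by rw [Finset.mem_range]; omega) w' (by rw [Finset.mem_range]; omega) h
  · intro i hi j hj hij u hu hu'
    rw [Finset.mem_range] at hi hj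
    rw [hbag' i (by omega)] at hu
    by_cases h : j = k
    · subst h
      rw [hbag] at hu'
      rw [hpar, hbag' p hp]
      rcases hu' with rfl | hu'
      · exact absurd hu (hzb i hij)
      · exact hS hu'
    · have hj' : j < k := by omega
      rw [hbag' j hj'] at hu'
      have := T.par_lt j (by omega)
      rw [hpar' j h, hbag' _ (by omega)]
      exact T.rip i (by rw [Finset.mem_range]; omega) j (by rw [Finset.mem_range]; omega) hij u hu
        hu'

/-- An induced subgraph has at most as many maximal cliques as the whole graph. -/
theorem card_le [Finite V] (T : IsCliqueTree G U F r par bag) :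
    F.card ≤ (maxCliques (⊤ : G.Subgraph)).ncard := by
  classical
  have : ∀ w : ℕ, ∃ K, w ∈ F → K ∈ maxCliques (⊤ : G.Subgraph) ∧ bag w ⊆ K := by
    intro w
    by_cases hw : w ∈ F
    · obtain ⟨K, hK, h⟩ := exists_maxClique_superset (G := G) (U := Set.univ)
        (Set.subset_univ (bag w)) (T.bag_pairwise hw)
      rw [sub_univ] at hK
      exact ⟨K, fun _ => ⟨hK, h⟩⟩
    · exact ⟨∅, fun h => absurd h hw⟩
  choose f hf using this
  rw [← Set.ncard_coe_finset F]
  refine Set.ncard_le_ncard_of_injOn f (fun w hw => (hf w hw).1) ?_ (Set.toFinite _)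
  intro w hw w' hw' heq
  refine T.eq_of_subset hw hw' fun u hu => ?_
  refine (maxCliques_sub.1 (T.bag_mem w' hw')).2.2 u (T.bag_subset hw hu) fun k hk hku => ?_
  have h1 := (hf w hw).1.1.2 ((hf w hw).2 hu)
  have h2 : k ∈ f w := heq ▸ (hf w' hw').2 hk
  exact (h1 h2 hku.symm).symm

theorem card_eq [Finite V] (T : IsCliqueTree G Set.univ F r par bag) :
    (maxCliques (⊤ : G.Subgraph)).ncard = F.card := by
  refine le_antisymm ?_ T.card_le
  rw [← Set.ncard_coe_finset F]
  have : maxCliques (⊤ : G.Subgraph) ⊆ bag '' F := by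
    intro K hK
    rw [← sub_univ] at hK
    obtain ⟨w, hw, rfl⟩ := T.surj K hK
    exact ⟨w, hw, rfl⟩
  exact (Set.ncard_le_ncard this (Set.toFinite _)).trans (Set.ncard_image_le (Set.toFinite _))

/-- Every chordal graph has a clique tree. -/
theorem exists_of_chordal [Finite V] (hG : IsChordal G) :
    ∃ k par, ∃ bag : ℕ → Set V, par 0 = 0 ∧
      IsCliqueTree G Set.univ (Finset.range k) 0 par bag := by
  classical
  have main : ∀ n : ℕ, n ≤ Nat.card V → ∃ (W : Set V) (k : ℕ) (par : ℕ → ℕ) (bag : ℕ → Set V),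
      W.ncard = n ∧ Good G Set.univ W ∧ par 0 = 0 ∧
        IsCliqueTree G W (Finset.range k) 0 par bag := by
    intro n
    induction n with
    | zero =>
      refine fun _ => ⟨∅, 1, fun j => j - 1, fun _ => ∅, by simp, ⟨by simp, by simp⟩, rfl,
        IsCliqueTree.empty G (fun j hj => by omega) rfl⟩
    | succ n ih =>
      intro hn
      obtain ⟨W, k, par, bag, hW, hgood, h0, T⟩ := ih (by omega)
      obtain ⟨y, hy⟩ : ∃ y, y ∉ W := by
        by_contra h
        push Not at h
        have : W = Set.univ := Set.eq_univ_of_forall h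
        rw [this, Set.ncard_univ] at hW
        omega
      obtain ⟨z, hz, hsat⟩ := hgood.exists_saturated hG ⟨Set.mem_univ y, hy⟩
      have hz' := comp_subset (G := G) (Z := Set.univ \ W) ⟨Set.mem_univ y, hy⟩ hz
      have hclique := hgood.pairwise_of_mem hz'
      obtain ⟨p, hp, hSp⟩ := T.exists_bag (Set.sep_subset _ _) hclique
      rw [Finset.mem_range] at hp
      refine ⟨insert z W, ?_⟩
      have hcard : (insert z W).ncard = n + 1 := by
        rw [Set.ncard_insert_of_notMem hz'.2, hW]
      by_cases heq : {s ∈ W | G.Adj s z} = bag p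
      · exact ⟨k, par, Function.update bag p (insert z (bag p)), hcard,
          hgood.insert_saturated hz' hsat, h0, T.enlarge hz'.2 hp heq (by simp)
            (fun j _ hj => by simp [hj])⟩
      · have hk : 0 ≠ k := by omega
        exact ⟨k + 1, Function.update par k p,
          Function.update bag k (insert z {s ∈ W | G.Adj s z}), hcard,
          hgood.insert_saturated hz' hsat, by rw [Function.update_of_ne hk, h0],
          T.grow hz'.2 hp hSp heq (by simp) (fun j hj => by simp [hj.ne]) (by simp)
            (fun j hj => by simp [hj])⟩
  obtain ⟨W, k, par, bag, hW, -, h0, T⟩ := main _ le_rfl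
  have : W = Set.univ := by
    refine Set.eq_of_subset_of_ncard_le (Set.subset_univ _) ?_ (Set.toFinite _)
    rw [Set.ncard_univ, hW]
  exact ⟨k, par, bag, h0, this ▸ T⟩

end IsCliqueTree

/-! ### Flowers in a clique tree -/

/-- A tree on the nodes `0, …, size - 1` with a set of vertices (a bag) at each node. -/
structure BagTree (V : Type*) where
  size : ℕ
  par : ℕ → ℕ
  bag : ℕ → Set V

namespace BagTree

/-- The label of the edge between `j` and its parent; empty for `j = 0`. -/
abbrev lab (t : BagTree V) (j : ℕ) : Set V := label t.par t.bag j

/-- The edges of the path between `x` and `y`. -/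
abbrev path (t : BagTree V) (x y : ℕ) : Finset ℕ := pathEdges t.par x y

open Classical in
/-- The nodes that can be reached from `h` along edges with a label strictly larger than that of the
edge `j`. If `h` is an end of `j`, these are the cliques of a flower for the label of `j`. -/
noncomputable def nodes (t : BagTree V) (j h : ℕ) : Finset ℕ :=
  (Finset.range t.size).filter fun w => ∀ e ∈ t.path h w, t.lab j ⊂ t.lab e

/-- The vertices of the flower `t.nodes j h` outside of the label of `j`. -/
def flower (t : BagTree V) (j h : ℕ) : Set V :=
  {y | ∃ w ∈ t.nodes j h, y ∈ t.bag w ∧ y ∉ t.lab j}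

/-- `t` is a clique tree of `G` with root `0`. -/
structure IsFor (t : BagTree V) (G : SimpleGraph V) : Prop where
  tree : IsCliqueTree G Set.univ (Finset.range t.size) 0 t.par t.bag
  par_zero : t.par 0 = 0

theorem mem_nodes {t : BagTree V} {j h w : ℕ} :
    w ∈ t.nodes j h ↔ w < t.size ∧ ∀ e ∈ t.path h w, t.lab j ⊂ t.lab e := by
  classical
  simp [nodes]

/-- `h` is an end of the edge `j`; for the pseudo-edge `0`, `h = 0`. -/
def IsEnd (t : BagTree V) (j h : ℕ) : Prop := j < t.size ∧ (h = j ∨ h = t.par j)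

/-- Flowers are identified by numbers below `2 * t.size`: `d < t.size` stands for the flower of the
edge `d` on the side of `d`, and `t.size + d` for the one on the side of the parent of `d`. The
number `0` stands for the whole graph. -/
def edge (t : BagTree V) (d : ℕ) : ℕ := if d < t.size then d else d - t.size

/-- The end of the edge `t.edge d` that lies in the flower with number `d`. -/
def head (t : BagTree V) (d : ℕ) : ℕ := if d < t.size then d else t.par (d - t.size)

end BagTree

/-- The vertices of the flower with number `d`. -/
local notation "𝓕[" t "," d "]" => BagTree.flower t (BagTree.edge t d) (BagTree.head t d)

/-- The nodes of the flower with number `d`. -/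
local notation "𝓚[" t "," d "]" => BagTree.nodes t (BagTree.edge t d) (BagTree.head t d)

namespace BagTree

theorem isEnd_of_lt {t : BagTree V} {d : ℕ} (hd : d < 2 * t.size) :
    t.IsEnd (t.edge d) (t.head d) := by
  unfold IsEnd edge head
  split_ifs with h
  · exact ⟨h, .inl rfl⟩
  · exact ⟨by omega, .inr rfl⟩

theorem exists_id {t : BagTree V} {j h : ℕ} (hj : t.IsEnd j h) :
    ∃ d < 2 * t.size, t.edge d = j ∧ t.head d = h := by
  obtain ⟨hlt, rfl | rfl⟩ := hj
  · exact ⟨h, by omega, by simp [edge, hlt], by simp [head, hlt]⟩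
  · exact ⟨t.size + j, by omega, by simp [edge], by simp [head]⟩

/-- The condition for the flower of `j'`, `h'` to be a subproblem of the clique at the node `v` in
the flower of the edge `j` and its end `h`. -/
def Sub (t : BagTree V) (j h v j' h' : ℕ) : Prop :=
  t.lab j ⊂ t.lab j' ∧ h' ∈ t.nodes j h ∧ (∀ e ∈ t.path v h', ¬ t.lab e ⊂ t.lab j') ∧
    ∃ e ∈ t.path v h', t.lab e = t.lab j'

/-- `j'`, `h'` describe the same flower as `j`, `h`. -/
def Same (t : BagTree V) (j h j' h' : ℕ) : Prop :=
  t.lab j = t.lab j' ∧ h' ∈ t.nodes j h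

/-- `d` is the smallest number of its flower. -/
def Canon (t : BagTree V) (d : ℕ) : Prop :=
  ∀ d' < d, ¬ t.Same (t.edge d) (t.head d) (t.edge d') (t.head d')

section

variable {t : BagTree V}

namespace IsFor

theorem size_pos (T : t.IsFor G) : 0 < t.size := by simpa using T.tree.root_mem

theorem mem_range {w : ℕ} (hw : w < t.size) : w ∈ Finset.range t.size := Finset.mem_range.2 hw

theorem isEnd_zero (T : t.IsFor G) : t.IsEnd 0 0 := ⟨T.size_pos, .inl rfl⟩

theorem end_lt (T : t.IsFor G) {j h : ℕ} (hj : t.IsEnd j h) : h < t.size := by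
  obtain ⟨hlt, rfl | rfl⟩ := hj
  · exact hlt
  · rcases Nat.eq_zero_or_pos j with rfl | hpos
    · rw [T.par_zero]; exact hlt
    · exact (T.tree.par_lt j hpos).trans hlt

theorem _root_.CliquePicking.BagTree.lab_subset {j h : ℕ} (hj : t.IsEnd j h) :
    t.lab j ⊆ t.bag h := by
  obtain ⟨_, rfl | rfl⟩ := hj
  · exact fun u hu => hu.2.1
  · exact fun u hu => hu.2.2

theorem lab_zero : t.lab 0 = ∅ := by
  ext u; simp [label]

theorem lab_pairwise (T : t.IsFor G) {j : ℕ} (hj : j < t.size) : (t.lab j).Pairwise G.Adj :=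
  (T.tree.bag_pairwise (mem_range hj)).mono fun _ hu => hu.2.1

theorem exists_mem_not_mem_lab [Nonempty V] (T : t.IsFor G) {j w : ℕ} (hj : j < t.size)
    (hw : w < t.size) : ∃ u ∈ t.bag w, u ∉ t.lab j := by
  by_contra hcon
  push Not at hcon
  rcases Nat.eq_zero_or_pos j with rfl | hpos
  · have hemp : t.bag w = ∅ := by
      rw [Set.eq_empty_iff_forall_notMem]
      intro u hu
      have := hcon u hu
      rw [lab_zero] at this
      exact this
    have := (maxCliques_sub.1 (T.tree.bag_mem w (mem_range hw))).2.2 (Classical.arbitrary V)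
      trivial (by simp [hemp])
    rw [hemp] at this
    exact this
  · have hp := (T.tree.par_lt j hpos)
    have h1 := T.tree.eq_of_subset (mem_range hw) (mem_range hj) fun u hu => (hcon u hu).2.1
    have h2 := T.tree.eq_of_subset (mem_range hw) (mem_range (hp.trans hj))
      fun u hu => (hcon u hu).2.2
    omega

theorem end_mem_nodes (T : t.IsFor G) {j h : ℕ} (hj : t.IsEnd j h) : h ∈ t.nodes j h := by
  rw [mem_nodes]
  exact ⟨T.end_lt hj, by simp⟩

theorem path_nodes (T : t.IsFor G) {j h x y : ℕ} (hx : x ∈ t.nodes j h) (hy : y ∈ t.nodes j h)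
    {e : ℕ} (he : e ∈ t.path x y) : t.lab j ⊂ t.lab e := by
  rcases mem_pathEdges_trans T.tree.par_lt h he with he | he
  · rw [pathEdges_comm T.tree.par_lt] at he
    exact (mem_nodes.1 hx).2 e he
  · exact (mem_nodes.1 hy).2 e he

theorem lab_subset_bag (T : t.IsFor G) {j h w : ℕ} (hj : t.IsEnd j h) (hw : w ∈ t.nodes j h) :
    t.lab j ⊆ t.bag w := by
  intro s hs
  by_contra hsw
  have hsh := lab_subset hj hs
  obtain ⟨e, he, hflip⟩ := exists_flip_edge T.tree.par_lt (fun w => s ∈ t.bag w) (x := h) (y := w)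
    (by simp [hsh, hsw])
  have := ((mem_nodes.1 hw).2 e he).1 hs
  exact hflip (by simp [this.2.1, this.2.2])

theorem bag_subset_commonNbrs (T : t.IsFor G) {j w : ℕ} (hw : w < t.size)
    (h : t.lab j ⊆ t.bag w) {u : V} (hu : u ∈ t.bag w) (huj : u ∉ t.lab j) :
    u ∈ commonNbrs G Set.univ (t.lab j) :=
  ⟨trivial, fun _ hs => T.tree.bag_pairwise (mem_range hw) (h hs) hu (by rintro rfl; exact huj hs)⟩

theorem joined_of_mem_nodes (T : t.IsFor G) {j h x y : ℕ} (hj : t.IsEnd j h)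
    (hx : x ∈ t.nodes j h) (hy : y ∈ t.nodes j h) {a b : V} (ha : a ∈ t.bag x) (haj : a ∉ t.lab j)
    (hb : b ∈ t.bag y) (hbj : b ∉ t.lab j) :
    Joined G (commonNbrs G Set.univ (t.lab j)) a b := by
  have hx' := (mem_nodes.1 hx).1
  have hy' := (mem_nodes.1 hy).1
  refine T.tree.joined_of_path (mem_range hx') (mem_range hy') (fun e he => ?_)
    ha (T.bag_subset_commonNbrs hx' (T.lab_subset_bag hj hx) ha haj)
    hb (T.bag_subset_commonNbrs hy' (T.lab_subset_bag hj hy) hb hbj)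
  have hss := T.path_nodes hx hy he
  obtain ⟨u, hu, huj⟩ := Set.not_subset.1 hss.2
  obtain ⟨h1, -⟩ := T.tree.path_mem (mem_range hx') (mem_range hy') he
  exact ⟨u, hu, T.bag_subset_commonNbrs (by simpa using h1) (fun s hs => (hss.1 hs).2.1) hu.2.1 huj⟩

/-- A bag joined with the flower by common neighbors of its separator belongs to the flower. -/
theorem mem_nodes_of_joined [Finite V] (T : t.IsFor G) {j h w : ℕ} (hj : t.IsEnd j h)
    (hw : w < t.size) (hsub : t.lab j ⊆ t.bag w) {a b : V} (ha : a ∈ t.bag h) (haj : a ∉ t.lab j)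
    (hb : b ∈ t.bag w) (hab : Joined G (commonNbrs G Set.univ (t.lab j)) a b) :
    w ∈ t.nodes j h := by
  rw [mem_nodes]
  refine ⟨hw, fun e he => ⟨fun s hs => ?_, fun hle => ?_⟩⟩
  · exact (T.tree.path_mem (mem_range (T.end_lt hj)) (mem_range hw) he).2.2.2 s
      (lab_subset hj hs) (hsub hs)
  · refine T.tree.not_mem_path_of_joined (Set.subset_univ _) (fun u hu hu' => ?_)
      (mem_range (T.end_lt hj)) (mem_range hw) ha
      (T.bag_subset_commonNbrs (T.end_lt hj) (lab_subset hj) ha haj) hb hab he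
    exact (hu'.2 u (hle hu)).ne rfl

/-- Flowers (without their separator) are the connected components of the common neighborhoods of
labels. -/
theorem flower_eq_comp [Finite V] (T : t.IsFor G) {j h : ℕ} (hj : t.IsEnd j h) {a : V}
    (ha : a ∈ t.flower j h) : t.flower j h = comp G (commonNbrs G Set.univ (t.lab j)) a := by
  obtain ⟨w, hw, haw, haj⟩ := ha
  have hh := T.end_mem_nodes hj
  ext y
  constructor
  · rintro ⟨z, hz, hyz, hyj⟩
    exact T.joined_of_mem_nodes hj hw hz haw haj hyz hyj
  · intro hy
    have hyC := Joined.mem hy (T.bag_subset_commonNbrs (mem_nodes.1 hw).1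
      (T.lab_subset_bag hj hw) haw haj)
    have hyj : y ∉ t.lab j := fun h => (hyC.2 y h).ne rfl
    obtain ⟨z, hz, hsub⟩ := T.tree.exists_bag (C := insert y (t.lab j)) (Set.subset_univ _) (by
      rintro p (rfl | hp) q (rfl | hq) hpq
      · exact absurd rfl hpq
      · exact (hyC.2 q hq).symm
      · exact hyC.2 p hp
      · exact T.lab_pairwise hj.1 hp hq hpq)
    have hzk : z < t.size := by simpa using hz
    have hyz := hsub (Set.mem_insert _ _)
    refine ⟨z, ?_, hyz, hyj⟩
    have : Nonempty V := ⟨y⟩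
    obtain ⟨a₀, ha₀, ha₀j⟩ := T.exists_mem_not_mem_lab hj.1 (T.end_lt hj)
    exact T.mem_nodes_of_joined hj hzk (fun s hs => hsub (.inr hs)) ha₀ ha₀j hyz
      ((T.joined_of_mem_nodes hj hh hw ha₀ ha₀j haw haj).trans hy)

theorem flower_nonempty [Nonempty V] (T : t.IsFor G) {j h : ℕ} (hj : t.IsEnd j h) :
    (t.flower j h).Nonempty := by
  obtain ⟨a, ha, haj⟩ := T.exists_mem_not_mem_lab hj.1 (T.end_lt hj)
  exact ⟨a, h, T.end_mem_nodes hj, ha, haj⟩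

theorem flower_subset_commonNbrs (T : t.IsFor G) {j h : ℕ} (hj : t.IsEnd j h) :
    t.flower j h ⊆ commonNbrs G Set.univ (t.lab j) := by
  rintro y ⟨w, hw, hyw, hyj⟩
  exact T.bag_subset_commonNbrs (mem_nodes.1 hw).1 (T.lab_subset_bag hj hw) hyw hyj

/-- A node belongs to a flower as soon as its bag contains the separator and a vertex of the
flower. -/
theorem mem_nodes_of_mem_flower [Finite V] (T : t.IsFor G) {j h w : ℕ} (hj : t.IsEnd j h)
    (hw : w < t.size) (hsub : t.lab j ⊆ t.bag w) {b : V} (hb : b ∈ t.bag w)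
    (hbF : b ∈ t.flower j h) : w ∈ t.nodes j h := by
  have : Nonempty V := ⟨b⟩
  obtain ⟨a, ha, haj⟩ := T.exists_mem_not_mem_lab hj.1 (T.end_lt hj)
  rw [T.flower_eq_comp hj ⟨h, T.end_mem_nodes hj, ha, haj⟩] at hbF
  exact T.mem_nodes_of_joined hj hw hsub ha haj hb hbF

/-- The bags of a flower, without its separator, form a clique tree of the flower. -/
theorem flowerTree [Finite V] [Nonempty V] (T : t.IsFor G) {j h r : ℕ} (hj : t.IsEnd j h)
    (hr : r ∈ t.nodes j h) (hmin : ∀ w ∈ t.nodes j h, r ≤ w) :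
    IsCliqueTree G (t.flower j h) (t.nodes j h) r t.par (fun w => t.bag w \ t.lab j) := by
  have hlt : ∀ {w}, w ∈ t.nodes j h → w < t.size := fun hw => (mem_nodes.1 hw).1
  have par_mem : ∀ w ∈ t.nodes j h, w ≠ r → t.par w ∈ t.nodes j h := by
    intro w hw hwr
    have hrw : r < w := lt_of_le_of_ne (hmin w hw) (Ne.symm hwr)
    rw [mem_nodes]
    refine ⟨(T.tree.par_lt w (by omega)).trans (hlt hw), fun e he => ?_⟩
    rcases mem_pathEdges_trans T.tree.par_lt r he with he | he
    · exact (mem_nodes.1 hr).2 e he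
    · refine T.path_nodes hr hw (e := e) ?_
      rw [path, pathEdges_lt T.tree.par_lt hrw]
      exact Finset.mem_insert_of_mem he
  have bag_mem : ∀ w ∈ t.nodes j h, t.bag w \ t.lab j ∈ maxCliques (sub G (t.flower j h)) := by
    intro w hw
    have hb := maxCliques_sub.1 (T.tree.bag_mem w (mem_range (hlt hw)))
    rw [maxCliques_sub]
    refine ⟨fun u hu => ⟨w, hw, hu.1, hu.2⟩, hb.2.1.mono Set.sdiff_subset, fun x hx hK => ?_⟩
    refine ⟨hb.2.2 x trivial fun k hk hkx => ?_, fun h =>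
      ((T.flower_subset_commonNbrs hj hx).2 x h).ne rfl⟩
    by_cases hkj : k ∈ t.lab j
    · exact (T.flower_subset_commonNbrs hj hx).2 k hkj
    · exact hK k ⟨hk, hkj⟩ hkx
  refine ⟨T.tree.par_lt, hr, hmin, par_mem, bag_mem, ?_, ?_, ?_⟩
  · intro K hK
    have hK' := maxCliques_sub.1 hK
    obtain ⟨w, hw, hsub⟩ := T.tree.exists_bag (C := K ∪ t.lab j) (Set.subset_univ _) (by
      rintro p (hp | hp) q (hq | hq) hpq
      · exact hK'.2.1 hp hq hpq
      · exact ((T.flower_subset_commonNbrs hj (hK'.1 hp)).2 q hq).symm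
      · exact (T.flower_subset_commonNbrs hj (hK'.1 hq)).2 p hp
      · exact T.lab_pairwise hj.1 hp hq hpq)
    have hKne : K.Nonempty := by
      by_contra hemp
      rw [Set.not_nonempty_iff_eq_empty] at hemp
      obtain ⟨x, hx⟩ := T.flower_nonempty hj
      have := hK'.2.2 x hx (by simp [hemp])
      rw [hemp] at this
      exact this
    obtain ⟨x, hx⟩ := hKne
    have hwn : w ∈ t.nodes j h := T.mem_nodes_of_mem_flower hj (by simpa using hw)
      (fun s hs => hsub (.inr hs)) (hsub (.inl hx)) (hK'.1 hx)
    refine ⟨w, hwn, Set.Subset.antisymm ?_ ?_⟩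
    · exact hK.2 (bag_mem w hwn).1 fun y hy => ⟨hsub (.inl hy), fun h =>
        ((T.flower_subset_commonNbrs hj (hK'.1 hy)).2 y h).ne rfl⟩
    · exact fun y hy => ⟨hsub (.inl hy), fun h =>
        ((T.flower_subset_commonNbrs hj (hK'.1 hy)).2 y h).ne rfl⟩
  · intro w hw w' hw' heq
    refine T.tree.inj w (mem_range (hlt hw)) w' (mem_range (hlt hw')) ?_
    have h1 := Set.sdiff_union_of_subset (T.lab_subset_bag hj hw)
    have h2 := Set.sdiff_union_of_subset (T.lab_subset_bag hj hw')
    beta_reduce at heq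
    rw [← h1, ← h2, heq]
  · intro a ha b hb hab u hu hu'
    exact ⟨T.tree.rip a (mem_range (hlt ha)) b (mem_range (hlt hb)) hab u hu.1 hu'.1, hu.2⟩

theorem flowerTree_label (j : ℕ) (e : ℕ) :
    label t.par (fun w => t.bag w \ t.lab j) e = t.lab e \ t.lab j := by
  ext u
  simp only [label, Set.mem_sdiff, Set.mem_ofPred_eq]
  tauto

theorem nodes_subset (T : t.IsFor G) {j h j' h' : ℕ} (hlab : t.lab j ⊂ t.lab j')
    (hh : h' ∈ t.nodes j h) : t.nodes j' h' ⊆ t.nodes j h := by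
  intro w hw
  rw [mem_nodes] at hw ⊢
  refine ⟨hw.1, fun e he => ?_⟩
  rcases mem_pathEdges_trans T.tree.par_lt h' he with he | he
  · exact (mem_nodes.1 hh).2 e he
  · exact hlab.trans (hw.2 e he)

theorem exists_root (T : t.IsFor G) {j h : ℕ} (hj : t.IsEnd j h) :
    ∃ r ∈ t.nodes j h, ∀ w ∈ t.nodes j h, r ≤ w :=
  ⟨(t.nodes j h).min' ⟨h, T.end_mem_nodes hj⟩, Finset.min'_mem _ _,
    fun w hw => Finset.min'_le _ w hw⟩

/-- All vertices of a flower with the property `Sub` lie outside of the clique at `v`, the separator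
of the flower is the closest one, and the flower is the subproblem of each of its vertices. -/
theorem bubble_of_sub [Finite V] (T : t.IsFor G) {j h v j' h' : ℕ} (hj : t.IsEnd j h)
    (hv : v ∈ t.nodes j h) (hj' : t.IsEnd j' h') (hsub : t.Sub j h v j' h') {x : V}
    (hx : x ∈ t.flower j' h') :
    x ∈ t.flower j h \ (t.bag v \ t.lab j) ∧
      nearSep G (t.flower j h) (t.bag v \ t.lab j) x = t.lab j' \ t.lab j ∧
      bubble G (t.flower j h) (t.bag v \ t.lab j) x = t.flower j' h' := by
  have : Nonempty V := ⟨x⟩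
  obtain ⟨hss, hh', hno, e₀, he₀, heq₀⟩ := hsub
  obtain ⟨r, hr, hmin⟩ := T.exists_root hj
  have TF := T.flowerTree hj hr hmin
  have hnodes := T.nodes_subset hss hh'
  have hx₀ := hx
  obtain ⟨w, hw, hxw, hxj'⟩ := hx
  have hwF := hnodes hw
  have hxj : x ∉ t.lab j := fun h => hxj' (hss.1 h)
  have hxF : x ∈ t.flower j h := ⟨w, hwF, hxw, hxj⟩
  have hlt : ∀ {w}, w ∈ t.nodes j h → w ∈ Finset.range t.size :=
    fun hw => mem_range (mem_nodes.1 hw).1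
  have he₀w : e₀ ∈ t.path v w := by
    rcases mem_pathEdges_trans T.tree.par_lt w he₀ with he | he
    · exact he
    · rw [pathEdges_comm T.tree.par_lt] at he
      have := (mem_nodes.1 hw).2 e₀ he
      rw [heq₀] at this
      exact absurd rfl this.ne
  have hxv : x ∉ t.bag v := by
    intro hxv
    have := (T.tree.path_mem (hlt hv) (hlt hwF) he₀w).2.2.2 x hxv hxw
    rw [← heq₀] at hxj'
    exact hxj' this
  have hnear : nearSep G (t.flower j h) (t.bag v \ t.lab j) x = t.lab j' \ t.lab j := by
    have h1 := TF.nearSep_subset_label (e := e₀) hv hwF (x := x) ⟨hxw, hxj⟩ he₀w (by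
      intro u hu
      rw [flowerTree_label] at hu
      have hu' : u ∈ t.lab j' := by rw [← heq₀]; exact hu.1
      exact T.tree.bag_pairwise (hlt hwF) hxw (T.lab_subset_bag hj' hw hu')
        (by rintro rfl; exact hxj' hu'))
    rw [flowerTree_label] at h1
    change _ ⊆ t.lab e₀ \ _ at h1
    rw [heq₀] at h1
    obtain ⟨e₁, he₁, heq₁⟩ := TF.exists_nearSep_eq_label hv hwF (x := x) (fun h => hxv h.1)
      ⟨hxw, hxj⟩
    rw [flowerTree_label] at heq₁
    rw [heq₁] at h1
    have hle : t.lab e₁ ⊆ t.lab j' := by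
      intro u hu
      by_cases huj : u ∈ t.lab j
      · exact hss.1 huj
      · exact (h1 ⟨hu, huj⟩).1
    rcases mem_pathEdges_trans T.tree.par_lt h' he₁ with he | he
    · have : t.lab e₁ = t.lab j' := by
        by_contra hne
        exact hno e₁ he (hle.ssubset_of_ne hne)
      rw [heq₁]
      change t.lab e₁ \ _ = _
      rw [this]
    · exact absurd hle ((mem_nodes.1 hw).2 e₁ he).2
  refine ⟨⟨hxF, fun h => hxv h.1⟩, hnear, ?_⟩
  rw [bubble, hnear, T.flower_eq_comp hj' hx₀]
  ext y
  constructor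
  · intro hy
    refine Joined.mono ?_ hy
    intro z hz
    refine ⟨trivial, fun s hs => ?_⟩
    by_cases hsj : s ∈ t.lab j
    · exact (T.flower_subset_commonNbrs hj hz.1).2 s hsj
    · exact hz.2 s ⟨hs, hsj⟩
  · intro hy
    have hy' := joined_comp hy
    rw [← T.flower_eq_comp hj' hx₀] at hy'
    refine Joined.mono ?_ hy'
    rintro z ⟨w', hw', hzw, hzj⟩
    have hz : z ∈ t.flower j' h' := ⟨w', hw', hzw, hzj⟩
    exact ⟨⟨w', hnodes hw', hzw, fun h => hzj (hss.1 h)⟩, fun s hs =>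
      (T.flower_subset_commonNbrs hj' hz).2 s hs.1⟩

/-- Every vertex outside of the clique at `v` belongs to a flower with the property `Sub`. -/
theorem exists_sub [Finite V] (T : t.IsFor G) {j h v : ℕ} (hj : t.IsEnd j h)
    (hv : v ∈ t.nodes j h) {x : V} (hx : x ∈ t.flower j h \ (t.bag v \ t.lab j)) :
    ∃ j' h', t.IsEnd j' h' ∧ t.Sub j h v j' h' ∧ x ∈ t.flower j' h' := by
  have : Nonempty V := ⟨x⟩
  obtain ⟨r, hr, hmin⟩ := T.exists_root hj
  have TF := T.flowerTree hj hr hmin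
  have hlt : ∀ {w}, w ∈ t.nodes j h → w ∈ Finset.range t.size :=
    fun hw => mem_range (mem_nodes.1 hw).1
  obtain ⟨⟨w, hw, hxw, hxj⟩, hxv⟩ := hx
  have hxF : x ∈ t.flower j h := ⟨w, hw, hxw, hxj⟩
  -- a node whose bag contains both `x` and its separator
  obtain ⟨e₀, he₀, heq₀⟩ := TF.exists_nearSep_eq_label hv hw hxv ⟨hxw, hxj⟩
  rw [flowerTree_label] at heq₀
  have hadj : ∀ s ∈ nearSep G (t.flower j h) (t.bag v \ t.lab j) x, G.Adj x s := fun s hs => hs.2.1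
  have hxn : x ∉ nearSep G (t.flower j h) (t.bag v \ t.lab j) x := fun h => (hadj x h).ne rfl
  obtain ⟨q, hq, hqsub⟩ := TF.exists_bag
    (C := insert x (nearSep G (t.flower j h) (t.bag v \ t.lab j) x)) (by
      rintro s (rfl | hs)
      · exact hxF
      · exact hs.1) (by
      have hcl : (nearSep G (t.flower j h) (t.bag v \ t.lab j) x).Pairwise G.Adj := by
        rw [heq₀]
        exact (T.lab_pairwise (j := e₀)
          (Finset.mem_range.1 (hlt (TF.path_mem hv hw he₀).1))).mono Set.sdiff_subset
      rintro a (rfl | ha) b (rfl | hb) hab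
      · exact absurd rfl hab
      · exact hadj b hb
      · exact (hadj a ha).symm
      · exact hcl ha hb hab)
  have hxq : x ∈ t.bag q := (hqsub (Set.mem_insert _ _)).1
  obtain ⟨e₁, he₁, heq₁⟩ := TF.exists_nearSep_eq_label hv hq hxv ⟨hxq, hxj⟩
  rw [flowerTree_label] at heq₁
  have hje₁ : t.lab j ⊂ t.lab e₁ := T.path_nodes hv hq he₁
  have hlabq : t.lab e₁ ⊆ t.bag q := by
    intro s hs
    by_cases hsj : s ∈ t.lab j
    · exact T.lab_subset_bag hj hq hsj
    · exact (hqsub (.inr (by rw [heq₁]; exact ⟨hs, hsj⟩))).1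
  have hadj₁ : ∀ s ∈ t.lab e₁, G.Adj x s := by
    intro s hs
    by_cases hsj : s ∈ t.lab j
    · exact ((T.flower_subset_commonNbrs hj hxF).2 s hsj).symm
    · exact hadj s (by rw [heq₁]; exact ⟨hs, hsj⟩)
  -- the last edge with this label on the way from `v`
  rw [pathEdges_comm T.tree.par_lt] at he₁
  obtain ⟨e₂, he₂, p, hp, heq₂, hlast⟩ := exists_first_edge T.tree.par_lt
    (fun e => t.lab e = t.lab e₁) ⟨e₁, he₁, rfl⟩
  obtain ⟨h1, h2, -, -⟩ := TF.path_mem hq hv he₂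
  have hpF : p ∈ t.nodes j h := by rcases hp with rfl | rfl <;> assumption
  have hend : t.IsEnd e₂ p := ⟨Finset.mem_range.1 (hlt h1), hp⟩
  have he₂q : e₂ ∉ t.path q p := fun h => hlast e₂ h heq₂
  have hqp : ∀ e ∈ t.path q p, t.lab e₂ ⊆ t.lab e := fun e he s hs =>
    (T.tree.path_mem (hlt hq) (hlt hpF) he).2.2.2 s (hlabq (heq₂ ▸ hs)) (lab_subset hend hs)
  refine ⟨e₂, p, hend, ⟨?_, hpF, ?_, e₂, ?_, rfl⟩, q, ?_, hxq, ?_⟩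
  · rw [heq₂]; exact hje₁
  · intro e he hss
    rcases mem_pathEdges_trans T.tree.par_lt q he with he' | he'
    · have h3 := TF.nearSep_subset_label (e := e) hv hq (x := x) ⟨hxq, hxj⟩ he' (by
        intro u hu
        rw [flowerTree_label] at hu
        exact hadj₁ u (heq₂ ▸ hss.1 hu.1))
      rw [flowerTree_label] at h3
      rw [heq₁] at h3
      refine hss.2 fun u hu => ?_
      by_cases huj : u ∈ t.lab j
      · exact (T.path_nodes hv hq he').1 huj
      · exact (h3 ⟨heq₂ ▸ hu, huj⟩).1
    · exact hss.2 (hqp e he')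
  · rw [pathEdges_comm T.tree.par_lt] at he₂
    rcases mem_pathEdges_trans T.tree.par_lt p he₂ with he | he
    · exact he
    · rw [pathEdges_comm T.tree.par_lt] at he
      exact absurd he he₂q
  · rw [mem_nodes]
    refine ⟨Finset.mem_range.1 (hlt hq), fun e he => ?_⟩
    rw [path, pathEdges_comm T.tree.par_lt] at he
    refine (hqp e he).ssubset_of_ne fun h => ?_
    exact hlast e he (by rw [← h, heq₂])
  · intro h
    rw [heq₂] at h
    exact (hadj₁ x h).ne rfl

/-! ### Numbering the flowers -/

theorem same_refl (T : t.IsFor G) {j h : ℕ} (hj : t.IsEnd j h) : t.Same j h j h :=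
  ⟨rfl, T.end_mem_nodes hj⟩

theorem same_nodes (T : t.IsFor G) {j h j' h' : ℕ} (hs : t.Same j h j' h') :
    t.nodes j' h' = t.nodes j h := by
  ext w
  rw [mem_nodes, mem_nodes, ← hs.1]
  refine and_congr_right fun hw => ⟨fun H e he => ?_, fun H e he => ?_⟩
  · rcases mem_pathEdges_trans T.tree.par_lt h' he with he | he
    · exact (mem_nodes.1 hs.2).2 e he
    · exact H e he
  · rcases mem_pathEdges_trans T.tree.par_lt h he with he | he
    · rw [pathEdges_comm T.tree.par_lt] at he
      exact (mem_nodes.1 hs.2).2 e he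
    · exact H e he

theorem same_flower (T : t.IsFor G) {j h j' h' : ℕ} (hs : t.Same j h j' h') :
    t.flower j' h' = t.flower j h := by
  unfold flower
  rw [T.same_nodes hs, hs.1]

theorem same_symm (T : t.IsFor G) {j h j' h' : ℕ} (hj : t.IsEnd j h) (hs : t.Same j h j' h') :
    t.Same j' h' j h :=
  ⟨hs.1.symm, by rw [T.same_nodes hs]; exact T.end_mem_nodes hj⟩

theorem same_sub (T : t.IsFor G) {j h v j' h' j'' h'' : ℕ} (hs : t.Same j' h' j'' h'')
    (hsub : t.Sub j h v j' h') : t.Sub j h v j'' h'' := by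
  obtain ⟨h1, h2, h3, e, he, heq⟩ := hsub
  refine ⟨hs.1 ▸ h1, T.nodes_subset h1 h2 hs.2, fun e he => ?_, e, ?_, heq.trans hs.1⟩
  · rw [← hs.1]
    rcases mem_pathEdges_trans T.tree.par_lt h' he with he | he
    · exact h3 e he
    · exact fun h => ((mem_nodes.1 hs.2).2 e he).2 h.1
  · rcases mem_pathEdges_trans T.tree.par_lt h'' he with he | he
    · exact he
    · rw [pathEdges_comm T.tree.par_lt] at he
      have := (mem_nodes.1 hs.2).2 e he
      rw [heq] at this
      exact absurd rfl this.ne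

theorem exists_canon (T : t.IsFor G) {d : ℕ} (hd : d < 2 * t.size) :
    ∃ d' < 2 * t.size, t.Canon d' ∧ t.Same (t.edge d) (t.head d) (t.edge d') (t.head d') := by
  classical
  have hex : ∃ d', t.Same (t.edge d) (t.head d) (t.edge d') (t.head d') :=
    ⟨d, T.same_refl (isEnd_of_lt hd)⟩
  have hs := Nat.find_spec hex
  have hle : Nat.find hex ≤ d := Nat.find_min' hex (T.same_refl (isEnd_of_lt hd))
  refine ⟨Nat.find hex, by omega, fun d' hd' h => Nat.find_min hex hd' ⟨hs.1.trans h.1, ?_⟩, hs⟩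
  rw [← T.same_nodes hs]
  exact h.2

theorem flower_zero [Finite V] (T : t.IsFor G) (hG : G.Connected) :
    𝓕[t, 0] = Set.univ := by
  have := hG.nonempty
  have h0 : t.edge 0 = 0 := by simp [edge, T.size_pos]
  have h0' : t.head 0 = 0 := by simp [head, T.size_pos]
  rw [h0, h0']
  obtain ⟨a, ha⟩ := T.flower_nonempty T.isEnd_zero
  rw [T.flower_eq_comp T.isEnd_zero ha, Set.eq_univ_iff_forall]
  intro y
  obtain ⟨p⟩ := hG.preconnected a y
  exact joined_of_walk p fun x _ => ⟨trivial, by simp [lab_zero]⟩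

/-- The subproblems of a clique in a flower. -/
theorem subproblems_flower [Finite V] (T : t.IsFor G) (hG : IsChordal G) {j h v : ℕ}
    (hj : t.IsEnd j h) (hv : v ∈ t.nodes j h) {C : G.Subgraph} :
    C ∈ subproblems (sub G (t.flower j h)) (t.bag v \ t.lab j) ↔
      ∃ d < 2 * t.size, t.Canon d ∧ t.Sub j h v (t.edge d) (t.head d) ∧
        C = sub G 𝓕[t, d] := by
  constructor
  · intro hC
    obtain ⟨r, hr, hmin⟩ := T.exists_root hj
    obtain hV | hV := isEmpty_or_nonempty V
    · obtain ⟨⟨x⟩⟩ := hC.1.2.coe.nonempty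
      exact (hV.false x).elim
    have TF := T.flowerTree hj hr hmin
    rw [subproblems_eq hG (TF.bag_mem v hv)] at hC
    obtain ⟨x, hx, rfl⟩ := hC
    obtain ⟨j', h', hj', hsub, hx'⟩ := T.exists_sub hj hv hx
    obtain ⟨d, hd, rfl, rfl⟩ := exists_id hj'
    obtain ⟨d', hd', hcan, hsame⟩ := T.exists_canon hd
    refine ⟨d', hd', hcan, T.same_sub hsame hsub, ?_⟩
    rw [(T.bubble_of_sub hj hv hj' hsub hx').2.2, T.same_flower hsame]
  · rintro ⟨d, hd, hcan, hsub, rfl⟩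
    obtain ⟨r, hr, hmin⟩ := T.exists_root hj
    have hne : Nonempty V := by
      obtain ⟨u, -⟩ := Set.exists_of_ssubset hsub.1
      exact ⟨u⟩
    have TF := T.flowerTree hj hr hmin
    rw [subproblems_eq hG (TF.bag_mem v hv)]
    obtain ⟨x, hx⟩ := T.flower_nonempty (isEnd_of_lt hd)
    have := T.bubble_of_sub hj hv (isEnd_of_lt hd) hsub hx
    exact ⟨x, this.1, by rw [this.2.2]⟩

/-- Different numbers stand for different subproblems. -/
theorem sub_injective [Finite V] (T : t.IsFor G) {j h v d d' : ℕ} (hj : t.IsEnd j h)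
    (hv : v ∈ t.nodes j h) (hd : d < 2 * t.size) (hd' : d' < 2 * t.size) (hc : t.Canon d)
    (hc' : t.Canon d') (hs : t.Sub j h v (t.edge d) (t.head d))
    (hs' : t.Sub j h v (t.edge d') (t.head d'))
    (heq : 𝓕[t, d] = 𝓕[t, d']) : d = d' := by
  have hne : Nonempty V := by
    obtain ⟨u, -⟩ := Set.exists_of_ssubset hs.1
    exact ⟨u⟩
  have hE := isEnd_of_lt hd
  have hE' := isEnd_of_lt hd'
  obtain ⟨x, hx⟩ := T.flower_nonempty hE
  have h1 := (T.bubble_of_sub hj hv hE hs hx).2.1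
  have h2 := (T.bubble_of_sub hj hv hE' hs' (heq ▸ hx)).2.1
  have hlab : t.lab (t.edge d) = t.lab (t.edge d') := by
    rw [h1] at h2
    rw [← Set.sdiff_union_of_subset hs.1.1, h2, Set.sdiff_union_of_subset hs'.1.1]
  have hsame : t.Same (t.edge d) (t.head d) (t.edge d') (t.head d') := by
    refine ⟨hlab, ?_⟩
    obtain ⟨b, hb, hbj⟩ := T.exists_mem_not_mem_lab hE'.1 (T.end_lt hE')
    refine T.mem_nodes_of_mem_flower hE (T.end_lt hE') (hlab ▸ lab_subset hE') hb ?_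
    rw [heq]
    exact ⟨_, T.end_mem_nodes hE', hb, hbj⟩
  rcases Nat.lt_trichotomy d d' with h | h | h
  · exact absurd (T.same_symm hE hsame) (hc' d h)
  · exact h
  · exact absurd hsame (hc d' h)

end IsFor

end

end BagTree

/-! ### The graphs explored by Clique-Picking -/

theorem IsChordal.coe_sub (hG : IsChordal G) (U : Set V) : IsChordal (sub G U).coe := by
  intro v c hc hlen
  have hinj : Function.Injective (sub G U).hom := SimpleGraph.Subgraph.hom_injective
  obtain ⟨x, hx, y, hy, hxy, hne⟩ := hG _ (c.map (sub G U).hom)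
    (hc.map hinj) (by rw [SimpleGraph.Walk.length_map]; exact hlen)
  rw [SimpleGraph.Walk.support_map] at hx hy
  rw [List.mem_map] at hx hy
  obtain ⟨x, hx, rfl⟩ := hx
  obtain ⟨y, hy, rfl⟩ := hy
  refine ⟨x, hx, y, hy, sub_adj.2 ⟨x.2, y.2, hxy⟩, fun h => hne ?_⟩
  rw [SimpleGraph.Walk.edges_map]
  exact List.mem_map.2 ⟨_, h, rfl⟩

namespace BagTree

variable {t : BagTree V}

/-- The subgraph of `G` induced by the flower with number `d`, without its separator. -/
abbrev graph (t : BagTree V) (G : SimpleGraph V) (d : ℕ) : G.Subgraph :=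
  sub G 𝓕[t, d]

namespace IsFor

theorem graph_zero [Finite V] (T : t.IsFor G) (hG : G.Connected) : t.graph G 0 = ⊤ := by
  rw [graph, T.flower_zero hG, sub_univ]

theorem isUCCG_graph [Finite V] [Nonempty V] (T : t.IsFor G) (hG : IsChordal G) {d : ℕ}
    (hd : d < 2 * t.size) : IsUCCG (t.graph G d).coe := by
  have hj := isEnd_of_lt hd
  obtain ⟨a, ha⟩ := T.flower_nonempty hj
  refine ⟨(sub_connected.2 ⟨⟨a, ha⟩, ?_⟩).coe, hG.coe_sub _⟩
  rw [T.flower_eq_comp hj ha]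
  exact connSet_comp

/-- The label of an edge is a minimal separator of vertices on its two sides. -/
theorem lab_mem_minSeparators [Finite V] [Nonempty V] (T : t.IsFor G) {j : ℕ} (hj : j < t.size)
    (hpos : 0 < j) : t.lab j ∈ minSeparators G := by
  have hlt := T.tree.par_lt j hpos
  obtain ⟨a, ha, haj⟩ := T.exists_mem_not_mem_lab hj hj
  obtain ⟨b, hb, hbj⟩ := T.exists_mem_not_mem_lab hj (hlt.trans hj)
  have hsep : ¬ Joined G (t.lab j)ᶜ a b := fun h =>
    T.tree.not_mem_path_of_joined (Z := (t.lab j)ᶜ) (Set.subset_univ _) (fun u hu hu' => hu' hu)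
      (mem_range hj)
      (mem_range (hlt.trans hj)) ha haj hb h (by
        rw [pathEdges_gt T.tree.par_lt hlt]; exact Finset.mem_insert_self _ _)
  refine ⟨a, b, ⟨?_, ?_, haj, hbj, ?_⟩, ?_⟩
  · rintro rfl
    exact hsep Joined.refl
  · exact fun h => hsep (Joined.single h haj hbj)
  · rwa [reachable_induce_iff]
  · rintro S' ⟨hab, -, ha', hb', hS'⟩ hle s hs
    by_contra hsS
    rw [reachable_induce_iff] at hS'
    have h1 : G.Adj a s := T.tree.bag_pairwise (mem_range hj) ha hs.2.1
      (by rintro rfl; exact haj hs)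
    have h2 : G.Adj s b := T.tree.bag_pairwise (mem_range (hlt.trans hj)) hs.2.2 hb
      (by rintro rfl; exact hbj hs)
    exact hS' ((Joined.single h1 ha' hsS).tail h2 hsS hb')

theorem exists_flower_eq [Finite V] [Nonempty V] (T : t.IsFor G) {j h : ℕ} (hj : t.IsEnd j h) :
    ∃ F ∈ bouquet G (t.lab j), sub G (t.flower j h) = flowerMinus G F (t.lab j) := by
  have hF : ⋃₀ {K | ∃ w ∈ t.nodes j h, K = t.bag w} \ t.lab j = t.flower j h := by
    ext y
    simp only [Set.mem_sdiff, Set.mem_sUnion, Set.mem_ofPred_eq, flower]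
    constructor
    · rintro ⟨⟨_, ⟨w, hw, rfl⟩, hy⟩, hyj⟩
      exact ⟨w, hw, hy, hyj⟩
    · rintro ⟨w, hw, hy, hyj⟩
      exact ⟨⟨_, ⟨w, hw, rfl⟩, hy⟩, hyj⟩
  obtain ⟨a, ha⟩ := T.flower_nonempty hj
  refine ⟨{K | ∃ w ∈ t.nodes j h, K = t.bag w}, ⟨⟨?_, ?_⟩, ?_⟩, ?_⟩
  · rintro _ ⟨w, hw, rfl⟩
    refine ⟨?_, T.lab_subset_bag hj hw⟩
    rw [← sub_univ]
    exact T.tree.bag_mem w (mem_range (mem_nodes.1 hw).1)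
  · rw [hF, connected_induce_iff]
    refine ⟨⟨a, ha⟩, ?_⟩
    rw [T.flower_eq_comp hj ha]
    exact connSet_comp
  · rintro F' ⟨hF', hconn⟩ hle K hK
    have hKb := hF' hK
    rw [← sub_univ] at hKb
    obtain ⟨w, hw, rfl⟩ := T.tree.surj K hKb.1
    have hw' : w < t.size := Finset.mem_range.1 hw
    refine ⟨w, ?_, rfl⟩
    obtain ⟨b, hb, hbj⟩ := T.exists_mem_not_mem_lab hj.1 hw'
    obtain ⟨c, hc, hcj⟩ := T.exists_mem_not_mem_lab hj.1 (T.end_lt hj)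
    rw [connected_induce_iff] at hconn
    have hcF : c ∈ ⋃₀ F' \ t.lab j :=
      ⟨⟨t.bag h, hle ⟨h, T.end_mem_nodes hj, rfl⟩, hc⟩, hcj⟩
    refine T.mem_nodes_of_joined hj hw' hKb.2 hc hcj hb
      ((hconn.2 c hcF b ⟨⟨_, hK, hb⟩, hbj⟩).mono ?_)
    rintro y ⟨⟨K', hK', hyK'⟩, hyj⟩
    have hKb' := hF' hK'
    rw [← sub_univ] at hKb'
    exact ⟨trivial, fun s hs => (maxCliques_sub.1 hKb'.1).2.1 (hKb'.2 hs) hyK'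
      (by rintro rfl; exact hyj hs)⟩
  · rw [flowerMinus, hF]

/-- A graph that belongs to a flower of the tree. -/
def IsFlowerGraph (t : BagTree V) (H : G.Subgraph) : Prop := ∃ d < 2 * t.size, H = t.graph G d

/-- All graphs a task has to be executed on belong to flowers of the tree. -/
def FlowerTask (t : BagTree V) : Task G → Prop
  | .count H => IsFlowerGraph t H
  | .loop H _ _ _ => IsFlowerGraph t H
  | .prod Hs _ => ∀ H ∈ Hs, IsFlowerGraph t H

theorem run_calls [Finite V] [Nonempty V] (T : t.IsFor G) (hG : IsChordal G) {task : Task G}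
    {memo memo' : List (G.Subgraph × ℕ)} {log : List (Event G)} {a : ℕ}
    (hrun : Run task memo log memo' a) (htask : FlowerTask t task) (H : G.Subgraph)
    (hH : .call H ∈ log) : IsFlowerGraph t H := by
  induction hrun with
  | count_memo h =>
    simp only [List.mem_cons, Event.call.injEq, reduceCtorEq, List.not_mem_nil, or_false] at hH
    exact hH ▸ htask
  | count_new h 𝒯 run ih =>
    simp only [List.mem_cons, Event.call.injEq, reduceCtorEq, List.not_mem_nil, or_false,
      List.mem_append, List.cons_append] at hH
    rcases hH with rfl | hH
    · exact htask
    · exact ih htask hH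
  | loop_done => simp at hH
  | @loop_step H₀ 𝒯 v _ _ _ _ _ Hs _ _ _ _ _ _ _ _ mem_Hs inner rest ih1 ih2 =>
    simp only [List.mem_cons, reduceCtorEq, List.mem_append, List.cons_append, false_or] at hH
    rcases hH with hH | hH
    · refine ih1 (fun H' hH' => ?_) hH
      obtain ⟨d, hd, rfl⟩ := htask
      have hj := isEnd_of_lt hd
      obtain ⟨r, hr, hmin⟩ := T.exists_root hj
      obtain ⟨w, hw, hbag⟩ := (T.flowerTree hj hr hmin).surj _ (𝒯.bijOn.mapsTo (Set.mem_univ v))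
      have := (mem_Hs H').1 hH'
      rw [← hbag, T.subproblems_flower hG hj hw] at this
      obtain ⟨d', hd', -, -, rfl⟩ := this
      exact ⟨d', hd', rfl⟩
    · exact ih2 htask hH
  | prod_done => simp at hH
  | prod_step _ _ ih1 ih2 =>
    rw [List.mem_append] at hH
    rcases hH with hH | hH
    · exact ih1 (htask _ List.mem_cons_self) hH
    · exact ih2 (fun H' hH' => htask H' (List.mem_cons_of_mem _ hH')) hH

end IsFor

end BagTree

/-- In every execution of Clique-Picking, the explored graphs are the input graph and graphs of
flowers; they are connected and chordal, and there are at most `2|Π(G)| - 1` of them. -/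
theorem explored_spec [Finite V] (hG : IsUCCG G) {log : List (Event G)}
    (hlog : IsCliquePickingLog G log) :
    (explored log).ncard ≤ 2 * (maxCliques (⊤ : G.Subgraph)).ncard - 1 ∧
      (∀ H ∈ explored log, IsUCCG H.coe) ∧
      (∀ H ∈ explored log, H ≠ ⊤ →
        ∃ S ∈ minSeparators G, ∃ F ∈ bouquet G S, H = flowerMinus G F S) := by
  classical
  have := hG.1.nonempty
  obtain ⟨k, par, bag, h0, T'⟩ := IsCliqueTree.exists_of_chordal hG.2
  have T : (BagTree.mk k par bag).IsFor G := ⟨T', h0⟩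
  set t : BagTree V := BagTree.mk k par bag with ht
  obtain ⟨memo, a, hrun⟩ := hlog
  have key : ∀ H ∈ explored log, ∃ d < 2 * t.size, H = t.graph G d := fun H hH =>
    T.run_calls hG.2 hrun ⟨0, by have := T.size_pos; omega, (T.graph_zero hG.1).symm⟩ H hH
  refine ⟨?_, ?_, ?_⟩
  · have hsub : explored log ⊆
        (t.graph G) '' ((Finset.range (2 * t.size)).erase t.size : Finset ℕ) := by
      intro H hH
      obtain ⟨d, hd, rfl⟩ := key H hH
      by_cases hdk : d = t.size
      · -- the two numbers of the whole graph
        refine ⟨0, by simp [T.size_pos.ne, T.size_pos], ?_⟩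
        simp [BagTree.graph, BagTree.edge, BagTree.head, T.size_pos, T.par_zero, hdk]
      · exact ⟨d, by simp [hd, hdk], rfl⟩
    refine (Set.ncard_le_ncard hsub (Set.toFinite _)).trans ((Set.ncard_image_le
      (Set.toFinite _)).trans ?_)
    rw [Set.ncard_coe_finset, Finset.card_erase_of_mem (by simp [T.size_pos]), Finset.card_range,
      T.tree.card_eq, Finset.card_range]
  · intro H hH
    obtain ⟨d, hd, rfl⟩ := key H hH
    exact T.isUCCG_graph hG.2 hd
  · intro H hH hne
    obtain ⟨d, hd, rfl⟩ := key H hH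
    have hj := BagTree.isEnd_of_lt hd
    have hpos : 0 < t.edge d := by
      rcases Nat.eq_zero_or_pos (t.edge d) with h | h
      · exfalso
        apply hne
        have hh : t.head d = 0 := by
          obtain ⟨-, h' | h'⟩ := hj
          · rw [h', h]
          · rw [h', h, T.par_zero]
        have h0 : t.edge 0 = 0 := by simp [BagTree.edge, T.size_pos]
        have h0' : t.head 0 = 0 := by simp [BagTree.head, T.size_pos]
        rw [← T.graph_zero hG.1, BagTree.graph, BagTree.graph, h, hh, h0, h0']
      · exact h
    obtain ⟨F, hF, heq⟩ := T.exists_flower_eq hj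
    exact ⟨_, T.lab_mem_minSeparators hj.1 hpos, F, hF, heq⟩

/-! ### Rooted clique trees from parent arrays -/

/-- The tree on `Fin m` in which the parent of every `x > 0` is `q x`. -/
def parentTree {m : ℕ} (q : Fin m → Fin m) : SimpleGraph (Fin m) :=
  SimpleGraph.fromRel fun x y => y < x ∧ q x = y

section ParentTree

variable {m : ℕ} {q : Fin m → Fin m}

theorem parentTree_adj {x y : Fin m} :
    (parentTree q).Adj x y ↔ (y < x ∧ q x = y) ∨ (x < y ∧ q y = x) := by
  rw [parentTree, SimpleGraph.fromRel_adj]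
  constructor
  · exact fun h => h.2
  · rintro (h | h)
    · exact ⟨h.1.ne', .inl h⟩
    · exact ⟨h.1.ne, .inr h⟩

theorem parentTree_induce_connected {A : Set (Fin m)} {x₀ : Fin m} (h₀ : x₀ ∈ A)
    (h : ∀ x ∈ A, x ≠ x₀ → q x ∈ A ∧ q x < x) : ((parentTree q).induce A).Connected := by
  have key : ∀ n : ℕ, ∀ x, ∀ hx : x ∈ A, x.val = n →
      ((parentTree q).induce A).Reachable ⟨x, hx⟩ ⟨x₀, h₀⟩ := by
    intro n
    induction n using Nat.strong_induction_on with
    | _ n ih =>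
      rintro x hx rfl
      by_cases hxx : x = x₀
      · subst hxx; exact SimpleGraph.Reachable.refl _
      · obtain ⟨h1, h2⟩ := h x hx hxx
        refine SimpleGraph.Reachable.trans (SimpleGraph.Adj.reachable ?_) (ih (q x) h2 (q x) h1 rfl)
        exact parentTree_adj.2 (.inl ⟨h2, rfl⟩)
  have : Nonempty A := ⟨⟨x₀, h₀⟩⟩
  exact ⟨fun x y => (key _ x.1 x.2 rfl).trans (key _ y.1 y.2 rfl).symm⟩

theorem parentTree_isTree {x₀ : Fin m} (h : ∀ x, x ≠ x₀ → q x < x) : (parentTree q).IsTree := by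
  classical
  have hmin : ∀ x, x₀ ≤ x := by
    intro x
    by_contra hlt
    push Not at hlt
    obtain ⟨y, -, hy⟩ := Set.Finite.exists_le_minimal (Set.toFinite {y | y < x₀}) hlt
    have h1 := h y hy.1.ne
    exact absurd (hy.2 (h1.trans hy.1) h1.le) (not_le.2 h1)
  refine SimpleGraph.isTree_iff_connected_and_card.2 ⟨?_, ?_⟩
  · have := parentTree_induce_connected (q := q) (A := Set.univ) (x₀ := x₀) trivial
      (fun x _ hx => ⟨trivial, h x hx⟩)
    exact (SimpleGraph.Iso.connected_iff (SimpleGraph.induceUnivIso _)).1 this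
  · have hb : Set.BijOn (fun x => s(x, q x)) {x₀}ᶜ (parentTree q).edgeSet := by
      refine ⟨fun x hx => ?_, fun x hx y hy hxy => ?_, ?_⟩
      · exact (SimpleGraph.mem_edgeSet _).2 (parentTree_adj.2 (.inl ⟨h x hx, rfl⟩))
      · rcases Sym2.eq_iff.1 hxy with h1 | ⟨h1, h2⟩
        · exact h1.1
        · have h3 := h x hx
          have h4 := h y hy
          rw [h2] at h3
          rw [← h1] at h4
          exact absurd h3 h4.asymm
      · rintro ⟨x, y⟩ hxy
        rcases parentTree_adj.1 ((SimpleGraph.mem_edgeSet _).1 hxy) with ⟨h1, h2⟩ | ⟨h1, h2⟩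
        · exact ⟨x, ((hmin y).trans_lt h1).ne', by simp [h2]⟩
        · exact ⟨y, ((hmin x).trans_lt h1).ne', by simp [h2, Sym2.eq_swap]⟩
    have h1 : Nat.card (parentTree q).edgeSet = ({x₀}ᶜ : Set (Fin m)).ncard := by
      rw [Nat.card_coe_set_eq, ← hb.image_eq, hb.injOn.ncard_image]
    have h2 := Set.ncard_add_ncard_compl ({x₀} : Set (Fin m))
    rw [Set.ncard_singleton] at h2
    rw [h1, ← h2, add_comm]

/-- The path from the root to a node: its last edge leads from the parent to the node. -/
theorem parentTree_exists_path {x₀ : Fin m} (h : ∀ x, x ≠ x₀ → q x < x) (x : Fin m) (hx : x ≠ x₀)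
    {p : (parentTree q).Walk x₀ x} (hp : p.IsPath) :
    ∃ p' : (parentTree q).Walk x₀ (q x), p'.IsPath ∧
      ∃ hadj : (parentTree q).Adj (q x) x, p = p'.concat hadj := by
  have hT := parentTree_isTree h
  have main : ∀ n : ℕ, ∀ x : Fin m, x.val = n → ∃ p' : (parentTree q).Walk x₀ x, p'.IsPath ∧
      ∀ y ∈ p'.support, y ≤ x := by
    intro n
    induction n using Nat.strong_induction_on with
    | _ n ih =>
      rintro x rfl
      by_cases hxx : x = x₀
      · subst hxx; exact ⟨.nil, .nil, by simp⟩
      · obtain ⟨p', hp', hle⟩ := ih (q x) (h x hxx) (q x) rfl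
        have hadj : (parentTree q).Adj (q x) x := parentTree_adj.2 (.inr ⟨h x hxx, rfl⟩)
        refine ⟨p'.concat hadj, hp'.concat (fun hmem => ?_) hadj, fun y hy => ?_⟩
        · exact absurd (hle x hmem) (not_le.2 (h x hxx))
        · rw [SimpleGraph.Walk.support_concat, List.mem_append, List.mem_singleton] at hy
          rcases hy with hy | rfl
          · exact (hle y hy).trans (h x hxx).le
          · exact le_rfl
  obtain ⟨p', hp', hle⟩ := main _ (q x) rfl
  have hadj : (parentTree q).Adj (q x) x := parentTree_adj.2 (.inr ⟨h x hx, rfl⟩)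
  refine ⟨p', hp', hadj, (hT.isAcyclic.subsingleton_path _ _).elim ⟨p, hp⟩
    ⟨_, hp'.concat (fun hmem => ?_) hadj⟩ |>
    congrArg Subtype.val⟩
  exact absurd (hle x hmem) (not_le.2 (h x hx))

theorem parentTree_dist {x₀ : Fin m} (h : ∀ x, x ≠ x₀ → q x < x) {x : Fin m} (hx : x ≠ x₀) :
    (parentTree q).dist x₀ x = (parentTree q).dist x₀ (q x) + 1 := by
  have hT := parentTree_isTree h
  obtain ⟨p, hp, hlen⟩ := hT.connected.exists_path_of_dist x₀ x
  obtain ⟨p', hp', hadj, rfl⟩ := parentTree_exists_path h x hx hp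
  obtain ⟨p'', hp'', hlen'⟩ := hT.connected.exists_path_of_dist x₀ (q x)
  have : p' = p'' := congrArg Subtype.val
    ((hT.isAcyclic.subsingleton_path _ _).elim ⟨p', hp'⟩ ⟨p'', hp''⟩)
  rw [← hlen, ← hlen', this, SimpleGraph.Walk.length_concat]

end ParentTree

namespace IsCliqueTree

variable {U : Set V} {F : Finset ℕ} {r : ℕ} {par : ℕ → ℕ} {bag : ℕ → Set V}

/-- A clique tree given by a parent array, as a rooted clique tree. -/
theorem exists_rooted [Finite V] (T : IsCliqueTree G U F r par bag) :
    ∃ (𝒯 : RootedCliqueTree (sub G U)) (f : Fin 𝒯.size → ℕ), Function.Injective f ∧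
      (∀ w, w ∈ F ↔ ∃ x, f x = w) ∧ f 𝒯.root = r ∧ (∀ x, 𝒯.bag x = bag (f x)) ∧
      (∀ x y, IsChild 𝒯 x y ↔ f y ≠ r ∧ par (f y) = f x) ∧
      ∀ x, forbiddenPrefixes 𝒯 x =
        {X | ∃ e ∈ pathEdges par r (f x), X = label par bag e ∧ X ⊆ bag (f x)} := by
  classical
  set g := F.orderIsoOfFin rfl with hg
  set f : Fin F.card → ℕ := fun x => (g x).1 with hf
  have hfF : ∀ x, f x ∈ F := fun x => (g x).2
  have hflt : ∀ x y, f x < f y ↔ x < y := fun x y => by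
    simp only [hf, Subtype.coe_lt_coe, OrderIso.lt_iff_lt]
  have hinj : Function.Injective f := fun x y h => g.injective (Subtype.ext h)
  have hsurj : ∀ w ∈ F, ∃ x, f x = w := fun w hw => ⟨g.symm ⟨w, hw⟩, by simp [hf]⟩
  obtain ⟨x₀, hx₀⟩ := hsurj r T.root_mem
  have hne : ∀ x, x ≠ x₀ ↔ f x ≠ r := fun x => by rw [← hx₀, hinj.ne_iff]
  have hq : ∀ x, ∃ y, x ≠ x₀ → f y = par (f x) := fun x => by
    by_cases h : x = x₀
    · exact ⟨x, fun h' => absurd h h'⟩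
    · obtain ⟨y, hy⟩ := hsurj _ (T.par_mem _ (hfF x) ((hne x).1 h))
      exact ⟨y, fun _ => hy⟩
  choose q hq using hq
  have hpos : ∀ x, x ≠ x₀ → 0 < f x := fun x hx =>
    (Nat.zero_le r).trans_lt (lt_of_le_of_ne (T.root_le _ (hfF x)) (Ne.symm ((hne x).1 hx)))
  have hqlt : ∀ x, x ≠ x₀ → q x < x := fun x hx => by
    rw [← hflt, hq x hx]; exact T.par_lt _ (hpos x hx)
  have hmin : ∀ x, x₀ ≤ x := fun x => by
    rw [← not_lt, ← hflt, not_lt, hx₀]; exact T.root_le _ (hfF x)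
  have hconn : ∀ v ∈ U, ((parentTree q).induce {x | v ∈ bag (f x)}).Connected := by
    intro v hv
    obtain ⟨w, hw, hvw⟩ := T.exists_bag (C := {v}) (by simpa using hv) (Set.pairwise_singleton _ _)
    obtain ⟨x, rfl⟩ := hsurj w hw
    obtain ⟨x₁, -, hx₁⟩ := Set.Finite.exists_le_minimal (Set.toFinite {x | v ∈ bag (f x)})
      (a := x) (hvw rfl)
    refine parentTree_induce_connected hx₁.1 fun y hy hyx => ?_
    have hlt : x₁ < y := by
      rcases lt_trichotomy x₁ y with h | h | h
      · exact h
      · exact absurd h.symm hyx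
      · exact absurd (hx₁.2 hy h.le) (not_le.2 h)
    have hy₀ : y ≠ x₀ := ((hmin x₁).trans_lt hlt).ne'
    refine ⟨?_, hqlt y hy₀⟩
    change v ∈ bag (f (q y))
    rw [hq y hy₀]
    exact T.rip _ (hfF x₁) _ (hfF y) ((hflt _ _).2 hlt) v hx₁.1 hy
  let 𝒯 : RootedCliqueTree (sub G U) :=
    { size := F.card
      tree := parentTree q
      root := x₀
      bag := fun x => bag (f x)
      isTree := parentTree_isTree hqlt
      bijOn := ⟨fun x _ => T.bag_mem _ (hfF x), fun x _ y _ h => hinj (T.inj _ (hfF x) _ (hfF y) h),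
        fun K hK => by
          obtain ⟨w, hw, rfl⟩ := T.surj K hK
          obtain ⟨x, rfl⟩ := hsurj w hw
          exact ⟨x, trivial, rfl⟩⟩
      connected := hconn }
  refine ⟨𝒯, f, hinj, fun w => ⟨hsurj w, ?_⟩, hx₀, fun x => rfl, fun x y => ?_, fun x => ?_⟩
  · rintro ⟨x, rfl⟩; exact hfF x
  · change (parentTree q).Adj x y ∧ (parentTree q).dist x₀ y = (parentTree q).dist x₀ x + 1 ↔ _
    constructor
    · rintro ⟨hadj, hdist⟩
      rcases parentTree_adj.1 hadj with ⟨h1, h2⟩ | ⟨h1, h2⟩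
      · exfalso
        have := parentTree_dist hqlt (x := x) ((hmin y).trans_lt h1).ne'
        rw [h2] at this
        omega
      · have hy₀ : y ≠ x₀ := ((hmin x).trans_lt h1).ne'
        exact ⟨(hne y).1 hy₀, by rw [← hq y hy₀, h2]⟩
    · rintro ⟨h1, h2⟩
      have hy₀ := (hne y).2 h1
      have hqy : q y = x := hinj (by rw [hq y hy₀, h2])
      refine ⟨parentTree_adj.2 (.inr ⟨hqy ▸ hqlt y hy₀, hqy⟩), ?_⟩
      rw [parentTree_dist hqlt hy₀, hqy]
  · have key : ∀ n : ℕ, ∀ x, x.val = n → ∀ p : (parentTree q).Walk x₀ x, p.IsPath →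
        ∀ X : Set V, (∃ d ∈ p.darts, X = bag (f d.fst) ∩ bag (f d.snd)) ↔
          ∃ e ∈ pathEdges par r (f x), X = label par bag e := by
      intro n
      induction n using Nat.strong_induction_on with
      | _ n ih =>
        rintro x rfl p hp X
        by_cases hxx : x = x₀
        · subst hxx
          obtain rfl := (SimpleGraph.Walk.isPath_iff_nil.1 hp).eq_nil
          simp [hx₀]
        · obtain ⟨p', hp', hadj, rfl⟩ := parentTree_exists_path hqlt x hxx hp
          have hrx : r < f x := hx₀ ▸ (hflt _ _).2 (lt_of_le_of_ne (hmin x) (Ne.symm hxx))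
          rw [pathEdges_lt T.par_lt hrx, SimpleGraph.Walk.darts_concat]
          have hlab : label par bag (f x) = bag (f (q x)) ∩ bag (f x) := by
            ext u
            simp only [label, Set.mem_ofPred_eq, hpos x hxx, true_and, hq x hxx, Set.mem_inter_iff]
            exact and_comm
          have := ih (q x) (hqlt x hxx) (q x) rfl p' hp' X
          rw [hq x hxx] at this
          simp only [List.concat_eq_append, List.mem_append, List.mem_singleton, Finset.mem_insert,
            or_and_right, exists_or, exists_eq_left, this, hlab]
          exact or_comm
    ext X
    simp only [forbiddenPrefixes, Set.mem_ofPred_eq]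
    constructor
    · rintro ⟨p, hp, d, hd, hX, hle⟩
      obtain ⟨e, he, hXe⟩ := (key _ x rfl p hp X).1 ⟨d, hd, hX⟩
      exact ⟨e, he, hXe, hle⟩
    · rintro ⟨e, he, hX, hle⟩
      obtain ⟨p, hp⟩ := (parentTree_isTree hqlt).connected.preconnected.exists_isPath x₀ x
      obtain ⟨d, hd, hXd⟩ := (key _ x rfl p hp X).2 ⟨e, he, hX⟩
      exact ⟨p, hp, d, hd, hXd, hle⟩

end IsCliqueTree

/-! ### A recursion for the function `φ` -/

section Phi

open Nat

theorem isPermOf_iff_perm [DecidableEq V] {X : Finset V} {π : List V} :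
    IsPermOf π (X : Set V) ↔ π.Perm X.toList := by
  constructor
  · rintro ⟨h1, h2⟩
    rw [List.perm_ext_iff_of_nodup h1 X.nodup_toList]
    simpa using h2
  · exact fun h => ⟨h.nodup_iff.2 X.nodup_toList, fun v => by simp [h.mem_iff]⟩

theorem finite_perms [Finite V] (X : Set V) : {π : List V | IsPermOf π X}.Finite := by
  classical
  lift X to Finset V using Set.toFinite X
  refine (List.finite_toSet X.toList.permutations).subset fun π hπ => ?_
  exact List.mem_permutations.2 (isPermOf_iff_perm.1 hπ)

theorem ncard_perms [Finite V] (X : Set V) : {π : List V | IsPermOf π X}.ncard = X.ncard ! := by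
  classical
  lift X to Finset V using Set.toFinite X
  have : {π : List V | IsPermOf π (X : Set V)} =
      (X.toList.permutations.toFinset : Set (List V)) := by
    ext π
    simp [isPermOf_iff_perm]
  rw [this, Set.ncard_coe_finset, Set.ncard_coe_finset, List.toFinset_card_of_nodup
    (List.nodup_permutations _ X.nodup_toList), List.length_permutations, Finset.length_toList]

theorem IsPermOf.length [Finite V] {π : List V} {X : Set V} (h : IsPermOf π X) :
    π.length = X.ncard := by
  classical
  lift X to Finset V using Set.toFinite X
  rw [(isPermOf_iff_perm.1 h).length_eq, Set.ncard_coe_finset, Finset.length_toList]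

/-- The permutations of `X` without a proper prefix that is a permutation of a set in `R`. -/
def prefixFreePerms (R : Set (Set V)) (X : Set V) : Set (List V) :=
  {π | IsPermOf π X ∧ ∀ Y ∈ R, Y ≠ X → ∀ ρ, ρ <+: π → ¬ IsPermOf ρ Y}

theorem phi_eq_ncard {S : Set V} {R : Set (Set V)} (h : S ∉ R) :
    phi S R = (prefixFreePerms R S).ncard := by
  have : ∀ Y ∈ R, Y ≠ S := fun Y hY hYS => h (hYS ▸ hY)
  unfold phi prefixFreePerms
  congr 1
  ext π
  exact and_congr_right fun _ => ⟨fun h Y hY _ => h Y hY, fun h Y hY => h Y hY (this Y hY)⟩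

/-- Every permutation of `X` has a unique shortest prefix that is a permutation of a set in `R` or
of `X` itself. -/
theorem factorial_eq_sum [Finite V] [DecidableEq (Set V)] (R : Finset (Set V)) {X : Set V}
    (hX : ∀ Y ∈ R, Y ≠ X → Y ⊂ X) :
    X.ncard ! = (prefixFreePerms (R : Set (Set V)) X).ncard +
      ∑ Y ∈ R.erase X, (prefixFreePerms (R : Set (Set V)) Y).ncard * (X.ncard - Y.ncard)! := by
  classical
  have hfin : ∀ Y : Set V, (prefixFreePerms (R : Set (Set V)) Y).Finite := fun Y =>
    (finite_perms Y).subset fun π h => h.1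
  set B : Set V → Set (List V) := fun Y =>
    Set.image2 (· ++ ·) (prefixFreePerms (R : Set (Set V)) Y) {σ | IsPermOf σ (X \ Y)} with hB
  have hle : ∀ Y ∈ insert X (R.erase X), Y ⊆ X := by
    intro Y hY
    rcases Finset.mem_insert.1 hY with rfl | hY
    · exact subset_rfl
    · exact (hX Y (Finset.mem_of_mem_erase hY) (Finset.ne_of_mem_erase hY)).subset
  have hBfin : ∀ Y, (B Y).Finite := fun Y => (hfin Y).image2 _ (finite_perms _)
  have hcard : ∀ Y ∈ insert X (R.erase X), (hBfin Y).toFinset.card =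
      (prefixFreePerms (R : Set (Set V)) Y).ncard * (X.ncard - Y.ncard)! := by
    intro Y hY
    rw [← Set.ncard_eq_toFinset_card (B Y) (hBfin Y),
      ← Set.ncard_sdiff (hle Y hY) (Set.toFinite _), ← ncard_perms,
      ← Set.ncard_prod]
    rw [hB]
    simp only [← Set.image_prod]
    refine Set.InjOn.ncard_image ?_
    rintro ⟨ρ, σ⟩ ⟨h1, -⟩ ⟨ρ', σ'⟩ ⟨h2, -⟩ heq
    have := List.append_inj heq (h1.1.length.trans h2.1.length.symm)
    exact Prod.ext this.1 this.2
  have hsame : ∀ Y ∈ insert X (R.erase X), ∀ Y' ∈ insert X (R.erase X), ∀ ρ ρ' : List V,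
      ρ ∈ prefixFreePerms (R : Set (Set V)) Y → ρ' ∈ prefixFreePerms (R : Set (Set V)) Y' →
      ρ <+: ρ' → Y = Y' := by
    intro Y hY Y' hY' ρ ρ' hρ hρ' hpre
    by_contra hne
    rcases Finset.mem_insert.1 hY with rfl | hYR
    · refine hne (Set.Subset.antisymm (fun v hv => ?_) (hle Y' hY'))
      exact (hρ'.1.2 v).1 (hpre.subset ((hρ.1.2 v).2 hv))
    · exact hρ'.2 Y (Finset.mem_of_mem_erase hYR) hne ρ hpre hρ.1
  have hdisj : Set.PairwiseDisjoint (↑(insert X (R.erase X)))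
      (fun Y => (hBfin Y).toFinset) := by
    intro Y hY Y' hY' hne
    rw [Function.onFun, Finset.disjoint_left]
    intro π h1 h2
    rw [Set.Finite.mem_toFinset] at h1 h2
    obtain ⟨ρ, hρ, σ, -, rfl⟩ := h1
    obtain ⟨ρ', hρ', σ', -, heq⟩ := h2
    have h1 : ρ <+: ρ ++ σ := List.prefix_append _ _
    have h2 : ρ' <+: ρ ++ σ := ⟨σ', heq⟩
    rcases List.prefix_or_prefix_of_prefix h1 h2 with h | h
    · exact hne (hsame Y hY Y' hY' ρ ρ' hρ hρ' h)
    · exact hne (hsame Y' hY' Y hY ρ' ρ hρ' hρ h).symm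
  have hunion : (finite_perms X).toFinset =
      (insert X (R.erase X)).biUnion fun Y => (hBfin Y).toFinset := by
    ext π
    simp only [Set.Finite.mem_toFinset, Finset.mem_biUnion]
    constructor
    · intro hπ
      have hex : ∃ j, ∃ Y ∈ insert X (R.erase X), IsPermOf (π.take j) Y :=
        ⟨π.length, X, Finset.mem_insert_self _ _, by rwa [List.take_length]⟩
      obtain ⟨Y, hY, hpY⟩ := Nat.find_spec hex
      refine ⟨Y, hY, π.take (Nat.find hex), ⟨hpY, fun Z hZ hZY ρ hρ hρZ => ?_⟩,
        π.drop (Nat.find hex), ⟨hπ.1.sublist (List.drop_sublist _ _), fun v => ?_⟩,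
        List.take_append_drop _ _⟩
      · have hlt : ρ.length < Nat.find hex := by
          rcases lt_or_ge ρ.length (π.take (Nat.find hex)).length with h | h
          · exact h.trans_le (List.length_take_le _ _)
          · exfalso
            rw [hρ.eq_of_length_le h] at hρZ
            exact hZY (Set.ext fun v => (hρZ.2 v).symm.trans (hpY.2 v))
        refine Nat.find_min hex hlt ⟨Z, ?_, ?_⟩
        · by_cases h : Z = X
          · exact h ▸ Finset.mem_insert_self _ _
          · exact Finset.mem_insert_of_mem (Finset.mem_erase.2 ⟨h, hZ⟩)
        · rwa [← List.prefix_iff_eq_take.1 (hρ.trans (List.take_prefix _ _))]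
      · have hnd := hπ.1
        rw [← List.take_append_drop (Nat.find hex) π, List.nodup_append] at hnd
        rw [Set.mem_sdiff, ← hπ.2 v, ← hpY.2 v]
        have hmem : v ∈ π ↔ v ∈ π.take (Nat.find hex) ∨ v ∈ π.drop (Nat.find hex) := by
          rw [← List.mem_append, List.take_append_drop]
        rw [hmem]
        constructor
        · exact fun h => ⟨.inr h, fun h' => hnd.2.2 v h' v h rfl⟩
        · rintro ⟨h | h, h'⟩
          · exact absurd h h'
          · exact h
    · rintro ⟨Y, hY, ρ, hρ, σ, hσ, rfl⟩
      refine ⟨List.nodup_append.2 ⟨hρ.1.1, hσ.1, ?_⟩, fun v => ?_⟩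
      · rintro v hv _ hw rfl
        exact ((hσ.2 v).1 hw).2 ((hρ.1.2 v).1 hv)
      · rw [List.mem_append, hρ.1.2, hσ.2, Set.mem_sdiff]
        constructor
        · rintro (h | h)
          · exact hle Y hY h
          · exact h.1
        · intro h
          by_cases hv : v ∈ Y
          · exact .inl hv
          · exact .inr ⟨h, hv⟩
  have key : X.ncard ! = ∑ Y ∈ insert X (R.erase X),
      (prefixFreePerms (R : Set (Set V)) Y).ncard * (X.ncard - Y.ncard)! := by
    rw [← ncard_perms, Set.ncard_eq_toFinset_card _ (finite_perms X), hunion,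
      Finset.card_biUnion hdisj]
    exact Finset.sum_congr rfl hcard
  rw [key, Finset.sum_insert (Finset.notMem_erase _ _), Nat.sub_self, Nat.factorial_zero, mul_one]

/-- `prefixFree mark a` is the number of permutations of a set of size `a` without a proper prefix
in a chain of sets, when `mark b` is `1` for the sizes `b` of the sets in the chain, and `0` for
other numbers. -/
def prefixFree (mark : ℕ → ℕ) (a : ℕ) : ℕ :=
  (a !) - ∑ b : Fin a, mark b * ((a - b) ! * prefixFree mark b)
termination_by a
decreasing_by exact b.2

theorem prefixFree_eq (mark : ℕ → ℕ) (a : ℕ) : prefixFree mark a =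
    (a !) - ∑ b ∈ Finset.range a, mark b * ((a - b) ! * prefixFree mark b) := by
  rw [prefixFree, Finset.sum_range]

/-- If the forbidden prefixes form a chain, only their sizes matter. -/
theorem ncard_prefixFreePerms [Finite V] {R : Finset (Set V)} {mark : ℕ → ℕ} {S : Set V}
    (hchain : ∀ Y ∈ R, ∀ Z ∈ R, Y ⊆ Z ∨ Z ⊆ Y) (hS : ∀ Y ∈ R, Y ⊂ S)
    (hmark : ∀ b < S.ncard, mark b = if ∃ Y ∈ R, Y.ncard = b then 1 else 0) :
    (prefixFreePerms (R : Set (Set V)) S).ncard = prefixFree mark S.ncard := by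
  classical
  have main : ∀ a, ∀ X : Set V, X ∈ R ∨ X = S → X.ncard = a →
      (prefixFreePerms (R : Set (Set V)) X).ncard = prefixFree mark a := by
    intro a
    induction a using Nat.strong_induction_on with
    | _ a ih =>
      rintro X hX rfl
      have hfilter : ∀ Y ∈ R, Y ≠ X → Y ⊂ X ∨ X ⊂ Y := by
        intro Y hY hne
        rcases hX with hX | rfl
        · rcases hchain Y hY X hX with h | h
          · exact .inl (h.ssubset_of_ne hne)
          · exact .inr (h.ssubset_of_ne hne.symm)
        · exact .inl (hS Y hY)
      set R' := R.filter (· ⊆ X) with hR'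
      have hRR' : ∀ Y, Y ⊆ X → prefixFreePerms (R : Set (Set V)) Y =
          prefixFreePerms (R' : Set (Set V)) Y := by
        intro Y hYX
        ext π
        refine and_congr_right fun hπ => ⟨fun h Z hZ => h Z (Finset.mem_filter.1 hZ).1,
          fun h Z hZ hne ρ hρ hρZ => ?_⟩
        refine h Z (Finset.mem_filter.2 ⟨hZ, fun v hv => hYX ?_⟩) hne ρ hρ hρZ
        exact (hπ.2 v).1 (hρ.subset ((hρZ.2 v).2 hv))
      have h1 := factorial_eq_sum R' (X := X) fun Y hY hne =>
        (Finset.mem_filter.1 hY).2.ssubset_of_ne hne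
      have hXS : X ⊆ S := hX.elim (fun h => (hS X h).subset) (fun h => h.subset)
      have hlt : ∀ Y ∈ R'.erase X, Y.ncard < X.ncard := fun Y hY =>
        Set.ncard_lt_ncard ((Finset.mem_filter.1 (Finset.mem_of_mem_erase hY)).2.ssubset_of_ne
          (Finset.ne_of_mem_erase hY))
      have h2 : ∑ b ∈ Finset.range X.ncard, mark b * ((X.ncard - b)! * prefixFree mark b) =
          ∑ Y ∈ R'.erase X,
            (prefixFreePerms (R' : Set (Set V)) Y).ncard * (X.ncard - Y.ncard)! := by
        have hinj : Set.InjOn (fun Y : Set V => Y.ncard) (R'.erase X : Finset (Set V)) := by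
          intro Y hY Z hZ h
          have hYR := (Finset.mem_filter.1 (Finset.mem_of_mem_erase hY)).1
          have hZR := (Finset.mem_filter.1 (Finset.mem_of_mem_erase hZ)).1
          rcases hchain Y hYR Z hZR with h' | h'
          · exact Set.eq_of_subset_of_ncard_le h' h.ge
          · exact (Set.eq_of_subset_of_ncard_le h' h.le).symm
        have h3 : ∀ b ∈ Finset.range X.ncard, b ∉ (R'.erase X).image (fun Y : Set V => Y.ncard) →
            mark b * ((X.ncard - b)! * prefixFree mark b) = 0 := by
          intro b hb hnot
          rw [hmark b ((Finset.mem_range.1 hb).trans_le (Set.ncard_le_ncard hXS)), if_neg, zero_mul]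
          rintro ⟨Y, hY, rfl⟩
          have hlt' := Finset.mem_range.1 hb
          have hne : Y ≠ X := by rintro rfl; exact lt_irrefl _ hlt'
          rcases hfilter Y hY hne with h | h
          · exact hnot (Finset.mem_image.2 ⟨Y, Finset.mem_erase.2 ⟨hne, Finset.mem_filter.2
              ⟨hY, h.subset⟩⟩, rfl⟩)
          · exact absurd (Set.ncard_lt_ncard h) hlt'.asymm
        rw [← Finset.sum_subset (s₁ := (R'.erase X).image (fun Y : Set V => Y.ncard)) ?_ h3,
          Finset.sum_image hinj]
        · refine Finset.sum_congr rfl fun Y hY => ?_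
          have hYR := (Finset.mem_filter.1 (Finset.mem_of_mem_erase hY)).1
          rw [hmark _ ((hlt Y hY).trans_le (Set.ncard_le_ncard hXS)), if_pos ⟨Y, hYR, rfl⟩, one_mul,
            ← hRR' Y (Finset.mem_filter.1 (Finset.mem_of_mem_erase hY)).2,
            ih _ (hlt Y hY) Y (.inl hYR) rfl, mul_comm]
        · intro b hb
          obtain ⟨Y, hY, rfl⟩ := Finset.mem_image.1 hb
          exact Finset.mem_range.2 (hlt Y hY)
      rw [prefixFree_eq, h2, h1, hRR' X subset_rfl, Nat.add_sub_cancel]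
  exact main _ S (.inr rfl) rfl

end Phi

namespace BagTree.IsFor

variable {t : BagTree V}

open Classical in
/-- The value of `φ` needed for the bag `v` in a flower: the chain of forbidden prefixes consists of
the labels on the path from the root that are contained in the bag, without the label of the
flower. -/
theorem phi_flower [Finite V] [Nonempty V] (T : t.IsFor G) {j h v r : ℕ} (hj : t.IsEnd j h)
    (hv : v ∈ t.nodes j h) (hr : r ∈ t.nodes j h)
    (hmin : ∀ w ∈ t.nodes j h, r ≤ w) {mark : ℕ → ℕ}
    (hmark : ∀ b < (t.bag v).ncard - (t.lab j).ncard, mark b =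
      if ∃ e ∈ t.path r v, t.lab e ⊆ t.bag v ∧ (t.lab e).ncard - (t.lab j).ncard = b
      then 1 else 0) :
    phi (t.bag v \ t.lab j) {X | ∃ e ∈ t.path r v,
        X = label t.par (fun w => t.bag w \ t.lab j) e ∧ X ⊆ t.bag v \ t.lab j} =
      prefixFree mark ((t.bag v).ncard - (t.lab j).ncard) := by
  have hvk : v < t.size := (mem_nodes.1 hv).1
  have hrk : r < t.size := (mem_nodes.1 hr).1
  have hjl : ∀ e ∈ t.path r v, t.lab j ⊂ t.lab e := fun e he => T.path_nodes hr hv he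
  have hsub : ∀ e ∈ t.path r v,
      (t.lab e \ t.lab j ⊆ t.bag v \ t.lab j ↔ t.lab e ⊆ t.bag v) := by
    intro e he
    constructor
    · intro h u hu
      by_cases huj : u ∈ t.lab j
      · exact T.lab_subset_bag hj hv huj
      · exact (h ⟨hu, huj⟩).1
    · exact fun h => Set.sdiff_subset_sdiff_left h
  set R : Finset (Set V) := ((t.path r v).filter fun e => t.lab e ⊆ t.bag v).image
    fun e => t.lab e \ t.lab j with hR
  have hRset : {X | ∃ e ∈ t.path r v, X = label t.par (fun w => t.bag w \ t.lab j) e ∧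
      X ⊆ t.bag v \ t.lab j} = (R : Set (Set V)) := by
    ext X
    simp only [flowerTree_label, Set.mem_ofPred_eq, hR, Finset.coe_image, Set.mem_image,
      Finset.coe_filter]
    constructor
    · rintro ⟨e, he, rfl, hle⟩
      exact ⟨e, ⟨he, (hsub e he).1 hle⟩, rfl⟩
    · rintro ⟨e, ⟨he, hle⟩, rfl⟩
      exact ⟨e, he, rfl, (hsub e he).2 hle⟩
  have hlt : ∀ Y ∈ R, Y ⊂ t.bag v \ t.lab j := by
    intro Y hY
    obtain ⟨e, he, rfl⟩ := Finset.mem_image.1 hY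
    obtain ⟨he, hle⟩ := Finset.mem_filter.1 he
    obtain ⟨hek, hpk, -, -⟩ := T.tree.path_mem (mem_range hrk) (mem_range hvk) he
    have hpos := (mem_pathEdges_pos T.tree.par_lt he).1
    refine ⟨Set.sdiff_subset_sdiff_left hle, fun hge => ?_⟩
    have h1 : t.bag v ⊆ t.lab e := fun u hu => by
      by_cases huj : u ∈ t.lab j
      · exact (hjl e he).subset huj
      · exact (hge ⟨hu, huj⟩).1
    have h2 := T.tree.eq_of_subset (mem_range hvk) hek (h1.trans fun u hu => hu.2.1)
    have h3 := T.tree.eq_of_subset (mem_range hvk) hpk (h1.trans fun u hu => hu.2.2)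
    exact absurd (h2.symm.trans h3) (T.tree.par_lt e hpos).ne'
  have hchain : ∀ Y ∈ R, ∀ Z ∈ R, Y ⊆ Z ∨ Z ⊆ Y := by
    -- of two edges on the path from the root, the label of the first is part of both ends of the
    -- path that starts at the second
    have key : ∀ e ∈ t.path r v, ∀ e' ∈ t.path r v, t.lab e ⊆ t.bag v → t.lab e' ⊆ t.bag v →
        t.lab e ⊆ t.lab e' ∨ t.lab e' ⊆ t.lab e := by
      intro e he e' he' hle hle'
      obtain ⟨hek, hpk, -, -⟩ := T.tree.path_mem (mem_range hrk) (mem_range hvk) he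
      obtain ⟨hek', hpk', -, -⟩ := T.tree.path_mem (mem_range hrk) (mem_range hvk) he'
      by_cases h : e ∈ t.path e' v
      · right
        intro u hu
        exact (T.tree.path_mem hek' (mem_range hvk) h).2.2.2 u hu.2.1 (hle' hu)
      · have h1 : e ∈ t.path r e' := (mem_pathEdges_trans T.tree.par_lt e' he).resolve_right h
        by_cases h' : e' ∈ t.path e v
        · left
          intro u hu
          exact (T.tree.path_mem hek (mem_range hvk) h').2.2.2 u hu.2.1 (hle hu)
        · have h2 : e' ∈ t.path r e := (mem_pathEdges_trans T.tree.par_lt e he').resolve_right h'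
          have h3 := (T.flowerTree hj hr hmin).path_mem hr hv he
          have h4 := (T.flowerTree hj hr hmin).path_mem hr hv he'
          have h5 := hmin e h3.1
          have h6 := hmin e' h4.1
          have h7 := (mem_pathEdges_pos T.tree.par_lt h1).2
          have h8 := (mem_pathEdges_pos T.tree.par_lt h2).2
          have h9 : e = e' := by have := h3.2.2.1; have := h4.2.2.1; omega
          exact .inl (h9 ▸ subset_rfl)
    intro Y hY Z hZ
    obtain ⟨e, he, rfl⟩ := Finset.mem_image.1 hY
    obtain ⟨e', he', rfl⟩ := Finset.mem_image.1 hZ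
    obtain ⟨he, hle⟩ := Finset.mem_filter.1 he
    obtain ⟨he', hle'⟩ := Finset.mem_filter.1 he'
    exact (key e he e' he' hle hle').imp Set.sdiff_subset_sdiff_left Set.sdiff_subset_sdiff_left
  have hcard : ∀ e ∈ t.path r v, (t.lab e \ t.lab j).ncard = (t.lab e).ncard - (t.lab j).ncard :=
    fun e he => Set.ncard_sdiff (hjl e he).subset
  have hScard : (t.bag v \ t.lab j).ncard = (t.bag v).ncard - (t.lab j).ncard :=
    Set.ncard_sdiff (T.lab_subset_bag hj hv)
  rw [hRset, phi_eq_ncard fun h => (hlt _ h).ne rfl, ← hScard]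
  refine ncard_prefixFreePerms hchain hlt fun b hb => ?_
  rw [hmark b (hScard ▸ hb)]
  congr 1
  rw [eq_iff_iff]
  constructor
  · rintro ⟨e, he, hle, rfl⟩
    exact ⟨_, Finset.mem_image.2 ⟨e, Finset.mem_filter.2 ⟨he, hle⟩, rfl⟩, hcard e he⟩
  · rintro ⟨Y, hY, rfl⟩
    obtain ⟨e, he, rfl⟩ := Finset.mem_image.1 hY
    obtain ⟨he, hle⟩ := Finset.mem_filter.1 he
    exact ⟨e, he, hle, (hcard e he).symm⟩

end BagTree.IsFor

/-! ### Counting vertices, edges and maximal cliques -/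

section Bounds

variable {n : ℕ} {G : SimpleGraph (Fin n)}

open Classical in
theorem card_adj_or_eq_le : (Finset.univ.filter fun p : Fin n × Fin n =>
    p.1 = p.2 ∨ G.Adj p.1 p.2).card ≤ n + 2 * G.edgeSet.ncard := by
  have h1 : (Finset.univ.filter fun p : Fin n × Fin n => p.1 = p.2).card ≤ n := by
    calc _ ≤ (Finset.univ : Finset (Fin n)).card := by
          refine Finset.card_le_card_of_injOn Prod.fst (fun _ _ => Finset.mem_univ _) ?_
          rintro ⟨a, b⟩ ha ⟨c, d⟩ hc h
          simp only [Finset.coe_filter, Finset.mem_univ, true_and, Set.mem_ofPred_eq] at ha hc h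
          rw [Prod.mk.injEq]
          exact ⟨h, ha ▸ hc ▸ h⟩
      _ = n := by simp
  have h2 : (Finset.univ.filter fun p : Fin n × Fin n => G.Adj p.1 p.2).card ≤
      2 * G.edgeSet.ncard := by
    have : G.edgeSet.ncard = G.edgeFinset.card := by
      rw [← SimpleGraph.coe_edgeFinset, Set.ncard_coe_finset]
    rw [this, ← G.dart_card_eq_twice_card_edges, ← Finset.card_univ]
    refine Finset.card_le_card_of_surjOn (fun d : G.Dart => (d.fst, d.snd)) ?_
    rintro ⟨a, b⟩ hab
    simp only [Finset.coe_filter, Finset.mem_univ, true_and, Set.mem_ofPred_eq] at hab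
    exact ⟨⟨(a, b), hab⟩, by simp, rfl⟩
  rw [Finset.filter_or]
  exact (Finset.card_union_le _ _).trans (Nat.add_le_add h1 h2)

theorem ncard_sq_le_of_pairwise {S : Set (Fin n)} (hS : S.Pairwise G.Adj) :
    S.ncard ^ 2 ≤ n + 2 * G.edgeSet.ncard := by
  classical
  refine le_trans ?_ (card_adj_or_eq_le (G := G))
  lift S to Finset (Fin n) using Set.toFinite S
  rw [Set.ncard_coe_finset, sq, ← Finset.card_product]
  refine Finset.card_le_card fun p hp => ?_
  obtain ⟨h1, h2⟩ := Finset.mem_product.1 hp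
  simp only [Finset.mem_filter, Finset.mem_univ, true_and]
  by_cases h : p.1 = p.2
  · exact .inl h
  · exact .inr (hS h1 h2 h)

/-- The vertices are partitioned into one clique per bag; the squares of the sizes of these cliques
add up to at most `n + 2 * m`. -/
theorem IsCliqueTree.sq_card_le {F : Finset ℕ} {r : ℕ} {par : ℕ → ℕ}
    {bag : ℕ → Set (Fin n)} (T : IsCliqueTree G Set.univ F r par bag) :
    n ^ 2 ≤ F.card * (n + 2 * G.edgeSet.ncard) := by
  classical
  have hex : ∀ v : Fin n, ∃ w ∈ F, v ∈ bag w := fun v => by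
    obtain ⟨w, hw, h⟩ := T.exists_bag (C := {v}) (Set.subset_univ _) (Set.pairwise_singleton _ _)
    exact ⟨w, hw, h rfl⟩
  choose f hfF hf using hex
  have h1 : n = ∑ w ∈ F, (Finset.univ.filter fun v => f v = w).card := by
    rw [← Finset.card_eq_sum_card_fiberwise fun v _ => hfF v]
    simp
  have h2 : ∑ w ∈ F, (Finset.univ.filter fun v => f v = w).card ^ 2 ≤
      n + 2 * G.edgeSet.ncard := by
    refine le_trans ?_ (card_adj_or_eq_le (G := G))
    have : ∀ w ∈ F, (Finset.univ.filter fun v => f v = w).card ^ 2 =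
        ((Finset.univ.filter fun v => f v = w) ×ˢ (Finset.univ.filter fun v => f v = w)).card := by
      intro w _
      rw [Finset.card_product, sq]
    rw [Finset.sum_congr rfl this, ← Finset.card_biUnion]
    · refine Finset.card_le_card fun p hp => ?_
      obtain ⟨w, hw, hp⟩ := Finset.mem_biUnion.1 hp
      simp only [Finset.mem_product, Finset.mem_filter, Finset.mem_univ, true_and] at hp ⊢
      by_cases h : p.1 = p.2
      · exact .inl h
      · refine .inr (T.bag_pairwise hw ?_ ?_ h)
        · exact hp.1 ▸ hf p.1
        · exact hp.2 ▸ hf p.2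
    · intro w _ w' _ hne
      rw [Function.onFun, Finset.disjoint_left]
      intro p hp hp'
      simp only [Finset.mem_product, Finset.mem_filter, Finset.mem_univ, true_and] at hp hp'
      exact hne (hp.1.symm.trans hp'.1)
  calc n ^ 2 = (∑ w ∈ F, (Finset.univ.filter fun v => f v = w).card) ^ 2 := by rw [← h1]
    _ ≤ F.card * ∑ w ∈ F, (Finset.univ.filter fun v => f v = w).card ^ 2 :=
        sq_sum_le_card_mul_sum_sq
    _ ≤ _ := Nat.mul_le_mul_left _ h2

theorem BagTree.IsFor.size_le {t : BagTree (Fin n)} [Nonempty (Fin n)] (T : t.IsFor G) :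
    t.size ≤ n := by
  have hex : ∀ j : Fin t.size, ∃ u, u ∈ t.bag j ∧ u ∉ t.lab j := fun j =>
    T.exists_mem_not_mem_lab j.2 j.2
  choose f hf hf' using hex
  have hlt : ∀ i j : Fin t.size, i < j → f i ≠ f j := by
    intro i j hij heq
    have hpos : 0 < j.val := (Nat.zero_le _).trans_lt (Fin.lt_def.1 hij)
    refine hf' j ⟨hpos, hf j, ?_⟩
    exact T.tree.rip i (Finset.mem_range.2 i.2) j (Finset.mem_range.2 j.2) hij _ (heq ▸ hf i) (hf j)
  have hinj : Function.Injective f := by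
    intro i j h
    rcases lt_trichotomy i j with h' | h' | h'
    · exact absurd h (hlt i j h')
    · exact h'
    · exact absurd h.symm (hlt j i h')
  simpa using Fintype.card_le_of_injective f hinj

end Bounds

/-! ### Reasoning about programs -/

instance : Add Expr := ⟨.add⟩
instance : Sub Expr := ⟨.sub⟩
instance : Mul Expr := ⟨.mul⟩
instance (c : ℕ) : OfNat Expr c := ⟨.const c⟩

/-- The scalar variable kept in cell `0` of an array. -/
abbrev Expr.var (a : ℕ) : Expr := .get a 0

namespace Expr

variable {mem : ℕ → ℕ → ℕ} {e f : Expr}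

@[simp] theorem eval_add : (e + f).eval mem = e.eval mem + f.eval mem := (rfl)
@[simp] theorem eval_sub : (e - f).eval mem = e.eval mem - f.eval mem := (rfl)
@[simp] theorem eval_mul : (e * f).eval mem = e.eval mem * f.eval mem := (rfl)
@[simp] theorem eval_two : (2 : Expr).eval mem = 2 := (rfl)
@[simp] theorem eval_three : (3 : Expr).eval mem = 3 := (rfl)
@[simp] theorem eval_zero : (0 : Expr).eval mem = 0 := (rfl)
@[simp] theorem eval_one : (1 : Expr).eval mem = 1 := (rfl)
@[simp] theorem eval_get (a : ℕ) : (get a e).eval mem = mem a (e.eval mem) := (rfl)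
@[simp] theorem eval_lt : (lt e f).eval mem = if e.eval mem < f.eval mem then 1 else 0 := (rfl)
@[simp] theorem eval_eq : (eq e f).eval mem = if e.eval mem = f.eval mem then 1 else 0 := (rfl)

@[simp] theorem cost_add : (e + f).cost = e.cost + f.cost + 1 := rfl
@[simp] theorem cost_sub : (e - f).cost = e.cost + f.cost + 1 := rfl
@[simp] theorem cost_mul : (e * f).cost = e.cost + f.cost + 1 := rfl
@[simp] theorem cost_two : (2 : Expr).cost = 1 := rfl
@[simp] theorem cost_three : (3 : Expr).cost = 1 := rfl
@[simp] theorem cost_zero : (0 : Expr).cost = 1 := rfl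
@[simp] theorem cost_one : (1 : Expr).cost = 1 := rfl
@[simp] theorem cost_get (a : ℕ) : (get a e).cost = e.cost + 1 := rfl
@[simp] theorem cost_lt : (lt e f).cost = e.cost + f.cost + 1 := rfl
@[simp] theorem cost_eq : (eq e f).cost = e.cost + f.cost + 1 := rfl

/-- The arrays an expression refers to. -/
def reads : Expr → List ℕ
  | .const _ => []
  | .get a i => a :: i.reads
  | .add e f => e.reads ++ f.reads
  | .sub e f => e.reads ++ f.reads
  | .mul e f => e.reads ++ f.reads
  | .lt e f => e.reads ++ f.reads
  | .eq e f => e.reads ++ f.reads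

theorem eval_congr {mem mem' : ℕ → ℕ → ℕ} {e : Expr} (h : ∀ a ∈ e.reads, mem' a = mem a) :
    e.eval mem' = e.eval mem := by
  induction e with
  | const c => rfl
  | get a i ih =>
    simp only [reads, List.mem_cons, forall_eq_or_imp] at h
    simp only [eval, h.1, ih h.2]
  | add e f ihe ihf | sub e f ihe ihf | mul e f ihe ihf | lt e f ihe ihf | eq e f ihe ihf =>
    simp only [reads, List.mem_append] at h
    simp only [eval, ihe fun a ha => h a (.inl ha), ihf fun a ha => h a (.inr ha)]

end Expr

namespace MachineState

/-- The state after an assignment. -/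
def set (s : MachineState) (a i x : ℕ) : MachineState :=
  { s with mem := Function.update s.mem a (Function.update (s.mem a) i x) }

variable {s : MachineState} {a b i j x : ℕ}

@[simp] theorem set_out : (s.set a i x).out = s.out := rfl

@[simp] theorem set_mem_of_ne (h : b ≠ a) : (s.set a i x).mem b = s.mem b :=
  Function.update_of_ne h _ _

@[simp] theorem set_mem_self : (s.set a i x).mem a i = x := by simp [set]

/-- The state after an output. -/
def emit (s : MachineState) (x : ℕ) : MachineState := { s with out := s.out ++ [x] }

@[simp] theorem emit_out : (s.emit x).out = s.out ++ [x] := rfl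

@[simp] theorem emit_mem : (s.emit x).mem = s.mem := rfl

theorem set_mem_same : (s.set a i x).mem a j = if j = i then x else s.mem a j := by
  simp [set, Function.update_apply]

end MachineState

namespace Cmd

/-- The arrays a command without procedure calls can change. -/
def writes : Cmd → List ℕ
  | .skip => []
  | .assign a _ _ => [a]
  | .emit _ => []
  | .seq c d => c.writes ++ d.writes
  | .ite _ c d => c.writes ++ d.writes
  | .while _ c => c.writes
  | .call _ => []

/-- A command without procedure calls and output. -/
def Plain : Cmd → Prop
  | .skip => True
  | .assign _ _ _ => True
  | .emit _ => False
  | .seq c d => c.Plain ∧ d.Plain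
  | .ite _ c d => c.Plain ∧ d.Plain
  | .while _ c => c.Plain
  | .call _ => False

end Cmd

theorem Exec.frame {procs : List Cmd} {c : Cmd} {s s' : MachineState} {t : ℕ}
    (h : Exec procs c s t s') (hc : c.Plain) :
    (∀ a, a ∉ c.writes → s'.mem a = s.mem a) ∧ s'.out = s.out := by
  induction h with
  | skip s => exact ⟨fun _ _ => rfl, rfl⟩
  | assign a i v s =>
    refine ⟨fun b hb => ?_, rfl⟩
    simp only [Cmd.writes, List.mem_singleton] at hb
    exact Function.update_of_ne hb _ _
  | emit => exact absurd hc id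
  | seq _ _ ih1 ih2 =>
    obtain ⟨h1, h2⟩ := ih1 hc.1
    obtain ⟨h3, h4⟩ := ih2 hc.2
    refine ⟨fun a ha => ?_, h4.trans h2⟩
    simp only [Cmd.writes, List.mem_append, not_or] at ha
    rw [h3 a ha.2, h1 a ha.1]
  | ite_true _ _ ih =>
    refine ⟨fun a ha => ?_, (ih hc.1).2⟩
    simp only [Cmd.writes, List.mem_append, not_or] at ha
    exact (ih hc.1).1 a ha.1
  | ite_false _ _ ih =>
    refine ⟨fun a ha => ?_, (ih hc.2).2⟩
    simp only [Cmd.writes, List.mem_append, not_or] at ha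
    exact (ih hc.2).1 a ha.2
  | while_true _ _ _ ih1 ih2 =>
    obtain ⟨h1, h2⟩ := ih1 hc
    obtain ⟨h3, h4⟩ := ih2 hc
    exact ⟨fun a ha => (h3 a ha).trans (h1 a ha), h4.trans h2⟩
  | while_false _ => exact ⟨fun _ _ => rfl, rfl⟩
  | call => exact absurd hc id

/-- Started in `s`, the command halts after at most `b` steps in a state that satisfies `Q`. -/
def WP (procs : List Cmd) (c : Cmd) (s : MachineState) (b : ℕ) (Q : MachineState → Prop) : Prop :=
  ∃ t s', Exec procs c s t s' ∧ t ≤ b ∧ Q s'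

namespace WP

variable {procs : List Cmd} {c d : Cmd} {s : MachineState} {b b' : ℕ} {Q Q' : MachineState → Prop}

theorem mono (h : WP procs c s b Q) (hb : b ≤ b') (hQ : ∀ s', Q s' → Q' s') :
    WP procs c s b' Q' := by
  obtain ⟨t, s', h1, h2, h3⟩ := h
  exact ⟨t, s', h1, h2.trans hb, hQ s' h3⟩

theorem le (h : WP procs c s b Q) (hb : b ≤ b') : WP procs c s b' Q := h.mono hb fun _ h => h

theorem skip (h : Q s) : WP procs .skip s 1 Q := ⟨_, _, .skip s, le_rfl, h⟩

theorem assign {a : ℕ} {i v : Expr} (h : Q (s.set a (i.eval s.mem) (v.eval s.mem))) :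
    WP procs (.assign a i v) s (i.cost + v.cost + 1) Q :=
  ⟨_, _, .assign a i v s, le_rfl, h⟩

theorem emit {v : Expr} (h : Q (s.emit (v.eval s.mem))) :
    WP procs (.emit v) s (v.cost + 1) Q :=
  ⟨_, _, .emit v s, le_rfl, h⟩

theorem seq (h : WP procs c s b fun s' => WP procs d s' b' Q) :
    WP procs (.seq c d) s (b + b') Q := by
  obtain ⟨t, s', h1, h2, t', s'', h3, h4, h5⟩ := h
  exact ⟨_, _, .seq h1 h3, Nat.add_le_add h2 h4, h5⟩

theorem ite {e : Expr} (h1 : e.eval s.mem ≠ 0 → WP procs c s b Q)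
    (h2 : e.eval s.mem = 0 → WP procs d s b Q) :
    WP procs (.ite e c d) s (e.cost + 1 + b) Q := by
  by_cases h : e.eval s.mem = 0
  · obtain ⟨t, s', h3, h4, h5⟩ := h2 h
    exact ⟨_, _, .ite_false h h3, Nat.add_le_add_left h4 _, h5⟩
  · obtain ⟨t, s', h3, h4, h5⟩ := h1 h
    exact ⟨_, _, .ite_true h h3, Nat.add_le_add_left h4 _, h5⟩

theorem frame (hc : c.Plain) (h : WP procs c s b Q) :
    WP procs c s b fun s' => Q s' ∧ (∀ a, a ∉ c.writes → s'.mem a = s.mem a) ∧ s'.out = s.out := by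
  obtain ⟨t, s', h1, h2, h3⟩ := h
  exact ⟨t, s', h1, h2, h3, h1.frame hc⟩

end WP

/-- `for i < N do body`, for a scalar variable `i`. -/
def forLoop (i : ℕ) (N : Expr) (body : Cmd) : Cmd :=
  .seq (.assign i 0 0) (.while (.lt (.var i) N) (.seq body (.assign i 0 (.var i + 1))))

theorem WP.loop {procs : List Cmd} {body : Cmd} {s : MachineState} {b i n : ℕ} {N : Expr}
    {Q : MachineState → Prop} (Inv : ℕ → MachineState → Prop)
    (h0 : Inv 0 (s.set i 0 0))
    (hN : ∀ j ≤ n, ∀ s', Inv j s' → N.eval s'.mem = n)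
    (hi : ∀ j ≤ n, ∀ s', Inv j s' → s'.mem i 0 = j)
    (hstep : ∀ j < n, ∀ s', Inv j s' →
      WP procs body s' b fun s'' => s''.mem i 0 = j ∧ Inv (j + 1) (s''.set i 0 (j + 1)))
    (hQ : ∀ s', Inv n s' → Q s') :
    WP procs (forLoop i N body) s (n * (b + N.cost + 10) + N.cost + 7) Q := by
  have main : ∀ m j, j + m = n → ∀ s', Inv j s' →
      WP procs (.while (.lt (.var i) N) (.seq body (.assign i 0 (.var i + 1)))) s'
        (m * (b + N.cost + 10) + N.cost + 4) Q := by
    intro m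
    induction m with
    | zero =>
      rintro j rfl s' hinv
      refine ⟨_, _, .while_false ?_, ?_, hQ _ hinv⟩
      · simp [hi _ le_rfl s' hinv, hN _ le_rfl s' hinv]
      · simp; omega
    | succ m ih =>
      intro j hj s' hinv
      obtain ⟨t, s'', h1, h2, h3, h4⟩ := hstep j (by omega) s' hinv
      obtain ⟨t', s''', h5, h6, h7⟩ := ih (j + 1) (by omega) _ h4
      have h8 := Exec.assign (procs := procs) i 0 (.var i + 1) s''
      rw [show (Expr.var i + 1).eval s''.mem = j + 1 by simp [h3]] at h8
      refine ⟨_, _, .while_true ?_ (.seq h1 h8) h5, ?_, h7⟩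
      rotate_left
      · simp only [Expr.cost_lt, Expr.cost_add, Expr.cost_get, Expr.cost_zero, Expr.cost_one]
        rw [Nat.succ_mul]
        omega
      · simp only [Expr.eval_lt, Expr.eval_get, Expr.eval_zero, hi j (by omega) s' hinv,
          hN j (by omega) s' hinv]
        rw [if_pos (by omega)]
        exact one_ne_zero
  refine (WP.seq (WP.assign (main n 0 (by omega) _ h0))).le ?_
  simp only [Expr.cost_zero]
  omega

/-- The rule for loops with a plain body that changes neither the loop variable nor the bound. -/
theorem WP.loop_plain {procs : List Cmd} {body : Cmd} {s : MachineState} {b i n : ℕ} {N : Expr}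
    {Q : MachineState → Prop} (Inv : ℕ → MachineState → Prop) (hbody : body.Plain)
    (hi : i ∉ body.writes) (hN : ∀ a ∈ N.reads, a ≠ i ∧ a ∉ body.writes) (hn : N.eval s.mem = n)
    (h0 : Inv 0 (s.set i 0 0))
    (hstep : ∀ j < n, ∀ s', (∀ a, a ≠ i → a ∉ body.writes → s'.mem a = s.mem a) →
      s'.out = s.out → s'.mem i 0 = j → Inv j s' →
      WP procs body s' b fun s'' => Inv (j + 1) (s''.set i 0 (j + 1)))
    (hQ : ∀ s', (∀ a, a ≠ i → a ∉ body.writes → s'.mem a = s.mem a) → s'.out = s.out →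
      Inv n s' → Q s') :
    WP procs (forLoop i N body) s (n * (b + N.cost + 10) + N.cost + 7) Q := by
  refine WP.loop (n := n) (fun j s' => Inv j s' ∧ s'.mem i 0 = j ∧
    (∀ a, a ≠ i → a ∉ body.writes → s'.mem a = s.mem a) ∧ s'.out = s.out) ?_ ?_ ?_ ?_ ?_
  · exact ⟨h0, by simp, fun a ha _ => by simp [ha], rfl⟩
  · rintro j - s' ⟨-, -, h, -⟩
    rw [← hn]
    exact Expr.eval_congr fun a ha => h a (hN a ha).1 (hN a ha).2
  · exact fun j _ s' h => h.2.1
  · rintro j hj s' ⟨h1, h2, h3, h4⟩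
    refine ((hstep j hj s' h3 h4 h2 h1).frame hbody).mono le_rfl ?_
    rintro s'' ⟨h5, h6, h7⟩
    refine ⟨by rw [h6 i hi, h2], h5, by simp, fun a ha ha' => ?_, ?_⟩
    · rw [MachineState.set_mem_of_ne ha, h6 a ha', h3 a ha ha']
    · rw [MachineState.set_out, h7, h4]
  · exact fun s' h => hQ s' h.2.2.1 h.2.2.2 h.1

@[simp] theorem writes_forLoop {i : ℕ} {N : Expr} {body : Cmd} :
    (forLoop i N body).writes = i :: (body.writes ++ [i]) := rfl

@[simp] theorem plain_forLoop {i : ℕ} {N : Expr} {body : Cmd} :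
    (forLoop i N body).Plain ↔ body.Plain := by
  simp [forLoop, Cmd.Plain]

open CliquePicking.MachineState (set_mem_of_ne set_mem_same set_mem_self set_out emit_mem)
open CliquePicking.Expr (eval_add eval_congr eval_eq eval_get eval_lt eval_mul eval_one eval_sub
  eval_three eval_two eval_zero)

/-! ### Filling tables and collecting lists -/

local notation "rI" => (60 : ℕ)
local notation "rJ" => (61 : ℕ)
local notation "rK" => (62 : ℕ)
local notation "rU" => (63 : ℕ)
local notation "rAcc" => (64 : ℕ)

/-- The arrays that hold the scalar variables of `fill`. -/
abbrev scratch : List ℕ := [rI, rJ, rK, rU, rAcc]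

theorem not_mem_scratch {a : ℕ} :
    a ∉ scratch ↔ ¬a = rI ∧ ¬a = rJ ∧ ¬a = rK ∧ ¬a = rU ∧ ¬a = rAcc := by
  simp only [scratch, List.mem_cons, List.not_mem_nil, or_false, not_or]

/-- Fills an `N × M × L` table. The entry with indices `i`, `j`, `k` is the value of `g`;
this expression can use the indices, the entries that precede it lexicographically, and, in `rAcc`,
the sum of the values of `e` over all `u < S`; `e` can use the same things and `u`. -/
def fill (A : ℕ) (N M L S e g : Expr) : Cmd :=
  forLoop rI N (forLoop rJ M (forLoop rK L (.seq (.assign rAcc 0 0) (.seq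
    (forLoop rU S (.assign rAcc 0 (.var rAcc + e)))
    (.assign A ((.var rI * M + .var rJ) * L + .var rK) g)))))

theorem fill_plain {A : ℕ} {N M L S e g : Expr} : (fill A N M L S e g).Plain := by
  simp [fill, Cmd.Plain]

theorem mem_writes_fill {A a : ℕ} {N M L S e g : Expr} (ha : a ≠ A) (has : a ∉ scratch) :
    a ∉ (fill A N M L S e g).writes := by
  simp only [not_mem_scratch] at has
  simp [fill, Cmd.writes, ha, has]

/-- The entries of a table that lexicographically precede `(i, j, k)` are given by `f`. -/
def FilledBefore (m l : ℕ) (f : ℕ → ℕ → ℕ → ℕ) (arr : ℕ → ℕ) (i j k : ℕ) : Prop :=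
  ∀ i' j' k', j' < m → k' < l → (i' < i ∨ i' = i ∧ (j' < j ∨ j' = j ∧ k' < k)) →
    arr ((i' * m + j') * l + k') = f i' j' k'

theorem pair_index_inj {m i j i' j' : ℕ} (hj : j < m) (hj' : j' < m)
    (h : i * m + j = i' * m + j') : i = i' ∧ j = j' := by
  have h1 : i = i' := by
    have := congrArg (· / m) h
    simpa [Nat.mul_comm _ m, Nat.mul_add_div (Nat.zero_lt_of_lt hj), Nat.div_eq_of_lt hj,
      Nat.div_eq_of_lt hj'] using this
  subst h1
  exact ⟨rfl, by omega⟩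

theorem loop_cost_le {x y D a : ℕ} (hx : 1 ≤ x) (hy : 1 ≤ y) :
    x * (y * D + a + 10) + a + 7 ≤ x * y * (D + 2 * a + 17) := by
  have h1 : x * 1 * (2 * a + 17) ≤ x * y * (2 * a + 17) :=
    Nat.mul_le_mul_right _ (Nat.mul_le_mul_left _ hy)
  have h2 : 1 * (a + 7) ≤ x * (a + 7) := Nat.mul_le_mul_right _ hx
  nlinarith

/-- The costs of the expressions of a `fill` command, up to constants. -/
def fillCost (N M L S e g : Expr) : ℕ :=
  N.cost + M.cost + L.cost + S.cost + e.cost + g.cost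

/-- The rule for `fill`: the time is bounded in terms of the number of iterations. -/
theorem wp_fill {procs : List Cmd} {s : MachineState} {A : ℕ} {N M L S e g : Expr} {n m l p : ℕ}
    (w : ℕ → ℕ → ℕ → ℕ → ℕ) (f : ℕ → ℕ → ℕ → ℕ) (hA : A ∉ scratch)
    (hr : ∀ a ∈ N.reads ++ M.reads ++ L.reads ++ S.reads, a ≠ A ∧ a ∉ scratch)
    (hN : N.eval s.mem = n) (hM : M.eval s.mem = m) (hL : L.eval s.mem = l)
    (hS : S.eval s.mem = p) (hn0 : 1 ≤ n) (hm0 : 1 ≤ m) (hl0 : 1 ≤ l)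
    (he : ∀ s' : MachineState, (∀ a, a ≠ A → a ∉ scratch → s'.mem a = s.mem a) →
      ∀ i j k u, i < n → j < m → k < l → u < p → s'.mem rI 0 = i → s'.mem rJ 0 = j →
        s'.mem rK 0 = k → s'.mem rU 0 = u → FilledBefore m l f (s'.mem A) i j k →
        e.eval s'.mem = w i j k u)
    (hg : ∀ s' : MachineState, (∀ a, a ≠ A → a ∉ scratch → s'.mem a = s.mem a) →
      ∀ i j k, i < n → j < m → k < l → s'.mem rI 0 = i → s'.mem rJ 0 = j → s'.mem rK 0 = k →
        s'.mem rAcc 0 = ∑ u ∈ Finset.range p, w i j k u →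
        FilledBefore m l f (s'.mem A) i j k → g.eval s'.mem = f i j k) :
    WP procs (fill A N M L S e g) s ((8 * fillCost N M L S e g + 100) * (n * m * l * (p + 1)))
      fun s' => ∀ i j k, i < n → j < m → k < l → s'.mem A ((i * m + j) * l + k) = f i j k := by
  simp only [List.mem_append] at hr
  have hAI : A ≠ rI := fun h => hA (by simp [h])
  have hAJ : A ≠ rJ := fun h => hA (by simp [h])
  have hAK : A ≠ rK := fun h => hA (by simp [h])
  have hAU : A ≠ rU := fun h => hA (by simp [h])
  have hAAcc : A ≠ rAcc := fun h => hA (by simp [h])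
  have hdom : ∀ {T : Expr}, (∀ a ∈ T.reads, a ≠ A ∧ a ∉ scratch) →
      ∀ {s' : MachineState}, (∀ a, a ≠ A → a ∉ scratch → s'.mem a = s.mem a) →
        T.eval s'.mem = T.eval s.mem := fun h _ h' =>
    eval_congr fun a ha => h' a (h a ha).1 (h a ha).2
  have hNr : ∀ a ∈ N.reads, a ≠ A ∧ a ∉ scratch := fun a ha => hr a (by simp [ha])
  have hMr : ∀ a ∈ M.reads, a ≠ A ∧ a ∉ scratch := fun a ha => hr a (by simp [ha])
  have hLr : ∀ a ∈ L.reads, a ≠ A ∧ a ∉ scratch := fun a ha => hr a (by simp [ha])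
  have hSr : ∀ a ∈ S.reads, a ≠ A ∧ a ∉ scratch := fun a ha => hr a (by simp [ha])
  -- the body of the innermost loop
  have hbody : ∀ s' : MachineState, (∀ a, a ≠ A → a ∉ scratch → s'.mem a = s.mem a) →
      ∀ i j k, i < n → j < m → k < l → s'.mem rI 0 = i → s'.mem rJ 0 = j → s'.mem rK 0 = k →
      FilledBefore m l f (s'.mem A) i j k →
      WP procs (.seq (.assign rAcc 0 0) (.seq (forLoop rU S (.assign rAcc 0 (.var rAcc + e)))
        (.assign A ((.var rI * M + .var rJ) * L + .var rK) g))) s'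
        ((p + 1) * (fillCost N M L S e g + 25))
        fun s'' => FilledBefore m l f (s''.mem A) i j (k + 1) := by
    intro s' hs' i j k hi hj hk hsi hsj hsk hbef
    refine (WP.seq (WP.assign (WP.seq (WP.loop_plain
      (fun u s'' => s''.mem rAcc 0 = ∑ u ∈ Finset.range u, w i j k u) (n := p) (by simp [Cmd.Plain])
      ?_ ?_ ?_ ?_
      ?_ ?_)))).mono (b := 3 + (p * (e.cost + 5 + S.cost + 10) + S.cost + 7 +
        (M.cost + L.cost + g.cost + 12))) ?_ fun _ h => h
    · simp [Cmd.writes]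
    · intro a ha
      obtain ⟨-, h⟩ := hSr a ha
      simp only [not_mem_scratch] at h
      simp [Cmd.writes, h]
    · rw [← hS]
      refine hdom hSr fun a haA has => ?_
      have : a ≠ rAcc := fun h => has (by simp [h])
      rw [set_mem_of_ne this, hs' a haA has]
    · simp
    · intro u hu s'' hfr _ hsu hacc
      refine (WP.assign ?_).mono (b := 1 + (2 + e.cost + 1) + 1) (by omega) fun _ h => h
      have h1 : ∀ a, a ≠ rU → a ≠ rAcc → s''.mem a = s'.mem a := fun a ha ha' => by
        rw [hfr a ha (by simpa [Cmd.writes] using ha'), set_mem_of_ne (by simpa using ha')]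
      have h2 : e.eval s''.mem = w i j k u := by
        refine he s'' (fun a haA has => ?_) i j k u hi hj hk hu ?_ ?_ ?_ hsu ?_
        · rw [h1 a (fun h => has (by simp [h])) (fun h => has (by simp [h])), hs' a haA has]
        · rw [h1 _ (by simp) (by simp), hsi]
        · rw [h1 _ (by simp) (by simp), hsj]
        · rw [h1 _ (by simp) (by simp), hsk]
        · rw [h1 A hAU hAAcc]; exact hbef
      simp [h2, hacc, Finset.sum_range_succ]
    · intro s'' hfr _ hacc
      have h1 : ∀ a, a ≠ rU → a ≠ rAcc → s''.mem a = s'.mem a := fun a ha ha' => by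
        rw [hfr a ha (by simpa [Cmd.writes] using ha'), set_mem_of_ne (by simpa using ha')]
      have h2 : ∀ a, a ≠ A → a ∉ scratch → s''.mem a = s.mem a := fun a haA has => by
        rw [h1 a (fun h => has (by simp [h])) (fun h => has (by simp [h])), hs' a haA has]
      have h3 : s''.mem rI 0 = i := by rw [h1 _ (by simp) (by simp), hsi]
      have h4 : s''.mem rJ 0 = j := by rw [h1 _ (by simp) (by simp), hsj]
      have h5 : s''.mem rK 0 = k := by rw [h1 _ (by simp) (by simp), hsk]
      have h6 : FilledBefore m l f (s''.mem A) i j k := by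
        rw [h1 A hAU hAAcc]; exact hbef
      have h7 := hg s'' h2 i j k hi hj hk h3 h4 h5 hacc h6
      have h8 : ((Expr.var rI * M + .var rJ) * L + .var rK).eval s''.mem = (i * m + j) * l + k := by
        simp [h3, h4, h5, hdom hMr h2, hdom hLr h2, hM, hL]
      refine (WP.assign ?_).mono (b' := M.cost + L.cost + g.cost + 12) ?_ fun _ h => h
      · rw [h7, h8]
        intro i' j' k' hj' hk' hlt
        rw [set_mem_same]
        split_ifs with heq
        · obtain ⟨h9, rfl⟩ := pair_index_inj hk' hk heq
          obtain ⟨rfl, rfl⟩ := pair_index_inj hj' hj h9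
          rfl
        · refine h6 i' j' k' hj' hk' ?_
          rcases hlt with h | ⟨rfl, h | ⟨rfl, h⟩⟩
          · exact .inl h
          · exact .inr ⟨rfl, .inl h⟩
          · refine .inr ⟨rfl, .inr ⟨rfl, lt_of_le_of_ne (Nat.lt_succ_iff.1 h) ?_⟩⟩
            rintro rfl
            exact heq rfl
      · simp only [Expr.cost_add, Expr.cost_mul, Expr.cost_get, Expr.cost_zero]
        omega
    · simp only [fillCost]
      nlinarith
  have hK : ∀ s' : MachineState, (∀ a, a ≠ A → a ∉ scratch → s'.mem a = s.mem a) →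
      ∀ i j, i < n → j < m → s'.mem rI 0 = i → s'.mem rJ 0 = j →
      FilledBefore m l f (s'.mem A) i j 0 →
      WP procs (forLoop rK L (.seq (.assign rAcc 0 0) (.seq
        (forLoop rU S (.assign rAcc 0 (.var rAcc + e)))
        (.assign A ((.var rI * M + .var rJ) * L + .var rK) g)))) s'
        (l * ((p + 1) * (fillCost N M L S e g + 25) + L.cost + 10) + L.cost + 7)
        fun s'' => FilledBefore m l f (s''.mem A) i (j + 1) 0 := by
    intro s' hs' i j hi hj hsi hsj hbef
    refine WP.loop_plain (fun k s'' => FilledBefore m l f (s''.mem A) i j k) (n := l)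
      (by simp [Cmd.Plain]) (by simp [Cmd.writes, hAK.symm]) ?_ ?_ ?_ ?_ ?_
    · intro a ha
      obtain ⟨h1, h⟩ := hLr a ha
      simp only [not_mem_scratch] at h
      simp [Cmd.writes, h, h1]
    · rw [hdom hLr hs', hL]
    · rw [set_mem_of_ne hAK]; exact hbef
    · intro k hk s'' hfr _ hsk hbef'
      have h1 : ∀ a, a ≠ A → a ≠ rK → a ≠ rU → a ≠ rAcc → s''.mem a = s'.mem a :=
        fun a ha ha1 ha2 ha3 => hfr a ha1 (by simp [Cmd.writes, ha, ha2, ha3])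
      refine (hbody s'' (fun a haA has => ?_) i j k hi hj hk ?_ ?_ hsk hbef').mono le_rfl ?_
      · rw [h1 a haA (fun h => has (by simp [h])) (fun h => has (by simp [h]))
          (fun h => has (by simp [h])), hs' a haA has]
      · rw [h1 _ hAI.symm (by simp) (by simp) (by simp), hsi]
      · rw [h1 _ hAJ.symm (by simp) (by simp) (by simp), hsj]
      · intro s3 h3
        rwa [set_mem_of_ne hAK]
    · intro s'' _ _ h i' j' k' hj' hk' hlt
      refine h i' j' k' hj' hk' ?_
      omega
  have hJ : ∀ s' : MachineState, (∀ a, a ≠ A → a ∉ scratch → s'.mem a = s.mem a) →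
      ∀ i, i < n → s'.mem rI 0 = i → FilledBefore m l f (s'.mem A) i 0 0 →
      WP procs (forLoop rJ M (forLoop rK L (.seq (.assign rAcc 0 0) (.seq
        (forLoop rU S (.assign rAcc 0 (.var rAcc + e)))
        (.assign A ((.var rI * M + .var rJ) * L + .var rK) g))))) s'
        (m * (l * ((p + 1) * (fillCost N M L S e g + 25) + L.cost + 10) + L.cost + 7 +
          M.cost + 10) + M.cost + 7)
        fun s'' => FilledBefore m l f (s''.mem A) (i + 1) 0 0 := by
    intro s' hs' i hi hsi hbef
    refine WP.loop_plain (fun j s'' => FilledBefore m l f (s''.mem A) i j 0) (n := m)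
      (by simp [Cmd.Plain]) (by simp [Cmd.writes, hAJ.symm]) ?_ ?_ ?_ ?_ ?_
    · intro a ha
      obtain ⟨h1, h⟩ := hMr a ha
      simp only [not_mem_scratch] at h
      simp [Cmd.writes, h, h1]
    · rw [hdom hMr hs', hM]
    · rw [set_mem_of_ne hAJ]; exact hbef
    · intro j hj s'' hfr _ hsj hbef'
      have h1 : ∀ a, a ≠ A → a ≠ rJ → a ≠ rK → a ≠ rU → a ≠ rAcc → s''.mem a = s'.mem a :=
        fun a ha ha1 ha2 ha3 ha4 => hfr a ha1 (by simp [Cmd.writes, ha, ha2, ha3, ha4])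
      refine (hK s'' (fun a haA has => ?_) i j hi hj ?_ hsj hbef').mono le_rfl ?_
      · rw [h1 a haA (fun h => has (by simp [h])) (fun h => has (by simp [h]))
          (fun h => has (by simp [h])) (fun h => has (by simp [h])), hs' a haA has]
      · rw [h1 _ hAI.symm (by simp) (by simp) (by simp) (by simp), hsi]
      · intro s3 h3
        rwa [set_mem_of_ne hAJ]
    · intro s'' _ _ h i' j' k' hj' hk' hlt
      refine h i' j' k' hj' hk' ?_
      omega
  refine (WP.loop_plain (fun i s'' => FilledBefore m l f (s''.mem A) i 0 0) (n := n)
    (b := m * (l * ((p + 1) * (fillCost N M L S e g + 25) + L.cost + 10) + L.cost + 7 +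
      M.cost + 10) + M.cost + 7)
    (by simp [Cmd.Plain]) (by simp [Cmd.writes, hAI.symm]) ?_ hN ?_ ?_ ?_).le ?_
  · intro a ha
    obtain ⟨h1, h⟩ := hNr a ha
    simp only [not_mem_scratch] at h
    simp [Cmd.writes, h, h1]
  · intro i' j' k' hj' hk' hlt
    omega
  · intro i hi s'' hfr _ hsi hbef'
    refine (hJ s'' (fun a haA has => hfr a (fun h => has (by simp [h])) ?_) i hi hsi hbef').mono
      le_rfl ?_
    · simp only [not_mem_scratch] at has
      simp [Cmd.writes, haA, has]
    · intro s3 h3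
      rwa [set_mem_of_ne hAI]
  · intro s'' _ _ h i j k hi hj hk
    exact h i j k hj hk (.inl hi)
  · have h1 := loop_cost_le (x := l) (y := p + 1) (D := fillCost N M L S e g + 25) (a := L.cost)
      hl0 (by omega)
    have h2 := loop_cost_le (x := m) (y := l * (p + 1))
      (D := fillCost N M L S e g + 25 + 2 * L.cost + 17) (a := M.cost) hm0
      (Nat.mul_pos hl0 (Nat.succ_pos p))
    have h3 := loop_cost_le (x := n) (y := m * (l * (p + 1)))
      (D := fillCost N M L S e g + 25 + 2 * L.cost + 17 + 2 * M.cost + 17) (a := N.cost) hn0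
      (Nat.mul_pos hm0 (Nat.mul_pos hl0 (Nat.succ_pos p)))
    have h4 : fillCost N M L S e g + 25 + 2 * L.cost + 17 + 2 * M.cost + 17 + 2 * N.cost + 17 ≤
        8 * fillCost N M L S e g + 100 := by
      simp only [fillCost]; omega
    calc _ ≤ n * (m * (l * (p + 1) * (fillCost N M L S e g + 25 + 2 * L.cost + 17) + M.cost + 10) +
          M.cost + 7 + N.cost + 10) + N.cost + 7 := by gcongr
      _ ≤ n * (m * (l * (p + 1)) * (fillCost N M L S e g + 25 + 2 * L.cost + 17 + 2 * M.cost + 17) +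
          N.cost + 10) + N.cost + 7 := by gcongr
      _ ≤ _ := h3
      _ ≤ n * (m * (l * (p + 1))) * (8 * fillCost N M L S e g + 100) := by gcongr
      _ = _ := by ring

/-- The list `l` is stored in an array from cell `b` on. -/
def ListAt (arr : ℕ → ℕ) (b : ℕ) (l : List ℕ) : Prop :=
  ∀ i (h : i < l.length), arr (b + i) = l[i]

/-- Appends all `x < N` that satisfy a condition to the list stored from cell `base` on. -/
def collect (A : ℕ) (base : Expr) (cnt x : ℕ) (N cond : Expr) : Cmd :=
  forLoop x N (.ite cond (.seq (.assign A (base + .var cnt) (.var x))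
    (.assign cnt 0 (.var cnt + 1))) .skip)

theorem wp_collect {procs : List Cmd} {s : MachineState} {A cnt x n b : ℕ} {base N cond : Expr}
    (P : ℕ → Prop) [DecidablePred P] (l : List ℕ) (hAc : A ≠ cnt) (hAx : A ≠ x) (hcx : cnt ≠ x)
    (hr : ∀ a ∈ N.reads ++ base.reads, a ≠ A ∧ a ≠ cnt ∧ a ≠ x)
    (hN : N.eval s.mem = n) (hb : base.eval s.mem = b)
    (hcond : ∀ s' : MachineState, (∀ a, a ≠ A → a ≠ cnt → a ≠ x → s'.mem a = s.mem a) →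
      ∀ i < n, s'.mem x 0 = i → (cond.eval s'.mem ≠ 0 ↔ P i))
    (hcnt : s.mem cnt 0 = l.length) (hl : ListAt (s.mem A) b l) :
    WP procs (collect A base cnt x N cond) s
      (n * (cond.cost + base.cost + N.cost + 30) + N.cost + 7) fun s' =>
        s'.mem cnt 0 = (l ++ (List.range n).filter P).length ∧
        ListAt (s'.mem A) b (l ++ (List.range n).filter P) ∧ ∀ i < b, s'.mem A i = s.mem A i := by
  simp only [List.mem_append] at hr
  refine (WP.loop_plain (b := cond.cost + 1 + (base.cost + 3 + 2 + 1 + 6)) (fun j s' =>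
    s'.mem cnt 0 = (l ++ (List.range j).filter P).length ∧
    ListAt (s'.mem A) b (l ++ (List.range j).filter P) ∧ ∀ i < b, s'.mem A i = s.mem A i) (n := n)
    (by simp [Cmd.Plain]) (by simp [Cmd.writes, hAx.symm, hcx.symm]) ?_ hN ?_ ?_ ?_).le ?_
  · intro a ha
    obtain ⟨h1, h2, h3⟩ := hr a (.inl ha)
    simp [Cmd.writes, h1, h2, h3]
  · simpa [hAx, hcx, hcnt] using hl
  · rintro j hj s' hfr - hx ⟨h1, h2, h3⟩
    have hfr' : ∀ a, a ≠ A → a ≠ cnt → a ≠ x → s'.mem a = s.mem a := fun a ha ha1 ha2 =>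
      hfr a ha2 (by simp [Cmd.writes, ha, ha1])
    have hb' : base.eval s'.mem = b := by
      rw [← hb]
      exact eval_congr fun a ha => by
        obtain ⟨h1, h2, h3⟩ := hr a (.inr ha)
        exact hfr' a h1 h2 h3
    have hc := hcond s' hfr' j hj hx
    have hfil : (List.range (j + 1)).filter P =
        (List.range j).filter P ++ if P j then [j] else [] := by
      by_cases hP : P j <;> simp [List.range_succ, hP]
    refine WP.ite (fun h => ?_) (fun h => ?_)
    · have hP := hc.1 h
      refine (WP.seq (WP.assign (WP.assign ?_))).mono (by simp) fun _ h => h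
      simp only [set_mem_of_ne hAc, set_mem_of_ne hcx,
        set_mem_of_ne hAx, eval_add, eval_get, eval_zero, hx, h1, hb',
        set_mem_self, set_mem_of_ne hAc.symm, eval_one,
        hfil, if_pos hP]
      rw [← List.append_assoc]
      refine ⟨by rw [List.length_append (bs := [j]), List.length_singleton], fun i hi => ?_,
        fun i hi => ?_⟩
      · rw [set_mem_same]
        split_ifs with heq
        · have hi' : i = (l ++ (List.range j).filter P).length := by omega
          subst hi'
          rw [List.getElem_append_right le_rfl]
          simp
        · rw [List.length_append (bs := [j]), List.length_singleton] at hi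
          have hi' : i < (l ++ (List.range j).filter P).length := by omega
          rw [h2 i hi', List.getElem_append_left hi']
      · rw [set_mem_same, if_neg (by omega), h3 i hi]
    · have hP : ¬ P j := fun hP => hc.2 hP h
      refine WP.skip ?_ |>.mono (by omega) fun _ h => h
      simp only [set_mem_of_ne hAx, set_mem_of_ne hcx, hfil, if_neg hP,
        List.append_nil]
      exact ⟨h1, h2, h3⟩
  · exact fun s' _ _ h => h
  · nlinarith

/-! ### Tables describing the flowers of a clique tree -/

-- Where the clique tree is stored, as described by `Table.Stored`.
local notation "aN" => (1 : ℕ)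
local notation "aSize" => (2 : ℕ)
local notation "aPar" => (3 : ℕ)
local notation "aBag" => (4 : ℕ)

section Indicator

variable {n : ℕ} {S T : Set (Fin n)} {u : ℕ}

open Classical in
/-- The indicator function of a set of vertices. -/
noncomputable def ind (S : Set (Fin n)) (u : ℕ) : ℕ :=
  if ∃ h : u < n, (⟨u, h⟩ : Fin n) ∈ S then 1 else 0

open Classical in
theorem ind_fin (u : Fin n) : ind S u = if u ∈ S then 1 else 0 := by
  simp [ind]

theorem ind_inter : ind (S ∩ T) u = ind S u * ind T u := by
  by_cases h : u < n
  · lift u to Fin n using h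
    simp only [ind_fin, Set.mem_inter_iff]
    split_ifs <;> simp_all
  · simp [ind, h]

theorem ind_sdiff : ind (S \ T) u = ind S u * (1 - ind T u) := by
  by_cases h : u < n
  · lift u to Fin n using h
    simp only [ind_fin, Set.mem_sdiff]
    split_ifs <;> simp_all
  · simp [ind, h]

theorem ind_eq_one_iff (u : Fin n) : ind S u = 1 ↔ u ∈ S := by
  simp [ind_fin]

theorem sum_ind (S : Set (Fin n)) : ∑ u ∈ Finset.range n, ind S u = S.ncard := by
  classical
  rw [Finset.sum_range]
  simp only [ind_fin, Finset.sum_boole, Nat.cast_id]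
  rw [← Set.ncard_coe_finset]
  congr 1
  ext u
  simp

theorem ncard_sdiff_eq_zero : (S \ T).ncard = 0 ↔ S ⊆ T := by
  rw [Set.ncard_eq_zero (Set.toFinite _), Set.sdiff_eq_empty]

theorem ncard_sdiff_pos : 0 < (S \ T).ncard ↔ ¬ S ⊆ T := by
  rw [Nat.pos_iff_ne_zero, ne_eq, ncard_sdiff_eq_zero]

end Indicator

theorem pathEdges_card_gt {par : ℕ → ℕ} (hpar : ∀ j, 0 < j → par j < j) (P : ℕ → Prop)
    [DecidablePred P] {x y : ℕ} (h : y < x) : ((pathEdges par x y).filter P).card =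
      (if P x then 1 else 0) + ((pathEdges par (par x) y).filter P).card := by
  have hx : x ∉ pathEdges par (par x) y := fun hx => by
    have := (mem_pathEdges_pos hpar hx).2
    have := hpar x (by omega)
    omega
  rw [pathEdges_gt hpar h, Finset.filter_insert]
  split_ifs with hP
  · rw [Finset.card_insert_of_notMem fun h => hx (Finset.mem_filter.1 h).1, add_comm]
  · rw [zero_add]

theorem pathEdges_card_lt {par : ℕ → ℕ} (hpar : ∀ j, 0 < j → par j < j) (P : ℕ → Prop)
    [DecidablePred P] {x y : ℕ} (h : x < y) : ((pathEdges par x y).filter P).card =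
      (if P y then 1 else 0) + ((pathEdges par x (par y)).filter P).card := by
  rw [pathEdges_comm hpar x y, pathEdges_card_gt hpar P h, pathEdges_comm hpar (par y) x]

/-- The tables computed from a clique tree. Numbers of edges and nodes are at most `t.size`, numbers
of flowers at most `2 * t.size`. -/
inductive Table where
  /-- the labels -/
  | lab
  /-- the sizes of the labels -/
  | labSize
  /-- the sizes of the bags -/
  | bagSize
  /-- the sizes of the differences of two labels -/
  | labDiff
  /-- the sizes of the differences of a label and a bag -/
  | labBag
  /-- the number of edges on a path whose label is not strictly larger than a given label -/
  | pathNotAbove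
  /-- the number of edges on a path whose label is strictly smaller than a given label -/
  | pathBelow
  /-- the number of edges on a path with a given label -/
  | pathSame
  /-- whether an edge is on a path -/
  | pathHas
  /-- `BagTree.edge` -/
  | edge
  /-- `BagTree.head` -/
  | head
  /-- the nodes of a flower -/
  | node
  /-- the vertices of a flower -/
  | vertex
  /-- whether a number of a flower is canonical -/
  | canon
  /-- whether two flowers have the same vertices -/
  | equal
  /-- whether a number is the smallest one for the vertex set of its flower -/
  | first
  /-- the smallest number of a flower with the same vertices -/
  | rep
  /-- the root of a flower -/
  | top
  /-- the number of vertices of a flower -/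
  | size
  /-- the factorials -/
  | fact

namespace Table

/-- The number of the array that holds a table. -/
def array : Table → ℕ
  | lab => 20
  | labSize => 21
  | bagSize => 22
  | labDiff => 23
  | labBag => 24
  | pathNotAbove => 25
  | pathBelow => 26
  | pathSame => 27
  | pathHas => 28
  | edge => 29
  | head => 30
  | node => 31
  | vertex => 32
  | canon => 33
  | equal => 34
  | first => 35
  | rep => 36
  | top => 37
  | size => 38
  | fact => 39

/-- An entry of a table, as an expression. -/
def entry (T : Table) (e : Expr) : Expr := .get T.array e

@[simp] theorem eval_entry {mem : ℕ → ℕ → ℕ} {T : Table} {e : Expr} :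
    (T.entry e).eval mem = mem T.array (e.eval mem) := (rfl)

@[simp] theorem cost_entry {T : Table} {e : Expr} : (T.entry e).cost = e.cost + 1 := rfl

open Classical in
/-- The content of a table. -/
def Spec {n : ℕ} (t : BagTree (Fin n)) (T : Table) (a : ℕ → ℕ) : Prop :=
  match T with
  | lab => ∀ j < t.size, ∀ u < n, a (j * n + u) = ind (t.lab j) u
  | labSize => ∀ j < t.size, a j = (t.lab j).ncard
  | bagSize => ∀ j < t.size, a j = (t.bag j).ncard
  | labDiff => ∀ j < t.size, ∀ e < t.size, a (j * t.size + e) = (t.lab j \ t.lab e).ncard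
  | labBag => ∀ j < t.size, ∀ v < t.size, a (j * t.size + v) = (t.lab j \ t.bag v).ncard
  | pathNotAbove => ∀ j < t.size, ∀ x < t.size, ∀ y < t.size, a ((j * t.size + x) * t.size + y) =
      ((t.path x y).filter fun e => ¬ t.lab j ⊂ t.lab e).card
  | pathBelow => ∀ j < t.size, ∀ x < t.size, ∀ y < t.size, a ((j * t.size + x) * t.size + y) =
      ((t.path x y).filter fun e => t.lab e ⊂ t.lab j).card
  | pathSame => ∀ j < t.size, ∀ x < t.size, ∀ y < t.size, a ((j * t.size + x) * t.size + y) =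
      ((t.path x y).filter fun e => t.lab e = t.lab j).card
  | pathHas => ∀ j < t.size, ∀ x < t.size, ∀ y < t.size, a ((j * t.size + x) * t.size + y) =
      ((t.path x y).filter fun e => e = j).card
  | edge => ∀ d < 2 * t.size, a d = t.edge d
  | head => ∀ d < 2 * t.size, a d = t.head d
  | node => ∀ d < 2 * t.size, ∀ w < t.size, a (d * t.size + w) =
      if w ∈ 𝓚[t, d] then 1 else 0
  | vertex => ∀ d < 2 * t.size, ∀ u < n, a (d * n + u) = ind 𝓕[t, d] u
  | canon => ∀ d < 2 * t.size, a d = if t.Canon d then 1 else 0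
  | equal => ∀ d < 2 * t.size, ∀ d' < 2 * t.size, a (d * (2 * t.size) + d') =
      if 𝓕[t, d] = 𝓕[t, d'] then 1 else 0
  | first => ∀ d < 2 * t.size, a d = if ∀ d' < d, 𝓕[t, d] ≠
      𝓕[t, d'] then 1 else 0
  | rep => ∀ d < 2 * t.size, IsLeast {d' | 𝓕[t, d] =
      𝓕[t, d']} (a d)
  | top => ∀ d < 2 * t.size, IsLeast {w | w ∈ 𝓚[t, d]} (a d)
  | size => ∀ d < 2 * t.size, a d = 𝓕[t, d].ncard
  | fact => ∀ i ≤ n, a i = i.factorial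

/-- The number of vertices. -/
abbrev eN : Expr := .var aN

/-- The number of nodes of the clique tree. -/
abbrev eSize : Expr := .var aSize

/-- Fills the table of the numbers of edges on paths with a property: `W` is an expression for the
property of an edge. -/
def pathCmd (T : Table) (W : Expr → Expr) : Cmd :=
  fill T.array eSize eSize eSize 0 0
    (.lt (.var rK) (.var rJ) * (W (.var rJ) +
        T.entry ((.var rI * eSize + .get aPar (.var rJ)) * eSize + .var rK)) +
      .lt (.var rJ) (.var rK) * (W (.var rK) +
        T.entry ((.var rI * eSize + .var rJ) * eSize + .get aPar (.var rK))))

/-- The command that computes a table. -/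
def cmd : Table → Cmd
  | lab => fill lab.array 1 eSize eN 0 0 (.lt 0 (.var rJ) *
      (.get aBag (.var rJ * eN + .var rK) * .get aBag (.get aPar (.var rJ) * eN + .var rK)))
  | labSize => fill labSize.array 1 1 eSize eN (lab.entry (.var rK * eN + .var rU)) (.var rAcc)
  | bagSize => fill bagSize.array 1 1 eSize eN (.get aBag (.var rK * eN + .var rU)) (.var rAcc)
  | labDiff => fill labDiff.array 1 eSize eSize eN (lab.entry (.var rJ * eN + .var rU) *
      (1 - lab.entry (.var rK * eN + .var rU))) (.var rAcc)
  | labBag => fill labBag.array 1 eSize eSize eN (lab.entry (.var rJ * eN + .var rU) *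
      (1 - .get aBag (.var rK * eN + .var rU))) (.var rAcc)
  | pathNotAbove => pathCmd pathNotAbove fun e =>
      1 - .eq (labDiff.entry (.var rI * eSize + e)) 0 * .lt 0 (labDiff.entry (e * eSize + .var rI))
  | pathBelow => pathCmd pathBelow fun e =>
      .eq (labDiff.entry (e * eSize + .var rI)) 0 * .lt 0 (labDiff.entry (.var rI * eSize + e))
  | pathSame => pathCmd pathSame fun e =>
      .eq (labDiff.entry (e * eSize + .var rI)) 0 * .eq (labDiff.entry (.var rI * eSize + e)) 0
  | pathHas => pathCmd pathHas fun e => .eq e (.var rI)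
  | edge => fill edge.array 1 1 (2 * eSize) 0 0 (.lt (.var rK) eSize * .var rK +
      (1 - .lt (.var rK) eSize) * (.var rK - eSize))
  | head => fill head.array 1 1 (2 * eSize) 0 0 (.lt (.var rK) eSize * .var rK +
      (1 - .lt (.var rK) eSize) * .get aPar (.var rK - eSize))
  | node => fill node.array 1 (2 * eSize) eSize 0 0 (.eq (pathNotAbove.entry
      ((edge.entry (.var rJ) * eSize + head.entry (.var rJ)) * eSize + .var rK)) 0)
  | vertex => fill vertex.array 1 (2 * eSize) eN eSize (node.entry (.var rJ * eSize + .var rU) *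
      (.get aBag (.var rU * eN + .var rK) * (1 - lab.entry (edge.entry (.var rJ) * eN + .var rK))))
      (.lt 0 (.var rAcc))
  | canon => fill canon.array 1 1 (2 * eSize) (2 * eSize) (.lt (.var rU) (.var rK) *
      (.eq (labDiff.entry (edge.entry (.var rK) * eSize + edge.entry (.var rU))) 0 *
        .eq (labDiff.entry (edge.entry (.var rU) * eSize + edge.entry (.var rK))) 0 *
        node.entry (.var rK * eSize + head.entry (.var rU)))) (.eq (.var rAcc) 0)
  | equal => fill equal.array 1 (2 * eSize) (2 * eSize) eN
      (1 - .eq (vertex.entry (.var rJ * eN + .var rU)) (vertex.entry (.var rK * eN + .var rU)))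
      (.eq (.var rAcc) 0)
  | first => fill first.array 1 1 (2 * eSize) (2 * eSize) (.lt (.var rU) (.var rK) *
      equal.entry (.var rK * (2 * eSize) + .var rU)) (.eq (.var rAcc) 0)
  | rep => fill rep.array 1 1 (2 * eSize) (2 * eSize)
      (equal.entry (.var rK * (2 * eSize) + .var rU) * first.entry (.var rU) * .var rU) (.var rAcc)
  | top => fill top.array 1 1 (2 * eSize) eSize (node.entry (.var rK * eSize + .var rU) *
      (1 - node.entry (.var rK * eSize + .get aPar (.var rU))) * .var rU) (.var rAcc)
  | size => fill size.array 1 1 (2 * eSize) eN (vertex.entry (.var rK * eN + .var rU)) (.var rAcc)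
  | fact => fill fact.array 1 1 (eN + 1) 0 0
      (.eq (.var rK) 0 + .var rK * fact.entry (.var rK - 1))

/-- The clique tree `t` is stored in the memory. -/
structure Stored {n : ℕ} (t : BagTree (Fin n)) (mem : ℕ → ℕ → ℕ) : Prop where
  card : mem aN 0 = n
  size : mem aSize 0 = t.size
  par : ∀ j < t.size, mem aPar j = t.par j
  bag : ∀ j < t.size, ∀ u < n, mem aBag (j * n + u) = ind (t.bag j) u

/-- The tables before `T` have been computed. -/
def Known {n : ℕ} (t : BagTree (Fin n)) (mem : ℕ → ℕ → ℕ) (T : Table) : Prop :=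
  ∀ T' : Table, T'.array < T.array → T'.Spec t (mem T'.array)

theorem array_bounds (T : Table) : 20 ≤ T.array ∧ T.array < 60 := by
  cases T <;> simp [array]

theorem array_not_mem_scratch (T : Table) : T.array ∉ scratch := by
  have := T.array_bounds.2
  simp only [not_mem_scratch]
  omega

section

variable {n : ℕ} {t : BagTree (Fin n)} {procs : List Cmd} {s : MachineState}

theorem Stored.frame {mem mem' : ℕ → ℕ → ℕ} (h : Stored t mem) (hf : ∀ a < 20, mem' a = mem a) :
    Stored t mem' := by
  refine ⟨?_, ?_, ?_, ?_⟩
  · rw [hf _ (by simp)]; exact h.card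
  · rw [hf _ (by simp)]; exact h.size
  · rw [hf _ (by simp)]; exact h.par
  · rw [hf _ (by simp)]; exact h.bag

theorem Known.frame {mem mem' : ℕ → ℕ → ℕ} {T : Table} (h : Known t mem T)
    (hf : ∀ a, 20 ≤ a → a < T.array → mem' a = mem a) : Known t mem' T := fun T' hT' => by
  rw [hf _ T'.array_bounds.1 hT']; exact h T' hT'

theorem frame_of_fill {T : Table} {mem mem' : ℕ → ℕ → ℕ}
    (hf : ∀ a, a ≠ T.array → a ∉ scratch → mem' a = mem a) (hs : Stored t mem)
    (hk : Known t mem T) : Stored t mem' ∧ Known t mem' T := by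
  have h := T.array_bounds
  constructor
  · refine hs.frame fun a ha => hf a (by omega) ?_
    simp only [not_mem_scratch]
    omega
  · refine hk.frame fun a ha ha' => hf a (by omega) ?_
    simp only [not_mem_scratch]
    omega

/-- The rule for tables with at most two indices. -/
theorem wp_fill_pair (T : Table) {M L S e g : Expr} {m l p : ℕ} (w : ℕ → ℕ → ℕ → ℕ)
    (f : ℕ → ℕ → ℕ) (hs : Stored t s.mem) (hk : Known t s.mem T)
    (hr : ∀ a ∈ M.reads ++ L.reads ++ S.reads, a = aN ∨ a = aSize ∨ a = 0)
    (hM : M.eval s.mem = m) (hL : L.eval s.mem = l) (hS : S.eval s.mem = p) (hm0 : 1 ≤ m)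
    (hl0 : 1 ≤ l)
    (he : ∀ mem, Stored t mem → Known t mem T → ∀ j k u, j < m → k < l → u < p → mem rJ 0 = j →
      mem rK 0 = k → mem rU 0 = u → e.eval mem = w j k u)
    (hg : ∀ mem, Stored t mem → Known t mem T → ∀ j k, j < m → k < l → mem rJ 0 = j →
      mem rK 0 = k → mem rAcc 0 = ∑ u ∈ Finset.range p, w j k u →
      (∀ k' < k, mem T.array (j * l + k') = f j k') → g.eval mem = f j k)
    {c q : ℕ} (hc : 8 * fillCost 1 M L S e g + 100 ≤ c) (hq : m * l * (p + 1) ≤ q) :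
    WP procs (fill T.array 1 M L S e g) s (c * q)
      fun s' => ∀ j k, j < m → k < l → s'.mem T.array (j * l + k) = f j k := by
  refine (wp_fill (N := 1) (n := 1) (fun _ => w) (fun _ => f) T.array_not_mem_scratch ?_ rfl hM
    hL hS le_rfl hm0
    hl0 ?_ ?_).mono ?_ ?_
  · have h := T.array_bounds
    intro a ha
    have : a = aN ∨ a = aSize ∨ a = 0 := hr a (by simpa [Expr.reads] using ha)
    refine ⟨by omega, ?_⟩
    simp only [not_mem_scratch]
    omega
  · intro s' hf i j k u _ hj hk' hu _ hsj hsk hsu _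
    obtain ⟨h1, h2⟩ := frame_of_fill hf hs hk
    exact he _ h1 h2 j k u hj hk' hu hsj hsk hsu
  · intro s' hf i j k hi hj hk' hsi hsj hsk hacc hbef
    obtain ⟨h1, h2⟩ := frame_of_fill hf hs hk
    refine hg _ h1 h2 j k hj hk' hsj hsk hacc fun k' hk'' => ?_
    obtain rfl : i = 0 := by omega
    have := hbef 0 j k' hj (by omega) (.inr ⟨rfl, .inr ⟨rfl, hk''⟩⟩)
    simpa using this
  · rw [one_mul]
    exact Nat.mul_le_mul hc hq
  · intro s' h j k hj hk'
    simpa using h 0 j k Nat.zero_lt_one hj hk'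

open Classical in
/-- The table of the numbers of edges on paths is filled from the ends of a path upwards. -/
theorem wp_pathCmd (T : Table) {W : Expr → Expr} (P : ℕ → ℕ → Prop)
    (hpar : ∀ j, 0 < j → t.par j < j) (h0 : 1 ≤ t.size)
    (hs : Stored t s.mem) (hk : Known t s.mem T)
    (hW : ∀ mem, Stored t mem → Known t mem T → ∀ j < t.size, mem rI 0 = j → ∀ e < t.size,
      ∀ E : Expr, E.eval mem = e → (W E).eval mem = if P j e then 1 else 0)
    {c q : ℕ} (hc : (W (.var rJ)).cost + (W (.var rK)).cost ≤ c)
    (hq : t.size * t.size * t.size ≤ q) :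
    WP procs (pathCmd T W) s ((8 * c + 600) * q)
      fun s' => ∀ j < t.size, ∀ x < t.size, ∀ y < t.size,
        s'.mem T.array ((j * t.size + x) * t.size + y) =
          ((t.path x y).filter fun e => P j e).card := by
  have hr : ∀ a ∈ eSize.reads ++ eSize.reads ++ eSize.reads ++ (0 : Expr).reads,
      a ≠ T.array ∧ a ∉ scratch := by
    have h := T.array_bounds
    intro a ha
    have : a = aSize ∨ a = 0 := by
      rcases List.mem_append.1 ha with h | h
      · simp only [Expr.reads, List.mem_append, List.mem_cons,
          or_self] at h
        rcases h with h | h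
        · exact .inl h
        · exact absurd h List.not_mem_nil
      · exact absurd h List.not_mem_nil
    refine ⟨by omega, ?_⟩
    simp only [not_mem_scratch]
    omega
  refine (wp_fill (n := t.size) (m := t.size) (l := t.size) (p := 0) (fun _ _ _ _ => 0)
    (fun j x y => ((t.path x y).filter fun e => P j e).card) T.array_not_mem_scratch hr hs.size
    hs.size hs.size rfl h0 h0 h0 ?_ ?_).mono ?_ ?_
  · intros; omega
  · intro s' hf j x y hj hx hy hsj hsx hsy _ hbef
    obtain ⟨h1, h2⟩ := frame_of_fill hf hs hk
    have hWx := hW s'.mem h1 h2 j hj hsj x hx (.var rJ) (by simpa using hsx)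
    have hWy := hW s'.mem h1 h2 j hj hsj y hy (.var rK) (by simpa using hsy)
    simp only [eval_add, eval_mul, eval_lt, eval_get, eval_zero, hsx, hsy,
      hsj, hWx, hWy, eval_entry, h1.size]
    rcases lt_trichotomy x y with h | rfl | h
    · rw [if_neg h.asymm, if_pos h, h1.par y hy, pathEdges_card_lt hpar _ h,
        hbef j x (t.par y) hx ((hpar y (by omega)).trans hy)
          (.inr ⟨rfl, .inr ⟨rfl, hpar y (by omega)⟩⟩)]
      simp
    · simp
    · rw [if_neg h.asymm, if_pos h, h1.par x hx, pathEdges_card_gt hpar _ h,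
        hbef j (t.par x) y ((hpar x (by omega)).trans hx) hy
          (.inr ⟨rfl, .inl (hpar x (by omega))⟩)]
      simp
  · refine Nat.mul_le_mul ?_ (by simpa using hq)
    simp only [fillCost, eSize, Expr.cost_add, Expr.cost_mul, Expr.cost_lt, Expr.cost_get,
      Expr.cost_zero, cost_entry]
    omega
  · intro s' h j hj x hx y hy
    exact h j x y hj hx hy

end

end Table

namespace Table

section

variable {n : ℕ} {t : BagTree (Fin n)} {G : SimpleGraph (Fin n)} {procs : List Cmd}
  {s : MachineState}

theorem lab_pos {j : ℕ} (hj : 0 < j) : t.lab j = t.bag j ∩ t.bag (t.par j) := by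
  ext u
  simp [label, hj]

theorem _root_.CliquePicking.BagTree.IsFor.par_lt_size (T : t.IsFor G) {j : ℕ} (hj : j < t.size) :
    t.par j < t.size := by
  rcases Nat.eq_zero_or_pos j with rfl | h
  · rw [T.par_zero]; exact hj
  · exact (T.tree.par_lt j h).trans hj

/-- The command of the table `A` computes it in time `O(t.size ^ 2 * n)`. -/
abbrev Computes (t : BagTree (Fin n)) (procs : List Cmd) (s : MachineState) (A : Table) : Prop :=
  WP procs A.cmd s (2000 * (12 * (t.size * t.size * n))) fun s' => A.Spec t (s'.mem A.array)

theorem edge_lt {d : ℕ} (hd : d < 2 * t.size) : t.edge d < t.size := (BagTree.isEnd_of_lt hd).1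

theorem head_lt (T : t.IsFor G) {d : ℕ} (hd : d < 2 * t.size) : t.head d < t.size :=
  T.end_lt (BagTree.isEnd_of_lt hd)

theorem edge_eq {d : ℕ} : t.edge d =
    (if d < t.size then 1 else 0) * d + (1 - if d < t.size then 1 else 0) * (d - t.size) := by
  unfold BagTree.edge
  split_ifs <;> simp

theorem head_eq {d : ℕ} : t.head d = (if d < t.size then 1 else 0) * d +
    (1 - if d < t.size then 1 else 0) * t.par (d - t.size) := by
  unfold BagTree.head
  split_ifs <;> simp

theorem cube_le (hkn : t.size ≤ n) : t.size * t.size * t.size ≤ 12 * (t.size * t.size * n) := by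
  have := Nat.mul_le_mul_left (t.size * t.size) hkn
  omega

variable (T : t.IsFor G) (hkn : t.size ≤ n) (hs : Table.Stored t s.mem)

include T hkn hs

/-- The rule for tables with at most two indices, with the number of iterations compared with
`t.size ^ 2 * n`. -/
theorem wp_fill_pair' (A : Table) {M L S e g : Expr} {m l p : ℕ} (w : ℕ → ℕ → ℕ → ℕ)
    (f : ℕ → ℕ → ℕ) (hk : Known t s.mem A)
    (he : ∀ mem, Stored t mem → Known t mem A → ∀ j k u, j < m → k < l → u < p → mem rJ 0 = j →
      mem rK 0 = k → mem rU 0 = u → e.eval mem = w j k u)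
    (hg : ∀ mem, Stored t mem → Known t mem A → ∀ j k, j < m → k < l → mem rJ 0 = j →
      mem rK 0 = k → mem rAcc 0 = ∑ u ∈ Finset.range p, w j k u →
      (∀ k' < k, mem A.array (j * l + k') = f j k') → g.eval mem = f j k)
    (hr : ∀ a ∈ M.reads ++ L.reads ++ S.reads, a = aN ∨ a = aSize ∨ a = 0 := by simp [Expr.reads])
    (hD : s.mem aN 0 = n → s.mem aSize 0 = t.size →
      M.eval s.mem = m ∧ L.eval s.mem = l ∧ S.eval s.mem = p := by intro h1 h2; simp [h1, h2])
    (hm : 0 < t.size → 1 ≤ m ∧ 1 ≤ l ∧ m ≤ 2 * t.size := by omega)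
    (hdim : 0 < t.size → t.size ≤ n → l ≤ 2 * t.size ∧ p ≤ 2 * n ∨ l ≤ 2 * n ∧ p ≤ t.size :=
      by omega)
    (hc : fillCost 1 M L S e g ≤ 200 := by simp [fillCost]) :
    WP procs (fill A.array 1 M L S e g) s (2000 * (12 * (t.size * t.size * n)))
      fun s' => ∀ j k, j < m → k < l → s'.mem A.array (j * l + k) = f j k := by
  have hk0 := T.size_pos
  obtain ⟨hM, hL, hS⟩ := hD hs.card hs.size
  obtain ⟨hm0, hl0, hm⟩ := hm hk0
  refine wp_fill_pair A w f hs hk hr hM hL hS hm0 hl0 he hg (by omega) ?_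
  rcases hdim hk0 hkn with ⟨h1, h2⟩ | ⟨h1, h2⟩
  · calc m * l * (p + 1) ≤ 2 * t.size * (2 * t.size) * (3 * n) := by gcongr; omega
      _ = _ := by ring
  · calc m * l * (p + 1) ≤ 2 * t.size * (2 * n) * (2 * t.size) := by gcongr; omega
      _ ≤ _ := by nlinarith

open Classical in
theorem wp_pathLab (A : Table) {W : Expr → Expr} (P : ℕ → ℕ → Prop) (hk : Known t s.mem A)
    (hA : labDiff.array < A.array) (hc : (W (.var rJ)).cost + (W (.var rK)).cost ≤ 100)
    (hW : ∀ mem (E : Expr) j e,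
      (labDiff.entry (.var rI * eSize + E)).eval mem = (t.lab j \ t.lab e).ncard →
      (labDiff.entry (E * eSize + .var rI)).eval mem = (t.lab e \ t.lab j).ncard →
      (W E).eval mem = if P j e then 1 else 0) :
    WP procs (pathCmd A W) s (2000 * (12 * (t.size * t.size * n))) fun s' =>
      ∀ j < t.size, ∀ x < t.size, ∀ y < t.size,
        s'.mem A.array ((j * t.size + x) * t.size + y) =
          ((t.path x y).filter fun e => P j e).card := by
  refine (wp_pathCmd A P T.tree.par_lt T.size_pos hs hk (fun mem h1 h2 j hj hsj e he E hE =>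
    hW mem E j e ?_ ?_) hc (cube_le hkn)).mono (by gcongr; norm_num) fun _ h => h
  · simp [hsj, hE, h1.size, h2 labDiff hA j hj e he]
  · simp [hsj, hE, h1.size, h2 labDiff hA e he j hj]

theorem wp_lab (hk : Known t s.mem lab) : lab.Computes t procs s := by
  refine (wp_fill_pair' T hkn hs lab (m := t.size) (l := n) (p := 0) (fun _ _ _ => 0)
    (fun j u => ind (t.lab j) u) hk ?_ ?_).mono
    le_rfl fun s' h j hj u hu => h j u hj hu
  · intros; omega
  · intro mem h1 h2 j u hj hu hsj hsu _ _
    simp only [eval_mul, eval_lt, eval_zero, eval_get, eval_add, hsj, hsu,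
      h1.card, h1.par j hj, h1.bag j hj u hu, h1.bag _ (T.par_lt_size hj) u hu]
    split_ifs with h
    · rw [one_mul, ← ind_inter, ← lab_pos h]
    · obtain rfl : j = 0 := by omega
      rw [BagTree.IsFor.lab_zero]
      simp [ind]

theorem wp_labSize (hk : Known t s.mem labSize) : labSize.Computes t procs s := by
  refine (wp_fill_pair' T hkn hs labSize (m := 1) (l := t.size) (p := n)
    (fun _ j u => ind (t.lab j) u) (fun _ j => (t.lab j).ncard) hk ?_ ?_).mono
    le_rfl fun s' h j hj => by simpa using h 0 j Nat.one_pos hj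
  · intro mem h1 h2 _ j u _ hj hu _ hsj hsu
    simp only [eval_entry, eval_mul, eval_zero, eval_get, eval_add, hsj, hsu,
      h1.card, h2 lab (by simp [array]) j hj u hu]
  · intro mem h1 h2 _ j _ hj _ _ hacc _
    rw [eval_get, eval_zero, hacc, sum_ind]

theorem wp_bagSize (hk : Known t s.mem bagSize) : bagSize.Computes t procs s := by
  refine (wp_fill_pair' T hkn hs bagSize (m := 1) (l := t.size) (p := n)
    (fun _ j u => ind (t.bag j) u) (fun _ j => (t.bag j).ncard) hk ?_ ?_).mono
    le_rfl fun s' h j hj => by simpa using h 0 j Nat.one_pos hj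
  · intro mem h1 h2 _ j u _ hj hu _ hsj hsu
    simp only [eval_mul, eval_zero, eval_get, eval_add, hsj, hsu,
      h1.card, h1.bag j hj u hu]
  · intro mem h1 h2 _ j _ hj _ _ hacc _
    rw [eval_get, eval_zero, hacc, sum_ind]

theorem wp_labDiff (hk : Known t s.mem labDiff) : labDiff.Computes t procs s := by
  refine (wp_fill_pair' T hkn hs labDiff (m := t.size) (l := t.size) (p := n)
    (fun j e u => ind (t.lab j \ t.lab e) u) (fun j e => (t.lab j \ t.lab e).ncard) hk ?_ ?_).mono
    le_rfl fun s' h j hj e he => h j e hj he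
  · intro mem h1 h2 j e u hj he hu hsj hse hsu
    simp only [eval_entry, eval_mul, eval_zero, eval_get, eval_add, hsj, hsu,
      hse, h1.card, h2 lab (by simp [array]) j hj u hu, h2 lab (by simp [array]) e he u hu,
      eval_sub, eval_one, ind_sdiff]
  · intro mem h1 h2 j e hj he _ _ hacc _
    rw [eval_get, eval_zero, hacc, sum_ind]

theorem wp_labBag (hk : Known t s.mem labBag) : labBag.Computes t procs s := by
  refine (wp_fill_pair' T hkn hs labBag (m := t.size) (l := t.size) (p := n)
    (fun j e u => ind (t.lab j \ t.bag e) u) (fun j e => (t.lab j \ t.bag e).ncard) hk ?_ ?_).mono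
    le_rfl fun s' h j hj e he => h j e hj he
  · intro mem h1 h2 j e u hj he hu hsj hse hsu
    simp only [eval_entry, eval_mul, eval_zero, eval_get, eval_add, hsj, hsu,
      hse, h1.card, h2 lab (by simp [array]) j hj u hu, h1.bag e he u hu,
      eval_sub, eval_one, ind_sdiff]
  · intro mem h1 h2 j e hj he _ _ hacc _
    rw [eval_get, eval_zero, hacc, sum_ind]

theorem wp_pathNotAbove (hk : Known t s.mem pathNotAbove) : pathNotAbove.Computes t procs s := by
  simp only [Computes, cmd]
  refine (wp_pathLab T hkn hs pathNotAbove (fun j e => ¬ t.lab j ⊂ t.lab e) hk (by simp [array]) ?_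
    fun mem E j e h1 h2 => ?_).mono le_rfl ?_
  · simp
  · have h3 : (t.lab j \ t.lab e).ncard = 0 ↔ t.lab j ⊆ t.lab e := ncard_sdiff_eq_zero
    have h4 : (t.lab e \ t.lab j).ncard = 0 ↔ t.lab e ⊆ t.lab j := ncard_sdiff_eq_zero
    simp only [eval_sub, eval_one, eval_mul, eval_eq, eval_lt]
    rw [h1, h2, eval_zero]
    split_ifs <;> simp_all [Set.ssubset_def, Nat.pos_iff_ne_zero]
  · intro s' h j hj x hx y hy
    convert h j hj x hx y hy

theorem wp_pathBelow (hk : Known t s.mem pathBelow) : pathBelow.Computes t procs s := by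
  simp only [Computes, cmd]
  refine (wp_pathLab T hkn hs pathBelow (fun j e => t.lab e ⊂ t.lab j) hk (by simp [array]) ?_
    fun mem E j e h1 h2 => ?_).mono le_rfl ?_
  · simp
  · have h3 : (t.lab j \ t.lab e).ncard = 0 ↔ t.lab j ⊆ t.lab e := ncard_sdiff_eq_zero
    have h4 : (t.lab e \ t.lab j).ncard = 0 ↔ t.lab e ⊆ t.lab j := ncard_sdiff_eq_zero
    simp only [eval_mul, eval_eq, eval_lt]
    rw [h1, h2, eval_zero]
    split_ifs <;> simp_all [Set.ssubset_def, Nat.pos_iff_ne_zero]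
  · intro s' h j hj x hx y hy
    convert h j hj x hx y hy

theorem wp_pathSame (hk : Known t s.mem pathSame) : pathSame.Computes t procs s := by
  simp only [Computes, cmd]
  refine (wp_pathLab T hkn hs pathSame (fun j e => t.lab e = t.lab j) hk (by simp [array]) ?_
    fun mem E j e h1 h2 => ?_).mono le_rfl ?_
  · simp
  · have h3 : (t.lab j \ t.lab e).ncard = 0 ↔ t.lab j ⊆ t.lab e := ncard_sdiff_eq_zero
    have h4 : (t.lab e \ t.lab j).ncard = 0 ↔ t.lab e ⊆ t.lab j := ncard_sdiff_eq_zero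
    simp only [eval_mul, eval_eq]
    rw [h1, h2, eval_zero]
    split_ifs <;> simp_all [Set.Subset.antisymm_iff]
  · intro s' h j hj x hx y hy
    convert h j hj x hx y hy

theorem wp_pathHas (hk : Known t s.mem pathHas) : pathHas.Computes t procs s := by
  simp only [Computes, cmd]
  refine (wp_pathCmd pathHas (fun j e => e = j) T.tree.par_lt T.size_pos hs hk
    ?_ (c := 100) ?_ (cube_le hkn)).mono ?_ fun s' h => ?_
  · intro mem h1 h2 j hj hsj e he E hE
    simp only [eval_eq]
    rw [hE, eval_get, eval_zero, hsj]
    congr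
  · simp
  · gcongr; norm_num
  · intro j hj x hx y hy
    convert h j hj x hx y hy

theorem wp_edge (hk : Known t s.mem edge) : edge.Computes t procs s := by
  refine (wp_fill_pair' T hkn hs edge (m := 1) (l := 2 * t.size) (p := 0)
    (fun _ _ _ => 0) (fun _ d => t.edge d) hk ?_ ?_).mono
    le_rfl fun s' h j hj => by simpa using h 0 j Nat.one_pos hj
  · intros; omega
  · intro mem h1 h2 _ d _ hd _ hsd _ _
    simp [hsd, h1.size, edge_eq]

theorem wp_head (hk : Known t s.mem head) : head.Computes t procs s := by
  refine (wp_fill_pair' T hkn hs head (m := 1) (l := 2 * t.size) (p := 0)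
    (fun _ _ _ => 0) (fun _ d => t.head d) hk ?_ ?_).mono
    le_rfl fun s' h j hj => by simpa using h 0 j Nat.one_pos hj
  · intros; omega
  · intro mem h1 h2 _ d _ hd _ hsd _ _
    simp [hsd, h1.size, head_eq, h1.par (d - t.size) (by omega)]

theorem wp_node (hk : Known t s.mem node) : node.Computes t procs s := by
  classical
  refine (wp_fill_pair' T hkn hs node (m := 2 * t.size) (l := t.size) (p := 0)
    (fun _ _ _ => 0) (fun d w => if w ∈ 𝓚[t, d] then 1 else 0) hk ?_ ?_).mono
    le_rfl fun s' h d hd w hw => ?_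
  · intros; omega
  · intro mem h1 h2 d w hd hw hsd hsw _ _
    simp only [eval_eq, eval_zero, eval_get, eval_entry, eval_add,
      eval_mul, hsd, hsw, h1.size, h2 edge (by simp [array]) d hd,
      h2 head (by simp [array]) d hd, h2 pathNotAbove (by simp [array]) _ (edge_lt hd) _
      (head_lt T hd) w hw, Finset.card_eq_zero, Finset.filter_eq_empty_iff, BagTree.mem_nodes, hw,
      not_not, true_and]
  · rw [h d w hd hw]

theorem wp_vertex (hk : Known t s.mem vertex) : vertex.Computes t procs s := by
  classical
  refine (wp_fill_pair' T hkn hs vertex (m := 2 * t.size) (l := n) (p := t.size)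
    (fun d u w => if w ∈ 𝓚[t, d] ∧ ind (t.bag w \ t.lab (t.edge d)) u = 1
      then 1 else 0)
    (fun d u => ind 𝓕[t, d] u) hk ?_ ?_).mono
    le_rfl fun s' h d hd u hu => h d u hd hu
  · intro mem h1 h2 d u w hd hu hw hsd hsu hsw
    simp only [eval_zero, eval_get, eval_entry, eval_add, eval_sub,
      eval_one, eval_mul, hsd, hsw, hsu, h1.size, h1.card, h2 edge (by simp [array]) d hd,
      h2 node (by simp [array]) d hd w hw, h1.bag w hw u hu,
      h2 lab (by simp [array]) _ (edge_lt hd) u hu, ← ind_sdiff]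
    by_cases h : w ∈ 𝓚[t, d]
    · simp only [h, if_true, one_mul, true_and]
      lift u to Fin n using hu
      simp only [ind_fin]
      split_ifs <;> simp_all
    · simp [h]
  · intro mem h1 h2 d u hd hu hsd hsu hacc _
    simp only [eval_lt, eval_zero, eval_get, hacc, Finset.sum_boole, Nat.cast_id,
      Finset.card_pos]
    lift u to Fin n using hu
    simp only [ind_fin]
    congr 1
    rw [eq_iff_iff]
    simp only [Finset.Nonempty, Finset.mem_filter, Finset.mem_range]
    constructor
    · rintro ⟨w, hw, h, h'⟩
      by_contra hne
      rw [if_neg fun h'' : u ∈ t.bag w \ t.lab (t.edge d) => hne ⟨w, h, h''⟩] at h'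
      exact zero_ne_one h'
    · rintro ⟨w, hw, h⟩
      exact ⟨w, (BagTree.mem_nodes.1 hw).1, hw, if_pos h⟩

theorem wp_canon (hk : Known t s.mem canon) : canon.Computes t procs s := by
  classical
  refine (wp_fill_pair' T hkn hs canon (m := 1) (l := 2 * t.size) (p := 2 * t.size)
    (fun _ d d' => if d' < d ∧ t.Same (t.edge d) (t.head d) (t.edge d') (t.head d') then 1 else 0)
    (fun _ d => if t.Canon d then 1 else 0) hk ?_ ?_).mono
    le_rfl fun s' h d hd => ?_
  · intro mem h1 h2 _ d d' _ hd hd' _ hsd hsd'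
    have hD := h2 labDiff (by simp [array])
    simp only [eval_zero, eval_get, eval_entry, eval_add, eval_lt, eval_eq,
      eval_mul, hsd, hsd', h1.size, h2 edge (by simp [array]) d hd,
      h2 edge (by simp [array]) d' hd', h2 head (by simp [array]) d' hd',
      h2 node (by simp [array]) d hd _ (head_lt T hd'), hD _ (edge_lt hd) _ (edge_lt hd'),
      hD _ (edge_lt hd') _ (edge_lt hd), ncard_sdiff_eq_zero, BagTree.Same,
      Set.Subset.antisymm_iff]
    split_ifs <;> simp_all
  · intro mem h1 h2 _ d _ hd _ hsd hacc _
    simp only [eval_eq, eval_zero, eval_get, hacc, Finset.sum_boole, Nat.cast_id,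
      Finset.card_eq_zero, Finset.filter_eq_empty_iff, Finset.mem_range, BagTree.Canon]
    congr 1
    rw [eq_iff_iff]
    exact ⟨fun h d' hd' hs => h (hd'.trans hd) ⟨hd', hs⟩, fun h d' _ hs => h d' hs.1 hs.2⟩
  · have := h 0 d Nat.one_pos hd
    rw [zero_mul, zero_add] at this
    rw [this]

theorem wp_equal (hk : Known t s.mem equal) : equal.Computes t procs s := by
  classical
  refine (wp_fill_pair' T hkn hs equal (m := 2 * t.size) (l := 2 * t.size) (p := n)
    (fun d d' u => if ind 𝓕[t, d] u =
      ind 𝓕[t, d'] u then 0 else 1)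
    (fun d d' => if 𝓕[t, d] = 𝓕[t, d']
      then 1 else 0) hk ?_ ?_).mono
    le_rfl fun s' h d hd d' hd' => ?_
  · intro mem h1 h2 d d' u hd hd' hu hsd hsd' hsu
    simp only [eval_sub, eval_one, eval_zero, eval_get, eval_entry,
      eval_add, eval_eq, eval_mul, hsd, hsd', hsu, h1.card,
      h2 vertex (by simp [array]) d hd u hu, h2 vertex (by simp [array]) d' hd' u hu]
    split_ifs <;> simp
  · intro mem h1 h2 d d' hd hd' _ _ hacc _
    simp only [eval_eq, eval_zero, eval_get, hacc, Finset.sum_eq_zero_iff,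
      Finset.mem_range, ite_eq_left_iff, one_ne_zero, imp_false, not_not]
    congr 1
    rw [eq_iff_iff]
    constructor
    · intro h
      ext u
      have := h u u.2
      rw [← ind_eq_one_iff, ← ind_eq_one_iff (S := 𝓕[t, d']), this]
    · intro h u _
      rw [h]
  · rw [h d d' hd hd']

theorem wp_first (hk : Known t s.mem first) : first.Computes t procs s := by
  classical
  refine (wp_fill_pair' T hkn hs first (m := 1) (l := 2 * t.size) (p := 2 * t.size)
    (fun _ d d' => if d' < d ∧ 𝓕[t, d] = 𝓕[t, d']
      then 1 else 0)
    (fun _ d => if ∀ d' < d, 𝓕[t, d] ≠ 𝓕[t, d']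
      then 1 else 0) hk ?_ ?_).mono
    le_rfl fun s' h d hd => ?_
  · intro mem h1 h2 _ d d' _ hd hd' _ hsd hsd'
    simp only [eval_zero, eval_get, eval_entry, eval_add, eval_lt,
      eval_mul, eval_two, hsd, hsd', h1.size, h2 equal (by simp [array]) d hd d' hd']
    split_ifs <;> simp_all
  · intro mem h1 h2 _ d _ hd _ hsd hacc _
    simp only [eval_eq, eval_zero, eval_get, hacc, Finset.sum_boole, Nat.cast_id,
      Finset.card_eq_zero, Finset.filter_eq_empty_iff, Finset.mem_range]
    congr 1
    rw [eq_iff_iff]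
    exact ⟨fun h d' hd' hs => h (hd'.trans hd) ⟨hd', hs⟩, fun h d' _ hs => h d' hs.1 hs.2⟩
  · have := h 0 d Nat.one_pos hd
    rw [zero_mul, zero_add] at this
    rw [this]

theorem wp_rep (hk : Known t s.mem rep) : rep.Computes t procs s := by
  classical
  have hex : ∀ d, ∃ d', 𝓕[t, d] = 𝓕[t, d'] :=
    fun d => ⟨d, rfl⟩
  refine (wp_fill_pair' T hkn hs rep (m := 1) (l := 2 * t.size) (p := 2 * t.size)
    (fun _ d d' => if d' = Nat.find (hex d) then d' else 0) (fun _ d => Nat.find (hex d)) hk ?_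
    ?_).mono le_rfl fun s' h d hd => ?_
  · intro mem h1 h2 _ d d' _ hd hd' _ hsd hsd'
    simp only [eval_zero, eval_get, eval_entry, eval_add,
      eval_mul, eval_two, hsd, hsd', h1.size, h2 equal (by simp [array]) d hd d' hd',
      h2 first (by simp [array]) d' hd']
    by_cases h : d' = Nat.find (hex d)
    · have h3 := Nat.find_spec (hex d)
      rw [← h] at h3
      rw [if_pos h, if_pos h3, if_pos fun d'' hd'' => ?_, one_mul, one_mul]
      rw [← h3]
      exact Nat.find_min (hex d) (h ▸ hd'')
    · rw [if_neg h]
      split_ifs with h3 h4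
      · exfalso
        have h5 : Nat.find (hex d) < d' :=
          lt_of_le_of_ne (Nat.find_min' (hex d) h3) (Ne.symm h)
        exact h4 _ h5 (h3.symm.trans (Nat.find_spec (hex d)))
      all_goals simp
  · intro mem h1 h2 _ d _ hd _ hsd hacc _
    have : Nat.find (hex d) < 2 * t.size := (Nat.find_min' (hex d) rfl).trans_lt hd
    rw [eval_get, eval_zero, hacc, Finset.sum_ite_eq' , if_pos (Finset.mem_range.2 this)]
  · have := h 0 d Nat.one_pos hd
    rw [zero_mul, zero_add] at this
    rw [this]
    exact ⟨Nat.find_spec (hex d), fun d' hd' => Nat.find_min' (hex d) hd'⟩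

theorem wp_top (hk : Known t s.mem top) : top.Computes t procs s := by
  classical
  have hex : ∀ d, ∃ r, d < 2 * t.size → r ∈ 𝓚[t, d] ∧
      ∀ w ∈ 𝓚[t, d], r ≤ w := fun d => by
    by_cases hd : d < 2 * t.size
    · obtain ⟨r, h1, h2⟩ := T.exists_root (BagTree.isEnd_of_lt hd)
      exact ⟨r, fun _ => ⟨h1, h2⟩⟩
    · exact ⟨0, fun h => absurd h hd⟩
  choose r hr using hex
  refine (wp_fill_pair' T hkn hs top (m := 1) (l := 2 * t.size) (p := t.size)
    (fun _ d w => if w = r d then w else 0) (fun _ d => r d) hk ?_ ?_).mono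
    le_rfl fun s' h d hd => ?_
  · intro mem h1 h2 _ d w _ hd hw _ hsd hsw
    simp only [eval_zero, eval_get, eval_entry, eval_add, eval_sub,
      eval_one, eval_mul, hsd, hsw, h1.size, h1.par w hw,
      h2 node (by simp [array]) d hd w hw, h2 node (by simp [array]) d hd _ (T.par_lt_size hw)]
    obtain ⟨hrd, hmin⟩ := hr d hd
    have : Nonempty (Fin n) := ⟨⟨0, T.size_pos.trans_le hkn⟩⟩
    by_cases h : w = r d
    · subst h
      rw [if_pos rfl, if_pos hrd, one_mul]
      rcases Nat.eq_zero_or_pos (r d) with h0 | h0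
      · rw [h0, mul_zero]
      · rw [if_neg fun hp => absurd (hmin _ hp) (not_le.2 (T.tree.par_lt _ h0)), Nat.sub_zero,
          one_mul]
    · rw [if_neg h]
      by_cases hwF : w ∈ 𝓚[t, d]
      · rw [if_pos ((T.flowerTree (BagTree.isEnd_of_lt hd) hrd hmin).par_mem w hwF h)]
        simp
      · rw [if_neg hwF]; simp
  · intro mem h1 h2 _ d _ hd _ hsd hacc _
    rw [eval_get, eval_zero, hacc, Finset.sum_ite_eq',
      if_pos (Finset.mem_range.2 (BagTree.mem_nodes.1 (hr d hd).1).1)]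
  · have := h 0 d Nat.one_pos hd
    rw [zero_mul, zero_add] at this
    rw [this]
    exact hr d hd

theorem wp_size (hk : Known t s.mem size) : size.Computes t procs s := by
  refine (wp_fill_pair' T hkn hs size (m := 1) (l := 2 * t.size) (p := n)
    (fun _ d u => ind 𝓕[t, d] u)
    (fun _ d => 𝓕[t, d].ncard) hk ?_ ?_).mono
    le_rfl fun s' h j hj => by simpa using h 0 j Nat.one_pos hj
  · intro mem h1 h2 _ d u _ hd hu _ hsd hsu
    simp only [eval_entry, eval_mul, eval_zero, eval_get, eval_add, hsd, hsu,
      h1.card, h2 vertex (by simp [array]) d hd u hu]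
  · intro mem h1 h2 _ j _ hj _ _ hacc _
    rw [eval_get, eval_zero, hacc, sum_ind]

theorem wp_fact (hk : Known t s.mem fact) : fact.Computes t procs s := by
  refine (wp_fill_pair' T hkn hs fact (m := 1) (l := n + 1) (p := 0)
    (fun _ _ _ => 0) (fun _ i => i.factorial) hk ?_ ?_).mono le_rfl
    fun s' h j hj => by simpa using h 0 j Nat.one_pos (Nat.lt_succ_of_le hj)
  · intros; omega
  · intro mem h1 h2 j i hj hi _ hsi _ hbef
    obtain rfl : j = 0 := by omega
    simp only [eval_entry, eval_add, eval_eq, eval_mul, eval_get,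
      eval_zero, eval_sub, eval_one, hsi]
    rcases Nat.eq_zero_or_pos i with rfl | h
    · simp
    · have := hbef (i - 1) (by omega)
      rw [zero_mul, zero_add] at this
      rw [this, if_neg h.ne', zero_add, Nat.mul_factorial_pred h.ne']

/-- A table is computed correctly from the tables that precede it. -/
theorem wp_cmd (A : Table) (hk : Known t s.mem A) : A.Computes t procs s := by
  cases A
  exacts [wp_lab T hkn hs hk, wp_labSize T hkn hs hk, wp_bagSize T hkn hs hk,
    wp_labDiff T hkn hs hk, wp_labBag T hkn hs hk, wp_pathNotAbove T hkn hs hk,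
    wp_pathBelow T hkn hs hk, wp_pathSame T hkn hs hk, wp_pathHas T hkn hs hk,
    wp_edge T hkn hs hk, wp_head T hkn hs hk, wp_node T hkn hs hk, wp_vertex T hkn hs hk,
    wp_canon T hkn hs hk, wp_equal T hkn hs hk, wp_first T hkn hs hk, wp_rep T hkn hs hk,
    wp_top T hkn hs hk, wp_size T hkn hs hk, wp_fact T hkn hs hk]

end

end Table

namespace Table

/-- The tables in the order in which they are computed. -/
def all : List Table :=
  [lab, labSize, bagSize, labDiff, labBag, pathNotAbove, pathBelow, pathSame, pathHas, edge, head,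
    node, vertex, canon, equal, first, rep, top, size, fact]

theorem mem_all (A : Table) : A ∈ all := by cases A <;> simp [all]

theorem all_pairwise : all.Pairwise fun A B => A.array < B.array := by simp [all, array]

/-- The command that computes the tables of a list. -/
def build : List Table → Cmd
  | [] => .skip
  | A :: L => .seq A.cmd (build L)

theorem cmd_plain (A : Table) : A.cmd.Plain := by cases A <;> exact fill_plain

theorem mem_writes_cmd {A : Table} {a : ℕ} (ha : a ≠ A.array) (has : a ∉ scratch) :
    a ∉ A.cmd.writes := by
  cases A <;> exact mem_writes_fill ha has

theorem array_injective {A B : Table} (h : A.array = B.array) : A = B := by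
  cases A <;> cases B <;> first | rfl | simp [array] at h

theorem wp_build {n : ℕ} {t : BagTree (Fin n)} {G : SimpleGraph (Fin n)} {procs : List Cmd}
    (T : t.IsFor G) (hkn : t.size ≤ n) (L : List Table)
    (hL : L.Pairwise fun A B => A.array < B.array) (s : MachineState) (hs : Stored t s.mem)
    (hknown : ∀ A : Table, A ∉ L → A.Spec t (s.mem A.array)) :
    WP procs (build L) s (L.length * (2000 * (12 * (t.size * t.size * n))) + 1) fun s' =>
      Stored t s'.mem ∧ (∀ A : Table, A.Spec t (s'.mem A.array)) ∧ s'.out = s.out := by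
  induction L generalizing s with
  | nil => exact (WP.skip ⟨hs, fun A => hknown A (by simp), rfl⟩).mono (by simp) fun _ h => h
  | cons A L ih =>
    obtain ⟨hA, hL'⟩ := List.pairwise_cons.1 hL
    have hk : Known t s.mem A := fun B hB => hknown B fun hmem => by
      rcases List.mem_cons.1 hmem with rfl | h
      · exact lt_irrefl _ hB
      · exact lt_asymm hB (hA B h)
    refine (WP.seq (((wp_cmd T hkn hs A hk).frame A.cmd_plain).mono le_rfl
      (Q' := fun s' => WP procs (build L) s' (L.length * (2000 * (12 * (t.size * t.size * n))) + 1)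
        fun s'' => Stored t s''.mem ∧ (∀ A : Table, A.Spec t (s''.mem A.array)) ∧
          s''.out = s.out) ?_)).le ?_
    · rintro s' ⟨h1, h2, h3⟩
      have h4 : Stored t s'.mem := hs.frame fun a ha => h2 a <| by
        refine mem_writes_cmd ?_ ?_
        · have := A.array_bounds
          omega
        · simp only [not_mem_scratch]
          omega
      refine (ih hL' s' h4 fun B hB => ?_).mono le_rfl ?_
      · by_cases h : B = A
        · exact h ▸ h1
        · rw [h2 _ (mem_writes_cmd (fun h' => h (array_injective h')) B.array_not_mem_scratch)]
          exact hknown B (by simp [h, hB])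
      · rintro s'' ⟨h5, h6, h7⟩
        exact ⟨h5, h6, h7.trans h3⟩
    · rw [List.length_cons]
      ring_nf
      omega

end Table

/-! ### Vertex lists and the factors -/

-- Arrays for the vertex lists, the factors, the marked sizes and `prefixFree`, and loop variables.
local notation "aList" => (40 : ℕ)
local notation "aPhi" => (41 : ℕ)
local notation "aMark" => (42 : ℕ)
local notation "aFree" => (43 : ℕ)
local notation "rCnt" => (44 : ℕ)
local notation "rD" => (45 : ℕ)
local notation "rV" => (46 : ℕ)
local notation "rE" => (47 : ℕ)

/-- The clique tree and all tables are stored in the memory. -/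
structure Tables {n : ℕ} (t : BagTree (Fin n)) (mem : ℕ → ℕ → ℕ) : Prop extends
    Table.Stored t mem where
  table : ∀ A : Table, A.Spec t (mem A.array)

theorem Tables.frame {n : ℕ} {t : BagTree (Fin n)} {mem mem' : ℕ → ℕ → ℕ} (h : Tables t mem)
    (hf : ∀ a < 40, mem' a = mem a) : Tables t mem' where
  toStored := h.toStored.frame fun a ha => hf a (by omega)
  table A := by
    have : A.array < 40 := by cases A <;> simp [Table.array]
    rw [hf _ this]
    exact h.table A

open Table (eN eSize)

/-- The list of the vertices of a set, as numbers. -/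
noncomputable def vertexList {n : ℕ} (S : Set (Fin n)) : List ℕ :=
  (List.range n).filter fun u => ind S u ≠ 0

/-- The vertices of the flowers are stored in lists. -/
def VertexLists {n : ℕ} (t : BagTree (Fin n)) (mem : ℕ → ℕ → ℕ) : Prop :=
  ∀ d < 2 * t.size, ListAt (mem aList) (d * n) (vertexList 𝓕[t, d])

/-- Computes the lists of the vertices of the flowers. -/
def listsCmd : Cmd :=
  forLoop rD (2 * eSize) (.seq (.assign rCnt 0 0)
    (collect aList (.var rD * eN) rCnt rU eN (Table.vertex.entry (.var rD * eN + .var rU))))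

section

variable {n : ℕ} {t : BagTree (Fin n)} {G : SimpleGraph (Fin n)} {procs : List Cmd}
  {s : MachineState}

theorem length_vertexList_le (S : Set (Fin n)) : (vertexList S).length ≤ n :=
  (List.length_filter_le _ _).trans (by simp)

theorem listsCmd_plain : listsCmd.Plain := by simp [listsCmd, collect, Cmd.Plain]

theorem not_mem_writes_listsCmd {a : ℕ} (ha : a < 40) : a ∉ listsCmd.writes := by
  simp only [listsCmd, collect, Cmd.writes, writes_forLoop, List.mem_cons, List.mem_append,
    List.not_mem_nil, or_false, not_or]
  omega

theorem wp_listsCmd (h : Tables t s.mem) :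
    WP procs listsCmd s (2 * t.size * (60 * n + 100) + 20) fun s' => VertexLists t s'.mem := by
  refine (WP.loop_plain (n := 2 * t.size) (b := 60 * n + 20) (fun D s' => ∀ d < D,
    ListAt (s'.mem aList) (d * n) (vertexList 𝓕[t, d])) ?_ ?_ ?_ ?_ ?_ ?_
    ?_).le ?_
  · simp [collect, Cmd.Plain]
  · simp [collect, Cmd.writes]
  · simp [collect, Cmd.writes, Expr.reads, OfNat.ofNat]
  · simp [h.size]
  · simp
  · intro D hD s' hfr _ hsD hinv
    have hT : Tables t s'.mem := h.frame fun a ha => hfr a (by omega) (by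
      simp only [collect, Cmd.writes, writes_forLoop, List.mem_cons, List.mem_append,
        List.not_mem_nil, or_false, not_or]
      omega)
    refine (WP.seq (WP.assign ((wp_collect (n := n) (b := D * n)
      (fun u => ind 𝓕[t, D] u ≠ 0) [] (by simp) (by simp)
      (by simp) ?_ ?_ ?_ ?_ ?_ ?_).mono le_rfl ?_))).le ?_
    · simp [Expr.reads, OfNat.ofNat]
    · simp [hT.card]
    · simp [hT.card, hsD]
    · intro s'' hfr' u hu hsu
      have h1 : s''.mem Table.vertex.array = s'.mem Table.vertex.array := by
        rw [hfr' _ (by simp [Table.array]) (by simp [Table.array]) (by simp [Table.array]),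
          set_mem_of_ne (by simp [Table.array])]
      rw [Table.eval_entry, h1]
      simp only [eval_add, eval_mul, eval_get, eval_zero, hsu]
      rw [hfr' rD (by simp) (by simp) (by simp), hfr' aN (by simp) (by simp) (by simp),
        set_mem_of_ne (by simp), set_mem_of_ne (by simp), hsD, hT.card,
        hT.table .vertex D hD u hu]
    · simp
    · intro i hi
      simp at hi
    · rintro s'' ⟨-, h1, h2⟩ d hd
      rw [set_mem_of_ne (by simp)]
      rcases Nat.lt_succ_iff_lt_or_eq.1 hd with hd | rfl
      · intro i hi
        have hi' := hi.trans_le (length_vertexList_le _)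
        have h3 : d * n + i < D * n := by
          have := Nat.mul_le_mul_right n (Nat.succ_le_of_lt hd)
          rw [Nat.succ_mul] at this
          omega
        rw [h2 _ h3, set_mem_of_ne (by simp)]
        exact hinv d hd i hi
      · exact h1
    · simp
      omega
  · exact fun s' _ _ h => h
  · simp
    rw [mul_assoc, mul_assoc]
    have : t.size * (60 * n + 20 + 4 + 10) ≤ t.size * (60 * n + 100) :=
      Nat.mul_le_mul_left _ (by omega)
    omega

end

/-- The size of a clique in a flower, as an expression. -/
def cliqueSize (d v : Expr) : Expr :=
  Table.bagSize.entry v - Table.labSize.entry (Table.edge.entry d)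

/-- Whether the label of an edge is a forbidden prefix. -/
def isPrefix (d v e : Expr) : Expr :=
  Table.pathHas.entry ((e * eSize + Table.top.entry d) * eSize + v) *
    .eq (Table.labBag.entry (e * eSize + v)) 0

/-- Marks the sizes of the forbidden prefixes. -/
def markCmd : Cmd :=
  .seq (fill aMark 1 1 eN 0 0 0)
    (forLoop rE eSize (.ite (isPrefix (.var rD) (.var rV) (.var rE))
      (.assign aMark (Table.labSize.entry (.var rE) -
        Table.labSize.entry (Table.edge.entry (.var rD))) 1) .skip))

/-- Computes the values of `prefixFree`. -/
def freeCmd : Cmd :=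
  fill aFree 1 1 (cliqueSize (.var rD) (.var rV) + 1) (cliqueSize (.var rD) (.var rV))
    (.lt (.var rU) (.var rK) * (.get aMark (.var rU) *
      (Table.fact.entry (.var rK - .var rU) * .get aFree (.var rU))))
    (Table.fact.entry (.var rK) - .var rAcc)

/-- Computes the factors for all cliques in all flowers. -/
def phiCmd : Cmd :=
  forLoop rD (2 * eSize) (forLoop rV eSize (.seq markCmd (.seq freeCmd
    (.assign aPhi (.var rD * eSize + .var rV)
      (.get aFree (cliqueSize (.var rD) (.var rV)))))))

open Classical in
/-- The sizes of the forbidden prefixes of the bag `v` in the flower of the edge `j`. -/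
noncomputable def BagTree.mark {n : ℕ} (t : BagTree (Fin n)) (j r v b : ℕ) : ℕ :=
  if ∃ e ∈ t.path r v, t.lab e ⊆ t.bag v ∧ (t.lab e).ncard - (t.lab j).ncard = b then 1 else 0

/-- The factors are stored in the memory. -/
def Factors {n : ℕ} (t : BagTree (Fin n)) (mem : ℕ → ℕ → ℕ) : Prop :=
  ∀ d < 2 * t.size, ∀ v < t.size, mem aPhi (d * t.size + v) =
    prefixFree (t.mark (t.edge d) (mem Table.top.array d) v)
      ((t.bag v).ncard - (t.lab (t.edge d)).ncard)

section

variable {n : ℕ} {t : BagTree (Fin n)} {G : SimpleGraph (Fin n)} {procs : List Cmd}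
  {s : MachineState}

theorem eval_cliqueSize {mem : ℕ → ℕ → ℕ} (h : Tables t mem) {d v : Expr}
    (hd : d.eval mem < 2 * t.size) (hv : v.eval mem < t.size) :
    (cliqueSize d v).eval mem =
      (t.bag (v.eval mem)).ncard - (t.lab (t.edge (d.eval mem))).ncard := by
  simp only [cliqueSize, eval_sub, Table.eval_entry]
  rw [h.table .bagSize _ hv, h.table .edge _ hd, h.table .labSize _ (Table.edge_lt hd)]

open Classical in
theorem eval_isPrefix {mem : ℕ → ℕ → ℕ} (h : Tables t mem) {d v e : Expr}
    (hd : d.eval mem < 2 * t.size) (hv : v.eval mem < t.size) (he : e.eval mem < t.size) :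
    (isPrefix d v e).eval mem ≠ 0 ↔
      e.eval mem ∈ t.path (mem Table.top.array (d.eval mem)) (v.eval mem) ∧
        t.lab (e.eval mem) ⊆ t.bag (v.eval mem) := by
  have htop : mem Table.top.array (d.eval mem) < t.size :=
    (BagTree.mem_nodes.1 (h.table .top _ hd).1).1
  simp only [isPrefix, eval_mul, eval_add, eval_eq, Table.eval_entry, eval_get,
    eval_zero, h.size, h.table .pathHas _ he _ htop _ hv, h.table .labBag _ he _ hv,
    ncard_sdiff_eq_zero]
  rw [mul_ne_zero_iff]
  refine and_congr ?_ (by simp)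
  rw [Finset.card_ne_zero]
  constructor
  · rintro ⟨x, hx⟩
    obtain ⟨h1, h2⟩ := Finset.mem_filter.1 hx
    exact h2 ▸ h1
  · exact fun h1 => ⟨_, Finset.mem_filter.2 ⟨h1, rfl⟩⟩

theorem mem_writes_markCmd {a : ℕ} (ha : a < 60) (h : a ≠ aMark) (h' : a ≠ rE) :
    a ∉ markCmd.writes := by
  simp only [markCmd, fill, Cmd.writes, writes_forLoop, List.mem_cons, List.mem_append,
    List.not_mem_nil, or_false, not_or]
  omega

theorem mem_writes_freeCmd {a : ℕ} (ha : a < 60) (h : a ≠ aFree) : a ∉ freeCmd.writes := by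
  refine mem_writes_fill h ?_
  simp only [not_mem_scratch]
  omega

theorem markCmd_plain : markCmd.Plain := by simp [markCmd, fill, Cmd.Plain]

theorem wp_markCmd (T : t.IsFor G) (h : Tables t s.mem) (hn : 0 < n) {d v : ℕ}
    (hd : d < 2 * t.size) (hv : v < t.size) (hsd : s.mem rD 0 = d) (hsv : s.mem rV 0 = v) :
    WP procs markCmd s (200 * n + 100 * t.size + 50) fun s' => ∀ b < n, s'.mem aMark b =
      t.mark (t.edge d) (s.mem Table.top.array d) v b := by
  classical
  refine (WP.seq (((wp_fill (A := aMark) (N := 1) (M := 1) (L := eN) (S := 0) (e := 0) (g := 0)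
    (n := 1) (m := 1) (l := n) (p := 0) (fun _ _ _ _ => 0) (fun _ _ _ => 0) (by simp)
    ?_ (by simp) (by simp) (by simp [h.card]) (by simp) le_rfl le_rfl hn ?_ ?_).frame
    fill_plain).mono le_rfl (Q' := fun s' => WP procs _ s' (100 * t.size + 20) _) ?_)).le ?_
  · intro a ha
    have : a = aN := by simpa [Expr.reads, OfNat.ofNat] using ha
    subst this
    simp
  · intros; omega
  · intros; simp
  · rintro s1 ⟨h0, hfr0, -⟩
    have hfr1 : ∀ a < 60, a ≠ aMark → s1.mem a = s.mem a := fun a ha ha' => hfr0 a <| by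
      refine mem_writes_fill ha' ?_
      simp only [not_mem_scratch]
      omega
    have h1 : Tables t s1.mem := h.frame fun a ha => hfr1 a (by omega) (by omega)
    refine (WP.loop_plain (n := t.size) (b := 60) (fun E s' => ∀ b < n, s'.mem aMark b =
      if ∃ e < E, e ∈ t.path (s.mem Table.top.array d) v ∧ t.lab e ⊆ t.bag v ∧
        (t.lab e).ncard - (t.lab (t.edge d)).ncard = b then 1 else 0)
      (by simp [Cmd.Plain]) (by simp [Cmd.writes]) ?_ ?_ ?_ ?_ ?_).le ?_
    · simp [Cmd.writes, Expr.reads, OfNat.ofNat]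
    · simp [h1.size]
    · intro b hb
      have := h0 0 0 b one_pos one_pos hb
      simpa using this
    · intro e he s2 hfr _ hse hinv
      have hfr2 : ∀ a, a ≠ rE → a ≠ aMark → s2.mem a = s1.mem a := fun a ha ha' =>
        hfr a ha (by simp [Cmd.writes, ha'])
      have h2 : Tables t s2.mem := h1.frame fun a ha => hfr2 a (by omega) (by omega)
      have hd2 : (Expr.var rD).eval s2.mem = d := by
        simp [hfr2 rD, hfr1 rD, hsd]
      have hv2 : (Expr.var rV).eval s2.mem = v := by
        simp [hfr2 rV, hfr1 rV, hsv]
      have he2 : (Expr.var rE).eval s2.mem = e := by simp [hse]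
      have htop : s2.mem Table.top.array = s.mem Table.top.array := by
        rw [hfr2 _ (by simp [Table.array]) (by simp [Table.array]),
          hfr1 _ (by simp [Table.array]) (by simp [Table.array])]
      have hcond := eval_isPrefix h2 (d := .var rD) (v := .var rV) (e := .var rE)
        (by rwa [hd2]) (by rwa [hv2]) (by rwa [he2])
      rw [hd2, hv2, he2, htop] at hcond
      have hex : ∀ b, (∃ e' < e + 1, e' ∈ t.path (s.mem Table.top.array d) v ∧
          t.lab e' ⊆ t.bag v ∧ (t.lab e').ncard - (t.lab (t.edge d)).ncard = b) ↔
          (e ∈ t.path (s.mem Table.top.array d) v ∧ t.lab e ⊆ t.bag v ∧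
            (t.lab e).ncard - (t.lab (t.edge d)).ncard = b) ∨
          ∃ e' < e, e' ∈ t.path (s.mem Table.top.array d) v ∧
            t.lab e' ⊆ t.bag v ∧ (t.lab e').ncard - (t.lab (t.edge d)).ncard = b := by
        intro b
        simp only [Nat.lt_succ_iff_lt_or_eq, or_and_right, exists_or, exists_eq_left]
        exact or_comm
      refine (WP.ite (b := 12) (fun hc => ?_) (fun hc => ?_)).le ?_
      · rw [hcond] at hc
        refine (WP.assign ?_).mono (by simp) fun _ h => h
        intro b hb
        rw [set_mem_of_ne (by simp), set_mem_same]
        simp only [eval_sub, Table.eval_entry, hd2, he2, eval_one]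
        rw [h2.table .edge _ hd, h2.table .labSize _ he, h2.table .labSize _ (Table.edge_lt hd)]
        split_ifs with h3 h4 h4
        · rfl
        · exact absurd ((hex b).2 (.inl ⟨hc.1, hc.2, h3.symm⟩)) h4
        · rw [hinv b hb, if_pos]
          rcases (hex b).1 h4 with h5 | h5
          · exact absurd h5.2.2.symm h3
          · exact h5
        · rw [hinv b hb, if_neg fun h5 => h4 ((hex b).2 (.inr h5))]
      · refine (WP.skip ?_).mono (by simp) fun _ h => h
        intro b hb
        rw [set_mem_of_ne (by simp), hinv b hb]
        congr 1
        rw [eq_iff_iff, hex b]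
        refine ⟨.inr, fun h5 => h5.resolve_left fun h6 => ?_⟩
        exact hcond.2 ⟨h6.1, h6.2.1⟩ hc
      · simp [isPrefix]
    · intro s2 _ _ hinv b hb
      rw [hinv b hb, BagTree.mark]
      congr 1
      rw [eq_iff_iff]
      constructor
      · rintro ⟨e, -, h3⟩
        exact ⟨e, h3⟩
      · rintro ⟨e, h3, h4⟩
        have htop := (BagTree.mem_nodes.1 (h.table .top _ hd).1).1
        have := T.tree.path_mem (Finset.mem_range.2 htop) (Finset.mem_range.2 hv) h3
        exact ⟨e, Finset.mem_range.1 this.1, h3, h4⟩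
    · simp
      omega
  · simp [fillCost]
    omega

theorem ncard_sdiff_lab_le (T : t.IsFor G) (hn : 0 < n) {d v : ℕ} (hv : v < t.size) :
    ((t.bag v).ncard - (t.lab (t.edge d)).ncard + 1) ^ 2 ≤ 4 * (n + 2 * G.edgeSet.ncard) ∧
      (t.bag v).ncard ≤ n := by
  have h1 := ncard_sq_le_of_pairwise (T.tree.bag_pairwise (Finset.mem_range.2 hv))
  have h2 : (t.bag v).ncard ≤ n := by
    have := Set.ncard_le_ncard (Set.subset_univ (t.bag v)) (Set.toFinite _)
    rwa [Set.ncard_univ, Nat.card_eq_fintype_card, Fintype.card_fin] at this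
  refine ⟨?_, h2⟩
  rcases Nat.eq_zero_or_pos (t.bag v).ncard with h | h
  · rw [h, Nat.zero_sub]
    omega
  · calc _ ≤ (2 * (t.bag v).ncard) ^ 2 := Nat.pow_le_pow_left (by omega) 2
      _ = 4 * (t.bag v).ncard ^ 2 := by ring
      _ ≤ _ := Nat.mul_le_mul_left 4 h1

theorem wp_freeCmd (h : Tables t s.mem) {d v : ℕ} {mark : ℕ → ℕ}
    (hd : d < 2 * t.size) (hv : v < t.size) (hsd : s.mem rD 0 = d) (hsv : s.mem rV 0 = v)
    (hn : (t.bag v).ncard ≤ n) (hmark : ∀ b < n, s.mem aMark b = mark b) :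
    WP procs freeCmd s (500 * ((t.bag v).ncard - (t.lab (t.edge d)).ncard + 1) ^ 2)
      fun s' => s'.mem aFree ((t.bag v).ncard - (t.lab (t.edge d)).ncard) =
        prefixFree mark ((t.bag v).ncard - (t.lab (t.edge d)).ncard) := by
  have hsd' : (Expr.var rD).eval s.mem = d := by simpa using hsd
  have hsv' : (Expr.var rV).eval s.mem = v := by simpa using hsv
  have hsz := eval_cliqueSize h (d := .var rD) (v := .var rV) (by rwa [hsd']) (by rwa [hsv'])
  rw [hsd', hsv'] at hsz
  set z := (t.bag v).ncard - (t.lab (t.edge d)).ncard with hz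
  have hreads : ∀ a ∈ (cliqueSize (.var rD) (.var rV)).reads, a < 60 ∧ a ≠ aFree := by
    intro a ha
    simp [cliqueSize, Expr.reads, HSub.hSub, Sub.sub, Table.entry, Table.array, OfNat.ofNat] at ha
    rcases ha with rfl | rfl | rfl | rfl | rfl <;> simp
  refine (wp_fill (n := 1) (m := 1) (l := z + 1) (p := z)
    (fun _ _ k u => if u < k then mark u * ((k - u).factorial * prefixFree mark u) else 0)
    (fun _ _ k => prefixFree mark k) (by simp) ?_ rfl rfl ?_ hsz le_rfl le_rfl (by omega)
    ?_ ?_).mono ?_ ?_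
  · intro a ha
    have : a ∈ (cliqueSize (.var rD) (.var rV)).reads := by
      simpa [Expr.reads, HAdd.hAdd, Add.add, OfNat.ofNat] using ha
    obtain ⟨h1, h2⟩ := hreads a this
    refine ⟨h2, ?_⟩
    simp only [not_mem_scratch]
    omega
  · rw [eval_add, hsz, eval_one]
  · intro s' hfr i j k u hi hj hk hu _ _ hsk hsu hbef
    obtain rfl : i = 0 := by omega
    obtain rfl : j = 0 := by omega
    have h2 : Tables t s'.mem := h.frame fun a ha => hfr a (by omega) (by
      simp only [not_mem_scratch]
      omega)
    have hm : s'.mem aMark = s.mem aMark := hfr _ (by simp) (by simp)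
    simp only [eval_mul, eval_lt, eval_get, eval_zero, Table.eval_entry,
      eval_sub, hsk, hsu, hm, hmark u (by omega), h2.table .fact (k - u) (by omega)]
    split_ifs with hlt
    · have := hbef 0 0 u one_pos (by omega) (.inr ⟨rfl, .inr ⟨rfl, hlt⟩⟩)
      simp only [zero_mul, zero_add] at this
      rw [this, one_mul]
    · rw [zero_mul]
  · intro s' hfr i j k hi hj hk _ _ hsk hacc _
    have h2 : Tables t s'.mem := h.frame fun a ha => hfr a (by omega) (by
      simp only [not_mem_scratch]
      omega)
    rw [eval_sub, Table.eval_entry, eval_get, eval_get, eval_zero, hsk, hacc,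
      h2.table .fact k (by omega), prefixFree_eq, ← Finset.sum_filter]
    congr 1
    refine Finset.sum_congr ?_ fun _ _ => rfl
    ext u
    simp only [Finset.mem_filter, Finset.mem_range]
    omega
  · simp [fillCost, cliqueSize]
    nlinarith
  · intro s' h1
    simpa using h1 0 0 z one_pos one_pos (Nat.lt_succ_self z)

theorem phiCmd_plain : phiCmd.Plain := by
  simp [phiCmd, markCmd, freeCmd, fill, Cmd.Plain]

theorem mem_writes_phiCmd {a : ℕ} (ha : a < 41) : a ∉ phiCmd.writes := by
  simp only [phiCmd, markCmd, freeCmd, fill, Cmd.writes, writes_forLoop, List.mem_cons,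
    List.mem_append, List.not_mem_nil, or_false, not_or]
  omega

theorem wp_phiCmd (T : t.IsFor G) (h : Tables t s.mem) (hn : 0 < n) (hkn : t.size ≤ n) :
    WP procs phiCmd s (10000 * (t.size ^ 2 * (n + G.edgeSet.ncard))) fun s' =>
      Factors t s'.mem := by
  have hk0 := T.size_pos
  set N := n + G.edgeSet.ncard with hN
  have hbody : ∀ d < 2 * t.size, ∀ v < t.size, ∀ s' : MachineState, Tables t s'.mem →
      s'.mem rD 0 = d → s'.mem rV 0 = v →
      WP procs (.seq markCmd (.seq freeCmd (.assign aPhi (.var rD * eSize + .var rV)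
        (.get aFree (cliqueSize (.var rD) (.var rV)))))) s' (4500 * N)
        fun s'' => s''.mem aPhi (d * t.size + v) =
          prefixFree (t.mark (t.edge d) (s'.mem Table.top.array d) v)
            ((t.bag v).ncard - (t.lab (t.edge d)).ncard) ∧
          ∀ i ≠ d * t.size + v, s''.mem aPhi i = s'.mem aPhi i := by
    intro d hd v hv s1 h1 hsd hsv
    obtain ⟨hsq, hvn⟩ := ncard_sdiff_lab_le T hn (d := d) hv
    refine (WP.seq (((wp_markCmd T h1 hn hd hv hsd hsv).frame markCmd_plain).mono le_rfl
      (Q' := fun s' => WP procs _ s' (2000 * (n + 2 * G.edgeSet.ncard) + 50) _) ?_)).le ?_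
    · rintro s2 ⟨hmark, hfr1, -⟩
      have h2 : Tables t s2.mem := h1.frame fun a ha =>
        hfr1 a (mem_writes_markCmd (by omega) (by omega) (by omega))
      have hsd2 : s2.mem rD 0 = d := by
        rw [hfr1 _ (mem_writes_markCmd (by simp) (by simp) (by simp)), hsd]
      have hsv2 : s2.mem rV 0 = v := by
        rw [hfr1 _ (mem_writes_markCmd (by simp) (by simp) (by simp)), hsv]
      refine (WP.seq (((wp_freeCmd h2 hd hv hsd2 hsv2 hvn hmark).frame fill_plain).mono le_rfl
        (Q' := fun s' => WP procs _ s' 50 _) ?_)).le ?_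
      · rintro s3 ⟨hfree, hfr2, -⟩
        have h3 : Tables t s3.mem := h2.frame fun a ha =>
          hfr2 a (mem_writes_freeCmd (by omega) (by omega))
        have hsd3 : (Expr.var rD).eval s3.mem = d := by
          rw [eval_get, eval_zero, hfr2 _ (mem_writes_freeCmd (by simp) (by simp)), hsd2]
        have hsv3 : (Expr.var rV).eval s3.mem = v := by
          rw [eval_get, eval_zero, hfr2 _ (mem_writes_freeCmd (by simp) (by simp)), hsv2]
        have hsz := eval_cliqueSize h3 (d := .var rD) (v := .var rV) (by rwa [hsd3])
          (by rwa [hsv3])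
        rw [hsd3, hsv3] at hsz
        refine (WP.assign ?_).le ?_
        · rw [eval_add, eval_mul, hsd3, hsv3, eval_get, eval_get,
            eval_zero, h3.size, hsz, hfree]
          refine ⟨by simp, fun i hi => ?_⟩
          rw [set_mem_same, if_neg hi,
            hfr2 _ (mem_writes_freeCmd (by simp) (by simp)),
            hfr1 _ (mem_writes_markCmd (by simp) (by simp) (by simp))]
        · simp [cliqueSize]
      · nlinarith
    · omega
  have hinner : ∀ d < 2 * t.size, ∀ s' : MachineState, Tables t s'.mem → s'.mem rD 0 = d →
      WP procs (forLoop rV eSize (.seq markCmd (.seq freeCmd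
        (.assign aPhi (.var rD * eSize + .var rV)
          (.get aFree (cliqueSize (.var rD) (.var rV))))))) s' (4530 * (t.size * N))
        fun s'' => (∀ v < t.size, s''.mem aPhi (d * t.size + v) =
          prefixFree (t.mark (t.edge d) (s'.mem Table.top.array d) v)
            ((t.bag v).ncard - (t.lab (t.edge d)).ncard)) ∧
          ∀ i < d * t.size, s''.mem aPhi i = s'.mem aPhi i := by
    intro d hd s1 h1 hsd
    refine (WP.loop_plain (n := t.size) (b := 4500 * N) (fun V s' => (∀ v < V,
      s'.mem aPhi (d * t.size + v) = prefixFree (t.mark (t.edge d) (s1.mem Table.top.array d) v)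
        ((t.bag v).ncard - (t.lab (t.edge d)).ncard)) ∧
      ∀ i < d * t.size, s'.mem aPhi i = s1.mem aPhi i)
      (by simp [markCmd, freeCmd, fill, Cmd.Plain])
      (by simp [markCmd, freeCmd, fill, Cmd.writes]) ?_ ?_ ?_ ?_ ?_).le ?_
    · simp [markCmd, freeCmd, fill, Cmd.writes, Expr.reads, OfNat.ofNat]
    · simp [h1.size]
    · exact ⟨by simp, fun i _ => by rw [set_mem_of_ne (by simp)]⟩
    · rintro v hv s2 hfr - hsv ⟨h3, h4⟩
      have hfr' : ∀ a < 41, s2.mem a = s1.mem a := fun a ha => hfr a (by omega) (by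
        simp only [markCmd, freeCmd, fill, Cmd.writes, writes_forLoop, List.mem_cons,
          List.mem_append, List.not_mem_nil, or_false, not_or]
        omega)
      have h2 : Tables t s2.mem := h1.frame fun a ha => hfr' a (by omega)
      have hsd2 : s2.mem rD 0 = d := by
        rw [hfr _ (by simp) (by simp [markCmd, freeCmd, fill, Cmd.writes]), hsd]
      refine (hbody d hd v hv s2 h2 hsd2 hsv).mono le_rfl ?_
      rintro s3 ⟨h5, h6⟩
      rw [hfr' _ (by simp [Table.array])] at h5
      refine ⟨fun w hw => ?_, fun i hi => ?_⟩
      · rw [set_mem_of_ne (by simp)]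
        rcases Nat.lt_succ_iff_lt_or_eq.1 hw with hw | rfl
        · rw [h6 _ (by omega), h3 w hw]
        · exact h5
      · rw [set_mem_of_ne (by simp), h6 _ (by omega), h4 i hi]
    · exact fun s' _ _ h => h
    · have : 1 ≤ N := by omega
      have : t.size * 1 ≤ t.size * N := Nat.mul_le_mul_left _ this
      simp
      nlinarith
  refine (WP.loop_plain (n := 2 * t.size) (b := 4530 * (t.size * N)) (fun D s' => ∀ d < D,
    ∀ v < t.size, s'.mem aPhi (d * t.size + v) =
      prefixFree (t.mark (t.edge d) (s.mem Table.top.array d) v)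
        ((t.bag v).ncard - (t.lab (t.edge d)).ncard))
    (by simp [markCmd, freeCmd, fill, Cmd.Plain])
    (by simp [markCmd, freeCmd, fill, Cmd.writes]) ?_ ?_ ?_ ?_ ?_).le ?_
  · simp [markCmd, freeCmd, fill, Cmd.writes, Expr.reads, OfNat.ofNat]
  · simp [h.size]
  · simp
  · intro D hD s1 hfr _ hsD hinv
    have hfr' : ∀ a < 41, s1.mem a = s.mem a := fun a ha => hfr a (by omega) (by
      simp only [markCmd, freeCmd, fill, Cmd.writes, writes_forLoop, List.mem_cons,
        List.mem_append, List.not_mem_nil, or_false, not_or]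
      omega)
    refine (hinner D hD s1 (h.frame fun a ha => hfr' a (by omega)) hsD).mono le_rfl ?_
    rintro s2 ⟨h1, h2⟩ d hd v hv
    rw [set_mem_of_ne (by simp)]
    rcases Nat.lt_succ_iff_lt_or_eq.1 hd with hd | rfl
    · have h3 : d * t.size + v < D * t.size := by
        have := Nat.mul_le_mul_right t.size (Nat.succ_le_of_lt hd)
        rw [Nat.succ_mul] at this
        omega
      rw [h2 _ h3, hinv d hd v hv]
    · rw [h1 v hv, hfr' _ (by simp [Table.array])]
  · intro s1 hfr _ hinv d hd v hv
    rw [hinv d hd v hv, hfr Table.top.array (by simp [Table.array])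
      (by simp [markCmd, freeCmd, fill, Cmd.writes, Table.array])]
  · have h1 : 1 ≤ N := by omega
    have h2 : t.size * 1 ≤ t.size * N := Nat.mul_le_mul_left _ h1
    have h3 : t.size * (t.size * N) = t.size ^ 2 * N := by ring
    have h4 : t.size * t.size * 1 ≤ t.size * t.size * N := Nat.mul_le_mul_left _ h1
    have h5 : 1 * t.size ≤ t.size * t.size := Nat.mul_le_mul_right _ hk0
    simp
    nlinarith

end

/-! ### Runs and their output words -/

section Sim

variable {n : ℕ} {G : SimpleGraph (Fin n)}

/-- The task can be executed with a log that is described by the word `w`. -/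
def Sim (task : Task G) (M M' : List (G.Subgraph × ℕ)) (w : List ℕ) (a : ℕ) : Prop :=
  ∃ log codes, Run task M log M' a ∧ List.Forall₂ EncodesEvent log codes ∧ w = codes.flatten

/-- The word that describes a set of vertices. -/
noncomputable def setWord (S : Set (Fin n)) : List ℕ := S.ncard :: vertexList S

theorem exists_perm_vertexList (S : Set (Fin n)) :
    ∃ l : List (Fin n), IsPermOf l S ∧ setWord S = l.length :: l.map Fin.val := by
  classical
  have h1 : IsPermOf ((List.finRange n).filter fun v => v ∈ S) S :=
    ⟨(List.nodup_finRange n).filter _, fun v => by simp⟩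
  refine ⟨_, h1, ?_⟩
  rw [setWord, h1.length, vertexList, ← List.map_coe_finRange_eq_range, List.filter_map]
  congr 2
  refine List.filter_congr fun v _ => ?_
  simp [ind_fin]

variable {H : G.Subgraph} {M M' M'' : List (G.Subgraph × ℕ)} {w w' : List ℕ} {a b : ℕ}

theorem Sim.count_memo (h : (H, a) ∈ M) :
    Sim (.count H) M M (0 :: setWord H.verts ++ [3, a]) a := by
  obtain ⟨l, hl, heq⟩ := exists_perm_vertexList H.verts
  exact ⟨_, [0 :: setWord H.verts, [3, a]], .count_memo h,
    .cons (heq ▸ .call H l hl) (.cons (.ret a) .nil), by simp⟩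

theorem Sim.count_new {𝒯 : RootedCliqueTree H} (h : ∀ b, (H, b) ∉ M)
    (hrun : Sim (.loop H 𝒯 [𝒯.root] 0) M M' w a) :
    Sim (.count H) M ((H, a) :: M') (0 :: setWord H.verts ++ w ++ [3, a]) a := by
  obtain ⟨l, hl, heq⟩ := exists_perm_vertexList H.verts
  obtain ⟨log, codes, h1, h2, rfl⟩ := hrun
  refine ⟨_, (0 :: setWord H.verts) :: codes ++ [[3, a]], .count_new h 𝒯 h1,
    .cons (heq ▸ .call H l hl) ?_, by simp⟩
  exact List.rel_append h2 (.cons (.ret a) .nil)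

theorem Sim.loop_done {𝒯 : RootedCliqueTree H} : Sim (.loop H 𝒯 [] a) M M [] a :=
  ⟨_, [], .loop_done, .nil, rfl⟩

theorem Sim.loop_step {𝒯 : RootedCliqueTree H} {v : Fin 𝒯.size}
    {queue children : List (Fin 𝒯.size)} {sum prod : ℕ} {Hs : List G.Subgraph}
    (children_nodup : children.Nodup) (mem_children : ∀ w, w ∈ children ↔ IsChild 𝒯 v w)
    (Hs_nodup : Hs.Nodup) (mem_Hs : ∀ H', H' ∈ Hs ↔ H' ∈ subproblems H (𝒯.bag v))
    (inner : Sim (.prod Hs 1) M M' w prod)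
    (rest : Sim (.loop H 𝒯 (queue ++ children)
      (sum + phi (𝒯.bag v) (forbiddenPrefixes 𝒯 v) * prod)) M' M'' w' a) :
    Sim (.loop H 𝒯 (v :: queue) sum) M M'' (1 :: setWord (𝒯.bag v) ++ w ++
      (2 :: phi (𝒯.bag v) (forbiddenPrefixes 𝒯 v) :: w')) a := by
  obtain ⟨l, hl, heq⟩ := exists_perm_vertexList (𝒯.bag v)
  obtain ⟨log, codes, h1, h2, rfl⟩ := inner
  obtain ⟨log', codes', h1', h2', rfl⟩ := rest
  refine ⟨_, (1 :: setWord (𝒯.bag v)) :: codes ++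
    [2, phi (𝒯.bag v) (forbiddenPrefixes 𝒯 v)] :: codes',
    .loop_step children_nodup mem_children Hs_nodup mem_Hs h1 h1',
    .cons (heq ▸ .pop _ l hl) ?_, by simp⟩
  exact List.rel_append h2 (.cons (.factor _) h2')

theorem Sim.prod_done : Sim (G := G) (.prod [] a) M M [] a := ⟨_, [], .prod_done, .nil, rfl⟩

theorem Sim.prod_step {Hs : List G.Subgraph} {prod : ℕ} (call : Sim (.count H) M M' w b)
    (rest : Sim (.prod Hs (prod * b)) M' M'' w' a) :
    Sim (.prod (H :: Hs) prod) M M'' (w ++ w') a := by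
  obtain ⟨log, codes, h1, h2, rfl⟩ := call
  obtain ⟨log', codes', h1', h2', rfl⟩ := rest
  exact ⟨_, codes ++ codes', .prod_step h1 h1', List.rel_append h2 h2', by simp⟩

end Sim

namespace BagTree

variable {n : ℕ} {t : BagTree (Fin n)} {G : SimpleGraph (Fin n)}

/-- The number of vertices of a flower. -/
noncomputable def card (t : BagTree (Fin n)) (d : ℕ) : ℕ := 𝓕[t, d].ncard

/-- `δ` is the canonical number of a subproblem of the clique at `v` in the flower `d`. -/
def IsSub (t : BagTree (Fin n)) (d v δ : ℕ) : Prop :=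
  t.Canon δ ∧ t.Sub (t.edge d) (t.head d) v (t.edge δ) (t.head δ)

open Classical in
/-- The numbers `δ ≥ j` of the subproblems of the clique at `v` in the flower `d`. -/
noncomputable def subsFrom (t : BagTree (Fin n)) (d v j : ℕ) : List ℕ :=
  (List.range' j (2 * t.size - j)).filter (t.IsSub d v)

namespace IsFor

theorem subsFrom_done (d v : ℕ) : t.subsFrom d v (2 * t.size) = [] := by simp [subsFrom]

theorem subsFrom_pos {d v j : ℕ} (hj : j < 2 * t.size) (h : t.IsSub d v j) :
    t.subsFrom d v j = j :: t.subsFrom d v (j + 1) := by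
  obtain ⟨m, hm⟩ : ∃ m, 2 * t.size - j = m + 1 := ⟨2 * t.size - j - 1, by omega⟩
  have hm' : 2 * t.size - (j + 1) = m := by omega
  rw [subsFrom, hm, List.range'_succ, List.filter_cons_of_pos (by simpa using h), subsFrom, hm']

theorem subsFrom_neg {d v j : ℕ} (hj : j < 2 * t.size) (h : ¬ t.IsSub d v j) :
    t.subsFrom d v j = t.subsFrom d v (j + 1) := by
  obtain ⟨m, hm⟩ : ∃ m, 2 * t.size - j = m + 1 := ⟨2 * t.size - j - 1, by omega⟩
  have hm' : 2 * t.size - (j + 1) = m := by omega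
  rw [subsFrom, hm, List.range'_succ, List.filter_cons_of_neg (by simpa using h), subsFrom, hm']

theorem mem_subsFrom_zero {d v δ : ℕ} :
    δ ∈ t.subsFrom d v 0 ↔ δ < 2 * t.size ∧ t.IsSub d v δ := by
  classical
  simp [subsFrom]

theorem mem_map_subsFrom (T : t.IsFor G) (hG : IsChordal G) {d v : ℕ} (hd : d < 2 * t.size)
    (hv : v ∈ 𝓚[t, d]) (H : G.Subgraph) :
    H ∈ (t.subsFrom d v 0).map (t.graph G) ↔
      H ∈ subproblems (t.graph G d) (t.bag v \ t.lab (t.edge d)) := by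
  rw [T.subproblems_flower hG (isEnd_of_lt hd) hv, List.mem_map]
  constructor
  · rintro ⟨δ, hδ, rfl⟩
    obtain ⟨h1, h2, h3⟩ := mem_subsFrom_zero.1 hδ
    exact ⟨δ, h1, h2, h3, rfl⟩
  · rintro ⟨δ, h1, h2, h3, rfl⟩
    exact ⟨δ, mem_subsFrom_zero.2 ⟨h1, h2, h3⟩, rfl⟩

theorem nodup_map_subsFrom (T : t.IsFor G) {d v : ℕ} (hd : d < 2 * t.size)
    (hv : v ∈ 𝓚[t, d]) : ((t.subsFrom d v 0).map (t.graph G)).Nodup := by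
  classical
  have h1 : (t.subsFrom d v 0).Nodup := by
    rw [subsFrom]
    exact List.Nodup.filter _ List.nodup_range'
  refine (List.nodup_map_iff_inj_on h1).2 fun δ hδ δ' hδ' heq => ?_
  obtain ⟨h2, h3, h4⟩ := mem_subsFrom_zero.1 hδ
  obtain ⟨h2', h3', h4'⟩ := mem_subsFrom_zero.1 hδ'
  exact T.sub_injective (isEnd_of_lt hd) hv h2 h2' h3 h3' h4 h4'
    (congrArg SimpleGraph.Subgraph.verts heq)

theorem card_lt_of_isSub [Nonempty (Fin n)] (T : t.IsFor G) {d v δ : ℕ} (hd : d < 2 * t.size)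
    (hv : v ∈ 𝓚[t, d]) (hδ : δ < 2 * t.size) (h : t.IsSub d v δ) :
    t.card δ < t.card d := by
  refine Set.ncard_lt_ncard (Set.ssubset_iff_subset_ne.2 ⟨?_, fun heq => ?_⟩) (Set.toFinite _)
  · rintro u ⟨w, hw, hu, hu'⟩
    have := T.bubble_of_sub (isEnd_of_lt hd) hv (isEnd_of_lt hδ) h.2 ⟨w, hw, hu, hu'⟩
    exact this.1.1
  · obtain ⟨u, hu, hu'⟩ := T.exists_mem_not_mem_lab (isEnd_of_lt hd).1 (mem_nodes.1 hv).1
    have hmem : u ∈ 𝓕[t, d] := ⟨v, hv, hu, hu'⟩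
    rw [← heq] at hmem
    exact (T.bubble_of_sub (isEnd_of_lt hd) hv (isEnd_of_lt hδ) h.2 hmem).1.2 ⟨hu, hu'⟩

open Classical in
/-- The subproblems of a clique are disjoint. -/
theorem sum_card_le (T : t.IsFor G) {d v : ℕ} (hd : d < 2 * t.size)
    (hv : v ∈ 𝓚[t, d]) :
    ∑ δ ∈ Finset.range (2 * t.size), (if t.IsSub d v δ then t.card δ else 0) ≤ n := by
  rw [← Finset.sum_filter]
  have h1 : ∀ δ, t.card δ = 𝓕[t, δ].toFinset.card := fun δ => by
    rw [card, Set.ncard_eq_toFinset_card']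
  simp only [h1]
  rw [← Finset.card_biUnion]
  · exact (Finset.card_le_univ _).trans (by simp)
  · intro δ hδ δ' hδ' hne
    simp only [Finset.coe_filter, Finset.mem_range, Set.mem_ofPred_eq] at hδ hδ'
    rw [Function.onFun, Finset.disjoint_left]
    intro u hu hu'
    rw [Set.mem_toFinset] at hu hu'
    refine hne (T.sub_injective (isEnd_of_lt hd) hv hδ.1 hδ'.1 hδ.2.1 hδ'.2.1 hδ.2.2 hδ'.2.2 ?_)
    rw [← (T.bubble_of_sub (isEnd_of_lt hd) hv (isEnd_of_lt hδ.1) hδ.2.2 hu).2.2,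
      (T.bubble_of_sub (isEnd_of_lt hd) hv (isEnd_of_lt hδ'.1) hδ'.2.2 hu').2.2]

end IsFor

end BagTree

/-! ### Amortized costs -/

theorem WP.emit_of {procs : List Cmd} {s : MachineState} {Q : MachineState → Prop} {v : Expr}
    {x : ℕ} (hv : v.eval s.mem = x) (h : Q (s.emit x)) : WP procs (.emit v) s (v.cost + 1) Q :=
  WP.emit (hv ▸ h)

theorem WP.assign_of {procs : List Cmd} {s : MachineState} {Q : MachineState → Prop} {a i x : ℕ}
    {e v : Expr} (he : e.eval s.mem = i) (hv : v.eval s.mem = x) (h : Q (s.set a i x)) :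
    WP procs (.assign a e v) s (e.cost + v.cost + 1) Q :=
  WP.assign (he ▸ hv ▸ h)

/-- Started in `s`, the command halts in a state that satisfies `Q`; its running time, less the
increase of the potential, is at most `b`. -/
def AWP (pot : MachineState → ℕ) (procs : List Cmd) (c : Cmd) (s : MachineState) (b : ℕ)
    (Q : MachineState → Prop) : Prop :=
  ∃ t s', Exec procs c s t s' ∧ t + pot s ≤ pot s' + b ∧ Q s'

namespace AWP

variable {pot : MachineState → ℕ} {procs : List Cmd} {c d : Cmd} {s : MachineState} {b b' : ℕ}
  {Q Q' : MachineState → Prop}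

theorem of_wp (h : WP procs c s b fun s' => Q s' ∧ pot s' = pot s) : AWP pot procs c s b Q := by
  obtain ⟨t, s', h1, h2, h3, h4⟩ := h
  exact ⟨t, s', h1, by omega, h3⟩

theorem mono (h : AWP pot procs c s b Q) (hb : b ≤ b') (hQ : ∀ s', Q s' → Q' s') :
    AWP pot procs c s b' Q' := by
  obtain ⟨t, s', h1, h2, h3⟩ := h
  exact ⟨t, s', h1, by omega, hQ s' h3⟩

theorem le (h : AWP pot procs c s b Q) (hb : b ≤ b') : AWP pot procs c s b' Q :=
  h.mono hb fun _ h => h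

theorem seq (h : AWP pot procs c s b fun s' => AWP pot procs d s' b' Q) :
    AWP pot procs (.seq c d) s (b + b') Q := by
  obtain ⟨t, s', h1, h2, t', s'', h3, h4, h5⟩ := h
  exact ⟨_, _, .seq h1 h3, by omega, h5⟩

theorem ite {e : Expr} (h1 : e.eval s.mem ≠ 0 → AWP pot procs c s b Q)
    (h2 : e.eval s.mem = 0 → AWP pot procs d s b Q) :
    AWP pot procs (.ite e c d) s (e.cost + 1 + b) Q := by
  by_cases h : e.eval s.mem = 0
  · obtain ⟨t, s', h3, h4, h5⟩ := h2 h
    exact ⟨_, _, .ite_false h h3, by omega, h5⟩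
  · obtain ⟨t, s', h3, h4, h5⟩ := h1 h
    exact ⟨_, _, .ite_true h h3, by omega, h5⟩

theorem call {p : ℕ} {body : Cmd} (hp : procs[p]? = some body) (h : AWP pot procs body s b Q) :
    AWP pot procs (.call p) s (b + 1) Q := by
  obtain ⟨t, s', h1, h2, h3⟩ := h
  exact ⟨_, _, .call hp h1, by omega, h3⟩

/-- The rule for loops with at most `m` iterations. -/
theorem while_loop {e : Expr} {body : Cmd} (m : ℕ) (Inv : ℕ → MachineState → Prop) (b : ℕ → ℕ)
    (hstep : ∀ i s', Inv i s' → e.eval s'.mem ≠ 0 →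
      i < m ∧ AWP pot procs body s' (b i) (Inv (i + 1)))
    (h0 : Inv 0 s) (hQ : ∀ i s', Inv i s' → e.eval s'.mem = 0 → Q s') :
    AWP pot procs (.while e body) s (∑ i ∈ Finset.range m, (b i + e.cost + 1) + e.cost + 1) Q := by
  have main : ∀ r i, i + r = m → ∀ s', Inv i s' → AWP pot procs (.while e body) s'
      (∑ j ∈ Finset.range r, (b (i + j) + e.cost + 1) + e.cost + 1) Q := by
    intro r
    induction r with
    | zero =>
      intro i hi s' hinv
      by_cases h : e.eval s'.mem = 0
      · exact ⟨_, _, .while_false h, by omega, hQ i s' hinv h⟩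
      · have := (hstep i s' hinv h).1
        omega
    | succ r ih =>
      intro i hi s' hinv
      by_cases h : e.eval s'.mem = 0
      · exact ⟨_, _, .while_false h, by omega, hQ i s' hinv h⟩
      · obtain ⟨-, t, s'', h1, h2, h3⟩ := hstep i s' hinv h
        obtain ⟨t', s3, h4, h5, h6⟩ := ih (i + 1) (by omega) s'' h3
        refine ⟨_, _, .while_true h h1 h4, ?_, h6⟩
        have h7 : ∀ j, b (i + 1 + j) = b (i + (j + 1)) := fun j => by rw [add_assoc, add_comm 1]
        simp only [h7] at h5
        rw [Finset.sum_range_succ', add_zero]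
        omega
  have := main m 0 (by omega) s h0
  simpa using this

end AWP

/-- Outputs the values of an expression for all `x < N` that satisfy a condition. -/
def emitLoop (x : ℕ) (N cond e : Expr) : Cmd := forLoop x N (.ite cond (.emit e) .skip)

theorem wp_emitLoop {procs : List Cmd} {s : MachineState} {x n : ℕ} {N cond e : Expr}
    (P : ℕ → Prop) [DecidablePred P] (f : ℕ → ℕ) (hN : ∀ a ∈ N.reads, a ≠ x)
    (hn : N.eval s.mem = n)
    (hcond : ∀ s' : MachineState, (∀ a, a ≠ x → s'.mem a = s.mem a) → ∀ i < n, s'.mem x 0 = i →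
      (cond.eval s'.mem ≠ 0 ↔ P i) ∧ (P i → e.eval s'.mem = f i)) :
    WP procs (emitLoop x N cond e) s (n * (cond.cost + e.cost + N.cost + 15) + N.cost + 7) fun s' =>
      s'.out = s.out ++ ((List.range n).filter P).map f ∧ ∀ a, a ≠ x → s'.mem a = s.mem a := by
  refine (WP.loop (n := n) (b := cond.cost + 1 + (e.cost + 1)) (fun j s' => s'.mem x 0 = j ∧
    s'.out = s.out ++ ((List.range j).filter P).map f ∧ ∀ a, a ≠ x → s'.mem a = s.mem a)
    ?_ ?_ ?_ ?_ ?_).le ?_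
  · exact ⟨by simp, by simp, fun a ha => set_mem_of_ne ha⟩
  · rintro j - s' ⟨-, -, h⟩
    rw [← hn]
    exact eval_congr fun a ha => h a (hN a ha)
  · exact fun j _ s' h => h.1
  · rintro j hj s' ⟨h1, h2, h3⟩
    obtain ⟨h4, h5⟩ := hcond s' h3 j hj h1
    have hfil : (List.range (j + 1)).filter P =
        (List.range j).filter P ++ if P j then [j] else [] := by
      by_cases hP : P j <;> simp [List.range_succ, hP]
    refine WP.ite (fun h => ?_) (fun h => ?_)
    · have hP := h4.1 h
      refine WP.emit ⟨h1, by simp, ?_, fun a ha => ?_⟩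
      · simp [h2, h5 hP, hfil, hP]
      · rw [set_mem_of_ne ha]; exact h3 a ha
    · have hP : ¬ P j := fun hP => h4.2 hP h
      refine WP.skip ⟨h1, by simp, ?_, fun a ha => ?_⟩ |>.mono (by omega) fun _ h => h
      · simp [h2, hfil, hP]
      · rw [set_mem_of_ne ha]; exact h3 a ha
  · exact fun s' h => h.2
  · have : n * (cond.cost + 1 + (e.cost + 1) + N.cost + 10) ≤
        n * (cond.cost + e.cost + N.cost + 15) := Nat.mul_le_mul_left _ (by omega)
    omega

/-! ### The recursive procedure -/

-- The memo table, the value returned last, the depth; for each depth the flower, the ends of the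
-- queue, the sum, the product and the number of a subproblem; the queues; auxiliary variables.
local notation "aMemo" => (70 : ℕ)
local notation "rRes" => (71 : ℕ)
local notation "rSp" => (72 : ℕ)
local notation "aId" => (73 : ℕ)
local notation "aHd" => (74 : ℕ)
local notation "aTl" => (75 : ℕ)
local notation "aSum" => (76 : ℕ)
local notation "aProd" => (77 : ℕ)
local notation "aIdx" => (78 : ℕ)
local notation "aQueue" => (79 : ℕ)
local notation "rX" => (80 : ℕ)
local notation "rCt" => (81 : ℕ)
local notation "rCur" => (82 : ℕ)

/-- The recursion depth; the local variables of a call are the cells with this index, and its queue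
is stored from cell `eSp * eSize` on. -/
abbrev eSp : Expr := .var rSp
/-- The number of the flower of the current call. -/
abbrev eD : Expr := .get aId eSp
/-- The first node in the queue. -/
abbrev eV : Expr := .get aQueue (eSp * eSize + .get aHd eSp)
/-- The number that is tested for being a subproblem. -/
abbrev eJ : Expr := .get aIdx eSp

/-- Whether `j` is the canonical number of a subproblem of the clique at `v` in the flower `d`. -/
def isSub (d v j : Expr) : Expr :=
  Table.canon.entry j *
    (.eq (Table.labDiff.entry (Table.edge.entry d * eSize + Table.edge.entry j)) 0 *
      .lt 0 (Table.labDiff.entry (Table.edge.entry j * eSize + Table.edge.entry d)) *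
    (Table.node.entry (d * eSize + Table.head.entry j) *
    (.eq (Table.pathBelow.entry
      ((Table.edge.entry j * eSize + v) * eSize + Table.head.entry j)) 0 *
      .lt 0 (Table.pathSame.entry
        ((Table.edge.entry j * eSize + v) * eSize + Table.head.entry j)))))

/-- Outputs the log entry for a call. -/
def callCmd : Cmd :=
  .seq (.emit 0) (.seq (.emit (Table.size.entry eD))
    (emitLoop rX (Table.size.entry eD) 1 (.get aList (eD * eN + .var rX))))

/-- Outputs the log entry for a node taken from the queue. -/
def popCmd : Cmd :=
  .seq (.emit 1) (.seq (.emit (cliqueSize eD eV)) (emitLoop rX eN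
    (.get aBag (eV * eN + .var rX) * (1 - Table.lab.entry (Table.edge.entry eD * eN + .var rX)))
    (.var rX)))

/-- Calls `count` for a subproblem and multiplies the product by its result. -/
def subCall : Cmd :=
  .seq (.assign aId (eSp + 1) eJ) (.seq (.assign rSp 0 (eSp + 1)) (.seq (.call 0)
    (.seq (.assign rSp 0 (eSp - 1)) (.assign aProd eSp (.get aProd eSp * .var rRes)))))

/-- Computes the product of the results for the subproblems. -/
def prodCmd : Cmd :=
  .seq (.assign aProd eSp 1) (.seq (.assign aIdx eSp 0) (.while (.lt eJ (2 * eSize))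
    (.seq (.ite (isSub eD eV eJ) subCall .skip) (.assign aIdx eSp (eJ + 1)))))

/-- Outputs the factor and updates the sum. -/
def factorCmd : Cmd :=
  .seq (.emit 2) (.seq (.emit (.get aPhi (eD * eSize + eV)))
    (.assign aSum eSp (.get aSum eSp + .get aPhi (eD * eSize + eV) * .get aProd eSp)))

/-- Replaces the first node in the queue by its children at the end of the queue. -/
def pushCmd : Cmd :=
  .seq (.assign rCur 0 eV) (.seq (.assign rCt 0 (.get aTl eSp)) (.seq
    (collect aQueue (eSp * eSize) rCt rX eSize (Table.node.entry (eD * eSize + .var rX) *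
      ((1 - .eq (.var rX) (Table.top.entry eD)) * .eq (.get aPar (.var rX)) (.var rCur))))
    (.seq (.assign aTl eSp (.var rCt)) (.assign aHd eSp (.get aHd eSp + 1)))))

/-- The computation for a graph that is not in the memo table. -/
def missCmd : Cmd :=
  .seq (.assign aQueue (eSp * eSize) (Table.top.entry eD)) (.seq (.assign aHd eSp 0)
    (.seq (.assign aTl eSp 1) (.seq (.assign aSum eSp 0)
    (.seq (.while (.lt (.get aHd eSp) (.get aTl eSp))
      (.seq popCmd (.seq prodCmd (.seq factorCmd pushCmd))))
    (.seq (.assign rRes 0 (.get aSum eSp))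
      (.assign aMemo (Table.rep.entry eD) (.var rRes + 1)))))))

/-- The procedure `count`; a value `a` is stored in the memo table as `a + 1`. -/
def countCmd : Cmd :=
  .seq callCmd (.seq (.ite (.get aMemo (Table.rep.entry eD))
    (.assign rRes 0 (.get aMemo (Table.rep.entry eD) - 1)) missCmd)
    (.seq (.emit 3) (.emit (.var rRes))))

/-- All data that do not change during the recursion are stored in the memory. -/
structure Ready {n : ℕ} (t : BagTree (Fin n)) (mem : ℕ → ℕ → ℕ) : Prop extends Tables t mem where
  lists : VertexLists t mem
  factors : Factors t mem

/-- The local variables of the call at depth `p` for the flower `d`: `q` is the list of all nodes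
that have been in the queue, `h` of which have been taken from it. -/
structure Local {n : ℕ} (t : BagTree (Fin n)) (mem : ℕ → ℕ → ℕ) (p d h : ℕ) (q : List ℕ)
    (sum : ℕ) : Prop where
  ready : Ready t mem
  sp : mem rSp 0 = p
  id : mem aId p = d
  hd : mem aHd p = h
  tl : mem aTl p = q.length
  sum : mem aSum p = sum
  queue : ListAt (mem aQueue) (p * t.size) q

/-- What is left unchanged by calls at depth at least `p` that do not complete the computation for
flowers with at least `L` vertices. -/
structure Kept {n : ℕ} (t : BagTree (Fin n)) (p L : ℕ) (mem mem' : ℕ → ℕ → ℕ) : Prop where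
  low : ∀ a < 60, mem' a = mem a
  sp : mem' rSp 0 = mem rSp 0
  frame : ∀ a, 73 ≤ a → a ≤ 78 → ∀ i < p, mem' a i = mem a i
  queue : ∀ i < p * t.size, mem' aQueue i = mem aQueue i
  memo : ∀ δ < 2 * t.size, L ≤ t.card δ →
    mem' aMemo (mem Table.rep.array δ) = mem aMemo (mem Table.rep.array δ)

/-- The memo table stored in the memory agrees with `M`. -/
def MemoRel {n : ℕ} {G : SimpleGraph (Fin n)} (t : BagTree (Fin n)) (mem : ℕ → ℕ → ℕ)
    (M : List (G.Subgraph × ℕ)) : Prop :=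
  ∀ d < 2 * t.size, (mem aMemo (mem Table.rep.array d) = 0 → ∀ a, (t.graph G d, a) ∉ M) ∧
    ∀ a, mem aMemo (mem Table.rep.array d) = a + 1 → (t.graph G d, a) ∈ M

section

variable {n : ℕ} {t : BagTree (Fin n)} {G : SimpleGraph (Fin n)} {procs : List Cmd}
  {s : MachineState} {mem mem' mem'' : ℕ → ℕ → ℕ} {p d h sum L : ℕ} {q : List ℕ}

theorem Ready.frame (hr : Ready t mem) (hf : ∀ a < 60, mem' a = mem a) : Ready t mem' where
  toTables := hr.toTables.frame fun a ha => hf a (by omega)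
  lists := by rw [VertexLists, hf _ (by simp)]; exact hr.lists
  factors := by
    rw [Factors, hf _ (by simp), hf _ (by simp [Table.array])]
    exact hr.factors

theorem Kept.refl : Kept t p L mem mem :=
  ⟨fun _ _ => rfl, rfl, fun _ _ _ _ _ => rfl, fun _ _ => rfl, fun _ _ _ => rfl⟩

theorem Kept.trans (h1 : Kept t p L mem mem') (h2 : Kept t p L mem' mem'') :
    Kept t p L mem mem'' where
  low a ha := (h2.low a ha).trans (h1.low a ha)
  sp := h2.sp.trans h1.sp
  frame a ha ha' i hi := (h2.frame a ha ha' i hi).trans (h1.frame a ha ha' i hi)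
  queue i hi := (h2.queue i hi).trans (h1.queue i hi)
  memo δ hδ hL := by
    have := h2.memo δ hδ hL
    rw [h1.low _ (by simp [Table.array])] at this
    exact this.trans (h1.memo δ hδ hL)

theorem Kept.mono {p' L' : ℕ} (h1 : Kept t p L mem mem') (hp : p' ≤ p) (hL : L ≤ L') :
    Kept t p' L' mem mem' where
  low := h1.low
  sp := h1.sp
  frame a ha ha' i hi := h1.frame a ha ha' i (by omega)
  queue i hi := h1.queue i (hi.trans_le (Nat.mul_le_mul_right _ hp))
  memo δ hδ hle := h1.memo δ hδ (hL.trans hle)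

/-- Changes of the local variables at depth `p` and of scratch registers. -/
theorem Kept.of_local (hlow : ∀ a < 73, a ≠ rRes → mem' a = mem a)
    (hframe : ∀ a, 73 ≤ a → a ≤ 78 → ∀ i < p, mem' a i = mem a i)
    (hqueue : ∀ i < p * t.size, mem' aQueue i = mem aQueue i) : Kept t p L mem mem' where
  low a ha := hlow a (by omega) (by omega)
  sp := by rw [hlow _ (by simp) (by simp)]
  frame := hframe
  queue := hqueue
  memo _ _ _ := by rw [hlow _ (by simp) (by simp)]

theorem Local.frame (hl : Local t mem p d h q sum) (hf : ∀ a < 80, a ≠ aProd → a ≠ aIdx →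
    a ≠ rRes → mem' a = mem a) : Local t mem' p d h q sum where
  ready := hl.ready.frame fun a ha => hf a (by omega) (by omega) (by omega) (by omega)
  sp := by rw [hf _ (by simp) (by simp) (by simp) (by simp), hl.sp]
  id := by rw [hf _ (by simp) (by simp) (by simp) (by simp), hl.id]
  hd := by rw [hf _ (by simp) (by simp) (by simp) (by simp), hl.hd]
  tl := by rw [hf _ (by simp) (by simp) (by simp) (by simp), hl.tl]
  sum := by rw [hf _ (by simp) (by simp) (by simp) (by simp), hl.sum]
  queue := by rw [hf _ (by simp) (by simp) (by simp) (by simp)]; exact hl.queue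

theorem Local.eval_v (hl : Local t mem p d h q sum) (hh : h < q.length) :
    eV.eval mem = q[h] := by
  simp [hl.sp, hl.hd, hl.ready.size, hl.queue h hh]

theorem Local.eval_d (hl : Local t mem p d h q sum) : eD.eval mem = d := by
  simp [hl.sp, hl.id]

theorem MemoRel.frame {M : List (G.Subgraph × ℕ)} (hm : MemoRel t mem M)
    (h1 : mem' aMemo = mem aMemo) (h2 : mem' Table.rep.array = mem Table.rep.array) :
    MemoRel t mem' M := by
  rw [MemoRel, h1, h2]
  exact hm

open Classical in
theorem eval_isSub (T : t.IsFor G) (ht : Tables t mem) {v j : ℕ} {d' v' j' : Expr}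
    (hd' : d'.eval mem = d) (hv' : v'.eval mem = v) (hj' : j'.eval mem = j)
    (hd : d < 2 * t.size) (hv : v < t.size) (hj : j < 2 * t.size) :
    (isSub d' v' j').eval mem ≠ 0 ↔ t.IsSub d v j := by
  have he := Table.edge_lt hd
  have he' := Table.edge_lt hj
  have hh' := Table.head_lt T hj
  simp only [isSub, eval_mul, eval_add, eval_eq, eval_lt, eval_zero,
    Table.eval_entry, eval_get, hd', hv', hj', ht.size, ht.table .canon j hj,
    ht.table .edge j hj, ht.table .edge d hd, ht.table .head j hj,
    ht.table .labDiff _ he _ he', ht.table .labDiff _ he' _ he, ht.table .node d hd _ hh',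
    ht.table .pathBelow _ he' _ hv _ hh', ht.table .pathSame _ he' _ hv _ hh',
    ncard_sdiff_eq_zero, ncard_sdiff_pos, Finset.card_eq_zero, Finset.filter_eq_empty_iff,
    Finset.card_pos, BagTree.IsSub, BagTree.Sub, Set.ssubset_def]
  have h1 : ((t.path v (t.head j)).filter fun e => t.lab e = t.lab (t.edge j)).Nonempty ↔
      ∃ e ∈ t.path v (t.head j), t.lab e = t.lab (t.edge j) := by
    simp [Finset.Nonempty]
  simp only [h1, mul_ne_zero_iff, ne_eq, ite_eq_right_iff, one_ne_zero, imp_false, not_not]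

theorem wp_callCmd (hl : Ready t s.mem) (hsp : s.mem rSp 0 = p) (hid : s.mem aId p = d)
    (hd : d < 2 * t.size) :
    WP procs callCmd s (60 * t.card d + 60) fun s' =>
      s'.out = s.out ++ 0 :: setWord 𝓕[t, d] ∧
        ∀ a, a ≠ rX → s'.mem a = s.mem a := by
  have hsz : (Table.size.entry eD).eval s.mem = t.card d := by
    simp only [Table.eval_entry, eval_get, eval_zero, hsp, hid]
    exact hl.table .size d hd
  have hlen : (vertexList 𝓕[t, d]).length = t.card d := by
    obtain ⟨l, h1, h2⟩ := exists_perm_vertexList 𝓕[t, d]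
    rw [setWord, List.cons.injEq] at h2
    rw [h2.2, List.length_map, ← h2.1]
    rfl
  refine (WP.seq (WP.emit_of (eval_zero) (WP.seq (WP.emit_of hsz
    ((wp_emitLoop (s := (s.emit 0).emit (t.card d)) (n := t.card d) (fun _ => True)
    (fun i => s.mem aList (d * n + i)) ?_ hsz ?_).mono le_rfl ?_))))).le ?_
  · simp [Expr.reads, Table.entry, Table.array, OfNat.ofNat]
  · intro s' hfr i hi hsi
    refine ⟨by simp, fun _ => ?_⟩
    have h1 : ∀ a, a ≠ rX → s'.mem a = s.mem a := hfr
    simp [hsi, h1 aList, h1 aId, h1 rSp, h1 aN, hsp, hid, hl.card]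
  · rintro s' ⟨h1, h2⟩
    refine ⟨?_, h2⟩
    have h3 : (List.range (t.card d)).map (fun i => s.mem aList (d * n + i)) =
        vertexList 𝓕[t, d] := by
      refine List.ext_getElem (by simp [hlen]) fun i h3 h4 => ?_
      simp [hl.lists d hd i h4]
    rw [h1]
    simp [h3, setWord, ← BagTree.card.eq_def]
  · simp
    omega

theorem wp_popCmd (T : t.IsFor G) (hl : Local t s.mem p d h q sum) (hh : h < q.length)
    (hd : d < 2 * t.size) (hv : q[h] ∈ 𝓚[t, d]) :
    WP procs popCmd s (60 * n + 60) fun s' =>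
      s'.out = s.out ++ 1 :: setWord (t.bag q[h] \ t.lab (t.edge d)) ∧
        ∀ a, a ≠ rX → s'.mem a = s.mem a := by
  have hvk := (BagTree.mem_nodes.1 hv).1
  have hsz := eval_cliqueSize hl.ready.toTables (d := eD) (v := eV) (by rwa [hl.eval_d])
    (by rwa [hl.eval_v hh])
  rw [hl.eval_d, hl.eval_v hh, ← Set.ncard_sdiff (T.lab_subset_bag (BagTree.isEnd_of_lt hd) hv)
    (Set.toFinite _)] at hsz
  refine (WP.seq (WP.emit_of eval_one (WP.seq (WP.emit_of hsz ((wp_emitLoop (n := n)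
    (fun u => ind (t.bag q[h] \ t.lab (t.edge d)) u ≠ 0)
    (fun i => i) ?_ ?_ ?_).mono le_rfl ?_))))).le ?_
  · simp [Expr.reads, OfNat.ofNat]
  · exact hl.ready.card
  · intro s' hfr u hu hsu
    have h1 : ∀ a, a ≠ rX → s'.mem a = s.mem a := hfr
    have h2 : Local t s'.mem p d h q sum := hl.frame fun a ha _ _ _ => h1 a (by omega)
    refine ⟨?_, fun _ => by simpa using hsu⟩
    have h3 : (Expr.var rX).eval s'.mem = u := hsu
    have h4 : eN.eval s'.mem = n := h2.ready.card
    rw [eval_mul, eval_get, eval_sub, Table.eval_entry, eval_add, eval_mul,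
      h2.eval_v hh, eval_add, eval_mul, Table.eval_entry, h2.eval_d, h3, h4,
      h2.ready.bag _ hvk u hu, h2.ready.table .edge d hd,
      h2.ready.table .lab _ (Table.edge_lt hd) u hu, eval_one, ind_sdiff]
  · rintro s' ⟨h1, h2⟩
    refine ⟨?_, h2⟩
    rw [h1]
    simp [setWord, vertexList]
  · simp [cliqueSize]
    omega

theorem wp_factorCmd (hl : Local t s.mem p d h q sum) (hh : h < q.length) {x pr : ℕ}
    (hx : s.mem aPhi (d * t.size + q[h]) = x) (hpr : s.mem aProd p = pr) :
    WP procs factorCmd s 60 fun s' => s'.out = s.out ++ [2, x] ∧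
      Local t s'.mem p d h q (sum + x * pr) ∧ s'.mem aMemo = s.mem aMemo ∧
      Kept t p L s.mem s'.mem := by
  have hphi : (Expr.get aPhi (eD * eSize + eV)).eval s.mem = x := by
    have h1 : eSize.eval s.mem = t.size := hl.ready.size
    rw [eval_get, eval_add, eval_mul, hl.eval_d, hl.eval_v hh, h1, hx]
  have hsp : eSp.eval s.mem = p := hl.sp
  refine (WP.seq (WP.emit_of eval_two (WP.seq (WP.emit_of hphi (WP.assign_of (i := p)
    (x := sum + x * pr) hsp ?_ ?_))))).le ?_
  · have h1 : (Expr.get aSum eSp).eval s.mem = sum := by rw [eval_get, hsp, hl.sum]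
    have h2 : (Expr.get aProd eSp).eval s.mem = pr := by rw [eval_get, hsp, hpr]
    rw [eval_add, eval_mul, emit_mem, emit_mem, hphi, h1, h2]
  · have hset : ∀ a, a ≠ aSum → (((s.emit 2).emit x).set aSum p
        (sum + x * pr)).mem a = s.mem a := fun a ha => set_mem_of_ne ha
    refine ⟨by simp, ?_, hset _ (by simp), ?_⟩
    · refine ⟨hl.ready.frame fun a ha => hset a (by omega), ?_, ?_, ?_, ?_, by simp, ?_⟩
      · rw [hset _ (by simp), hl.sp]
      · rw [hset _ (by simp), hl.id]
      · rw [hset _ (by simp), hl.hd]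
      · rw [hset _ (by simp), hl.tl]
      · rw [hset _ (by simp)]; exact hl.queue
    · refine Kept.of_local (fun a ha _ => hset a (by omega)) (fun a ha ha' i hi => ?_)
        (fun i hi => by rw [hset _ (by simp)])
      by_cases h : a = aSum
      · subst h
        rw [set_mem_same, if_neg (by omega)]
        rfl
      · rw [hset a h]
  · simp

open Classical in
theorem wp_pushCmd (hl : Local t s.mem p d h q sum) (hh : h < q.length)
    (hd : d < 2 * t.size) :
    WP procs pushCmd s (80 * t.size + 80) fun s' => s'.out = s.out ∧
      Local t s'.mem p d (h + 1) (q ++ (List.range t.size).filter fun w =>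
        w ∈ 𝓚[t, d] ∧ w ≠ s.mem Table.top.array d ∧ t.par w = q[h]) sum ∧
      s'.mem aMemo = s.mem aMemo ∧ Kept t p L s.mem s'.mem := by
  have hq := hl.queue
  have hsp : eSp.eval s.mem = p := hl.sp
  set v := q[h] with hv
  set C := (List.range t.size).filter fun w =>
        w ∈ 𝓚[t, d] ∧ w ≠ s.mem Table.top.array d ∧ t.par w = v with hC
  set s1 := s.set rCur 0 v with hs1
  set s2 := s1.set rCt 0 q.length with hs2
  have hs2m : ∀ a, a ≠ rCur → a ≠ rCt → s2.mem a = s.mem a := fun a h1 h2 => by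
    rw [hs2, set_mem_of_ne h2, hs1, set_mem_of_ne h1]
  refine (WP.seq (WP.assign_of (i := 0) (x := v) eval_zero (hl.eval_v hh) (WP.seq
    (WP.assign_of (i := 0) (x := q.length) eval_zero ?_ (WP.seq (((wp_collect (s := s2)
      (A := aQueue) (cnt := rCt) (x := rX) (n := t.size) (b := p * t.size) (fun w =>
        w ∈ 𝓚[t, d] ∧ w ≠ s.mem Table.top.array d ∧ t.par w = v) q (by simp)
      (by simp) (by simp) ?_ ?_ ?_ ?_ ?_ ?_).frame ?_).mono le_rfl
      (Q' := fun s' => WP procs _ s' 20 _) ?_)))))).le ?_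
  · rw [eval_get, eval_get, set_mem_of_ne (by simp),
      set_mem_of_ne (by simp)]
    exact (congrArg (s.mem aTl) hsp).trans hl.tl
  · simp [Expr.reads, OfNat.ofNat]
  · rw [eval_get, eval_zero, hs2m _ (by simp) (by simp), hl.ready.size]
  · have h1 : eSp.eval s2.mem = p := by
      rw [eval_get, eval_zero, hs2m _ (by simp) (by simp), hl.sp]
    have h2 : eSize.eval s2.mem = t.size := by
      rw [eval_get, eval_zero, hs2m _ (by simp) (by simp), hl.ready.size]
    rw [eval_mul, h1, h2]
  · intro s3 hfr w hw hsw
    have h1 : ∀ a < 79, s3.mem a = s.mem a := fun a ha => by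
      rw [hfr a (by omega) (by omega) (by omega), hs2m a (by omega) (by omega)]
    have hr : Ready t s3.mem := hl.ready.frame fun a ha => h1 a (by omega)
    have h2 : eD.eval s3.mem = d := by
      simp [h1 aId, h1 rSp, hl.sp, hl.id]
    have h3 : eSize.eval s3.mem = t.size := hr.size
    have h4 : (Expr.var rX).eval s3.mem = w := hsw
    have h5 : (Expr.var rCur).eval s3.mem = v := by
      rw [eval_get, eval_zero, hfr _ (by simp) (by simp) (by simp), hs2,
        set_mem_of_ne (by simp), hs1, set_mem_self]
    simp only [eval_mul, Table.eval_entry, eval_add, eval_sub, eval_eq,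
      eval_one]
    rw [h2, h3, h4, h5, eval_get, h4, hr.par w hw, hr.table .node d hd w hw,
      h1 _ (by simp [Table.array])]
    by_cases hc1 : w ∈ 𝓚[t, d] <;>
      by_cases hc2 : w = s.mem Table.top.array d <;> by_cases hc3 : t.par w = v <;>
      simp [hc1, hc2, hc3]
  · rw [hs2, set_mem_self]
  · rw [hs2m _ (by simp) (by simp)]; exact hq
  · simp [collect, Cmd.Plain]
  · rintro s3 ⟨⟨h1, h2, h3⟩, hfr, hout⟩
    have h4 : ∀ a, a ≠ aQueue → a ≠ rCt → a ≠ rX → a ≠ rCur → s3.mem a = s.mem a :=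
      fun a ha ha1 ha2 ha3 => by
        rw [hfr a (by simp [collect, Cmd.writes, ha, ha1, ha2]), hs2m a ha3 ha1]
    have hsp3 : eSp.eval s3.mem = p := by
      rw [eval_get, eval_zero, h4 _ (by simp) (by simp) (by simp) (by simp), hl.sp]
    set s4 := s3.set aTl p (q ++ C).length with hs4
    refine (WP.seq (WP.assign_of (i := p) (x := (q ++ C).length) hsp3 ?_ (WP.assign_of (i := p)
      (x := h + 1) ?_ ?_ ?_))).le ?_
    · exact h1
    · rw [eval_get, set_mem_of_ne (by simp)]; exact hsp3
    · have h5 : eSp.eval s4.mem = p := by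
        rw [hs4, eval_get, set_mem_of_ne (by simp)]; exact hsp3
      rw [eval_add, eval_get, h5, eval_one,
        set_mem_of_ne (by simp), h4 _ (by simp) (by simp) (by simp) (by simp), hl.hd]
    · have h5 : ∀ a < 79, a ≠ aTl → a ≠ aHd → (s4.set aHd p (h + 1)).mem a = s.mem a :=
        fun a ha ha1 ha2 => by
          rw [set_mem_of_ne ha2, hs4, set_mem_of_ne ha1,
            h4 _ (by omega) (by omega) (by omega) (by omega)]
      have h6 : (s4.set aHd p (h + 1)).mem aQueue = s3.mem aQueue := by
        rw [set_mem_of_ne (by simp), hs4, set_mem_of_ne (by simp)]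
      refine ⟨?_, ?_, h5 _ (by simp) (by simp) (by simp), ?_⟩
      · rw [set_out, set_out, hout]
        rfl
      · refine ⟨hl.ready.frame fun a ha => h5 a (by omega) (by omega) (by omega), ?_, ?_,
          set_mem_self, ?_, ?_, ?_⟩
        · rw [h5 _ (by simp) (by simp) (by simp), hl.sp]
        · rw [h5 _ (by simp) (by simp) (by simp), hl.id]
        · rw [set_mem_of_ne (by simp), set_mem_self]
        · rw [h5 _ (by simp) (by simp) (by simp), hl.sum]
        · rw [h6]; exact h2
      · refine Kept.of_local (fun a ha _ => h5 a (by omega) (by omega) (by omega))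
          (fun a ha ha' i hi => ?_) (fun i hi => ?_)
        · by_cases h7 : a = aTl
          · subst h7
            rw [set_mem_of_ne (by simp), set_mem_same,
              if_neg (by omega), h4 _ (by simp) (by simp) (by simp) (by simp)]
          · by_cases h8 : a = aHd
            · subst h8
              rw [set_mem_same, if_neg (by omega),
                set_mem_of_ne h7, h4 _ (by simp) (by simp) (by simp) (by simp)]
            · rw [h5 a (by omega) h7 h8]
        · rw [h6, h3 i hi, hs2m _ (by simp) (by simp)]
    · simp
  · simp
    omega

end

theorem AWP.assign_seq {pot : MachineState → ℕ} {procs : List Cmd} {c : Cmd} {s : MachineState}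
    {a i x b : ℕ} {e v : Expr} {Q : MachineState → Prop} (he : e.eval s.mem = i)
    (hv : v.eval s.mem = x) (hpot : pot (s.set a i x) = pot s)
    (h : AWP pot procs c (s.set a i x) b Q) :
    AWP pot procs (.seq (.assign a e v) c) s (e.cost + v.cost + 1 + b) Q :=
  AWP.seq (AWP.of_wp (WP.assign_of he hv ⟨h, hpot⟩))

/-- An increase of the potential pays for the running time. -/
theorem AWP.seq_gain {pot : MachineState → ℕ} {procs : List Cmd} {c d : Cmd} {s : MachineState}
    {b b' b₀ A : ℕ} {Q : MachineState → Prop}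
    (h : AWP pot procs c s b fun s' => WP procs d s' b' fun s'' => Q s'' ∧ pot s' + A ≤ pot s'')
    (hb : b + b' ≤ b₀ + A) : AWP pot procs (.seq c d) s b₀ Q := by
  obtain ⟨t, s', h1, h2, t', s'', h3, h4, h5, h6⟩ := h
  exact ⟨_, _, .seq h1 h3, by omega, h5⟩

/-- The potential is the number of graphs in the memo table, multiplied by a bound for the costs of
the computation for one graph. So all calls have small amortized costs. -/
def memoPotential (k A : ℕ) (s : MachineState) : ℕ :=
  A * ((Finset.range (2 * k)).filter fun i => s.mem aMemo i ≠ 0).card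

theorem memoPotential_congr {k A : ℕ} {s s' : MachineState} (h : s'.mem aMemo = s.mem aMemo) :
    memoPotential k A s' = memoPotential k A s := by
  rw [memoPotential, memoPotential, h]

theorem memoPotential_set {k A i x : ℕ} {s : MachineState} (hi : i < 2 * k)
    (h0 : s.mem aMemo i = 0) :
    memoPotential k A (s.set aMemo i (x + 1)) = memoPotential k A s + A := by
  have h1 : ((Finset.range (2 * k)).filter fun j => (s.set aMemo i (x + 1)).mem aMemo j ≠ 0) =
      insert i ((Finset.range (2 * k)).filter fun j => s.mem aMemo j ≠ 0) := by
    ext j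
    rw [Finset.mem_insert, Finset.mem_filter, Finset.mem_filter, set_mem_same]
    by_cases hj : j = i
    · simp [hj, hi]
    · simp [hj]
  rw [memoPotential, memoPotential, h1, Finset.card_insert_of_notMem (by simp [h0]), Nat.mul_succ]

/-- The procedure works correctly, and with small amortized costs, for the flower `d`. -/
def CountSpec {n : ℕ} (t : BagTree (Fin n)) (G : SimpleGraph (Fin n)) (procs : List Cmd) (A d : ℕ) :
    Prop :=
  ∀ (p : ℕ) (s : MachineState) (M : List (G.Subgraph × ℕ)), Ready t s.mem → MemoRel t s.mem M →
    s.mem rSp 0 = p → s.mem aId p = d →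
    AWP (memoPotential t.size A) procs (.call 0) s (200 + 60 * t.card d) fun s' => ∃ M' w a,
      Sim (.count (t.graph G d)) M M' w a ∧ s'.out = s.out ++ w ∧ s'.mem rRes 0 = a ∧
        MemoRel t s'.mem M' ∧ Kept t p (t.card d + 1) s.mem s'.mem

section

variable {n : ℕ} {t : BagTree (Fin n)} {G : SimpleGraph (Fin n)} {procs : List Cmd}
  {s : MachineState} {A p d h sum j pr L : ℕ} {q : List ℕ} {M : List (G.Subgraph × ℕ)}

theorem Local.eval_hd (hl : Local t s.mem p d h q sum) :
    (Expr.get aHd eSp).eval s.mem = h := by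
  simp [hl.sp, hl.hd]

theorem Local.eval_tl (hl : Local t s.mem p d h q sum) :
    (Expr.get aTl eSp).eval s.mem = q.length := by
  simp [hl.sp, hl.tl]

/-- A nested call that satisfies its specification. -/
theorem awp_subCall (hspec : CountSpec t G procs A j) (hl : Local t s.mem p d h q sum)
    (hq : q.length ≤ t.size) (hm : MemoRel t s.mem M) (hj : s.mem aIdx p = j)
    (hpr : s.mem aProd p = pr) (hL : t.card j < L) :
    AWP (memoPotential t.size A) procs subCall s (250 + 60 * t.card j) fun s' => ∃ M' w a,
      Sim (.count (t.graph G j)) M M' w a ∧ s'.out = s.out ++ w ∧ Local t s'.mem p d h q sum ∧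
        s'.mem aIdx p = j ∧ s'.mem aProd p = pr * a ∧ MemoRel t s'.mem M' ∧
        Kept t p L s.mem s'.mem := by
  have hsp : eSp.eval s.mem = p := hl.sp
  have h1 : ∀ a, a ≠ aId → (s.set aId (p + 1) j).mem a = s.mem a :=
    fun a ha => set_mem_of_ne ha
  have h2 : ∀ a, a ≠ aId → a ≠ rSp → ((s.set aId (p + 1) j).set rSp 0 (p + 1)).mem a = s.mem a :=
    fun a ha ha' => by rw [set_mem_of_ne ha', h1 a ha]
  have h2id : ∀ i, ((s.set aId (p + 1) j).set rSp 0 (p + 1)).mem aId i =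
      if i = p + 1 then j else s.mem aId i := fun i => by
    rw [set_mem_of_ne (by simp), set_mem_same]
  set s2 := (s.set aId (p + 1) j).set rSp 0 (p + 1) with hs2
  refine (AWP.assign_seq (i := p + 1) (x := j) (b := 10 + (200 + 60 * t.card j + 20)) ?_ ?_
    (memoPotential_congr (h1 _ (by simp))) ?_).le ?_
  · rw [eval_add, hsp, eval_one]
  · rw [eval_get, hsp, hj]
  · refine (AWP.assign_seq (i := 0) (x := p + 1) (b := 200 + 60 * t.card j + 20) eval_zero ?_
      (memoPotential_congr (set_mem_of_ne (by simp))) ?_).mono (by simp) fun _ h => h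
    · rw [eval_add, eval_get, eval_zero, h1 _ (by simp), hl.sp, eval_one]
    · refine AWP.seq ((hspec (p + 1) s2 M (hl.ready.frame fun a ha => h2 a (by omega) (by omega))
        (hm.frame (h2 _ (by simp) (by simp)) (h2 _ (by simp [Table.array]) (by simp [Table.array])))
        (by simp [hs2]) (by simp [h2id])).mono le_rfl ?_)
      rintro s3 ⟨M', w, a, hsim, hout, hres, hm', hk⟩
      have hk' : ∀ b, b ≠ rSp → b ≠ aProd →
          ((s3.set rSp 0 p).set aProd p (pr * a)).mem b = s3.mem b := fun b hb hb' => by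
        rw [set_mem_of_ne hb', set_mem_of_ne hb]
      have h3 : ∀ b, 73 ≤ b → b ≤ 78 → ∀ i ≤ p, s3.mem b i = s.mem b i := fun b hb hb' i hi => by
        rw [hk.frame b hb hb' i (by omega)]
        by_cases h : b = aId
        · subst h
          rw [h2id, if_neg (by omega)]
        · rw [h2 b h (by omega)]
      have h4 : ∀ i < (p + 1) * t.size, s3.mem aQueue i = s.mem aQueue i := fun i hi => by
        rw [hk.queue i hi, h2 _ (by simp) (by simp)]
      have hlow : ∀ b < 60, s3.mem b = s.mem b := fun b hb => by
        rw [hk.low b hb, h2 b (by omega) (by omega)]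
      have hsp3 : s3.mem rSp 0 = p + 1 := by rw [hk.sp, hs2, set_mem_self]
      refine AWP.of_wp ((WP.seq (WP.assign_of (i := 0) (x := p) eval_zero ?_
        (WP.assign_of (i := p) (x := pr * a) ?_ ?_ ?_))).mono (by simp) fun _ h => h)
      · rw [eval_sub, eval_get, eval_zero, hsp3, eval_one, Nat.add_sub_cancel]
      · rw [eval_get, eval_zero, set_mem_self]
      · rw [eval_mul, eval_get, eval_get, eval_get, eval_zero,
          set_mem_self, set_mem_of_ne (by simp),
          set_mem_of_ne (by simp), h3 _ (by simp) (by simp) p le_rfl, hpr, hres]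
      · set s5 := (s3.set rSp 0 p).set aProd p (pr * a) with hs5
        have h5sp : s5.mem rSp 0 = p := by
          rw [hs5, set_mem_of_ne (by simp), set_mem_self]
        have h5 : ∀ b, 73 ≤ b → b ≤ 78 → b ≠ aProd → ∀ i ≤ p, s5.mem b i = s.mem b i :=
          fun b hb hb' hb2 i hi => by rw [hk' b (by omega) hb2, h3 b hb hb' i hi]
        have h5low : ∀ b < 60, s5.mem b = s.mem b := fun b hb => by
          rw [hk' b (by omega) (by omega), hlow b hb]
        have h5q : ∀ i < (p + 1) * t.size, s5.mem aQueue i = s.mem aQueue i := fun i hi => by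
          rw [hk' _ (by simp) (by simp), h4 i hi]
        refine ⟨⟨M', w, a, hsim, ?_, ⟨hl.ready.frame h5low, h5sp, ?_, ?_, ?_, ?_, ?_⟩, ?_, ?_, ?_,
          ?_⟩,
          memoPotential_congr (hk' _ (by simp) (by simp))⟩
        · exact hout
        · rw [h5 _ (by simp) (by simp) (by simp) p le_rfl, hl.id]
        · rw [h5 _ (by simp) (by simp) (by simp) p le_rfl, hl.hd]
        · rw [h5 _ (by simp) (by simp) (by simp) p le_rfl, hl.tl]
        · rw [h5 _ (by simp) (by simp) (by simp) p le_rfl, hl.sum]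
        · intro i hi
          rw [h5q _ (by rw [Nat.succ_mul]; omega)]
          exact hl.queue i hi
        · rw [h5 _ (by simp) (by simp) (by simp) p le_rfl, hj]
        · rw [hs5, set_mem_self]
        · exact hm'.frame (hk' _ (by simp) (by simp))
            (hk' _ (by simp [Table.array]) (by simp [Table.array]))
        · refine ⟨h5low, h5sp.trans hl.sp.symm, fun b hb hb' i hi => ?_, fun i hi =>
            h5q i (hi.trans_le (Nat.mul_le_mul_right _ (by omega))), fun δ hδ hle => ?_⟩
          · by_cases hb2 : b = aProd
            · subst hb2
              rw [hs5, set_mem_same, if_neg (by omega),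
                set_mem_of_ne (by simp), h3 _ hb hb' i (by omega)]
            · exact h5 b hb hb' hb2 i (by omega)
          · have := hk.memo δ hδ (by omega)
            rw [h2 aMemo (by simp) (by simp), h2 Table.rep.array (by simp [Table.array])
              (by simp [Table.array])] at this
            rw [hk' _ (by simp) (by simp), this]
  · simp
    omega

open Classical in
theorem awp_prodCmd (T : t.IsFor G) (hd : d < 2 * t.size) (hl : Local t s.mem p d h q sum)
    (hh : h < q.length) (hq : q.length ≤ t.size) (hv : q[h] ∈ 𝓚[t, d])
    (hspec : ∀ j < 2 * t.size, t.IsSub d q[h] j → CountSpec t G procs A j ∧ t.card j < L)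
    (hm : MemoRel t s.mem M) :
    AWP (memoPotential t.size A) procs prodCmd s (60 * n + 1200 * t.size + 50) fun s' =>
      ∃ M' w pr, Sim (.prod ((t.subsFrom d q[h] 0).map (t.graph G)) 1) M M' w pr ∧
        s'.out = s.out ++ w ∧ Local t s'.mem p d h q sum ∧ s'.mem aProd p = pr ∧
        MemoRel t s'.mem M' ∧ Kept t p L s.mem s'.mem := by
  have hsp : eSp.eval s.mem = p := hl.sp
  set v := q[h] with hvdef
  have hvk := (BagTree.mem_nodes.1 hv).1
  set s1 := s.set aProd p 1 with hs1
  set s2 := s1.set aIdx p 0 with hs2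
  have h2 : ∀ a, a ≠ aProd → a ≠ aIdx → s2.mem a = s.mem a := fun a ha ha' => by
    rw [hs2, set_mem_of_ne ha', hs1, set_mem_of_ne ha]
  refine (AWP.assign_seq (i := p) (x := 1) (b := 10 +
      (∑ j ∈ Finset.range (2 * t.size), (500 + (if t.IsSub d v j then 60 * t.card j else 0) +
        (Expr.lt eJ (2 * eSize)).cost + 1) + (Expr.lt eJ (2 * eSize)).cost + 1)) hsp eval_one
    (memoPotential_congr (set_mem_of_ne (by simp))) ?_).le ?_
  · refine (AWP.assign_seq (i := p) (x := 0) (b := ∑ j ∈ Finset.range (2 * t.size),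
      (500 + (if t.IsSub d v j then 60 * t.card j else 0) + (Expr.lt eJ (2 * eSize)).cost + 1) +
        (Expr.lt eJ (2 * eSize)).cost + 1) ?_ eval_zero
      (memoPotential_congr (set_mem_of_ne (by simp))) ?_).mono (by simp) fun _ h => h
    · rw [eval_get, set_mem_of_ne (by simp)]
      exact hsp
    · refine AWP.while_loop (2 * t.size) (fun i s' => i ≤ 2 * t.size ∧ Local t s'.mem p d h q sum ∧
        s'.mem aIdx p = i ∧ Kept t p L s.mem s'.mem ∧ ∃ M' w pr, s'.mem aProd p = pr ∧
          s'.out = s.out ++ w ∧ MemoRel t s'.mem M' ∧ ∀ M'' w' a,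
            Sim (.prod ((t.subsFrom d v i).map (t.graph G)) pr) M' M'' w' a →
            Sim (.prod ((t.subsFrom d v 0).map (t.graph G)) 1) M M'' (w ++ w') a) _ ?_ ?_ ?_
      · rintro i s' ⟨hi, hl', hidx, hk, M', w, pr, hpr, hout, hm', hcps⟩ hcond
        have hsp' : eSp.eval s'.mem = p := hl'.sp
        have hJ : eJ.eval s'.mem = i := by rw [eval_get, hsp', hidx]
        have hi' : i < 2 * t.size := by
          by_contra hcon
          refine hcond ?_
          rw [eval_lt, hJ, eval_mul, eval_two, if_neg]
          have : eSize.eval s'.mem = t.size := hl'.ready.size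
          rw [this]
          exact hcon
        refine ⟨hi', ?_⟩
        have htest := eval_isSub T hl'.ready.toTables hl'.eval_d (hl'.eval_v hh) hJ hd hvk hi'
        rw [← hvdef] at htest
        have hinc : ∀ s3 : MachineState, (Local t s3.mem p d h q sum ∧ s3.mem aIdx p = i ∧
            Kept t p L s.mem s3.mem ∧ ∃ M' w pr, s3.mem aProd p = pr ∧
              s3.out = s.out ++ w ∧ MemoRel t s3.mem M' ∧ ∀ M'' w' a,
                Sim (.prod ((t.subsFrom d v (i + 1)).map (t.graph G)) pr) M' M'' w' a →
                Sim (.prod ((t.subsFrom d v 0).map (t.graph G)) 1) M M'' (w ++ w') a) →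
            AWP (memoPotential t.size A) procs (.assign aIdx eSp (eJ + 1)) s3 10
              fun s' => i + 1 ≤ 2 * t.size ∧ Local t s'.mem p d h q sum ∧
                s'.mem aIdx p = i + 1 ∧ Kept t p L s.mem s'.mem ∧ ∃ M' w pr, s'.mem aProd p = pr ∧
                s'.out = s.out ++ w ∧ MemoRel t s'.mem M' ∧ ∀ M'' w' a,
                  Sim (.prod ((t.subsFrom d v (i + 1)).map (t.graph G)) pr) M' M'' w' a →
                  Sim (.prod ((t.subsFrom d v 0).map (t.graph G)) 1) M M'' (w ++ w') a := by
          rintro s3 ⟨hl3, hidx3, hk3, M3, w3, pr3, hpr3, hout3, hm3, hcps3⟩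
          have hsp3 : eSp.eval s3.mem = p := hl3.sp
          have h4 : ∀ a, a ≠ aIdx → (s3.set aIdx p (i + 1)).mem a = s3.mem a :=
            fun a ha => set_mem_of_ne ha
          refine AWP.of_wp ((WP.assign_of (i := p) (x := i + 1) hsp3 ?_ ?_).mono (by simp)
            fun _ h => h)
          · rw [eval_add, eval_get, hsp3, hidx3, eval_one]
          · refine ⟨⟨hi', hl3.frame fun a _ _ ha _ => h4 a ha, set_mem_self, hk3.trans
              (Kept.of_local (fun a ha _ => h4 a (by omega)) (fun a ha ha' b hb => ?_)
                fun b hb => by rw [h4 _ (by simp)]), M3, w3, pr3, ?_, hout3,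
                hm3.frame (h4 _ (by simp)) (h4 _ (by simp [Table.array])), hcps3⟩,
              memoPotential_congr (h4 _ (by simp))⟩
            · by_cases h5 : a = aIdx
              · subst h5
                rw [set_mem_same, if_neg (by omega)]
              · rw [h4 a h5]
            · rw [h4 _ (by simp), hpr3]
        refine (AWP.seq ((AWP.ite (b := 250 + (if t.IsSub d v i then 60 * t.card i else 0))
          (fun hne => ?_) (fun hz => ?_)).mono le_rfl hinc)).le ?_
        · have hsub := htest.1 hne
          rw [if_pos hsub]
          refine (awp_subCall (L := L) (hspec i hi' hsub).1 hl' hq hm' hidx hpr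
            (hspec i hi' hsub).2).mono le_rfl ?_
          rintro s3 ⟨M3, w3, a, hsim, hout3, hl3, hidx3, hpr3, hm3, hk3⟩
          refine ⟨hl3, hidx3, hk.trans hk3, M3, w ++ w3, _, hpr3, ?_, hm3, fun M'' w' b hb => ?_⟩
          · rw [hout3, hout, List.append_assoc]
          · rw [List.append_assoc]
            refine hcps _ _ _ ?_
            rw [BagTree.IsFor.subsFrom_pos hi' hsub, List.map_cons]
            exact Sim.prod_step hsim hb
        · have hsub : ¬ t.IsSub d v i := fun h => htest.2 h hz
          rw [if_neg hsub]
          refine AWP.of_wp ((WP.skip ⟨⟨hl', hidx, hk, M', w, pr, hpr, hout, hm', ?_⟩, rfl⟩).mono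
            (by omega) fun _ h => h)
          rw [← BagTree.IsFor.subsFrom_neg hi' hsub]
          exact hcps
        · simp [isSub]
          omega
      · refine ⟨Nat.zero_le _, hl.frame fun a _ h3 h4 _ => h2 a h3 h4, by simp,
          Kept.of_local (fun a ha _ => h2 a (by omega) (by omega)) (fun a ha ha' b hb => ?_)
          (fun b hb => by rw [h2 _ (by simp) (by simp)]), M, [], 1, by simp,
          by simp, hm.frame (h2 _ (by simp) (by simp))
          (h2 _ (by simp [Table.array]) (by simp [Table.array])), fun _ _ _ h => by simpa using h⟩
        by_cases h3 : a = aIdx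
        · subst h3
          rw [set_mem_same, if_neg (by omega), set_mem_of_ne (by simp)]
        · rw [set_mem_of_ne h3]
          by_cases h4 : a = aProd
          · subst h4
            rw [set_mem_same, if_neg (by omega)]
          · rw [set_mem_of_ne h4]
      · rintro i s' ⟨hi, hl', hidx, hk, M', w, pr, hpr, hout, hm', hcps⟩ hcond
        have hi' : i = 2 * t.size := by
          refine le_antisymm hi (not_lt.1 fun hlt => ?_)
          have hJ : eJ.eval s'.mem = i := by
            have hsp' : eSp.eval s'.mem = p := hl'.sp
            rw [eval_get, hsp', hidx]
          have : eSize.eval s'.mem = t.size := hl'.ready.size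
          rw [eval_lt, hJ, eval_mul, eval_two, this, if_pos hlt] at hcond
          exact one_ne_zero hcond
        refine ⟨M', w, pr, ?_, hout, hl', hpr, hm', hk⟩
        have := hcps M' [] pr (by
          rw [hi', BagTree.IsFor.subsFrom_done]
          exact Sim.prod_done)
        simpa using this
  · have h3 : ∑ j ∈ Finset.range (2 * t.size), (500 + (if t.IsSub d v j then 60 * t.card j else 0) +
        (Expr.lt eJ (2 * eSize)).cost + 1) ≤ 1100 * t.size + 60 * n := by
      have h4 := T.sum_card_le hd hv
      have h5 : ∀ j, (500 + (if t.IsSub d v j then 60 * t.card j else 0) +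
        (Expr.lt eJ (2 * eSize)).cost + 1) =
          509 + 60 * (if t.IsSub d v j then t.card j else 0) := by
        intro j
        split_ifs <;> simp
        omega
      simp only [h5, Finset.sum_add_distrib, ← Finset.mul_sum, Finset.sum_const, Finset.card_range,
        smul_eq_mul]
      omega
    simp at h3 ⊢
    omega

theorem Tables.rep_eq_iff (ht : Tables t s.mem) {d d' : ℕ} (hd : d < 2 * t.size)
    (hd' : d' < 2 * t.size) : s.mem Table.rep.array d = s.mem Table.rep.array d' ↔
      t.graph G d = t.graph G d' := by
  have h1 := ht.table .rep d hd
  have h2 := ht.table .rep d' hd'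
  constructor
  · intro h
    have h3 := h1.1
    have h4 := h2.1
    rw [← h] at h4
    exact congrArg (sub G) (Eq.trans h3 h4.symm)
  · intro h
    have h3 : 𝓕[t, d] = 𝓕[t, d'] :=
      congrArg SimpleGraph.Subgraph.verts h
    rw [h3] at h1
    exact h1.unique h2

theorem Tables.rep_lt (ht : Tables t s.mem) (hd : d < 2 * t.size) :
    s.mem Table.rep.array d < 2 * t.size :=
  ((ht.table .rep d hd).2 rfl).trans_lt hd

open Classical in
/-- The breadth-first search in the clique tree of the flower `d`. -/
theorem awp_loop [Nonempty (Fin n)] (T : t.IsFor G) (hG : IsChordal G) (hd : d < 2 * t.size)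
    {r : ℕ} (hr : s.mem Table.top.array d = r) (hl : Local t s.mem p d 0 [r] 0)
    (hspec : ∀ j < 2 * t.size, t.card j < t.card d → CountSpec t G procs A j)
    (hm : MemoRel t s.mem M) :
    AWP (memoPotential t.size A) procs (.while (.lt (.get aHd eSp) (.get aTl eSp))
        (.seq popCmd (.seq prodCmd (.seq factorCmd pushCmd)))) s
      (t.size * (120 * n + 1280 * t.size + 270) + 20) fun s' =>
      ∃ (𝒯 : RootedCliqueTree (t.graph G d)) (M' : List (G.Subgraph × ℕ)) (w : List ℕ) (a : ℕ),
        Sim (.loop (t.graph G d) 𝒯 [𝒯.root] 0) M M' w a ∧ s'.out = s.out ++ w ∧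
        s'.mem rSp 0 = p ∧ s'.mem aId p = d ∧ s'.mem aSum p = a ∧ MemoRel t s'.mem M' ∧
        Kept t p (t.card d) s.mem s'.mem := by
  have hE := BagTree.isEnd_of_lt hd
  have htop : IsLeast {w | w ∈ 𝓚[t, d]} r := by
    rw [← hr]
    exact hl.ready.table .top d hd
  obtain ⟨𝒯, f, hinj, hfF, hroot, hbag, hchild, hfp⟩ :=
    (T.flowerTree hE htop.1 htop.2).exists_rooted
  have hfk : ∀ x, f x < t.size := fun x => (BagTree.mem_nodes.1 ((hfF _).2 ⟨x, rfl⟩)).1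
  have hsize : 𝒯.size ≤ t.size := by
    have := Fintype.card_le_of_injective (fun x => (⟨f x, hfk x⟩ : Fin t.size))
      fun x y h => hinj (Fin.mk.inj_iff.1 h)
    simpa using this
  have hlen : ∀ l : List (Fin 𝒯.size), l.Nodup → (l.map f).length ≤ t.size := fun l h => by
    have := h.length_le_card
    rw [Fintype.card_fin] at this
    rw [List.length_map]
    omega
  refine (AWP.while_loop t.size (fun i s' => ∃ (P Q : List (Fin 𝒯.size)) (M' : _) (w : _) (sum : ℕ),
    P.length = i ∧ (P ++ Q).Nodup ∧ (∀ y ∈ P ++ Q, y ≠ 𝒯.root → ∃ x ∈ P, t.par (f y) = f x) ∧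
    Local t s'.mem p d i ((P ++ Q).map f) sum ∧ s'.out = s.out ++ w ∧ MemoRel t s'.mem M' ∧
    Kept t p (t.card d) s.mem s'.mem ∧ ∀ M'' w' a, Sim (.loop (t.graph G d) 𝒯 Q sum) M' M'' w' a →
      Sim (.loop (t.graph G d) 𝒯 [𝒯.root] 0) M M'' (w ++ w') a)
    (fun _ => 120 * n + 1280 * t.size + 250) ?_ ?_ ?_).le ?_
  · rintro i s' ⟨P, Q, M', w, sum, rfl, hnd, hpar, hl', hout, hm', hk, hcps⟩ hcond
    have hlq := hlen _ hnd
    obtain ⟨x, Q, rfl⟩ : ∃ x Q', Q = x :: Q' := by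
      cases Q with
      | cons x Q' => exact ⟨x, Q', rfl⟩
      | nil =>
        refine absurd ?_ hcond
        rw [eval_lt, hl'.eval_hd, hl'.eval_tl]
        simp
    have hh : P.length < ((P ++ x :: Q).map f).length := by simp
    have hv : ((P ++ x :: Q).map f)[P.length] = f x := by simp
    have hvF : f x ∈ 𝓚[t, d] := (hfF _).2 ⟨x, rfl⟩
    have hvk := hfk x
    refine ⟨hh.trans_le hlq, ?_⟩
    refine (AWP.seq (AWP.of_wp ((wp_popCmd T hl' hh hd (hv ▸ hvF)).mono le_rfl ?_))).mono
      (b := 60 * n + 60 + (60 * n + 1200 * t.size + 50 + (60 + (80 * t.size + 80)))) (by omega)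
      fun _ h => h
    rintro s1 ⟨hout1, hfr1⟩
    have hl1 : Local t s1.mem p d P.length ((P ++ x :: Q).map f) sum :=
      hl'.frame fun a ha _ _ _ => hfr1 a (by omega)
    have hm1 : MemoRel t s1.mem M' := hm'.frame (hfr1 _ (by simp)) (hfr1 _ (by simp [Table.array]))
    have hk1 : Kept t p (t.card d) s.mem s1.mem := hk.trans (Kept.of_local
      (fun a ha _ => hfr1 a (by omega)) (fun a ha ha' i hi => by rw [hfr1 a (by omega)])
      fun i hi => by rw [hfr1 _ (by simp)])
    refine ⟨?_, memoPotential_congr (hfr1 _ (by simp))⟩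
    refine AWP.seq ((awp_prodCmd (L := t.card d) T hd hl1 hh hlq (hv ▸ hvF) (fun j hj hsub => ?_)
      hm1).mono le_rfl ?_)
    · have h1 := BagTree.IsFor.card_lt_of_isSub T hd hvF hj (hv ▸ hsub)
      exact ⟨hspec j hj h1, h1⟩
    · rintro s2 ⟨M2, w2, pr, hsim, hout2, hl2, hpr, hm2, hk2⟩
      have hx : s2.mem aPhi (d * t.size + ((P ++ x :: Q).map f)[P.length]) =
          phi (𝒯.bag x) (forbiddenPrefixes 𝒯 x) := by
        rw [hv, hl2.ready.factors d hd _ hvk, hbag, hfp,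
          hk2.low _ (by simp [Table.array]), hk1.low _ (by simp [Table.array]), hr]
        refine (T.phi_flower hE hvF htop.1 htop.2 fun b _ => ?_).symm
        rw [BagTree.mark]
      refine AWP.of_wp ((WP.seq ((wp_factorCmd (L := t.card d) hl2 hh hx hpr).mono le_rfl ?_)).mono
        le_rfl fun _ h => h)
      rintro s3 ⟨hout3, hl3, hmemo3, hk3⟩
      refine (wp_pushCmd (L := t.card d) hl3 hh hd).mono le_rfl ?_
      rintro s4 ⟨hout4, hl4, hmemo4, hk4⟩
      have hr3 : s3.mem Table.top.array d = r := by
        rw [hk3.low _ (by simp [Table.array]), hk2.low _ (by simp [Table.array]),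
          hk1.low _ (by simp [Table.array]), hr]
      rw [hv, hr3] at hl4
      have hCx : ∀ y ∈ (List.range t.size).filter fun w => w ∈ 𝓚[t, d] ∧
          w ≠ r ∧ t.par w = f x, ∃ z, f z = y := fun y hy => by
        simp only [List.mem_filter, decide_eq_true_eq] at hy
        exact (hfF y).1 hy.2.1
      obtain ⟨C, hC⟩ : ∃ C : List (Fin 𝒯.size), C.map f = (List.range t.size).filter fun w =>
          w ∈ 𝓚[t, d] ∧ w ≠ r ∧ t.par w = f x := by
        have := (Set.ext_iff.1 (Set.range_list_map f) _).2 hCx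
        exact this
      have hCmem : ∀ y, y ∈ C ↔ IsChild 𝒯 x y := fun y => by
        rw [← List.mem_map_of_injective hinj, hC, hchild]
        simp only [List.mem_filter, List.mem_range, decide_eq_true_eq]
        exact ⟨fun h => h.2.2, fun h => ⟨hfk y, (hfF _).2 ⟨y, rfl⟩, h⟩⟩
      have hCnd : C.Nodup := by
        refine List.Nodup.of_map f ?_
        rw [hC]
        exact List.nodup_range.filter _
      have hxP : x ∉ P := fun h => by
        rw [List.nodup_append] at hnd
        exact hnd.2.2 x h x (by simp) rfl
      refine ⟨⟨P ++ [x], Q ++ C, M2, w ++ (1 :: setWord (𝒯.bag x) ++ w2 ++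
        [2, phi (𝒯.bag x) (forbiddenPrefixes 𝒯 x)]),
        sum + phi (𝒯.bag x) (forbiddenPrefixes 𝒯 x) * pr, by simp, ?_, ?_, ?_, ?_, ?_,
        hk1.trans (hk2.trans (hk3.trans hk4)), ?_⟩, memoPotential_congr (hmemo4.trans hmemo3)⟩
      · have h1 : P ++ [x] ++ (Q ++ C) = P ++ x :: Q ++ C := by simp
        rw [h1, List.nodup_append]
        refine ⟨hnd, hCnd, ?_⟩
        rintro y hy _ hy' rfl
        obtain ⟨h2, h3⟩ := (hchild x y).1 ((hCmem y).1 hy')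
        obtain ⟨z, hz, h4⟩ := hpar y hy fun h => h2 (h ▸ hroot)
        exact hxP (hinj (h3.symm.trans h4) ▸ hz)
      · intro y hy hyr
        have h1 : y ∈ P ++ x :: Q ∨ y ∈ C := by
          simp only [List.mem_append, List.mem_cons] at hy ⊢
          tauto
        rcases h1 with h1 | h1
        · obtain ⟨z, hz, h2⟩ := hpar y h1 hyr
          exact ⟨z, by simp [hz], h2⟩
        · exact ⟨x, by simp, ((hchild x y).1 ((hCmem y).1 h1)).2⟩
      · have h1 : P ++ [x] ++ (Q ++ C) = P ++ x :: Q ++ C := by simp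
        rw [h1, List.map_append, hC]
        exact hl4
      · rw [hout4, hout3, hout2, hout1, hout, hv, hbag]
        simp
      · exact (hm2.frame hmemo3 (hk3.low _ (by simp [Table.array]))).frame hmemo4
          (hk4.low _ (by simp [Table.array]))
      · intro M'' w' a hsim'
        rw [List.append_assoc]
        refine hcps _ _ _ ?_
        have h1 := Sim.loop_step (𝒯 := 𝒯) hCnd hCmem (T.nodup_map_subsFrom hd hvF)
          (fun H => by rw [T.mem_map_subsFrom hG hd hvF, hbag]) (hv ▸ hsim) hsim'
        simpa using h1
  · refine ⟨[], [𝒯.root], M, [], 0, rfl, by simp, ?_, ?_, by simp, hm, Kept.refl,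
      fun _ _ _ h => by simpa using h⟩
    · intro y hy hne
      exact absurd (by simpa using hy) hne
    · simpa [hroot] using hl
  · rintro i s' ⟨P, Q, M', w, sum, rfl, hnd, hpar, hl', hout, hm', hk, hcps⟩ hcond
    have hQ : Q = [] := by
      by_contra hne
      rw [eval_lt, hl'.eval_hd, hl'.eval_tl, if_pos] at hcond
      · exact one_ne_zero hcond
      · simpa using List.length_pos_iff.2 hne
    subst hQ
    refine ⟨𝒯, M', w, sum, ?_, hout, hl'.sp, hl'.id, hl'.sum, hm', hk⟩
    simpa using hcps _ _ _ Sim.loop_done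
  · simp
    nlinarith

/-- The running time of `missCmd` is paid for by the new entry of the memo table. -/
theorem awp_missCmd [Nonempty (Fin n)] (T : t.IsFor G) (hG : IsChordal G) (hd : d < 2 * t.size)
    (hr : Ready t s.mem) (hsp : s.mem rSp 0 = p) (hid : s.mem aId p = d) (hm : MemoRel t s.mem M)
    (h0 : s.mem aMemo (s.mem Table.rep.array d) = 0)
    (hspec : ∀ j < 2 * t.size, t.card j < t.card d → CountSpec t G procs A j)
    (hA : t.size * (120 * n + 1280 * t.size + 270) ≤ A) :
    AWP (memoPotential t.size A) procs missCmd s 100 fun s' => ∃ M' w a,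
      Sim (.count (t.graph G d)) M M' (0 :: setWord (t.graph G d).verts ++ w ++ [3, a]) a ∧
        s'.out = s.out ++ w ∧ s'.mem rRes 0 = a ∧ MemoRel t s'.mem M' ∧
        Kept t p (t.card d + 1) s.mem s'.mem := by
  set r := s.mem Table.top.array d with hrdef
  set s4 := (((s.set aQueue (p * t.size) r).set aHd p 0).set aTl p 1).set aSum p 0 with hs4
  have h4 : ∀ a, a ≠ aQueue → a ≠ aHd → a ≠ aTl → a ≠ aSum → s4.mem a = s.mem a := by
    intro a h1 h2 h3 h4
    rw [hs4, set_mem_of_ne h4, set_mem_of_ne h3,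
      set_mem_of_ne h2, set_mem_of_ne h1]
  have h4' : ∀ a, a ≠ aQueue → ∀ i, i ≠ p → s4.mem a i = s.mem a i := by
    intro a h1 i hi
    simp only [hs4, MachineState.set, Function.update_apply]
    simp [h1]
    split_ifs <;> simp_all
  have h4q : ∀ i, s4.mem aQueue i = if i = p * t.size then r else s.mem aQueue i := by
    intro i
    simp [hs4, set_mem_same]
  have hlow : ∀ a < 73, s4.mem a = s.mem a := fun a ha =>
    h4 a (by omega) (by omega) (by omega) (by omega)
  have hr4 : Ready t s4.mem := hr.frame fun a ha => hlow a (by omega)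
  have hk4 : ∀ L, Kept t p L s.mem s4.mem := fun L => Kept.of_local (fun a ha _ => hlow a ha)
    (fun a _ _ i hi => h4' a (by omega) i hi.ne) fun i hi => by rw [h4q, if_neg hi.ne]
  have hm4 : MemoRel t s4.mem M := hm.frame (hlow _ (by simp)) (hlow _ (by simp [Table.array]))
  have hl4 : Local t s4.mem p d 0 [r] 0 := by
    refine ⟨hr4, by rw [hlow _ (by simp), hsp], ?_, by simp [hs4], by simp [hs4], by simp [hs4], ?_⟩
    · rw [h4 _ (by simp) (by simp) (by simp) (by simp), hid]
    · intro i hi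
      obtain rfl : i = 0 := by simpa using hi
      rw [Nat.add_zero, h4q, if_pos rfl]
      rfl
  have hpot : ∀ {s : MachineState} {a i x : ℕ}, a ≠ aMemo →
      memoPotential t.size A (s.set a i x) = memoPotential t.size A s := fun h =>
    memoPotential_congr (set_mem_of_ne h.symm)
  have hesp : ∀ {s' : MachineState}, s'.mem rSp = s.mem rSp → eSp.eval s'.mem = p := fun h => by
    rw [eval_get, eval_zero, h, hsp]
  refine (AWP.assign_seq (i := p * t.size) (x := r) (b := 70) ?_ ?_ (hpot (by simp))
    ((AWP.assign_seq (i := p) (x := 0) (b := 60) (hesp (by simp)) eval_zero (hpot (by simp))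
    ((AWP.assign_seq (i := p) (x := 1) (b := 50) (hesp (by simp)) eval_one (hpot (by simp))
    ((AWP.assign_seq (i := p) (x := 0) (b := 40) (hesp (by simp)) eval_zero (hpot (by simp))
    ?_).mono (by simp) fun _ h => h)).mono (by simp) fun _ h => h)).mono (by simp)
      fun _ h => h)).mono (by simp [Table.entry]) fun _ h => h
  · have h1 : eSize.eval s.mem = t.size := hr.size
    rw [eval_mul, hesp rfl, h1]
  · rw [Table.eval_entry, eval_get, hesp rfl, hid]
  · change AWP _ _ _ s4 _ _
    refine AWP.seq_gain (b' := 20) (A := A) ((awp_loop (M := M) T hG hd (r := r) ?_ hl4 hspec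
      hm4).mono le_rfl ?_) ?_
    · rw [hlow Table.top.array (by simp [Table.array])]
    · rintro s5 ⟨𝒯, M', w, a, hsim, hout, hsp5, hid5, hsum5, hm5, hk5⟩
      have hrep5 : s5.mem Table.rep.array = s.mem Table.rep.array := by
        rw [hk5.low _ (by simp [Table.array]), hlow _ (by simp [Table.array])]
      have hr5 : Ready t s5.mem := hr4.frame hk5.low
      have hreplt := hr5.toTables.rep_lt hd
      set ρ := s5.mem Table.rep.array d with hρ
      have h05 : s5.mem aMemo ρ = 0 := by
        have h1 := hk5.memo d hd le_rfl
        rw [hlow _ (by simp [Table.array]), hlow _ (by simp), ← hrep5] at h1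
        rw [h1, hrep5, h0]
      have hesp5 : eSp.eval s5.mem = p := hsp5
      have h6 : ∀ b, b ≠ rRes → b ≠ aMemo →
          ((s5.set rRes 0 a).set aMemo ρ (a + 1)).mem b = s5.mem b := fun b h1 h2 => by
        rw [set_mem_of_ne h2, set_mem_of_ne h1]
      have h6m : ∀ i, ((s5.set rRes 0 a).set aMemo ρ (a + 1)).mem aMemo i =
          if i = ρ then a + 1 else s5.mem aMemo i := fun i => by
        rw [set_mem_same, set_mem_of_ne (by simp)]
      refine (WP.seq (WP.assign_of (i := 0) (x := a) eval_zero ?_ (WP.assign_of (i := ρ)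
        (x := a + 1) ?_ ?_ ?_))).mono (by simp [Table.entry]) fun _ h => h
      · rw [eval_get, hesp5, hsum5]
      · rw [Table.eval_entry, eval_get, eval_get, eval_zero,
          set_mem_of_ne (b := Table.rep.array) (by simp [Table.array]),
          set_mem_of_ne (b := aId) (by simp),
          set_mem_of_ne (b := rSp) (by simp), hsp5, hid5]
      · rw [eval_add, eval_get, eval_zero, set_mem_self, eval_one]
      · refine ⟨⟨(t.graph G d, a) :: M', w, a, Sim.count_new (fun b => (hm d hd).1 h0 b) hsim, hout,
          ?_, ?_, ?_⟩, ?_⟩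
        · rw [set_mem_of_ne (by simp), set_mem_self]
        · intro d' hd'
          rw [h6 Table.rep.array (by simp [Table.array]) (by simp [Table.array]), h6m]
          have hiff := hr5.toTables.rep_eq_iff (G := G) hd' hd
          rw [← hρ] at hiff
          split_ifs with heq
          · refine ⟨fun h => h.elim, fun b hb => ?_⟩
            obtain rfl : a = b := by omega
            rw [hiff.1 heq]
            exact List.mem_cons_self
          · refine ⟨fun h b hb => ?_, fun b hb => List.mem_cons_of_mem _ ((hm5 d' hd').2 b hb)⟩
            rcases List.mem_cons.1 hb with hb | hb
            · exact heq (hiff.2 (Prod.ext_iff.1 hb).1)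
            · exact (hm5 d' hd').1 h b hb
        · refine ((hk4 _).trans (hk5.mono le_rfl (Nat.le_succ _))).trans ⟨fun b hb =>
            h6 b (by omega) (by omega), by rw [h6 _ (by simp) (by simp)], fun b hb hb' i _ => by
            rw [h6 b (by omega) (by omega)], fun i _ => by rw [h6 _ (by simp) (by simp)],
            fun δ hδ hle => ?_⟩
          rw [h6m, if_neg]
          intro heq
          have h7 := (hr5.toTables.rep_eq_iff (G := G) hδ hd).1 heq
          have h8 : t.card δ = t.card d := congrArg (fun H : G.Subgraph => Set.ncard H.verts) h7
          omega
        · rw [memoPotential_set hreplt (by rw [set_mem_of_ne (by simp), h05]),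
            hpot (by simp)]
    · exact (Nat.add_le_add_right (Nat.add_le_add_right hA 20) 20).trans (by omega)

/-- Correctness and costs of the procedure `count`. -/
theorem countSpec [Nonempty (Fin n)] (T : t.IsFor G) (hG : IsChordal G)
    (hA : t.size * (120 * n + 1280 * t.size + 270) ≤ A) (hprocs : procs[0]? = some countCmd)
    (hd : d < 2 * t.size) : CountSpec t G procs A d := by
  induction hc : t.card d using Nat.strong_induction_on generalizing d with
  | _ c ih =>
    subst hc
    intro p s M hr hm hsp hid
    refine (AWP.call hprocs (AWP.seq (AWP.of_wp ((wp_callCmd hr hsp hid hd).mono le_rfl ?_)))).mono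
      (b := 60 * t.card d + 60 + 138 + 1) (by omega) fun _ h => h
    rintro s1 ⟨hout1, hfr1⟩
    have hr1 : Ready t s1.mem := hr.frame fun a ha => hfr1 a (by omega)
    have hm1 : MemoRel t s1.mem M := hm.frame (hfr1 _ (by simp)) (hfr1 _ (by simp [Table.array]))
    have hsp1 : s1.mem rSp 0 = p := by rw [hfr1 _ (by simp), hsp]
    have hid1 : s1.mem aId p = d := by rw [hfr1 _ (by simp), hid]
    have hk1 : ∀ L, Kept t p L s.mem s1.mem := fun L => Kept.of_local
      (fun a ha _ => hfr1 a (by omega)) (fun a _ _ i _ => by rw [hfr1 a (by omega)])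
      fun i _ => by rw [hfr1 _ (by simp)]
    have hget : (Expr.get aMemo (Table.rep.entry eD)).eval s1.mem =
        s1.mem aMemo (s1.mem Table.rep.array d) := by
      rw [eval_get, Table.eval_entry, eval_get, eval_get, eval_zero, hsp1, hid1]
    refine ⟨?_, memoPotential_congr (hfr1 _ (by simp))⟩
    have hret : ∀ s2 : MachineState, (∃ M' w a, Sim (.count (t.graph G d)) M M'
        (0 :: setWord (t.graph G d).verts ++ w ++ [3, a]) a ∧ s2.out = s1.out ++ w ∧
        s2.mem rRes 0 = a ∧ MemoRel t s2.mem M' ∧ Kept t p (t.card d + 1) s1.mem s2.mem) →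
        AWP (memoPotential t.size A) procs (.seq (.emit 3) (.emit (.var rRes))) s2 10 fun s' =>
          ∃ M' w a, Sim (.count (t.graph G d)) M M' w a ∧ s'.out = s.out ++ w ∧ s'.mem rRes 0 = a ∧
            MemoRel t s'.mem M' ∧ Kept t p (t.card d + 1) s.mem s'.mem := by
      rintro s2 ⟨M', w, a, hsim, hout2, hres, hm2, hk2⟩
      refine AWP.of_wp ((WP.seq (WP.emit_of eval_three (WP.emit_of (v := .var rRes) (x := a) hres
        ⟨⟨M', _, a, hsim, ?_, hres, hm2, (hk1 _).trans hk2⟩, rfl⟩))).mono (by simp) fun _ h => h)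
      simp [hout2, hout1]
    refine (AWP.seq ((AWP.ite (b := 100) (fun hne => ?_) (fun hz => ?_)).mono le_rfl hret)).mono
      (by simp [Table.entry]) fun _ h => h
    · rw [hget] at hne
      obtain ⟨a, ha⟩ := Nat.exists_eq_succ_of_ne_zero hne
      refine AWP.of_wp ((WP.assign_of (i := 0) (x := a) eval_zero ?_ ⟨⟨M, [], a, ?_, by simp,
        set_mem_self, hm1.frame (set_mem_of_ne (by simp))
        (set_mem_of_ne (by simp [Table.array])), ?_⟩, ?_⟩).mono (by simp [Table.entry])
        fun _ h => h)
      · rw [eval_sub, hget, ha, eval_one, Nat.succ_sub_one]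
      · simpa using Sim.count_memo ((hm1 d hd).2 a ha)
      · exact Kept.of_local (fun b _ hb => set_mem_of_ne hb)
          (fun b hb _ i _ => by rw [set_mem_of_ne (by omega)])
          fun i _ => by rw [set_mem_of_ne (by simp)]
      · exact memoPotential_congr (set_mem_of_ne (by simp))
    · rw [hget] at hz
      exact awp_missCmd T hG hd hr1 hsp1 hid1 hm1 hz
        (fun j hj hlt => ih _ hlt hj rfl) hA

end

/-! ### Computing a clique tree -/

-- The adjacency matrix, the scores, the results of the searches for a vertex and for a bag, the
-- numbers of missing neighbors; the new vertex, the bag it is attached to, its own bag.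
local notation "aAdj" => (5 : ℕ)
local notation "aScore" => (6 : ℕ)
local notation "aArg" => (7 : ℕ)
local notation "aBad" => (8 : ℕ)
local notation "aRest" => (9 : ℕ)
local notation "rZ" => (10 : ℕ)
local notation "rP" => (11 : ℕ)
local notation "rQ" => (12 : ℕ)
local notation "rStep" => (13 : ℕ)
local notation "rY" => (14 : ℕ)

section

variable {procs : List Cmd} {s : MachineState}

/-- The special case of `wp_fill` for tables with one index. -/
theorem wp_fill_row {A : ℕ} {L S e g : Expr} {l p c : ℕ} (w : ℕ → ℕ → ℕ) (f : ℕ → ℕ)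
    (hA : A ∉ scratch) (hr : ∀ a ∈ L.reads ++ S.reads, a ≠ A ∧ a ∉ scratch)
    (hL : L.eval s.mem = l) (hS : S.eval s.mem = p) (hl0 : 1 ≤ l)
    (he : ∀ s' : MachineState, (∀ a, a ≠ A → a ∉ scratch → s'.mem a = s.mem a) →
      ∀ k < l, ∀ u < p, s'.mem rK 0 = k → s'.mem rU 0 = u → e.eval s'.mem = w k u)
    (hg : ∀ s' : MachineState, (∀ a, a ≠ A → a ∉ scratch → s'.mem a = s.mem a) →
      ∀ k < l, s'.mem rK 0 = k → s'.mem rAcc 0 = ∑ u ∈ Finset.range p, w k u →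
        (∀ k' < k, s'.mem A k' = f k') → g.eval s'.mem = f k)
    (hc : 8 * fillCost 1 1 L S e g + 100 ≤ c) :
    WP procs (fill A 1 1 L S e g) s (c * (l * (p + 1))) fun s' => (∀ k < l, s'.mem A k = f k) ∧
      (∀ a, a ≠ A → a ∉ scratch → s'.mem a = s.mem a) ∧ s'.out = s.out := by
  refine ((wp_fill (N := 1) (M := 1) (n := 1) (m := 1) (fun _ _ => w) (fun _ _ => f) hA ?_ rfl rfl
    hL hS le_rfl le_rfl hl0 ?_ ?_).frame fill_plain).mono ?_ ?_
  · intro a ha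
    exact hr a (by simpa [Expr.reads, OfNat.ofNat] using ha)
  · intro s' hf i j k u _ _ hk hu _ _ hsk hsu _
    exact he s' hf k hk u hu hsk hsu
  · intro s' hf i j k hi hj hk hsi hsj hsk hacc hbef
    refine hg s' hf k hk hsk hacc fun k' hk' => ?_
    have := hbef 0 0 k' (by omega) (by omega) (by omega)
    simpa using this
  · rw [one_mul, one_mul]
    exact Nat.mul_le_mul_right _ hc
  · rintro s' ⟨h1, h2, h3⟩
    refine ⟨fun k hk => ?_, fun a ha ha' => h2 a (mem_writes_fill ha ha'), h3⟩
    simpa using h1 0 0 k (by omega) (by omega) hk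

/-- An index up to `k` with a maximal value. -/
def argMax (a : ℕ → ℕ) : ℕ → ℕ
  | 0 => 0
  | k + 1 => if a (argMax a k) < a (k + 1) then k + 1 else argMax a k

theorem argMax_le (a : ℕ → ℕ) (k : ℕ) : argMax a k ≤ k := by
  induction k with
  | zero => exact le_rfl
  | succ k ih =>
    rw [argMax]
    split_ifs
    · exact le_rfl
    · omega

theorem le_argMax (a : ℕ → ℕ) {j k : ℕ} (hj : j ≤ k) : a j ≤ a (argMax a k) := by
  induction k with
  | zero => rw [Nat.le_zero.1 hj, argMax]
  | succ k ih =>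
    rw [argMax]
    rcases Nat.lt_or_eq_of_le hj with h | rfl
    · have := ih (Nat.lt_succ_iff.1 h)
      split_ifs <;> omega
    · split_ifs <;> omega

/-- Stores in the cell `k` of `A` an index up to `k` with a maximal value of `E`. -/
def argMaxCmd (A : ℕ) (L : Expr) (E : Expr → Expr) : Cmd :=
  fill A 1 1 L 0 0
    (.lt (E (.get A (.var rK - 1))) (E (.var rK)) * .var rK +
      (1 - .lt (E (.get A (.var rK - 1))) (E (.var rK))) * (.lt 0 (.var rK) * .get A (.var rK - 1)))

theorem wp_argMaxCmd {A : ℕ} {L : Expr} {E : Expr → Expr} {l c : ℕ} (a : ℕ → ℕ) (hA : A ∉ scratch)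
    (hr : ∀ b ∈ L.reads, b ≠ A ∧ b ∉ scratch) (hL : L.eval s.mem = l) (hl0 : 1 ≤ l)
    (hE : ∀ s' : MachineState, (∀ b, b ≠ A → b ∉ scratch → s'.mem b = s.mem b) →
      ∀ e : Expr, e.eval s'.mem < l → (E e).eval s'.mem = a (e.eval s'.mem))
    (hc : 8 * fillCost 1 1 L 0 0 (.lt (E (.get A (.var rK - 1))) (E (.var rK)) * .var rK +
      (1 - .lt (E (.get A (.var rK - 1))) (E (.var rK))) *
        (.lt 0 (.var rK) * .get A (.var rK - 1))) + 100 ≤ c) :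
    WP procs (argMaxCmd A L E) s (c * l) fun s' =>
      (s'.mem A (l - 1) < l ∧ ∀ j < l, a j ≤ a (s'.mem A (l - 1))) ∧
        (∀ b, b ≠ A → b ∉ scratch → s'.mem b = s.mem b) ∧ s'.out = s.out := by
  refine (wp_fill_row (p := 0) (fun _ _ => 0) (argMax a) hA ?_ hL rfl hl0 ?_ ?_ hc).mono
    (by simp) ?_
  · intro b hb
    exact hr b (by simpa [Expr.reads, OfNat.ofNat] using hb)
  · intros
    omega
  · intro s' hf k hk hsk _ hbef
    have h1 := hE s' hf (.var rK) (by simpa [hsk] using hk)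
    cases k with
    | zero => simp [hsk, argMax]
    | succ k =>
      have h2 : (Expr.get A (.var rK - 1)).eval s'.mem = argMax a k := by
        simp [hsk, hbef k (by omega)]
      have h3 := hE s' hf (.get A (.var rK - 1)) (by
        rw [h2]
        have := argMax_le a k
        omega)
      rw [h2] at h3
      have h4 : (Expr.var rK).eval s'.mem = k + 1 := hsk
      rw [h4] at h1
      simp only [eval_add, eval_mul, eval_sub, eval_lt, h1, h2, h3, h4,
        eval_one, eval_zero, argMax]
      split_ifs <;> simp_all
  · rintro s' ⟨h1, h2⟩
    have h3 := argMax_le a (l - 1)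
    rw [h1 (l - 1) (by omega)]
    exact ⟨⟨by omega, fun j hj => le_argMax a (by omega)⟩, h2⟩

end

/-- Whether `u` is a visited neighbor of the vertex in `rZ`. -/
def isNbr (u : Expr) : Expr := .eq (.get aScore u) 0 * .get aAdj (.var rZ * eN + u)

/-- Visits the vertex in `rZ`: the bag with the number in `rQ` becomes the set of the visited
neighbors together with the new vertex. -/
def visitCmd : Cmd :=
  forLoop rY eN (.seq (.assign aBag (.var rQ * eN + .var rY)
      (isNbr (.var rY) + .eq (.var rY) (.var rZ)))
    (.assign aScore (.var rY) (.lt 0 (.get aScore (.var rY)) * ((1 - .eq (.var rY) (.var rZ)) *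
      (.get aScore (.var rY) + .get aAdj (.var rZ * eN + .var rY))))))

/-- Chooses the number of the bag for the new vertex: it is the number of the bag in `rP` or the
number of a new bag below it. -/
def chooseCmd : Cmd :=
  .ite (.get aRest 0) (.seq (.assign aPar eSize (.var rP)) (.seq (.assign rQ 0 eSize)
    (.assign aSize 0 (eSize + 1)))) (.assign rQ 0 (.var rP))

/-- A step of maximum cardinality search: a vertex with a maximal number of visited neighbors is
visited and added to the clique tree. -/
def searchStep : Cmd :=
  .seq (argMaxCmd aArg eN fun i => .get aScore i) (.seq (.assign rZ 0 (.get aArg (eN - 1)))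
    (.seq (fill aBad 1 1 eSize eN
      (isNbr (.var rU) * (1 - .get aBag (.var rK * eN + .var rU))) (.var rAcc))
    (.seq (argMaxCmd aArg eSize fun i => .eq (.get aBad i) 0)
    (.seq (.assign rP 0 (.get aArg (eSize - 1)))
    (.seq (fill aRest 1 1 1 eN
      (.get aBag (.var rP * eN + .var rU) * (1 - isNbr (.var rU))) (.var rAcc))
    (.seq chooseCmd visitCmd))))))

open Classical in
/-- The value stored for a vertex during maximum cardinality search: `0` if it has been visited,
otherwise larger by one than the number of its visited neighbors. -/
noncomputable def mcsScore {n : ℕ} (G : SimpleGraph (Fin n)) (W : Set (Fin n)) (u : Fin n) : ℕ :=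
  if u ∈ W then 0 else {s ∈ W | G.Adj s u}.ncard + 1

open Classical in
/-- The state of maximum cardinality search: `W` is the set of visited vertices, and `t` is a clique
tree of the graph induced by it. -/
structure Searching {n : ℕ} (G : SimpleGraph (Fin n)) (W : Set (Fin n)) (t : BagTree (Fin n))
    (mem : ℕ → ℕ → ℕ) : Prop extends Table.Stored t mem where
  adj : ∀ u v : Fin n, mem aAdj (u * n + v) = if G.Adj u v then 1 else 0
  score : ∀ u : Fin n, mem aScore u = mcsScore G W u
  good : Good G Set.univ W
  tree : IsCliqueTree G W (Finset.range t.size) 0 t.par t.bag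
  par_zero : t.par 0 = 0

section

variable {n : ℕ} {G : SimpleGraph (Fin n)} {W : Set (Fin n)} {t : BagTree (Fin n)}
  {procs : List Cmd} {s : MachineState} {mem mem' : ℕ → ℕ → ℕ} {z : Fin n}

theorem Searching.frame (h : Searching G W t mem) (hf : ∀ a < 7, mem' a = mem a) :
    Searching G W t mem' := by
  refine ⟨⟨?_, ?_, ?_, ?_⟩, ?_, ?_, h.good, h.tree, h.par_zero⟩
  · rw [hf _ (by simp)]; exact h.card
  · rw [hf _ (by simp)]; exact h.size
  · rw [hf _ (by simp)]; exact h.par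
  · rw [hf _ (by simp)]; exact h.bag
  · rw [hf _ (by simp)]; exact h.adj
  · rw [hf _ (by simp)]; exact h.score

theorem eval_isNbr {u : ℕ} {e : Expr} (hu : u < n) (he : e.eval mem = u) (hz : mem rZ 0 = z)
    (hN : mem aN 0 = n) (hadj : mem aAdj (z * n + u) = ind (G.neighborSet z) u)
    (hscore : mem aScore u = 0 ↔ ind W u = 1) :
    (isNbr e).eval mem = ind {s ∈ W | G.Adj s z} u := by
  lift u to Fin n using hu
  simp only [isNbr, eval_mul, eval_eq, eval_get, eval_add, eval_zero, he,
    hz, hN, hadj, hscore]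
  have h1 : {s ∈ W | G.Adj s z} = W ∩ G.neighborSet z := by
    ext s
    simp [G.adj_comm]
  rw [h1, ind_inter]
  congr 1
  by_cases h : u ∈ W <;> simp [ind_fin, h]

open Classical in
theorem adj_ind (h : ∀ u v : Fin n, mem aAdj (u * n + v) = if G.Adj u v then 1 else 0) {u : ℕ}
    (hu : u < n) : mem aAdj (z * n + u) = ind (G.neighborSet z) u := by
  lift u to Fin n using hu
  rw [h z u, ind_fin]
  rfl

theorem score_ind (h : ∀ u : Fin n, mem aScore u = mcsScore G W u) {u : ℕ} (hu : u < n) :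
    mem aScore u = 0 ↔ ind W u = 1 := by
  lift u to Fin n using hu
  rw [h u, ind_eq_one_iff, mcsScore]
  split_ifs with h1 <;> simp [h1]

theorem Searching.eval_isNbr (h : Searching G W t mem) {u : ℕ} {e : Expr} (hu : u < n)
    (he : e.eval mem = u) (hz : mem rZ 0 = z) :
    (isNbr e).eval mem = ind {s ∈ W | G.Adj s z} u :=
  CliquePicking.eval_isNbr hu he hz h.card (adj_ind h.adj hu) (score_ind h.score hu)

open Classical in
theorem wp_visitCmd {q : ℕ} (hN : s.mem aN 0 = n)
    (hadj : ∀ u v : Fin n, s.mem aAdj (u * n + v) = if G.Adj u v then 1 else 0)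
    (hscore : ∀ u : Fin n, s.mem aScore u = mcsScore G W u) (hz : s.mem rZ 0 = z) (hzW : z ∉ W)
    (hq : s.mem rQ 0 = q) :
    WP procs visitCmd s (100 * n + 20) fun s' =>
      (∀ u < n, s'.mem aBag (q * n + u) = ind (insert z {s ∈ W | G.Adj s z}) u) ∧
      (∀ i, (∀ u < n, i ≠ q * n + u) → s'.mem aBag i = s.mem aBag i) ∧
      ∀ u : Fin n, s'.mem aScore u = mcsScore G (insert z W) u := by
  classical
  refine (WP.loop_plain (b := 70) (n := n) (fun j s' =>
    (∀ u < j, s'.mem aBag (q * n + u) = ind (insert z {s ∈ W | G.Adj s z}) u) ∧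
      (∀ i, (∀ u < n, i ≠ q * n + u) → s'.mem aBag i = s.mem aBag i) ∧
      ∀ u : Fin n, s'.mem aScore u = if u.val < j then
        mcsScore G (insert z W) u else s.mem aScore u) (by simp [Cmd.Plain]) (by simp [Cmd.writes])
      ?_ ?_ ?_ ?_
        ?_).le ?_
  · simp [Cmd.writes, Expr.reads, OfNat.ofNat]
  · exact hN
  · exact ⟨by simp, fun _ _ => rfl, fun u => by simp⟩
  · rintro u hu s' hfr - hsu ⟨h1, h2, h3⟩
    have hfr' : ∀ a, a ≠ aBag → a ≠ aScore → a ≠ rY → s'.mem a = s.mem a := fun a ha ha1 ha2 =>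
      hfr a ha2 (by simp [Cmd.writes, ha, ha1])
    have hN' : s'.mem aN 0 = n := by rw [hfr' _ (by simp) (by simp) (by simp)]; exact hN
    have hz' : s'.mem rZ 0 = z := by rw [hfr' _ (by simp) (by simp) (by simp), hz]
    have hq' : s'.mem rQ 0 = q := by rw [hfr' _ (by simp) (by simp) (by simp), hq]
    have hadj' : s'.mem aAdj (z * n + u) = ind (G.neighborSet z) u := by
      rw [hfr' _ (by simp) (by simp) (by simp)]
      exact adj_ind hadj hu
    have hsc' : s'.mem aScore u = s.mem aScore u := by simpa using h3 ⟨u, hu⟩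
    have hu' : (Expr.var rY).eval s'.mem = u := hsu
    have hnbr := CliquePicking.eval_isNbr hu hu' hz' hN' hadj'
      (by rw [hsc']; exact score_ind hscore hu)
    refine (WP.seq (WP.assign_of (i := q * n + u)
      (x := ind (insert z {s ∈ W | G.Adj s z}) u) ?_ ?_ (WP.assign_of (i := u)
        (x := mcsScore G (insert z W) ⟨u, hu⟩) ?_ ?_ ?_))).mono (by simp [isNbr]) fun _ h => h
    · simp [hq', hN', hsu]
    · rw [eval_add, hnbr, eval_eq, hu', eval_get, eval_zero, hz']
      lift u to Fin n using hu
      by_cases h4 : u = z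
      · subst h4
        simp [ind_fin]
      · have : (u : ℕ) ≠ z := fun h => h4 (Fin.ext h)
        simp [ind_fin, h4, this]
    · rw [eval_get, eval_zero, set_mem_of_ne (by simp), hsu]
    · have h4 : (Expr.var rY).eval (s'.set aBag (q * n + u)
          (ind (insert z {s ∈ W | G.Adj s z}) u)).mem = u := by simp [hsu]
      have h5 : (Expr.get aScore (.var rY)).eval (s'.set aBag (q * n + u)
          (ind (insert z {s ∈ W | G.Adj s z}) u)).mem = s.mem aScore u := by simp [hsu, hsc']
      have h6 : (Expr.get aAdj (.var rZ * eN + .var rY)).eval (s'.set aBag (q * n + u)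
          (ind (insert z {s ∈ W | G.Adj s z}) u)).mem = ind (G.neighborSet z) u := by
        simp [hsu, hz', hN', hadj']
      have h7 : (Expr.var rZ).eval (s'.set aBag (q * n + u)
          (ind (insert z {s ∈ W | G.Adj s z}) u)).mem = z := by simp [hz']
      rw [eval_mul, eval_mul, eval_lt, eval_sub, eval_eq, eval_add, h4,
        h5, h6, h7, eval_one, eval_zero]
      lift u to Fin n using hu
      rw [hscore u, mcsScore, mcsScore]
      by_cases h8 : u = z
      · subst h8
        simp
      · have h9 : (u : ℕ) ≠ z := fun h => h8 (Fin.ext h)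
        by_cases h10 : u ∈ W
        · simp [h10]
        · have h11 : {s | (s = z ∨ s ∈ W) ∧ G.Adj s u} =
              if G.Adj z u then insert z {s ∈ W | G.Adj s u} else {s ∈ W | G.Adj s u} := by
            ext v
            split_ifs with hzu
            · simp only [Set.mem_ofPred_eq, Set.mem_insert_iff]
              constructor
              · rintro ⟨rfl | h, h'⟩
                · exact .inl rfl
                · exact .inr ⟨h, h'⟩
              · rintro (rfl | h)
                · exact ⟨.inl rfl, hzu⟩
                · exact ⟨.inr h.1, h.2⟩
            · simp only [Set.mem_ofPred_eq]
              constructor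
              · rintro ⟨rfl | h, h'⟩
                · exact absurd h' hzu
                · exact ⟨h, h'⟩
              · exact fun h => ⟨.inr h.1, h.2⟩
          have h12 : z ∉ {s ∈ W | G.Adj s u} := fun h => hzW h.1
          have hpos : 0 < {s ∈ W | G.Adj s u}.ncard + 1 := Nat.succ_pos _
          simp only [h9, h10, h8, if_false, if_pos hpos, Set.mem_insert_iff, or_self, h11, ind_fin,
            SimpleGraph.mem_neighborSet]
          split_ifs with hzu
          · rw [Set.ncard_insert_of_notMem h12]
            simp
          · simp
    · refine ⟨fun v hv => ?_, fun i hi => ?_, fun v => ?_⟩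
      · rw [set_mem_of_ne (by simp), set_mem_of_ne (by simp),
          set_mem_same]
        split_ifs with heq
        · obtain rfl : v = u := by omega
          rfl
        · exact h1 v (by omega)
      · rw [set_mem_of_ne (by simp), set_mem_of_ne (by simp),
          set_mem_same, if_neg (hi u hu), h2 i hi]
      · rw [set_mem_of_ne (by simp), set_mem_same]
        by_cases h4 : v.val = u
        · obtain rfl : v = ⟨u, hu⟩ := Fin.ext h4
          rw [if_pos rfl, if_pos (Nat.lt_succ_self u)]
        · rw [if_neg h4, set_mem_of_ne (by simp), h3 v]
          congr 1
          rw [eq_iff_iff]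
          omega
  · rintro s' - - ⟨h1, h2, h3⟩
    exact ⟨h1, h2, fun u => by rw [h3 u, if_pos u.2]⟩
  · simp
    omega

theorem wp_chooseCmd {p c : ℕ} (h : Table.Stored t s.mem) (hp : s.mem rP 0 = p)
    (hc : s.mem aRest 0 = c) :
    WP procs chooseCmd s 30 fun s' => (∀ a, a ≠ aPar → a ≠ rQ → a ≠ aSize → s'.mem a = s.mem a) ∧
      s'.mem rQ 0 = (if c = 0 then p else t.size) ∧
      s'.mem aSize 0 = (if c = 0 then t.size else t.size + 1) ∧
      ∀ j, s'.mem aPar j = if c ≠ 0 ∧ j = t.size then p else s.mem aPar j := by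
  have hsz : eSize.eval s.mem = t.size := h.size
  refine (WP.ite (b := 20) (fun hne => ?_) (fun hz => ?_)).mono (by simp) fun _ h => h
  · replace hne : c ≠ 0 := by rw [← hc]; exact hne
    refine (WP.seq (WP.assign_of (i := t.size) (x := p) (v := .var rP) hsz hp
      (WP.seq (WP.assign_of (i := 0)
      (x := t.size) rfl ?_ (WP.assign_of (i := 0) (x := t.size + 1) rfl ?_ ?_))))).mono (by simp)
      fun _ h => h
    · simp [h.size]
    · simp [h.size]
    · refine ⟨fun a h1 h2 h3 => by simp [h1, h2, h3], by simp [hne], by simp [hne], fun j => ?_⟩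
      rw [set_mem_of_ne (by simp), set_mem_of_ne (by simp),
        set_mem_same]
      simp [hne]
  · replace hz : c = 0 := by rw [← hc]; exact hz
    refine (WP.assign_of (i := 0) (x := p) (v := .var rP) rfl hp ?_).mono (by simp) fun _ h => h
    exact ⟨fun a h1 h2 h3 => by simp [h2], by simp [hz], by simp [hz, h.size],
      fun j => by simp [hz]⟩

/-- The memory after the vertex `z`, attached to the bag `p`, has been added. -/
theorem Searching.next (hG : IsChordal G) (h : Searching G W t mem) (hzW : z ∉ W)
    (hmax : ∀ j < n, mem aScore j ≤ mem aScore z) {p : ℕ} (hp : p < t.size)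
    (hS : {s ∈ W | G.Adj s z} ⊆ t.bag p) {c : ℕ} (hc : c = (t.bag p \ {s ∈ W | G.Adj s z}).ncard)
    {q : ℕ} (hq : q = if c = 0 then p else t.size)
    (hN : mem' aN 0 = n) (hadj : mem' aAdj = mem aAdj)
    (hsize : mem' aSize 0 = if c = 0 then t.size else t.size + 1)
    (hpar : ∀ j, mem' aPar j = if c ≠ 0 ∧ j = t.size then p else mem aPar j)
    (hbag : ∀ u < n, mem' aBag (q * n + u) = ind (insert z {s ∈ W | G.Adj s z}) u)
    (hbag' : ∀ i, (∀ u < n, i ≠ q * n + u) → mem' aBag i = mem aBag i)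
    (hscore : ∀ u : Fin n, mem' aScore u = mcsScore G (insert z W) u) :
    ∃ t', Searching G (insert z W) t' mem' := by
  have hgood : Good G Set.univ (insert z W) := by
    refine h.good.insert_saturated ⟨Set.mem_univ z, hzW⟩
      (h.good.saturated_of_max hG ⟨Set.mem_univ z, hzW⟩ fun y hy => ?_)
    have h1 := hmax y y.2
    rw [h.score, h.score, mcsScore, mcsScore, if_neg hy.2, if_neg hzW] at h1
    omega
  have hne : ∀ {j q u : ℕ}, j ≠ q → u < n → ∀ v < n, j * n + u ≠ q * n + v :=
    fun hjq hu v hv heq => hjq (pair_index_inj hu hv heq).1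
  by_cases hc0 : c = 0
  · have heq : {s ∈ W | G.Adj s z} = t.bag p := by
      refine Set.Subset.antisymm hS ?_
      rw [← ncard_sdiff_eq_zero, ← hc, hc0]
    rw [if_pos hc0] at hq hsize
    subst hq
    refine ⟨⟨t.size, t.par, Function.update t.bag q (insert z (t.bag q))⟩, ⟨⟨hN, hsize,
      fun j hj => ?_, fun j hj u hu => ?_⟩, by rw [hadj]; exact h.adj, hscore, hgood,
      h.tree.enlarge hzW hp heq (by simp) fun j _ hj => by simp [hj], h.par_zero⟩⟩
    · rw [hpar, if_neg (by simp [hc0]), h.par j hj]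
    · by_cases hj' : j = q
      · subst hj'
        rw [hbag u hu, heq]
        simp
      · rw [hbag' _ (hne hj' hu), h.bag j hj u hu]
        simp [hj']
  · have hneq : {s ∈ W | G.Adj s z} ≠ t.bag p := by
      intro heq
      rw [heq, Set.sdiff_self, Set.ncard_empty] at hc
      exact hc0 hc
    have hk : 0 ≠ t.size := by omega
    rw [if_neg hc0] at hq hsize
    subst hq
    refine ⟨⟨t.size + 1, Function.update t.par t.size p,
      Function.update t.bag t.size (insert z {s ∈ W | G.Adj s z})⟩, ⟨⟨hN, hsize,
      fun j hj => ?_, fun j hj u hu => ?_⟩, by rw [hadj]; exact h.adj, hscore, hgood,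
      h.tree.grow hzW hp hS hneq (by simp) (fun j hj => by simp [hj.ne]) (by simp)
        (fun j hj => by simp [hj]), ?_⟩⟩
    · rw [hpar]
      by_cases hj' : j = t.size
      · simp [hc0, hj']
      · have : j < t.size := by
          simp only at hj
          omega
        simp [hj', h.par j this]
    · by_cases hj' : j = t.size
      · subst hj'
        rw [hbag u hu]
        simp
      · have : j < t.size := by
          simp only at hj
          omega
        rw [hbag' _ (hne hj' hu), h.bag j this u hu]
        simp [hj']
    · simp [hk, h.par_zero]

theorem wp_searchStep (hG : IsChordal G) (h : Searching G W t s.mem) (hW : W ≠ Set.univ) :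
    WP procs searchStep s (5000 * ((maxCliques (⊤ : G.Subgraph)).ncard * n)) fun s' =>
      ∃ z ∉ W, ∃ t', Searching G (insert z W) t' s'.mem := by
  obtain ⟨y, hy⟩ : ∃ y, y ∉ W := by
    by_contra hcon
    push Not at hcon
    exact hW (Set.eq_univ_of_forall hcon)
  have hn : 1 ≤ n := (Nat.zero_le _).trans_lt y.2
  have hk0 : 0 < t.size := by simpa using h.tree.root_mem
  have hcard : ∀ {mem}, Searching G W t mem → eN.eval mem = n := fun h => h.card
  have hsize : ∀ {mem}, Searching G W t mem → eSize.eval mem = t.size := fun h => h.size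
  have hK : t.size ≤ (maxCliques (⊤ : G.Subgraph)).ncard := by simpa using h.tree.card_le
  set K := (maxCliques (⊤ : G.Subgraph)).ncard with hKdef
  refine (WP.seq ((wp_argMaxCmd (l := n) (c := 500) (fun i => s.mem aScore i) (by simp [scratch])
    (by simp [Expr.reads, OfNat.ofNat, scratch]) (hcard h) hn (fun s' hf e _ => by
      rw [eval_get, hf _ (by simp) (by simp [scratch])]) (by simp [fillCost])).mono le_rfl
    (Q' := fun s' => WP procs _ s' (4300 * (K * n)) _) ?_)).le ?_
  · rintro s1 ⟨⟨hzn, hzmax⟩, hf1, -⟩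
    obtain ⟨z, hz⟩ : ∃ z : Fin n, s1.mem aArg (n - 1) = z := ⟨⟨_, hzn⟩, rfl⟩
    rw [hz] at hzmax
    have hzW : z ∉ W := by
      intro hzW
      have h1 := hzmax y y.2
      rw [h.score, h.score, mcsScore, mcsScore, if_pos hzW, if_neg hy] at h1
      omega
    have hN1 : eN.eval s1.mem = n := by
      rw [eval_get, hf1 _ (by simp) (by simp [scratch])]; exact h.card
    refine (WP.seq (b := 10) ((WP.assign_of (i := 0) (x := z) rfl (by
      rw [eval_get, eval_sub, hN1, eval_one, hz]) ?_).mono (by simp)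
      fun _ h => h)).mono (b' := 4300 * (K * n)) (b := 10 + 4200 * (K * n)) ?_ fun _ h => h
    · set s2 := s1.set rZ 0 z with hs2
      have hlow2 : ∀ a < 7, s2.mem a = s.mem a := fun a ha => by
        rw [hs2, set_mem_of_ne (by omega), hf1 a (by omega) (by simp [scratch]; omega)]
      have hz2 : s2.mem rZ 0 = z := set_mem_self
      have h2 : Searching G W t s2.mem := h.frame hlow2
      refine (WP.seq ((wp_fill_row (l := t.size) (p := n) (c := 500)
        (fun p u => ind ({s ∈ W | G.Adj s z} \ t.bag p) u)
        (fun p => ({s ∈ W | G.Adj s z} \ t.bag p).ncard) (by simp [scratch])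
        (by simp [Expr.reads, OfNat.ofNat, scratch]) (hsize h2) (hcard h2) hk0 ?_ ?_
        (by simp [fillCost, isNbr])).mono le_rfl
        (Q' := fun s' => WP procs _ s' (3100 * (K * n)) _) ?_)).le ?_
      · intro s' hf p hp u hu hsp hsu
        have h' : Searching G W t s'.mem :=
          h2.frame fun a ha => hf a (by omega) (by simp [scratch]; omega)
        have hz' : s'.mem rZ 0 = z := by rw [hf _ (by simp) (by simp [scratch]), hz2]
        have hnbr := h'.eval_isNbr hu (e := .var rU) hsu hz'
        have hbag : (Expr.get aBag (.var rK * eN + .var rU)).eval s'.mem = ind (t.bag p) u := by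
          simp [hsp, hsu, h'.card, h'.bag p hp u hu]
        rw [eval_mul, hnbr, eval_sub, hbag, eval_one, ind_sdiff]
      · intro s' _ p _ _ hacc _
        exact hacc.trans (sum_ind _)
      · rintro s3 ⟨hbad, hf3, -⟩
        have h3 : Searching G W t s3.mem :=
          h2.frame fun a ha => hf3 a (by omega) (by simp [scratch]; omega)
        have hz3 : s3.mem rZ 0 = z := by rw [hf3 _ (by simp) (by simp [scratch]), hz2]
        refine (WP.seq ((wp_argMaxCmd (l := t.size) (c := 600)
          (fun i => if s3.mem aBad i = 0 then 1 else 0) (by simp [scratch])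
          (by simp [Expr.reads, OfNat.ofNat, scratch]) (hsize h3) hk0 (fun s' hf e _ => by
            rw [eval_eq, eval_get, hf _ (by simp) (by simp [scratch]), eval_zero])
          (by simp [fillCost])).mono le_rfl
          (Q' := fun s' => WP procs _ s' (2300 * (K * n)) _) ?_)).le ?_
        · rintro s4 ⟨⟨hpk, hpmax⟩, hf4, -⟩
          set p := s4.mem aArg (t.size - 1) with hpdef
          have hSp : {s ∈ W | G.Adj s z} ⊆ t.bag p := by
            obtain ⟨p', hp', hsub⟩ := h.tree.exists_bag (Set.sep_subset W fun s => G.Adj s z)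
              (h.good.pairwise_of_mem ⟨Set.mem_univ z, hzW⟩)
            have h4 := hpmax p' (by simpa using hp')
            have h5 : s3.mem aBad p' = 0 := by
              rw [hbad p' (by simpa using hp')]
              exact ncard_sdiff_eq_zero.2 hsub
            rw [if_pos h5] at h4
            rw [← ncard_sdiff_eq_zero, ← hbad p hpk]
            by_contra h6
            rw [if_neg h6] at h4
            omega
          have hN4 : eSize.eval s4.mem = t.size := by
            rw [eval_get, hf4 _ (by simp) (by simp [scratch])]; exact h3.size
          refine (WP.seq (b := 10) ((WP.assign_of (i := 0) (x := p) rfl (by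
            rw [eval_get, eval_sub, hN4, eval_one]) ?_).mono (by simp)
            fun _ h => h)).mono (b := 10 + 2200 * (K * n)) ?_ fun _ h => h
          · set s5 := s4.set rP 0 p with hs5
            have hp5 : s5.mem rP 0 = p := set_mem_self
            have h5 : Searching G W t s5.mem := h3.frame fun a ha => by
              rw [hs5, set_mem_of_ne (by omega),
                hf4 a (by omega) (by simp [scratch]; omega)]
            have hz5 : s5.mem rZ 0 = z := by
              rw [hs5, set_mem_of_ne (by simp), hf4 _ (by simp) (by simp [scratch]), hz3]
            refine (WP.seq ((wp_fill_row (l := 1) (p := n) (c := 500)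
              (fun _ u => ind (t.bag p \ {s ∈ W | G.Adj s z}) u)
              (fun _ => (t.bag p \ {s ∈ W | G.Adj s z}).ncard) (by simp [scratch])
              (by simp [Expr.reads, OfNat.ofNat, scratch]) rfl (hcard h5) le_rfl ?_ ?_
              (by simp [fillCost, isNbr])).mono le_rfl
              (Q' := fun s' => WP procs _ s' (1000 * (K * n)) _) ?_)).le ?_
            · intro s' hf _ _ u hu _ hsu
              have h' : Searching G W t s'.mem :=
                h5.frame fun a ha => hf a (by omega) (by simp [scratch]; omega)
              have hz' : s'.mem rZ 0 = z := by rw [hf _ (by simp) (by simp [scratch]), hz5]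
              have hp' : s'.mem rP 0 = p := by rw [hf _ (by simp) (by simp [scratch]), hp5]
              have hnbr := h'.eval_isNbr hu (e := .var rU) hsu hz'
              have hbag : (Expr.get aBag (.var rP * eN + .var rU)).eval s'.mem =
                  ind (t.bag p) u := by
                simp [hp', hsu, h'.card, h'.bag p hpk u hu]
              rw [eval_mul, eval_sub, hnbr, hbag, eval_one, ind_sdiff]
            · intro s' _ _ _ _ hacc _
              exact hacc.trans (sum_ind _)
            · rintro s6 ⟨hrest, hf6, -⟩
              have h6 : Searching G W t s6.mem :=
                h5.frame fun a ha => hf6 a (by omega) (by simp [scratch]; omega)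
              have hz6 : s6.mem rZ 0 = z := by rw [hf6 _ (by simp) (by simp [scratch]), hz5]
              have hp6 : s6.mem rP 0 = p := by rw [hf6 _ (by simp) (by simp [scratch]), hp5]
              refine (WP.seq ((wp_chooseCmd h6.toStored hp6 (hrest 0 one_pos)).mono le_rfl
                (Q' := fun s' => WP procs _ s' (100 * n + 20) _) ?_)).le ?_
              · rintro s7 ⟨hf7, hq7, hsize7, hpar7⟩
                have h7 : ∀ a, a ≠ aPar → a ≠ aSize → a ≠ rQ → a < 7 → s7.mem a = s.mem a := by
                  intro a h1 h2 h3 h4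
                  rw [hf7 a h1 h3 h2, hf6 a (by omega) (by simp [scratch]; omega), hs5,
                    set_mem_of_ne (by omega),
                    hf4 a (by omega) (by simp [scratch]; omega),
                    hf3 a (by omega) (by simp [scratch]; omega), hlow2 a h4]
                have h7z : s7.mem rZ 0 = z := by
                  rw [hf7 _ (by simp) (by simp) (by simp), hz6]
                have h7a : s7.mem aAdj = s.mem aAdj :=
                  h7 _ (by simp) (by simp) (by simp) (by simp)
                have h7s : s7.mem aScore = s.mem aScore :=
                  h7 _ (by simp) (by simp) (by simp) (by simp)
                have h7N : s7.mem aN 0 = n := by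
                  rw [h7 _ (by simp) (by simp) (by simp) (by simp)]
                  exact h.card
                refine ((wp_visitCmd (G := G) (W := W) h7N (by rw [h7a]; exact h.adj)
                  (by rw [h7s]; exact h.score) h7z hzW hq7).frame
                    (by simp [visitCmd, Cmd.Plain])).mono
                  le_rfl ?_
                rintro s8 ⟨⟨hb8, hb8', hsc8⟩, hf8, -⟩
                have hf8' : ∀ a, a ≠ aBag → a ≠ aScore → a ≠ rY → s8.mem a = s7.mem a :=
                  fun a h1 h2 h3 => hf8 a (by simp [visitCmd, Cmd.writes, h1, h2, h3])
                refine ⟨z, hzW, h.next hG hzW hzmax hpk hSp rfl rfl ?_ ?_ ?_ ?_ hb8 ?_ hsc8⟩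
                · rw [hf8' _ (by simp) (by simp) (by simp), h7N]
                · rw [hf8' _ (by simp) (by simp) (by simp), h7a]
                · rw [hf8' _ (by simp) (by simp) (by simp), hsize7]
                · intro j
                  have h9 : s6.mem aPar = s.mem aPar := by
                    rw [hf6 _ (by simp) (by simp [scratch]), hs5,
                      set_mem_of_ne (by simp), hf4 _ (by simp) (by simp [scratch]),
                      hf3 _ (by simp) (by simp [scratch]), hlow2 _ (by simp)]
                  rw [hf8' _ (by simp) (by simp) (by simp), hpar7, h9]
                · intro i hi
                  rw [hb8' i hi, h7 _ (by simp) (by simp) (by simp) (by simp)]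
              · nlinarith
            · nlinarith
          · nlinarith
        · nlinarith
      · nlinarith
    · nlinarith
  · nlinarith

end

/-! ### The program -/

local notation "rPos" => (15 : ℕ)
local notation "rVertex" => (16 : ℕ)
local notation "rDeg" => (17 : ℕ)
local notation "rNbr" => (18 : ℕ)

/-- Reads the neighbors of the vertex in `rVertex`. -/
def parseVertex : Cmd :=
  .seq (.assign rDeg 0 (.get 0 (.var rPos))) (.seq (.assign rPos 0 (.var rPos + 1))
    (forLoop rNbr (.var rDeg)
      (.seq (.assign aAdj (.var rVertex * eN + .get 0 (.var rPos)) 1)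
        (.assign rPos 0 (.var rPos + 1)))))

/-- Reads the input and computes the adjacency matrix. -/
def parseCmd : Cmd :=
  .seq (.assign aN 0 (.get 0 0)) (.seq (.assign rPos 0 1) (forLoop rVertex eN parseVertex))

/-- Computes a clique tree by maximum cardinality search. -/
def searchCmd : Cmd :=
  .seq (.assign aSize 0 1) (.seq (fill aScore 1 1 eN 0 0 1) (forLoop rStep eN searchStep))

/-- The implementation of Clique-Picking. -/
def cliquePicking : Program where
  main := .seq parseCmd (.seq searchCmd (.seq (Table.build Table.all) (.seq listsCmd (.seq phiCmd
    (.seq (fill aMemo 1 1 (2 * eSize) 0 0 0) (.seq (.assign rSp 0 0) (.seq (.assign aId 0 0)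
      (.call 0))))))))
  procedures := [countCmd]

section

variable {n : ℕ} {G : SimpleGraph (Fin n)} {procs : List Cmd} {s : MachineState}
  {adj : Fin n → List (Fin n)}

theorem getD_of_drop_eq_cons {l l' : List ℕ} {i x : ℕ} (h : l.drop i = x :: l') :
    l.getD i 0 = x ∧ l.drop (i + 1) = l' := by
  have h1 : (l.drop i)[0]? = some x := by rw [h]; rfl
  rw [List.getElem?_drop, Nat.add_zero] at h1
  refine ⟨by rw [List.getD_eq_getElem?_getD, h1]; rfl, ?_⟩
  rw [← List.drop_drop, h]
  rfl

/-- The part of the input for the vertices from `v` on. -/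
def inputFrom (adj : Fin n → List (Fin n)) (v : ℕ) : List ℕ :=
  ((List.finRange n).drop v).flatMap fun v => (adj v).length :: (adj v).map Fin.val

theorem inputFrom_eq (v : Fin n) :
    inputFrom adj v = (adj v).length :: ((adj v).map Fin.val ++ inputFrom adj (v + 1)) := by
  have h : (v : ℕ) < (List.finRange n).length := by simp
  rw [inputFrom, List.drop_eq_getElem_cons h, List.flatMap_cons, inputFrom]
  simp

open Classical in
theorem wp_parseVertex (hA : IsAdjacencyLists G adj) {l : List ℕ} (v : Fin n)
    (h0 : ∀ i, s.mem 0 i = l.getD i 0) (hN : s.mem aN 0 = n) (hv : s.mem rVertex 0 = v)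
    (hpos : l.drop (s.mem rPos 0) = inputFrom adj v)
    (hadj : ∀ u w : Fin n, s.mem aAdj (u * n + w) = if u < v ∧ G.Adj u w then 1 else 0) :
    WP procs parseVertex s (60 * n + 60) fun s' =>
      l.drop (s'.mem rPos 0) = inputFrom adj (v + 1) ∧
      ∀ u w : Fin n, s'.mem aAdj (u * n + w) = if u ≤ v ∧ G.Adj u w then 1 else 0 := by
  obtain ⟨h1, h2⟩ := getD_of_drop_eq_cons (hpos.trans (inputFrom_eq v))
  have hdeg : (adj v).length ≤ n := by
    have := (hA v).1.length_le_card
    rwa [Fintype.card_fin] at this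
  refine (WP.seq (WP.assign_of (i := 0) (x := (adj v).length) rfl ?_ (WP.seq (WP.assign_of (i := 0)
    (x := s.mem rPos 0 + 1) rfl ?_ (WP.loop_plain (n := (adj v).length) (b := 30) (fun i s' =>
      l.drop (s'.mem rPos 0) = ((adj v).drop i).map Fin.val ++ inputFrom adj (v + 1) ∧
      ∀ u w : Fin n, s'.mem aAdj (u * n + w) =
        if u < v ∧ G.Adj u w ∨ u = v ∧ w ∈ (adj v).take i then 1 else 0) (by simp [Cmd.Plain])
      (by simp [Cmd.writes]) ?_ ?_ ?_ ?_ ?_))))).le ?_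
  · simp only [eval_get, eval_zero]
    rw [h0, h1]
  · simp
  · simp [Cmd.writes, Expr.reads, OfNat.ofNat]
  · simp
  · refine ⟨?_, fun u w => ?_⟩
    · simpa using h2
    · simpa using hadj u w
  · rintro i hi s' hfr - hsi ⟨h3, h4⟩
    rw [List.drop_eq_getElem_cons hi, List.map_cons, List.cons_append] at h3
    obtain ⟨h5, h6⟩ := getD_of_drop_eq_cons h3
    have hfr' : ∀ a, a < 15 → a ≠ aAdj → s'.mem a = s.mem a := fun a ha ha1 => by
      rw [hfr a (by omega) (by simp [Cmd.writes, ha1]; omega), set_mem_of_ne (by omega),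
        set_mem_of_ne (by omega)]
    have hv' : s'.mem rVertex 0 = v := by
      rw [hfr _ (by simp) (by simp [Cmd.writes])]
      simp [hv]
    refine (WP.seq (WP.assign_of (i := v * n + (adj v)[i]) (x := 1) ?_ rfl (WP.assign_of (i := 0)
      (x := s'.mem rPos 0 + 1) rfl ?_ ⟨?_, fun u w => ?_⟩))).mono (by simp) fun _ h => h
    · simp only [eval_add, eval_mul, eval_get, eval_zero, hv',
        hfr' aN (by simp) (by simp), hfr' 0 (by simp) (by simp), hN, h0, h5]
    · simp
    · rw [set_mem_of_ne (by simp), set_mem_self, h6]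
    · rw [set_mem_of_ne (by simp), set_mem_of_ne (by simp),
        set_mem_same, h4]
      have h7 : w ∈ (adj v).take (i + 1) ↔ w ∈ (adj v).take i ∨ w = (adj v)[i] := by
        rw [List.take_succ_eq_append_getElem hi, List.mem_append, List.mem_singleton]
      have h8 : (u : ℕ) * n + w = v * n + (adj v)[i] ↔ u = v ∧ w = (adj v)[i] := by
        constructor
        · intro h
          obtain ⟨h8, h9⟩ := pair_index_inj w.2 ((adj v)[i]).2 h
          exact ⟨Fin.ext h8, Fin.ext h9⟩
        · rintro ⟨rfl, h⟩
          rw [← h]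
      by_cases h9 : u = v ∧ w = (adj v)[i]
      · rw [if_pos (h8.2 h9), if_pos (.inr ⟨h9.1, h7.2 (.inr h9.2)⟩)]
      · rw [if_neg fun h => h9 (h8.1 h)]
        refine if_congr ?_ rfl rfl
        rw [h7]
        tauto
  · rintro s' - - ⟨h3, h4⟩
    refine ⟨by simpa using h3, fun u w => ?_⟩
    rw [h4]
    refine if_congr ?_ rfl rfl
    rw [List.take_length, (hA v).2, le_iff_lt_or_eq]
    constructor
    · rintro (⟨h, h'⟩ | ⟨rfl, h⟩)
      · exact ⟨.inl h, h'⟩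
      · exact ⟨.inr rfl, h⟩
    · rintro ⟨h | rfl, h'⟩
      · exact .inl ⟨h, h'⟩
      · exact .inr ⟨rfl, h'⟩
  · simp
    omega

open Classical in
theorem wp_parseCmd (hA : IsAdjacencyLists G adj) :
    WP procs parseCmd (initialState (encodeInput adj)) (60 * n ^ 2 + 100 * n + 40) fun s' =>
      (s'.mem aN 0 = n ∧ ∀ u v : Fin n, s'.mem aAdj (u * n + v) = if G.Adj u v then 1 else 0) ∧
      s'.mem aPar 0 = 0 ∧ (∀ i, s'.mem aBag i = 0) ∧ s'.out = [] := by
  have h0 : ∀ i, (initialState (encodeInput adj)).mem 0 i = (encodeInput adj).getD i 0 :=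
    fun i => rfl
  have hz : ∀ a, a ≠ 0 → ∀ i, (initialState (encodeInput adj)).mem a i = 0 := fun a ha i => by
    simp [initialState, ha]
  have hw : ∀ a, a = 0 ∨ a = aPar ∨ a = aBag → a ∉ parseCmd.writes := by
    rintro a (rfl | rfl | rfl) <;> simp [parseCmd, parseVertex, Cmd.writes]
  suffices h : WP procs parseCmd (initialState (encodeInput adj)) (60 * n ^ 2 + 100 * n + 40)
      fun s' => s'.mem aN 0 = n ∧
        ∀ u v : Fin n, s'.mem aAdj (u * n + v) = if G.Adj u v then 1 else 0 by
    refine (h.frame (by simp [parseCmd, parseVertex, Cmd.Plain])).mono le_rfl ?_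
    rintro s' ⟨h1, h2, h3⟩
    refine ⟨h1, ?_, fun i => ?_, h3⟩
    · rw [h2 _ (hw _ (by simp)), hz _ (by simp)]
    · rw [h2 _ (hw _ (by simp)), hz _ (by simp)]
  refine (WP.seq (WP.assign_of (i := 0) (x := n) rfl ?_ (WP.seq (WP.assign_of (i := 0) (x := 1) rfl
    rfl (WP.loop_plain (n := n) (b := 60 * n + 60) (fun j s' =>
      (encodeInput adj).drop (s'.mem rPos 0) = inputFrom adj j ∧
      ∀ u v : Fin n, s'.mem aAdj (u * n + v) = if u.val < j ∧ G.Adj u v then 1 else 0)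
      (by simp [parseVertex, Cmd.Plain]) (by simp [parseVertex, Cmd.writes]) ?_ ?_ ?_ ?_ ?_))))).le
      ?_
  · rw [eval_get, eval_zero, h0, encodeInput]
    rfl
  · simp [parseVertex, Cmd.writes, Expr.reads, OfNat.ofNat]
  · simp
  · refine ⟨?_, fun u v => ?_⟩
    · simp [encodeInput, inputFrom]
    · simp [hz]
  · rintro j hj s' hfr - hsj ⟨h1, h2⟩
    have hN : s'.mem aN 0 = n := by
      rw [hfr _ (by simp) (by simp [parseVertex, Cmd.writes])]
      simp
    refine (wp_parseVertex hA ⟨j, hj⟩ (l := encodeInput adj) (fun i => ?_) hN hsj h1 h2).mono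
      le_rfl ?_
    · rw [hfr _ (by simp) (by simp [parseVertex, Cmd.writes]), ← h0]
      simp
    · rintro s'' ⟨h3, h4⟩
      refine ⟨?_, fun u v => ?_⟩
      · rw [set_mem_of_ne (by simp), h3]
      · rw [set_mem_of_ne (by simp), h4]
        congr 1
        rw [eq_iff_iff, Nat.lt_succ_iff]
        rfl
  · rintro s' hfr - ⟨h1, h2⟩
    refine ⟨?_, fun u v => by simp [h2]⟩
    rw [hfr _ (by simp) (by simp [parseVertex, Cmd.writes])]
    simp
  · simp
    nlinarith

open Classical in
theorem wp_searchCmd (hG : IsChordal G) (hn : 0 < n) (hN : s.mem aN 0 = n)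
    (hadj : ∀ u v : Fin n, s.mem aAdj (u * n + v) = if G.Adj u v then 1 else 0)
    (hpar : s.mem aPar 0 = 0) (hbag : ∀ i, s.mem aBag i = 0) :
    WP procs searchCmd s (6000 * ((maxCliques (⊤ : G.Subgraph)).ncard * n ^ 2)) fun s' =>
      ∃ t : BagTree (Fin n), t.IsFor G ∧ Table.Stored t s'.mem := by
  have hcard : ∀ {W t mem}, Searching G W t mem → t.size ≤ (maxCliques (⊤ : G.Subgraph)).ncard :=
    fun h => by simpa using h.tree.card_le
  have hKdef : ∃ K, (maxCliques (⊤ : G.Subgraph)).ncard = K := ⟨_, rfl⟩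
  obtain ⟨K, hK⟩ := hKdef
  rw [hK] at hcard ⊢
  have hN1 : eN.eval (s.set aSize 0 1).mem = n := by simp [hN]
  by_cases hK0 : K = 0
  · have h1 := IsCliqueTree.card_le (G := G) (IsCliqueTree.empty G (par := fun j => j - 1)
      (bag := fun _ => ∅) (fun j (hj : 0 < j) => show j - 1 < j by omega) rfl)
    rw [hK, hK0] at h1
    simp at h1
  refine (WP.seq (WP.assign_of (i := 0) (x := 1) rfl rfl (WP.seq ((wp_fill_row (l := n) (p := 0)
    (c := 200) (fun _ _ => 0) (fun _ => 1) (by simp [scratch])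
    (by simp [Expr.reads, OfNat.ofNat, scratch]) hN1 rfl hn (fun _ _ _ _ _ hu => by omega)
    (fun _ _ _ _ _ _ _ => rfl) (by simp [fillCost])).mono le_rfl
    (Q' := fun s' => WP procs _ s' (n * (5000 * (K * n) + 12) + 9) _) ?_)))).le ?_
  · rintro s1 ⟨h1, hf1, -⟩
    have hs1 : ∀ a, a ≠ aScore → a ≠ aSize → a ∉ scratch → s1.mem a = s.mem a :=
        fun a h2 h3 h4 => by
      rw [hf1 a h2 h4, set_mem_of_ne h3]
    have hinit : Searching G ∅ ⟨1, fun j => j - 1, fun _ => ∅⟩ s1.mem := by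
      refine ⟨⟨?_, ?_, fun j hj => ?_, fun j _ u _ => ?_⟩, fun u v => ?_, fun u => ?_, ⟨by simp,
        by simp⟩, IsCliqueTree.empty G (fun j (hj : 0 < j) => show j - 1 < j by omega) rfl, rfl⟩
      · rw [hs1 _ (by simp) (by simp) (by simp [scratch]), hN]
      · rw [hf1 _ (by simp) (by simp [scratch]), set_mem_self]
      · obtain rfl : j = 0 := Nat.lt_one_iff.1 hj
        rw [hs1 _ (by simp) (by simp) (by simp [scratch]), hpar]
      · rw [hs1 _ (by simp) (by simp) (by simp [scratch]), hbag]
        simp [ind]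
      · rw [hs1 _ (by simp) (by simp) (by simp [scratch]), hadj]
      · rw [h1 u u.2]
        simp [mcsScore]
    have hc1 : eN.eval s1.mem = n := hinit.card
    refine (WP.loop_plain (n := n) (b := 5000 * (K * n)) (fun j s' => ∃ (W : Set (Fin n))
      (t : BagTree (Fin n)), W.ncard = j ∧
      Searching G W t s'.mem) ?_ ?_ ?_ hc1 ?_ ?_ ?_).mono (by simp) fun _ h => h
    · simp [searchStep, argMaxCmd, chooseCmd, visitCmd, fill, Cmd.Plain]
    · simp [searchStep, argMaxCmd, chooseCmd, visitCmd, fill, Cmd.writes]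
    · simp [searchStep, argMaxCmd, chooseCmd, visitCmd, fill, Cmd.writes, Expr.reads, OfNat.ofNat]
    · exact ⟨∅, _, by simp, hinit.frame fun a ha => set_mem_of_ne (by omega)⟩
    · rintro j hj s' - - - ⟨W, t, hW, h⟩
      have hne : W ≠ Set.univ := by
        rintro rfl
        rw [Set.ncard_univ, Nat.card_fin] at hW
        omega
      rw [← hK]
      refine (wp_searchStep hG h hne).mono le_rfl ?_
      rintro s'' ⟨z, hz, t', h'⟩
      exact ⟨insert z W, t', by rw [Set.ncard_insert_of_notMem hz, hW],
        h'.frame fun a ha => set_mem_of_ne (by omega)⟩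
    · rintro s' - - ⟨W, t, hW, h⟩
      have huniv : W = Set.univ := by
        refine Set.eq_of_subset_of_ncard_le (Set.subset_univ _) ?_ (Set.toFinite _)
        rw [Set.ncard_univ, hW, Nat.card_fin]
      subst huniv
      exact ⟨t, ⟨h.tree, h.par_zero⟩, h.toStored⟩
  · have : 1 ≤ K := Nat.pos_of_ne_zero hK0
    simp only [Expr.cost_zero, Expr.cost_one]
    have h1 : n ≤ n ^ 2 := Nat.le_self_pow two_ne_zero n
    have h2 : n ^ 2 ≤ K * n ^ 2 := Nat.le_mul_of_pos_left _ this
    have h3 : n * (5000 * (K * n) + 12) = 5000 * (K * n ^ 2) + 12 * n := by ring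
    omega

theorem memoPotential_le {k A : ℕ} : memoPotential k A s ≤ A * (2 * k) := by
  refine Nat.mul_le_mul_left _ ((Finset.card_filter_le _ _).trans ?_)
  rw [Finset.card_range]

/-- The recursion, started with an empty memo table. -/
theorem wp_call [Nonempty (Fin n)] {t : BagTree (Fin n)} (T : t.IsFor G) (hG : IsUCCG G)
    (hprocs : procs[0]? = some countCmd) (hr : Ready t s.mem) (hkn : t.size ≤ n)
    (hmemo : ∀ i < 2 * t.size, s.mem aMemo i = 0) (hsp : s.mem rSp 0 = 0) (hid : s.mem aId 0 = 0) :
    WP procs (.call 0) s (3600 * (t.size ^ 2 * n)) fun s' => ∃ M w a,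
      Sim (.count (⊤ : G.Subgraph)) [] M w a ∧ s'.out = s.out ++ w := by
  have hk := T.size_pos
  obtain ⟨τ, s', hexec, hτ, M, w, a, hsim, hout, -⟩ := countSpec (d := 0) T hG.2 le_rfl hprocs
    (by omega) 0 s [] hr (fun d hd => ⟨fun _ _ => by simp, fun b hb => by
      rw [hmemo _ (hr.toTables.rep_lt hd)] at hb
      omega⟩) hsp hid
  refine ⟨τ, s', hexec, ?_, M, w, a, by rwa [T.graph_zero hG.1] at hsim, hout⟩
  have h1 : t.card 0 ≤ n := by
    have := Set.ncard_le_card 𝓕[t, 0]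
    rwa [Nat.card_fin] at this
  have h2 := memoPotential_le (s := s') (k := t.size)
    (A := t.size * (120 * n + 1280 * t.size + 270))
  have h3 : t.size * (120 * n + 1280 * t.size + 270) * (2 * t.size) ≤ 3340 * (t.size ^ 2 * n) :=
    calc t.size * (120 * n + 1280 * t.size + 270) * (2 * t.size)
        ≤ t.size * (1670 * n) * (2 * t.size) := by gcongr; omega
      _ = 3340 * (t.size ^ 2 * n) := by ring
  have h4 : n ≤ t.size ^ 2 * n := Nat.le_mul_of_pos_left _ (pow_pos hk 2)
  omega

end

/-- Correctness and running time of the program. -/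
theorem cliquePicking_spec : ImplementsCliquePickingWithin cliquePicking fun n G =>
    600000 * (maxCliques (⊤ : G.Subgraph)).ncard ^ 2 * (n + G.edgeSet.ncard) := by
  intro n G hG adj hA
  obtain ⟨v₀⟩ := hG.1.nonempty
  have : Nonempty (Fin n) := ⟨v₀⟩
  have hn : 0 < n := v₀.pos
  obtain ⟨K, hK⟩ : ∃ K, (maxCliques (⊤ : G.Subgraph)).ncard = K := ⟨_, rfl⟩
  obtain ⟨N, hN⟩ : ∃ N, n + G.edgeSet.ncard = N := ⟨_, rfl⟩
  suffices h : WP [countCmd] cliquePicking.main (initialState (encodeInput adj))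
      (600000 * (K ^ 2 * N)) fun s' => ∃ M w a,
        Sim (.count (⊤ : G.Subgraph)) [] M w a ∧ s'.out = w by
    obtain ⟨τ, s', hexec, hτ, M, w, a, ⟨log, codes, hrun, hcodes, rfl⟩, hout⟩ := h
    refine ⟨τ, s'.out, log, ⟨s', hexec, rfl⟩, ⟨M, a, hrun⟩, ⟨codes, hcodes, hout⟩, ?_⟩
    simp only [hK, hN]
    rwa [mul_assoc]
  refine (WP.seq ((wp_parseCmd hA).mono le_rfl (Q' := fun s' => WP [countCmd] _ s'
    (6000 * (K * n ^ 2) + 580000 * (K ^ 2 * N)) fun s' => ∃ M w a,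
      Sim (.count (⊤ : G.Subgraph)) [] M w a ∧ s'.out = w) ?_)).le ?_
  · rintro s1 ⟨⟨hN1, hadj⟩, hpar, hbag, hout1⟩
    have hplain : searchCmd.Plain := by
      simp [searchCmd, searchStep, argMaxCmd, chooseCmd, visitCmd, fill, Cmd.Plain]
    refine WP.seq (((wp_searchCmd hG.2 hn hN1 hadj hpar hbag).frame hplain).mono (by rw [hK]) ?_)
    rintro s2 ⟨⟨t, T, hS⟩, -, hout2⟩
    have hkn := T.size_le
    have hk := T.size_pos
    obtain rfl : K = t.size := by rw [← hK, T.tree.card_eq, Finset.card_range]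
    have hnN : n ≤ N := by omega
    have hN0 : 0 < N := by omega
    have h1 : t.size ≤ t.size ^ 2 := Nat.le_self_pow two_ne_zero _
    have h2 : t.size ^ 2 * n ≤ t.size ^ 2 * N := Nat.mul_le_mul_left _ hnN
    have h3 : t.size ^ 2 ≤ t.size ^ 2 * n := Nat.le_mul_of_pos_right _ hn
    have h4 : t.size * n ≤ t.size ^ 2 * n := Nat.mul_le_mul_right _ h1
    refine (WP.seq ((Table.wp_build T hkn Table.all Table.all_pairwise s2 hS
      fun A hA => absurd (Table.mem_all A) hA).mono (b' := 490000 * (t.size ^ 2 * N)) ?_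
      (Q' := fun s' => WP [countCmd] _ s' (90000 * (t.size ^ 2 * N)) fun s' => ∃ M w a,
        Sim (.count (⊤ : G.Subgraph)) [] M w a ∧ s'.out = w) ?_)).mono (by omega) fun _ h => h
    · have h5 : t.size * t.size * n = t.size ^ 2 * n := by ring
      have h6 : Table.all.length = 20 := rfl
      rw [h5, h6]
      omega
    · rintro s3 ⟨hS3, hspec3, hout3⟩
      have hT3 : Tables t s3.mem := ⟨hS3, hspec3⟩
      refine (WP.seq (((wp_listsCmd hT3).frame listsCmd_plain).mono
        (b' := 400 * (t.size ^ 2 * N)) ?_ (Q' := fun s' => WP [countCmd] _ s'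
          (80000 * (t.size ^ 2 * N)) fun s' => ∃ M w a,
          Sim (.count (⊤ : G.Subgraph)) [] M w a ∧ s'.out = w) ?_)).mono (by omega) fun _ h => h
      · have h5 : 2 * t.size * (60 * n + 100) = 120 * (t.size * n) + 200 * t.size := by ring
        rw [h5]
        omega
      · rintro s4 ⟨hlists, hf4, hout4⟩
        have hT4 : Tables t s4.mem := hT3.frame fun a ha => hf4 a (not_mem_writes_listsCmd ha)
        refine (WP.seq (((wp_phiCmd T hT4 hn hkn).frame phiCmd_plain).mono
          (b' := 10000 * (t.size ^ 2 * N)) (by rw [hN]) (Q' := fun s' => WP [countCmd] _ s'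
            (60000 * (t.size ^ 2 * N)) fun s' => ∃ M w a,
            Sim (.count (⊤ : G.Subgraph)) [] M w a ∧ s'.out = w) ?_)).mono (by omega) fun _ h => h
        rintro s5 ⟨hphi, hf5, hout5⟩
        have hf5' : ∀ a < 41, s5.mem a = s4.mem a := fun a ha => hf5 a (mem_writes_phiCmd ha)
        have hR5 : Ready t s5.mem := ⟨hT4.frame fun a ha => hf5' a (by omega), by
          rw [VertexLists, hf5' _ (by simp)]
          exact hlists, hphi⟩
        have h2k : (2 * eSize : Expr).eval s5.mem = 2 * t.size := by
          rw [eval_mul, eval_two]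
          exact congrArg _ hR5.size
        refine (WP.seq ((wp_fill_row (l := 2 * t.size) (p := 0) (c := 200) (fun _ _ => 0)
          (fun _ => 0) (by simp [scratch])
          (by simp [Expr.reads, OfNat.ofNat, scratch]) h2k rfl (by omega)
          (fun _ _ _ _ _ hu => by omega) (fun _ _ _ _ _ _ _ => rfl) (by simp [fillCost])).mono
          (b' := 400 * (t.size ^ 2 * N)) (by omega) (Q' := fun s' => WP [countCmd] _ s'
            (50000 * (t.size ^ 2 * N)) fun s' => ∃ M w a,
            Sim (.count (⊤ : G.Subgraph)) [] M w a ∧ s'.out = w) ?_)).mono (by omega) fun _ h => h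
        rintro s6 ⟨hmemo, hf6, hout6⟩
        have hf6' : ∀ a < 60, ((s6.set rSp 0 0).set aId 0 0).mem a = s5.mem a := fun a ha => by
          rw [set_mem_of_ne (by omega), set_mem_of_ne (by omega),
            hf6 a (by omega) (by simp [scratch]; omega)]
        refine (WP.seq (WP.assign_of (i := 0) (x := 0) rfl rfl (WP.seq (WP.assign_of (i := 0)
          (x := 0) rfl rfl ((wp_call T hG rfl (hR5.frame hf6') hkn (fun i hi => ?_) ?_ ?_).mono
            le_rfl ?_))))).le ?_
        · rw [set_mem_of_ne (by simp), set_mem_of_ne (by simp), hmemo i hi]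
        · simp
        · simp
        · rintro s7 ⟨M, w, a, hsim, hout⟩
          refine ⟨M, w, a, hsim, ?_⟩
          rw [hout, set_out, set_out, hout6, hout5, hout4, hout3, hout2,
            hout1, List.nil_append]
        · simp only [Expr.cost_zero]
          omega
  · obtain ⟨k, par, bag, -, T⟩ := IsCliqueTree.exists_of_chordal hG.2
    have h1 := T.sq_card_le
    have h2 := T.card_eq
    rw [hK] at h2
    rw [← h2] at h1
    have hK0 : 0 < K := by
      have := Finset.card_pos.2 ⟨0, T.root_mem⟩
      omega
    have h3 : n ^ 2 ≤ 2 * (K * N) := by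
      calc n ^ 2 ≤ K * (n + 2 * G.edgeSet.ncard) := h1
        _ ≤ K * (2 * N) := Nat.mul_le_mul_left _ (by omega)
        _ = 2 * (K * N) := by ring
    have h4 : K * n ^ 2 ≤ 2 * (K ^ 2 * N) := by
      calc K * n ^ 2 ≤ K * (2 * (K * N)) := Nat.mul_le_mul_left _ h3
        _ = 2 * (K ^ 2 * N) := by ring
    have h5 : n ≤ n ^ 2 := Nat.le_self_pow two_ne_zero n
    have h6 : n ^ 2 ≤ K * n ^ 2 := Nat.le_mul_of_pos_left _ hK0
    omega

end CliquePicking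

theorem mainTheorem4 :
    (∀ (V : Type*) [Finite V] (G : SimpleGraph V), CliquePicking.IsUCCG G →
      ∀ log : List (CliquePicking.Event G), CliquePicking.IsCliquePickingLog G log →
        (CliquePicking.explored log).ncard ≤
            2 * (CliquePicking.maxCliques (⊤ : G.Subgraph)).ncard - 1 ∧
          (∀ H ∈ CliquePicking.explored log, CliquePicking.IsUCCG H.coe) ∧
          (∀ H ∈ CliquePicking.explored log, H ≠ ⊤ →
            ∃ S ∈ CliquePicking.minSeparators G, ∃ F ∈ CliquePicking.bouquet G S,
              H = CliquePicking.flowerMinus G F S)) ∧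
    (∃ (P : CliquePicking.Program) (C : ℕ),
      CliquePicking.ImplementsCliquePickingWithin P fun n G =>
        C * (CliquePicking.maxCliques (⊤ : G.Subgraph)).ncard ^ 2 *
          (n + G.edgeSet.ncard)) :=
  ⟨fun _ _ _ hG _ hlog => CliquePicking.explored_spec hG hlog,
    CliquePicking.cliquePicking, _, CliquePicking.cliquePicking_spec⟩
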